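/- **Setting.** $G=(V,E)$ is an undirected graph with $n$ vertices, $m$ edges and nonnegative integer edge weights, given as a list of edges; $d(u,v)$ is the shortest-path distance ($\infty$ if there is no path). For $S,T\subseteq V$ and $s\in S$ the $ST$-eccentricity of $s$ is $\varepsilon_{ST}(s)=\max_{t\in T}d(s,t)$ (equal to $0$ if $T=\emptyset$). An $\alpha$-approximation consists of estimates $\varepsilon'(s)$ with $\varepsilon_{ST}(s)/\alpha\le\varepsilon'(s)\le\varepsilon_{ST}(s)$ for all $s\in S$ (with $\alpha=2$ or $\alpha=2-\varepsilon$). The instance is *bichromatic* if $T=V\setminus S$; in the lower bounds $S$ and $T$ are also nonempty. Algorithms are randomized word-RAM programs with words of $O(\log(n+m+W))$ bits, where $W$ is the largest edge weight; running times are worst-case bounds, valid for all outcomes of the coin tosses. In the lower bounds an algorithm is only required to succeed with probability at least $2/3$. SETH is the statement that for no $\varepsilon>0$ can the satisfiability of CNF formulas with $n$ variables and $O(n)$ clauses be decided in randomized time $O((2-\varepsilon)^n)$, that is: for every $\varepsilon\in(0,1)$ there is a constant $D$ such that no randomized word-RAM program, on words of $O(n)$ bits, decides satisfiability of all CNF formulas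 with $n$ variables and at most $Dn$ clauses in time $O((2-\varepsilon)^n)$ with probability at least $2/3$ of answering correctly. **Theorem.** 1. For every constant $a\in\mathbb N$ there is a randomized algorithm that, given $G$ and any $S,T\subseteq V$, runs in time $O\big((n+m+1)^{3/2}\log^{O(1)}(n+m+2)\big)$, uniformly in the edge weights (hence $\tilde O(m^{3/2})$ if $G$ is connected and has an edge), and with probability at least $1-n^{-a}$ outputs for all $s\in S$ simultaneously estimates $\varepsilon'(s)$ with $$\varepsilon_{ST}(s)/2\le\varepsilon'(s)\le\varepsilon_{ST}(s).$$ 2. If for some $\varepsilon,\delta>0$ there is a $(2-\varepsilon)$-approximation algorithm for the $ST$-eccentricities running in $O(m^{2-\delta})$ time, even only on connected unweighted bichromatic instances, then SETH is false. 3. If for some $\varepsilon>0$ there is a $2$-approximation algorithm for the $ST$-eccentricities running in $O(m^{3/2-\varepsilon})$ time, even only on connected unweighted bichromatic instances, then SETH is false. 4. Under SETH, for every integer $k\ge2$, distinguishing bichromatic eccentricities $k$ and $3k-2$ in connected undirected unweighted graphs requires $m^{1+1/(k-1)-o(1)}$ time: for every $\delta>0$ there is no randomized algorithm running in $O(m^{1+1/(k-1)-\delta})$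 time that outputs a bit for every $s\in S$ which, for all $s\in S$ simultaneously, is $0$ if $\varepsilon_{ST}(s)=k$ and $1$ if $\varepsilon_{ST}(s)=3k-2$. -/

import Mathlib

open scoped ENNReal

noncomputable section

/-! ## A randomized word RAM

The machine has finitely many registers and finitely many memory banks (only those that a program
names are used; a constant number of banks is the same as one memory, by interleaving).
Every register and every memory cell holds one word, that is, a natural number below `2 ^ w`.
Programs are built from word instructions by sequencing, branching and loops; each instruction,
each test and each toss of a fair coin costs one time unit. -/

namespace WordRAM

/-- The binary word instructions (comparisons return `0` or `1`, subtraction is cut off at `0`,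
and a division by `0` returns `0`). -/
inductive BinOp
  | add | sub | mul | div | mod | and | or | xor | shl | shr | eq | lt

/-- The value of a binary instruction on the natural numbers, before the word length is checked. -/
def BinOp.eval : BinOp → ℕ → ℕ → ℕ
  | .add, a, b => a + b
  | .sub, a, b => a - b
  | .mul, a, b => a * b
  | .div, a, b => a / b
  | .mod, a, b => a % b
  | .and, a, b => a &&& b
  | .or, a, b => a ||| b
  | .xor, a, b => a ^^^ b
  | .shl, a, b => a <<< b
  | .shr, a, b => a >>> b
  | .eq, a, b => if a = b then 1 else 0
  | .lt, a, b => if a < b then 1 else 0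

/-- Programs. Registers and memory banks are named by natural numbers. -/
inductive Prog
  /-- do nothing -/
  | skip
  /-- `reg r := n` -/
  | const (r n : ℕ)
  /-- `reg r := reg a ∘ reg b` -/
  | op (o : BinOp) (r a b : ℕ)
  /-- `reg r := (bank k)[reg a]` -/
  | load (r k a : ℕ)
  /-- `(bank k)[reg a] := reg r` -/
  | store (k a r : ℕ)
  /-- `reg r :=` the result (`0` or `1`) of a fresh fair coin toss -/
  | flip (r : ℕ)
  /-- first `p`, then `q` -/
  | seq (p q : Prog)
  /-- if `reg r ≠ 0` then `p` else `q` -/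
  | ite (r : ℕ) (p q : Prog)
  /-- while `reg r ≠ 0` do `p` -/
  | loop (r : ℕ) (p : Prog)

/-- A configuration: the contents of the registers and of the memory banks, and the number of
coins tossed so far. -/
structure State where
  reg : ℕ → ℕ
  mem : ℕ → ℕ → ℕ
  coins : ℕ

/-- Write the word `x` to register `r`. -/
def State.setReg (σ : State) (r x : ℕ) : State :=
  { σ with reg := Function.update σ.reg r x }

/-- Write the word `x` to the cell with address `a` of memory bank `k`. -/
def State.setMem (σ : State) (k a x : ℕ) : State :=
  { σ with mem := Function.update σ.mem k (Function.update (σ.mem k) a x) }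

/-- Toss a coin with outcome `b` and write it to register `r`. -/
def State.toss (σ : State) (r : ℕ) (b : Bool) : State :=
  { σ.setReg r b.toNat with coins := σ.coins + 1 }

/-- `Exec w ρ p σ t σ'`: on the machine with `w`-bit words, when the successive coin tosses are
`ρ 0, ρ 1, …`, the program `p`, started in `σ`, halts in `σ'` after exactly `t` steps.
There is no such execution if `p` runs forever or if a value that does not fit into a word
is produced. -/
inductive Exec (w : ℕ) (ρ : ℕ → Bool) : Prog → State → ℕ → State → Prop
  | skip (σ : State) : Exec w ρ .skip σ 1 σ
  | const (r n : ℕ) (σ : State) (hn : n < 2 ^ w) :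
      Exec w ρ (.const r n) σ 1 (σ.setReg r n)
  | op (o : BinOp) (r a b : ℕ) (σ : State) (ho : o.eval (σ.reg a) (σ.reg b) < 2 ^ w) :
      Exec w ρ (.op o r a b) σ 1 (σ.setReg r (o.eval (σ.reg a) (σ.reg b)))
  | load (r k a : ℕ) (σ : State) :
      Exec w ρ (.load r k a) σ 1 (σ.setReg r (σ.mem k (σ.reg a)))
  | store (k a r : ℕ) (σ : State) :
      Exec w ρ (.store k a r) σ 1 (σ.setMem k (σ.reg a) (σ.reg r))
  | flip (r : ℕ) (σ : State) (hw : 0 < w) :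
      Exec w ρ (.flip r) σ 1 (σ.toss r (ρ σ.coins))
  | seq {p q : Prog} {σ σ' σ'' : State} {t t' : ℕ}
      (hp : Exec w ρ p σ t σ') (hq : Exec w ρ q σ' t' σ'') :
      Exec w ρ (.seq p q) σ (t + t') σ''
  | iteTrue {r : ℕ} {p q : Prog} {σ σ' : State} {t : ℕ} (hr : σ.reg r ≠ 0)
      (hp : Exec w ρ p σ t σ') : Exec w ρ (.ite r p q) σ (t + 1) σ'
  | iteFalse {r : ℕ} {p q : Prog} {σ σ' : State} {t : ℕ} (hr : σ.reg r = 0)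
      (hq : Exec w ρ q σ t σ') : Exec w ρ (.ite r p q) σ (t + 1) σ'
  | loopStop {r : ℕ} {p : Prog} {σ : State} (hr : σ.reg r = 0) :
      Exec w ρ (.loop r p) σ 1 σ
  | loopStep {r : ℕ} {p : Prog} {σ σ' σ'' : State} {t t' : ℕ} (hr : σ.reg r ≠ 0)
      (hp : Exec w ρ p σ t σ') (hl : Exec w ρ (.loop r p) σ' t' σ'') :
      Exec w ρ (.loop r p) σ (t + t' + 1) σ''

/-- The law of an infinite sequence of independent fair coin tosses. -/
def coinLaw : MeasureTheory.Measure (ℕ → Bool) :=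
  MeasureTheory.Measure.infinitePi fun _ : ℕ => (PMF.uniformOfFintype Bool).toMeasure

/-- On `w`-bit words, `p` started in `σ` halts within `T` steps whatever the coins show,
and with probability at least `q` it halts in a configuration satisfying `Good`. -/
def Achieves (w : ℕ) (p : Prog) (σ : State) (T : ℝ) (q : ℝ≥0∞) (Good : State → Prop) : Prop :=
  (∀ ρ : ℕ → Bool, ∃ (t : ℕ) (σ' : State), Exec w ρ p σ t σ' ∧ (t : ℝ) ≤ T) ∧
    q ≤ coinLaw {ρ | ∃ (t : ℕ) (σ' : State), Exec w ρ p σ t σ' ∧ Good σ'}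

end WordRAM

/-! ## The strong exponential time hypothesis -/

/-- A CNF formula with `numVars` variables and `numClauses` clauses; a clause is a set of literals,
and the literal `(v, b)` is satisfied by the assignments that give `v` the value `b`. -/
structure CNF where
  numVars : ℕ
  numClauses : ℕ
  clause : Fin numClauses → Finset (Fin numVars × Bool)

/-- Satisfiability of a CNF formula. -/
def CNF.Satisfiable (φ : CNF) : Prop :=
  ∃ τ : Fin φ.numVars → Bool, ∀ j, ∃ l ∈ φ.clause j, τ l.1 = l.2

open Classical in
/-- The input configuration for a formula: registers `0` and `1` hold the numbers `n` of variables
and `M` of clauses, and banks `0` and `1` hold the incidence tables of the positive and of the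
negative literals (row `j` and column `v` at address `j * n + v`); everything else is `0`. -/
def CNF.init (φ : CNF) : WordRAM.State where
  reg := fun r => match r with
    | 0 => φ.numVars
    | 1 => φ.numClauses
    | _ => 0
  mem := fun k i => match k with
    | 0 => if ∃ (j : Fin φ.numClauses) (v : Fin φ.numVars),
        i = j * φ.numVars + v ∧ (v, true) ∈ φ.clause j then 1 else 0
    | 1 => if ∃ (j : Fin φ.numClauses) (v : Fin φ.numVars),
        i = j * φ.numVars + v ∧ (v, false) ∈ φ.clause j then 1 else 0
    | _ => 0
  coins := 0

/-- The program `p`, on words of `c * (n + 1)` bits (logarithmic in `2 ^ n`), decides with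
probability at least `2 / 3` and within `C * b ^ n` steps whether a formula with `n` variables and
at most `D * n` clauses is satisfiable (answer: register `0` is nonzero). -/
def DecidesSat (p : WordRAM.Prog) (c D : ℕ) (C b : ℝ) : Prop :=
  ∀ φ : CNF, φ.numClauses ≤ D * φ.numVars →
    WordRAM.Achieves (c * (φ.numVars + 1)) p φ.init (C * b ^ φ.numVars) (2 / 3)
      (fun σ => σ.reg 0 ≠ 0 ↔ φ.Satisfiable)

/-- The strong exponential time hypothesis: for no `ε > 0` can the satisfiability of CNF formulas
with `n` variables and `O(n)` clauses be decided in randomized time `O((2 - ε) ^ n)`. -/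
def SETH : Prop :=
  ¬ ∃ ε : ℝ, 0 < ε ∧ ε < 1 ∧ ∀ D : ℕ, ∃ (p : WordRAM.Prog) (c : ℕ) (C : ℝ),
    DecidesSat p c D C (2 - ε)

/-! ## `ST`-Eccentricities -/

/-- An undirected graph with vertex set `{0, …, n - 1}` and `m` edges, nonnegative integer edge
weights and two sets `S`, `T` of vertices. The edges are listed, in any order and each in any of its
two orientations, by `src` and `dst`. -/
structure STInstance where
  n : ℕ
  m : ℕ
  G : SimpleGraph (Fin n)
  src : Fin m → Fin n
  dst : Fin m → Fin n
  edges_bij : Set.BijOn (fun i => s(src i, dst i)) Set.univ G.edgeSet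
  weight : Sym2 (Fin n) → ℕ
  S : Finset (Fin n)
  T : Finset (Fin n)

namespace STInstance

variable (I : STInstance)

/-- The weight of the `i`-th edge. -/
def edgeWeight (i : Fin I.m) : ℕ := I.weight s(I.src i, I.dst i)

/-- The largest edge weight (`0` if there are no edges). -/
def maxWeight : ℕ := Finset.univ.sup I.edgeWeight

/-- The length of a walk: the sum of the weights of its edges. -/
def walkLength {u v : Fin I.n} (q : I.G.Walk u v) : ℕ := (q.edges.map I.weight).sum

/-- The distance `d(u, v)`, equal to `⊤` if no walk joins `u` and `v`. -/
def dist (u v : Fin I.n) : ℕ∞ := ⨅ q : I.G.Walk u v, (I.walkLength q : ℕ∞)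

/-- The `ST`-eccentricity of `s`: the largest distance from `s` to a vertex of `T`. -/
def ecc (s : Fin I.n) : ℕ∞ := ⨆ t ∈ I.T, I.dist s t

/-- The input configuration: registers `0` and `1` hold `n` and `m`, banks `0`, `1`, `2` hold the
endpoints and the weights of the listed edges, and banks `3`, `4` the characteristic vectors
of `S` and `T`; everything else is `0`. -/
def init : WordRAM.State where
  reg := fun r => match r with
    | 0 => I.n
    | 1 => I.m
    | _ => 0
  mem := fun k i => match k with
    | 0 => if h : i < I.m then (I.src ⟨i, h⟩ : ℕ) else 0
    | 1 => if h : i < I.m then (I.dst ⟨i, h⟩ : ℕ) else 0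
    | 2 => if h : i < I.m then I.edgeWeight ⟨i, h⟩ else 0
    | 3 => if h : i < I.n then (if ⟨i, h⟩ ∈ I.S then 1 else 0) else 0
    | 4 => if h : i < I.n then (if ⟨i, h⟩ ∈ I.T then 1 else 0) else 0
    | _ => 0
  coins := 0

/-- The word length: `c` times the number of bits of `n + m + W + 1`, where `W` is the largest edge
weight. -/
def wordLength (c : ℕ) : ℕ := c * Nat.size (I.n + I.m + I.maxWeight + 1)

/-- The estimate written by a program for the vertex `v`: the quotient of the words at address `v`
of banks `5` and `6` (a positive number divided by `0` stands for infinity). -/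
def estimate (σ : WordRAM.State) (v : Fin I.n) : ℝ≥0∞ :=
  (σ.mem 5 v : ℝ≥0∞) / (σ.mem 6 v : ℝ≥0∞)

/-- The estimates `ε'` in `σ` satisfy `ε(s) / α ≤ ε'(s) ≤ ε(s)` for every `s ∈ S`. -/
def IsApprox (α : ℝ) (σ : WordRAM.State) : Prop :=
  ∀ s ∈ I.S, (I.ecc s : ℝ≥0∞) / ENNReal.ofReal α ≤ I.estimate σ s ∧
    I.estimate σ s ≤ (I.ecc s : ℝ≥0∞)

/-- The answers in `σ` (for the vertex `s`, the word at address `s` of bank `5`) tell apart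
eccentricity `a` (answer zero) and eccentricity `b` (answer nonzero), for every `s ∈ S`. -/
def Distinguishes (a b : ℕ) (σ : WordRAM.State) : Prop :=
  ∀ s ∈ I.S, (I.ecc s = a → σ.mem 5 s = 0) ∧ (I.ecc s = b → σ.mem 5 s ≠ 0)

/-- Connected unweighted instances (all weights are `1`) in which `S` and `T` are nonempty and
partition the vertex set. -/
def IsUnweightedBichromatic : Prop :=
  I.G.Connected ∧ (∀ i, I.edgeWeight i = 1) ∧ I.S.Nonempty ∧ I.T.Nonempty ∧ I.T = I.Sᶜ

end STInstance

/-- Some randomized algorithm, on words of `O(log (n + m))` bits, takes time `O(m ^ x)` on every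
connected unweighted bichromatic instance with `m` edges and reaches there a final configuration
with the property `Good` with probability at least `2 / 3`. -/
def SolvableBichromatic (x : ℝ) (Good : STInstance → WordRAM.State → Prop) : Prop :=
  ∃ (p : WordRAM.Prog) (c : ℕ) (C : ℝ), ∀ I : STInstance, I.IsUnweightedBichromatic →
    WordRAM.Achieves (I.wordLength c) p I.init (C * (I.m : ℝ) ^ x) (2 / 3) (Good I)

end

/-!
Programs for the word RAM are written in a small structured language (`WordRAM.Cmd`), which is
compiled to machine code and verified with a weakest precondition calculus that counts steps
(`WordRAM.Cmd.wp`, `WordRAM.Cmd.exec_of_wp`).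

**The approximation.** The algorithm is deterministic, so its probability of success is `1`. With
`q ≈ √(n + m + 1)`, choose greedily centers `w 0, …, w (q - 1)` in `T`, each as far as possible
from the preceding ones, and let `R` be the distance of the last one from the others. Two different
choices have distance at least `R`, so the open balls of radius `R / 2` around them are disjoint,
every edge meets at most two of them, and the ball of some center `c` meets at most
`2 * m / q ≤ 2 * q` edges (`STInstance.IsGreedy.mul_le`). The estimate for `s` is the maximum of
the distances from `s` to the centers and of `ε(x) - d(x, s)`, where `x` runs over `c` and the ends
of the edges that meet its ball. These are lower bounds for `ε(s)`. Suppose that all centers are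
closer to `s` than `ε(s) / 2`. Then a vertex of `T` farthest from `s` has distance more than
`ε(s) / 2` from every center, so `R > ε(s) / 2`. A shortest path from `c` to `s` has a vertex `x`
that is either `s` itself or the first one outside of the ball of `c`. In the former case `ε(s)` is
among the lower bounds, in the latter `d(x, s) = d(c, s) - d(c, x) < ε(s) / 2 - R / 2 < ε(s) / 4`,
so that `ε(x) - d(x, s) ≥ ε(s) - 2 * d(x, s) ≥ ε(s) / 2` (`STInstance.IsGreedy.approx`). Infinite
distances are represented by a number above all finite ones (`STInstance.inf`). This takes `O(q)`
runs of Dijkstra's algorithm, whose priority queue is a tournament tree (`WordRAM.wp_dijkstra`).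

**The lower bounds.** All three follow from one reduction. The variables of a formula are divided
into `k` groups. A value of a group is a partial assignment of it, or a dummy; the formula is
satisfiable iff there is a choice of one value for each group such that every clause (every
*coordinate*) is covered by one of them (`CNF.satisfiable_iff`). Additional coordinates, one for
each group, exclude the dummies. The graph of such a tuple problem has levels `0, …, k`. The
vertices on level `0`, the sources, are the choices of values for the groups `0, …, k - 2`, and
those on level `k`, the targets, which form `T`, are the choices for the groups `1, …, k - 1`. A
vertex on an inner level `i` consists of values of all groups except `k - 1 - i` and `k - i`, and
of `k - 1` coordinates. Along an edge from level `i` to level `i + 1` the value of group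
`k - 2 - i` is dropped (if `i < k - 1`) and one of group `k - i` is added (if `0 < i`), while the
other values and the coordinates stay the same; there is such an edge if prescribed coordinates are
not covered by prescribed values (`TupleProblem.Valid`). The numbers of vertices that are not used
in this way are attached as pendant vertices to the source `0`, so that the graph is connected.

If the tuple problem has no solution, any source is joined to any target by a path of `k` edges
(`TupleProblem.reach_of_unsolvable`), so all sources have eccentricity `k`. If it has a solution,
then the source and the target given by the solution have distance at least `3 * k - 2`: a shorter
walk crosses two of the `k` gaps between levels only once each, and the coordinates between these
two crossings yield one that the solution does not cover (`TupleProblem.three_mul_le_length`).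

The graph has `2 ^ ((k - 1) * n / k)` vertices, up to polynomial factors, and at most twice as many
edges. A program writes it to memory, runs the given algorithm in registers and memory banks of its
own, and inspects the answers for the sources (`WordRAM.exec_satProg`). An algorithm with running
time `O(m ^ (1 + 1 / (k - 1) - δ))` thus decides satisfiability in time `O((2 - ε) ^ n)`
(`WordRAM.not_SETH_of_solvableBichromatic`). The three bounds are the cases `k = 2`, where
`4 / 2 = 2`, `k = 3`, where `7 / 3 > 2`, and arbitrary `k`.
-/

noncomputable section

/-! ### Elementary facts about executions -/

namespace WordRAM

/-- All registers and memory cells hold numbers below `B`. -/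
def State.Bounded (B : ℕ) (σ : State) : Prop :=
  (∀ r, σ.reg r < B) ∧ ∀ k a, σ.mem k a < B

@[simp] theorem State.setReg_reg (σ : State) (r x r' : ℕ) :
    (σ.setReg r x).reg r' = if r' = r then x else σ.reg r' := Function.update_apply ..

@[simp] theorem State.setReg_mem (σ : State) (r x : ℕ) : (σ.setReg r x).mem = σ.mem := rfl

@[simp] theorem State.setMem_reg (σ : State) (k a x : ℕ) : (σ.setMem k a x).reg = σ.reg := rfl

@[simp] theorem State.setMem_mem (σ : State) (k a x k' : ℕ) :
    (σ.setMem k a x).mem k' = if k' = k then Function.update (σ.mem k) a x else σ.mem k' :=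
  Function.update_apply ..

theorem State.Bounded.setReg {B : ℕ} {σ : State} (h : σ.Bounded B) {r x : ℕ} (hx : x < B) :
    (σ.setReg r x).Bounded B := by
  refine ⟨fun r' => ?_, h.2⟩
  simp only [State.setReg_reg]
  split_ifs
  exacts [hx, h.1 r']

theorem State.Bounded.setMem {B : ℕ} {σ : State} (h : σ.Bounded B) {k a x : ℕ} (hx : x < B) :
    (σ.setMem k a x).Bounded B := by
  refine ⟨h.1, fun k' a' => ?_⟩
  simp only [State.setMem_mem]
  split_ifs
  · rw [Function.update_apply]
    split_ifs
    exacts [hx, h.2 k a']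
  · exact h.2 k' a'

theorem Exec.bounded {w : ℕ} {ρ : ℕ → Bool} {p : Prog} {σ σ' : State} {t : ℕ}
    (h : Exec w ρ p σ t σ') : σ.Bounded (2 ^ w) → σ'.Bounded (2 ^ w) := by
  induction h with
  | skip => exact id
  | const r n σ hn => exact fun h => h.setReg hn
  | op o r a b σ ho => exact fun h => h.setReg ho
  | load r k a σ => exact fun h => h.setReg (h.2 _ _)
  | store k a r σ => exact fun h => h.setMem (h.1 _)
  | flip r σ hw =>
    intro h
    have h2 : (ρ σ.coins).toNat < 2 ^ w :=
      lt_of_le_of_lt (Bool.toNat_le _) (Nat.one_lt_two_pow hw.ne')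
    exact h.setReg h2
  | seq _ _ ih1 ih2 => exact fun h => ih2 (ih1 h)
  | iteTrue _ _ ih => exact ih
  | iteFalse _ _ ih => exact ih
  | loopStop => exact id
  | loopStep _ _ _ ih1 ih2 => exact fun h => ih2 (ih1 h)

theorem Exec.mono {w w' : ℕ} (hww : w ≤ w') {ρ : ℕ → Bool} {p : Prog} {σ σ' : State} {t : ℕ}
    (h : Exec w ρ p σ t σ') : Exec w' ρ p σ t σ' := by
  have hp : 2 ^ w ≤ 2 ^ w' := Nat.pow_le_pow_right (by norm_num) hww
  induction h with
  | skip => exact .skip _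
  | const r n σ hn => exact .const r n σ (hn.trans_le hp)
  | op o r a b σ ho => exact .op o r a b σ (ho.trans_le hp)
  | load r k a σ => exact .load r k a σ
  | store k a r σ => exact .store k a r σ
  | flip r σ hw => exact .flip r σ (hw.trans_le hww)
  | seq _ _ ih1 ih2 => exact .seq ih1 ih2
  | iteTrue hr _ ih => exact .iteTrue hr ih
  | iteFalse hr _ ih => exact .iteFalse hr ih
  | loopStop hr => exact .loopStop hr
  | loopStep hr _ _ ih1 ih2 => exact .loopStep hr ih1 ih2

/-- A number above all registers that the program may write. -/
def Prog.regBound : Prog → ℕ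
  | .skip => 0
  | .const r _ => r + 1
  | .op _ r _ _ => r + 1
  | .load r _ _ => r + 1
  | .store _ _ _ => 0
  | .flip r => r + 1
  | .seq p q => max p.regBound q.regBound
  | .ite _ p q => max p.regBound q.regBound
  | .loop _ p => p.regBound

theorem Exec.reg_eq {w : ℕ} {ρ : ℕ → Bool} {p : Prog} {σ σ' : State} {t : ℕ}
    (h : Exec w ρ p σ t σ') {r : ℕ} (hr : p.regBound ≤ r) : σ'.reg r = σ.reg r := by
  induction h with
  | skip => rfl
  | const r' n σ hn =>
    simp only [Prog.regBound] at hr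
    simp; omega
  | op o r' a b σ ho =>
    simp only [Prog.regBound] at hr
    simp; omega
  | load r' k a σ =>
    simp only [Prog.regBound] at hr
    simp; omega
  | store k a r' σ => rfl
  | flip r' σ hw =>
    simp only [Prog.regBound] at hr
    simp [State.toss]; omega
  | seq _ _ ih1 ih2 =>
    simp only [Prog.regBound, max_le_iff] at hr
    rw [ih2 hr.2, ih1 hr.1]
  | iteTrue _ _ ih =>
    simp only [Prog.regBound, max_le_iff] at hr
    exact ih hr.1
  | iteFalse _ _ ih =>
    simp only [Prog.regBound, max_le_iff] at hr
    exact ih hr.2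
  | loopStop => rfl
  | loopStep _ _ _ ih1 ih2 =>
    simp only [Prog.regBound] at hr
    rw [ih2 (by simpa [Prog.regBound] using hr), ih1 hr]

/-- The program with all registers shifted by `a` and all memory banks shifted by `b`. -/
def Prog.shift (a b : ℕ) : Prog → Prog
  | .skip => .skip
  | .const r n => .const (r + a) n
  | .op o r x y => .op o (r + a) (x + a) (y + a)
  | .load r k x => .load (r + a) (k + b) (x + a)
  | .store k x r => .store (k + b) (x + a) (r + a)
  | .flip r => .flip (r + a)
  | .seq p q => .seq (p.shift a b) (q.shift a b)
  | .ite r p q => .ite (r + a) (p.shift a b) (q.shift a b)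
  | .loop r p => .loop (r + a) (p.shift a b)

/-- The state seen through the shift of `Prog.shift`. -/
def State.window (a b : ℕ) (τ : State) : State where
  reg := fun r => τ.reg (r + a)
  mem := fun k => τ.mem (k + b)
  coins := τ.coins

/-- The state `τ` with the window replaced by `σ`. -/
def State.withWindow (a b : ℕ) (τ σ : State) : State where
  reg := fun r => if a ≤ r then σ.reg (r - a) else τ.reg r
  mem := fun k => if b ≤ k then σ.mem (k - b) else τ.mem k
  coins := σ.coins

theorem State.withWindow_setReg (a b : ℕ) (τ σ : State) (r x : ℕ) :
    τ.withWindow a b (σ.setReg r x) = (τ.withWindow a b σ).setReg (r + a) x := by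
  simp only [withWindow, setReg, State.mk.injEq, and_true]
  funext r'
  simp only [Function.update_apply]
  split_ifs <;> first | rfl | omega

theorem State.withWindow_setMem (a b : ℕ) (τ σ : State) (k i x : ℕ) :
    τ.withWindow a b (σ.setMem k i x) = (τ.withWindow a b σ).setMem (k + b) i x := by
  simp only [withWindow, setMem, State.mk.injEq, and_true, true_and]
  funext k'
  simp only [Function.update_apply]
  split_ifs <;> first | rfl | omega | (simp)

@[simp] theorem State.withWindow_reg (a b : ℕ) (τ σ : State) (r : ℕ) :
    (τ.withWindow a b σ).reg (r + a) = σ.reg r := by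
  simp [withWindow]

@[simp] theorem State.withWindow_mem (a b : ℕ) (τ σ : State) (k : ℕ) :
    (τ.withWindow a b σ).mem (k + b) = σ.mem k := by
  simp [withWindow]

theorem State.withWindow_window (a b : ℕ) (τ : State) :
    τ.withWindow a b (τ.window a b) = τ := by
  rcases τ with ⟨f, g, c⟩
  simp only [withWindow, window, State.mk.injEq, and_true]
  constructor
  · funext r
    split_ifs with h
    · rw [Nat.sub_add_cancel h]
    · rfl
  · funext r
    split_ifs with h
    · rw [Nat.sub_add_cancel h]
    · rfl

/-- A shifted program does in its window what the program does, and leaves the rest alone. -/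
theorem Exec.shift {w : ℕ} {ρ : ℕ → Bool} {p : Prog} {σ σ' : State} {t : ℕ}
    (h : Exec w ρ p σ t σ') (a b : ℕ) (τ : State) :
    Exec w ρ (p.shift a b) (τ.withWindow a b σ) t (τ.withWindow a b σ') := by
  induction h with
  | skip => exact .skip _
  | const r n σ hn =>
    rw [State.withWindow_setReg]
    exact .const _ _ _ hn
  | op o r x y σ ho =>
    rw [State.withWindow_setReg]
    have := Exec.op (ρ := ρ) (w := w) o (r + a) (x + a) (y + a) (τ.withWindow a b σ) (by simpa)
    simpa [Prog.shift] using this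
  | load r k x σ =>
    rw [State.withWindow_setReg]
    have := Exec.load (ρ := ρ) (w := w) (r + a) (k + b) (x + a) (τ.withWindow a b σ)
    simpa [Prog.shift] using this
  | store k x r σ =>
    rw [State.withWindow_setMem]
    have := Exec.store (ρ := ρ) (w := w) (k + b) (x + a) (r + a) (τ.withWindow a b σ)
    simpa [Prog.shift] using this
  | flip r σ hw =>
    have := Exec.flip (ρ := ρ) (w := w) (r + a) (τ.withWindow a b σ) hw
    have h2 : τ.withWindow a b (σ.toss r (ρ σ.coins)) =
        (τ.withWindow a b σ).toss (r + a) (ρ σ.coins) := by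
      simp only [State.toss]
      rw [← State.withWindow_setReg]
      rfl
    rw [h2]
    exact this
  | seq _ _ ih1 ih2 => exact .seq ih1 ih2
  | iteTrue hr _ ih => exact .iteTrue (by simpa using hr) ih
  | iteFalse hr _ ih => exact .iteFalse (by simpa using hr) ih
  | loopStop hr => exact .loopStop (by simpa using hr)
  | loopStep hr _ _ ih1 ih2 => exact .loopStep (by simpa using hr) ih1 ih2

end WordRAM

/-! ### A structured language over the word RAM -/

namespace WordRAM

/-- Word expressions: literals, registers, memory cells and binary instructions. -/
inductive Ex
  | lit (n : ℕ)
  | reg (r : ℕ)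
  | ld (k : ℕ) (a : Ex)
  | bin (o : BinOp) (a b : Ex)

namespace Ex

instance (n : ℕ) : OfNat Ex n := ⟨.lit n⟩
instance : Add Ex := ⟨.bin .add⟩
instance : Sub Ex := ⟨.bin .sub⟩
instance : Mul Ex := ⟨.bin .mul⟩
instance : Div Ex := ⟨.bin .div⟩
instance : Mod Ex := ⟨.bin .mod⟩

/-- The comparison `a < b`, with value `0` or `1`. -/
def lt (a b : Ex) : Ex := .bin .lt a b

/-- The comparison `a = b`, with value `0` or `1`. -/
def eq (a b : Ex) : Ex := .bin .eq a b

/-- The value of an expression. -/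
def eval (σ : State) : Ex → ℕ
  | lit n => n
  | reg r => σ.reg r
  | ld k a => σ.mem k (a.eval σ)
  | bin o a b => o.eval (a.eval σ) (b.eval σ)

end Ex

/-- The condition under which the value of an instruction on words below `B` can exceed `B`
and has to be checked. -/
def BinOp.Fits (B : ℕ) : BinOp → ℕ → ℕ → Prop
  | .add, x, y => x + y < B
  | .mul, x, y => x * y < B
  | .shl, x, y => x <<< y < B
  | _, _, _ => True

/-- No sum, product or shift in the expression exceeds `B`. -/
def Ex.Fits (B : ℕ) (σ : State) : Ex → Prop
  | lit _ => True
  | reg _ => True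
  | ld _ a => a.Fits B σ
  | bin o a b => a.Fits B σ ∧ b.Fits B σ ∧ o.Fits B (a.eval σ) (b.eval σ)

theorem BinOp.eval_lt {w : ℕ} (hw : 0 < w) {o : BinOp} {x y : ℕ} (hx : x < 2 ^ w) (hy : y < 2 ^ w)
    (h : o.Fits (2 ^ w) x y) : o.eval x y < 2 ^ w := by
  have h1 : 1 < 2 ^ w := Nat.one_lt_two_pow hw.ne'
  cases o with
  | add => exact h
  | sub => exact (Nat.sub_le _ _).trans_lt hx
  | mul => exact h
  | div => exact (Nat.div_le_self _ _).trans_lt hx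
  | mod => exact (Nat.mod_le _ _).trans_lt hx
  | and => exact Nat.and_lt_two_pow _ hy
  | or => exact Nat.or_lt_two_pow hx hy
  | xor => exact Nat.xor_lt_two_pow hx hy
  | shl => exact h
  | shr => exact lt_of_le_of_lt (Nat.shiftRight_le _ _) hx
  | eq => simp only [BinOp.eval]; split_ifs <;> omega
  | lt => simp only [BinOp.eval]; split_ifs <;> omega

namespace Ex

@[simp] theorem eval_lit (σ : State) (n : ℕ) : (lit n).eval σ = n := rfl
@[simp] theorem eval_ofNat (σ : State) (n : ℕ) :
    (no_index (OfNat.ofNat n) : Ex).eval σ = n := rfl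
@[simp] theorem eval_reg (σ : State) (r : ℕ) : (reg r).eval σ = σ.reg r := rfl
@[simp] theorem eval_ld (σ : State) (k : ℕ) (a : Ex) : (ld k a).eval σ = σ.mem k (a.eval σ) := rfl
@[simp] theorem eval_add (σ : State) (a b : Ex) : (a + b).eval σ = a.eval σ + b.eval σ := rfl
@[simp] theorem eval_sub (σ : State) (a b : Ex) : (a - b).eval σ = a.eval σ - b.eval σ := rfl
@[simp] theorem eval_mul (σ : State) (a b : Ex) : (a * b).eval σ = a.eval σ * b.eval σ := rfl
@[simp] theorem eval_div (σ : State) (a b : Ex) : (a / b).eval σ = a.eval σ / b.eval σ := rfl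
@[simp] theorem eval_mod (σ : State) (a b : Ex) : (a % b).eval σ = a.eval σ % b.eval σ := rfl
@[simp] theorem eval_lt (σ : State) (a b : Ex) :
    (a.lt b).eval σ = if a.eval σ < b.eval σ then 1 else 0 := rfl
@[simp] theorem eval_eq (σ : State) (a b : Ex) :
    (a.eq b).eval σ = if a.eval σ = b.eval σ then 1 else 0 := rfl

@[simp] theorem fits_lit (B : ℕ) (σ : State) (n : ℕ) : (lit n).Fits B σ := trivial
@[simp] theorem fits_ofNat (B : ℕ) (σ : State) (n : ℕ) :
    (no_index (OfNat.ofNat n) : Ex).Fits B σ := trivial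
@[simp] theorem fits_reg (B : ℕ) (σ : State) (r : ℕ) : (reg r).Fits B σ := trivial
@[simp] theorem fits_ld (B : ℕ) (σ : State) (k : ℕ) (a : Ex) :
    (ld k a).Fits B σ ↔ a.Fits B σ := Iff.rfl
@[simp] theorem fits_add (B : ℕ) (σ : State) (a b : Ex) :
    (a + b).Fits B σ ↔ a.Fits B σ ∧ b.Fits B σ ∧ a.eval σ + b.eval σ < B := Iff.rfl
@[simp] theorem fits_mul (B : ℕ) (σ : State) (a b : Ex) :
    (a * b).Fits B σ ↔ a.Fits B σ ∧ b.Fits B σ ∧ a.eval σ * b.eval σ < B := Iff.rfl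
@[simp] theorem fits_sub (B : ℕ) (σ : State) (a b : Ex) :
    (a - b).Fits B σ ↔ a.Fits B σ ∧ b.Fits B σ :=
  ⟨fun h => ⟨h.1, h.2.1⟩, fun h => ⟨h.1, h.2, trivial⟩⟩
@[simp] theorem fits_div (B : ℕ) (σ : State) (a b : Ex) :
    (a / b).Fits B σ ↔ a.Fits B σ ∧ b.Fits B σ :=
  ⟨fun h => ⟨h.1, h.2.1⟩, fun h => ⟨h.1, h.2, trivial⟩⟩
@[simp] theorem fits_mod (B : ℕ) (σ : State) (a b : Ex) :
    (a % b).Fits B σ ↔ a.Fits B σ ∧ b.Fits B σ :=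
  ⟨fun h => ⟨h.1, h.2.1⟩, fun h => ⟨h.1, h.2, trivial⟩⟩
@[simp] theorem fits_lt (B : ℕ) (σ : State) (a b : Ex) :
    (a.lt b).Fits B σ ↔ a.Fits B σ ∧ b.Fits B σ :=
  ⟨fun h => ⟨h.1, h.2.1⟩, fun h => ⟨h.1, h.2, trivial⟩⟩
@[simp] theorem fits_eq (B : ℕ) (σ : State) (a b : Ex) :
    (a.eq b).Fits B σ ↔ a.Fits B σ ∧ b.Fits B σ :=
  ⟨fun h => ⟨h.1, h.2.1⟩, fun h => ⟨h.1, h.2, trivial⟩⟩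

/-- The largest literal. -/
def maxLit : Ex → ℕ
  | lit n => n
  | reg _ => 0
  | ld _ a => a.maxLit
  | bin _ a b => max a.maxLit b.maxLit

/-- All registers read are below `d`. -/
def RegsBelow (d : ℕ) : Ex → Bool
  | lit _ => true
  | reg r => decide (r < d)
  | ld _ a => a.RegsBelow d
  | bin _ a b => a.RegsBelow d && b.RegsBelow d

/-- The number of instructions of the compiled expression. -/
def cost : Ex → ℕ
  | lit _ => 1
  | reg _ => 1
  | ld _ a => a.cost + 1
  | bin _ a b => a.cost + (b.cost + 1)

/-- Code that computes the expression into register `d`, using registers from `d` on as a stack. -/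
def comp : Ex → ℕ → Prog
  | lit n, d => .const d n
  | reg r, d => .op .or d r r
  | ld k a, d => .seq (a.comp d) (.load d k d)
  | bin o a b, d => .seq (a.comp d) (.seq (b.comp (d + 1)) (.op o d d (d + 1)))

end Ex

/-- Equality of states up to the registers from `R` on. -/
structure State.Agree (R : ℕ) (τ σ : State) : Prop where
  reg : ∀ r < R, τ.reg r = σ.reg r
  mem : τ.mem = σ.mem
  coins : τ.coins = σ.coins

theorem Ex.eval_congr {R : ℕ} {τ σ : State} (h : τ.Agree R σ) :
    ∀ e : Ex, e.RegsBelow R → e.eval τ = e.eval σ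
  | lit _, _ => rfl
  | .reg r, he => h.reg r (by simpa [RegsBelow] using he)
  | ld k a, he => by
    simp only [eval, h.mem, a.eval_congr h he]
  | bin o a b, he => by
    simp only [RegsBelow, Bool.and_eq_true] at he
    simp only [eval, a.eval_congr h he.1, b.eval_congr h he.2]

theorem Ex.fits_congr {B R : ℕ} {τ σ : State} (h : τ.Agree R σ) :
    ∀ e : Ex, e.RegsBelow R → (e.Fits B τ ↔ e.Fits B σ)
  | lit _, _ => Iff.rfl
  | .reg r, _ => Iff.rfl
  | ld k a, he => a.fits_congr (B := B) h he
  | bin o a b, he => by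
    simp only [RegsBelow, Bool.and_eq_true] at he
    simp only [Fits, a.fits_congr h he.1, b.fits_congr h he.2, a.eval_congr h he.1,
      b.eval_congr h he.2]

theorem Ex.exec_comp {w : ℕ} (hw : 0 < w) (ρ : ℕ → Bool) {R : ℕ} : ∀ (e : Ex) {d : ℕ} (τ : State),
    R ≤ d → e.RegsBelow R → e.maxLit < 2 ^ w → τ.Bounded (2 ^ w) → e.Fits (2 ^ w) τ →
    ∃ τ', Exec w ρ (e.comp d) τ e.cost τ' ∧ τ'.reg d = e.eval τ ∧ τ'.Agree d τ
  | lit n, d, τ, _, _, hl, _, _ =>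
    ⟨_, .const d n τ hl, by simp, fun r hr => by simp [hr.ne], rfl, rfl⟩
  | .reg r, d, τ, _, _, _, hb, _ => by
    refine ⟨_, .op .or d r r τ ?_, by simp [BinOp.eval], fun r hr => by simp [hr.ne], rfl, rfl⟩
    simpa [BinOp.eval] using hb.1 r
  | ld k a, d, τ, hd, hr, hl, hb, hf => by
    obtain ⟨τ', h1, h2, h3⟩ := a.exec_comp hw ρ τ hd hr hl hb hf
    refine ⟨_, .seq h1 (.load d k d τ'), by simp [h2, h3.mem], fun r hr => ?_, h3.mem, h3.coins⟩
    simp [hr.ne, h3.reg r hr]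
  | bin o a b, d, τ, hd, hr, hl, hb, hf => by
    simp only [RegsBelow, Bool.and_eq_true] at hr
    simp only [maxLit, max_lt_iff] at hl
    obtain ⟨τ', h1, h2, h3⟩ := a.exec_comp hw ρ τ hd hr.1 hl.1 hb hf.1
    have hRd : τ'.Agree R τ := ⟨fun r h => h3.reg r (h.trans_le hd), h3.mem, h3.coins⟩
    obtain ⟨τ'', g1, g2, g3⟩ := b.exec_comp hw ρ τ' (d := d + 1) (by omega) hr.2 hl.2
      (h1.bounded hb) ((b.fits_congr hRd hr.2).2 hf.2.1)
    have e1 : τ''.reg d = a.eval τ := by rw [g3.reg d (by omega), h2]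
    have e2 : τ''.reg (d + 1) = b.eval τ := by rw [g2, b.eval_congr hRd hr.2]
    refine ⟨_, .seq h1 (.seq g1 (.op o d d (d + 1) τ'' ?_)), ?_, fun r hr => ?_, ?_, ?_⟩
    · have hb'' := g1.bounded (h1.bounded hb)
      refine BinOp.eval_lt hw (hb''.1 _) (hb''.1 _) ?_
      rw [e1, e2]
      exact hf.2.2
    · simp [e1, e2, eval]
    · simp [hr.ne, g3.reg r (by omega), h3.reg r hr]
    · exact g3.mem.trans h3.mem
    · exact g3.coins.trans h3.coins

/-- Structured commands without coin tosses. Registers below `tempReg` are the variables. -/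
inductive Cmd
  | skip
  /-- `reg r := e` -/
  | set (r : ℕ) (e : Ex)
  /-- `(bank k)[a] := e` -/
  | st (k : ℕ) (a e : Ex)
  /-- first `c`, then `d` -/
  | seq (c d : Cmd)
  | ite (e : Ex) (c d : Cmd)
  | whileDo (e : Ex) (c : Cmd)

infixr:60 " ;; " => Cmd.seq

/-- The registers from this number on hold intermediate values of expressions. -/
def tempReg : ℕ := 40

namespace Cmd

/-- The machine code of a command. -/
def comp : Cmd → Prog
  | skip => .skip
  | set r e => .seq (e.comp tempReg) (.op .or r tempReg tempReg)
  | st k a e => .seq (a.comp tempReg) (.seq (e.comp (tempReg + 1)) (.store k tempReg (tempReg + 1)))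
  | seq c d => .seq c.comp d.comp
  | ite e c d => .seq (e.comp tempReg) (.ite tempReg c.comp d.comp)
  | .whileDo e c => .seq (e.comp tempReg) (.loop tempReg (.seq c.comp (e.comp tempReg)))

/-- `for r := 0, …, reg l - 1 do c` -/
def forTo (r l : ℕ) (c : Cmd) : Cmd :=
  .set r 0 ;; .whileDo (.lt (.reg r) (.reg l)) (c ;; .set r (.reg r + 1))

/-- The variables occurring are registers below `tempReg`. -/
def WF : Cmd → Bool
  | skip => true
  | set r e => decide (r < tempReg) && e.RegsBelow tempReg
  | st _ a e => a.RegsBelow tempReg && e.RegsBelow tempReg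
  | seq c d => c.WF && d.WF
  | ite e c d => e.RegsBelow tempReg && c.WF && d.WF
  | .whileDo e c => e.RegsBelow tempReg && c.WF

/-- The largest literal. -/
def maxLit : Cmd → ℕ
  | skip => 0
  | set _ e => e.maxLit
  | st _ a e => max a.maxLit e.maxLit
  | seq c d => max c.maxLit d.maxLit
  | ite e c d => max e.maxLit (max c.maxLit d.maxLit)
  | .whileDo e c => max e.maxLit c.maxLit

/-- An upper bound for the number of instructions per elementary command. -/
def size : Cmd → ℕ
  | skip => 1
  | set _ e => e.cost + 1
  | st _ a e => a.cost + e.cost + 1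
  | seq c d => c.size + d.size
  | ite e c d => e.cost + 1 + c.size + d.size
  | .whileDo e c => e.cost + 1 + c.size

/-- The command may write to register `r`. -/
def wr (r : ℕ) : Cmd → Bool
  | skip => false
  | set r' _ => r == r'
  | st _ _ _ => false
  | seq c d => c.wr r || d.wr r
  | ite _ c d => c.wr r || d.wr r
  | .whileDo _ c => c.wr r

/-- The command may write to bank `k`. -/
def wm (k : ℕ) : Cmd → Bool
  | skip => false
  | set _ _ => false
  | st k' _ _ => k == k'
  | seq c d => c.wm k || d.wm k
  | ite _ c d => c.wm k || d.wm k
  | .whileDo _ c => c.wm k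

/-- The precondition for a `while` loop to reach the postcondition `Q` within fewer than `f`
rounds, when the precondition transformer of its body is `body`. -/
def whileWp (B : ℕ) (e : Ex) (body : (State → ℕ → Prop) → State → ℕ → Prop)
    (Q : State → ℕ → Prop) : ℕ → State → ℕ → Prop
  | 0, _, _ => False
  | f + 1, σ, t => e.Fits B σ ∧ (e.eval σ ≠ 0 → body (whileWp B e body Q f) σ (t + 1)) ∧
      (e.eval σ = 0 → Q σ (t + 1))

/-- Weakest precondition on words below `B`: started in `σ` when `t` elementary commands and tests
have been executed, the command halts without overflow in some `σ'` after `t'` of them, and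
`Q σ' t'` holds. -/
def wp (B : ℕ) : Cmd → (State → ℕ → Prop) → State → ℕ → Prop
  | skip, Q, σ, t => Q σ (t + 1)
  | set r e, Q, σ, t => e.Fits B σ ∧ Q (σ.setReg r (e.eval σ)) (t + 1)
  | st k a e, Q, σ, t =>
    a.Fits B σ ∧ e.Fits B σ ∧ Q (σ.setMem k (a.eval σ) (e.eval σ)) (t + 1)
  | seq c d, Q, σ, t => c.wp B (d.wp B Q) σ t
  | ite e c d, Q, σ, t =>
    e.Fits B σ ∧ (e.eval σ ≠ 0 → c.wp B Q σ (t + 1)) ∧ (e.eval σ = 0 → d.wp B Q σ (t + 1))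
  | .whileDo e c, Q, σ, t => ∃ f, whileWp B e (c.wp B) Q f σ t

theorem wp_mono {B : ℕ} : ∀ (c : Cmd) {Q Q' : State → ℕ → Prop} {σ : State} {t : ℕ},
    (∀ σ' t', Q σ' t' → Q' σ' t') → c.wp B Q σ t → c.wp B Q' σ t
  | skip, _, _, _, _, h, hc => h _ _ hc
  | set _ _, _, _, _, _, h, hc => ⟨hc.1, h _ _ hc.2⟩
  | st _ _ _, _, _, _, _, h, hc => ⟨hc.1, hc.2.1, h _ _ hc.2.2⟩
  | seq c d, _, _, _, _, h, hc => c.wp_mono (fun _ _ => d.wp_mono h) hc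
  | ite _ c d, _, _, _, _, h, hc =>
    ⟨hc.1, fun h0 => c.wp_mono h (hc.2.1 h0), fun h0 => d.wp_mono h (hc.2.2 h0)⟩
  | .whileDo e c, Q, Q', σ, t, h, hc => by
    obtain ⟨f, hf⟩ := hc
    refine ⟨f, ?_⟩
    induction f generalizing σ t with
    | zero => exact hf
    | succ f ih =>
      exact ⟨hf.1, fun h0 => c.wp_mono ih (hf.2.1 h0), fun h0 => h _ _ (hf.2.2 h0)⟩

/-- `σ'` differs from `σ` only in what the command may write. -/
structure Frame (c : Cmd) (σ σ' : State) : Prop where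
  reg : ∀ r, c.wr r = false → σ'.reg r = σ.reg r
  mem : ∀ k, c.wm k = false → σ'.mem k = σ.mem k
  coins : σ'.coins = σ.coins

theorem Frame.refl (c : Cmd) (σ : State) : c.Frame σ σ := ⟨fun _ _ => rfl, fun _ _ => rfl, rfl⟩

theorem Frame.trans {c : Cmd} {σ σ' σ'' : State} (h : c.Frame σ σ') (h' : c.Frame σ' σ'') :
    c.Frame σ σ'' :=
  ⟨fun r hr => (h'.reg r hr).trans (h.reg r hr), fun k hk => (h'.mem k hk).trans (h.mem k hk),
    h'.coins.trans h.coins⟩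

theorem Frame.weaken {c d : Cmd} (hr : ∀ r, d.wr r = false → c.wr r = false)
    (hm : ∀ k, d.wm k = false → c.wm k = false) {σ σ' : State} (h : c.Frame σ σ') : d.Frame σ σ' :=
  ⟨fun r h0 => h.reg r (hr r h0), fun k h0 => h.mem k (hm k h0), h.coins⟩

theorem wp_frame {B : ℕ} : ∀ (c : Cmd) {Q : State → ℕ → Prop} {σ : State} {t : ℕ},
    c.wp B Q σ t → c.wp B (fun σ' t' => c.Frame σ σ' ∧ Q σ' t') σ t
  | skip, _, _, _, hc => ⟨Frame.refl _ _, hc⟩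
  | set r e, _, σ, _, hc => by
    refine ⟨hc.1, ⟨fun r' hr => ?_, fun _ _ => rfl, rfl⟩, hc.2⟩
    have : r' ≠ r := by simpa [wr] using hr
    simp [this]
  | st k a e, _, σ, _, hc => by
    refine ⟨hc.1, hc.2.1, ⟨fun _ _ => rfl, fun k' hk => ?_, rfl⟩, hc.2.2⟩
    have : k' ≠ k := by simpa [wm] using hk
    simp [this]
  | seq c d, Q, σ, t, hc => by
    refine c.wp_mono ?_ (c.wp_frame hc)
    rintro σ' t' ⟨h1, h2⟩
    refine d.wp_mono ?_ (d.wp_frame h2)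
    rintro σ'' t'' ⟨h3, h4⟩
    refine ⟨(h1.weaken ?_ ?_).trans (h3.weaken ?_ ?_), h4⟩ <;>
      intro _ h <;> simp only [wr, wm, Bool.or_eq_false_iff] at h
    exacts [h.1, h.1, h.2, h.2]
  | ite e c d, Q, σ, t, hc => by
    refine ⟨hc.1, fun h0 => ?_, fun h0 => ?_⟩
    · refine c.wp_mono ?_ (c.wp_frame (hc.2.1 h0))
      rintro σ' t' ⟨h1, h2⟩
      refine ⟨h1.weaken ?_ ?_, h2⟩ <;>
        intro _ h <;> simp only [wr, wm, Bool.or_eq_false_iff] at h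
      exacts [h.1, h.1]
    · refine d.wp_mono ?_ (d.wp_frame (hc.2.2 h0))
      rintro σ' t' ⟨h1, h2⟩
      refine ⟨h1.weaken ?_ ?_, h2⟩ <;>
        intro _ h <;> simp only [wr, wm, Bool.or_eq_false_iff] at h
      exacts [h.2, h.2]
  | .whileDo e c, Q, σ, t, hc => by
    obtain ⟨f, hf⟩ := hc
    refine ⟨f, ?_⟩
    have key : ∀ f σ' t', c.Frame σ σ' → whileWp B e (c.wp B) Q f σ' t' →
        whileWp B e (c.wp B) (fun σ' t' => (Cmd.whileDo e c).Frame σ σ' ∧ Q σ' t') f σ' t' := by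
      intro f
      induction f with
      | zero => exact fun _ _ _ h => h
      | succ f ih =>
        intro σ' t' hF hf
        refine ⟨hf.1, fun h0 => ?_, fun h0 => ⟨⟨hF.reg, hF.mem, hF.coins⟩, hf.2.2 h0⟩⟩
        refine c.wp_mono ?_ (c.wp_frame (hf.2.1 h0))
        rintro σ'' t'' ⟨h1, h2⟩
        exact ih _ _ (hF.trans h1) h2
    exact key f σ t (Frame.refl _ _) hf

theorem wp_conseq {B : ℕ} {c : Cmd} {P Q : State → ℕ → Prop} {σ : State} {t : ℕ}
    (h : c.wp B P σ t) (hQ : ∀ σ' t', c.Frame σ σ' → P σ' t' → Q σ' t') : c.wp B Q σ t :=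
  c.wp_mono (fun σ' t' hq => hQ σ' t' hq.1 hq.2) (c.wp_frame h)

theorem wp_seq {B : ℕ} {c d : Cmd} {P Q : State → ℕ → Prop} {σ : State} {t : ℕ}
    (h : c.wp B P σ t) (hQ : ∀ σ' t', c.Frame σ σ' → P σ' t' → d.wp B Q σ' t') :
    (c ;; d).wp B Q σ t :=
  wp_conseq (c := c) (Q := d.wp B Q) h hQ

/-- The soundness of `Cmd.wp` for the compiled program. -/
theorem exec_of_wp {w : ℕ} (hw : 0 < w) (ρ : ℕ → Bool) :
    ∀ (c : Cmd) {Q : State → ℕ → Prop} {σ : State} {t : ℕ} (τ : State),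
    c.WF → c.maxLit < 2 ^ w → τ.Agree tempReg σ → τ.Bounded (2 ^ w) → c.wp (2 ^ w) Q σ t →
    ∃ (T s : ℕ) (σ' τ' : State), Exec w ρ c.comp τ T τ' ∧ τ'.Agree tempReg σ' ∧ T ≤ c.size * s ∧
      Q σ' (t + s)
  | skip, Q, σ, t, τ, _, _, ha, _, hq => ⟨1, 1, σ, τ, .skip τ, ha, by simp [size], hq⟩
  | set r e, Q, σ, t, τ, hwf, hl, ha, hb, hq => by
    simp only [WF, Bool.and_eq_true, decide_eq_true_eq] at hwf
    obtain ⟨τ', h1, h2, h3⟩ := e.exec_comp hw ρ (d := tempReg) τ le_rfl hwf.2 hl hb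
      ((e.fits_congr ha hwf.2).2 hq.1)
    refine ⟨_, 1, _, _, .seq h1 (.op .or r tempReg tempReg τ' ?_), ⟨fun r' hr => ?_, ?_, ?_⟩, ?_,
      hq.2⟩
    · simpa [BinOp.eval] using (h1.bounded hb).1 tempReg
    · simp only [BinOp.eval, Nat.or_self, State.setReg_reg, h2, e.eval_congr ha hwf.2]
      rw [h3.reg r' hr, ha.reg r' hr]
    · exact h3.mem.trans ha.mem
    · exact h3.coins.trans ha.coins
    · simp [size]
  | st k a e, Q, σ, t, τ, hwf, hl, ha, hb, hq => by
    simp only [WF, Bool.and_eq_true] at hwf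
    simp only [maxLit, max_lt_iff] at hl
    obtain ⟨τ', h1, h2, h3⟩ := a.exec_comp hw ρ (d := tempReg) τ le_rfl hwf.1 hl.1 hb
      ((a.fits_congr ha hwf.1).2 hq.1)
    have ha' : τ'.Agree tempReg σ :=
      ⟨fun r hr => (h3.reg r hr).trans (ha.reg r hr), h3.mem.trans ha.mem, h3.coins.trans ha.coins⟩
    obtain ⟨τ'', g1, g2, g3⟩ := e.exec_comp hw ρ (d := tempReg + 1) τ' (by omega) hwf.2 hl.2
      (h1.bounded hb) ((e.fits_congr ha' hwf.2).2 hq.2.1)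
    refine ⟨_, 1, _, _, .seq h1 (.seq g1 (.store k tempReg (tempReg + 1) τ'')),
      ⟨fun r' hr => ?_, ?_, ?_⟩, ?_, hq.2.2⟩
    · simp only [State.setMem_reg]
      rw [g3.reg r' (by omega), ha'.reg r' hr]
    · rw [g3.reg tempReg (by omega), h2, g2, a.eval_congr ha hwf.1, e.eval_congr ha' hwf.2]
      simp only [State.setMem, g3.mem, ha'.mem]
    · exact g3.coins.trans ha'.coins
    · simp [size, add_assoc]
  | seq c d, Q, σ, t, τ, hwf, hl, ha, hb, hq => by
    simp only [WF, Bool.and_eq_true] at hwf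
    simp only [maxLit, max_lt_iff] at hl
    obtain ⟨T, s, σ', τ', h1, h2, h3, h4⟩ := c.exec_of_wp hw ρ τ hwf.1 hl.1 ha hb hq
    obtain ⟨T', s', σ'', τ'', g1, g2, g3, g4⟩ :=
      d.exec_of_wp hw ρ τ' hwf.2 hl.2 h2 (h1.bounded hb) h4
    refine ⟨_, s + s', _, _, .seq h1 g1, g2, ?_, by rwa [← add_assoc]⟩
    simp only [size]
    nlinarith [Nat.zero_le (c.size * s'), Nat.zero_le (d.size * s)]
  | ite e c d, Q, σ, t, τ, hwf, hl, ha, hb, hq => by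
    simp only [WF, Bool.and_eq_true] at hwf
    simp only [maxLit, max_lt_iff] at hl
    obtain ⟨τ', h1, h2, h3⟩ := e.exec_comp hw ρ (d := tempReg) τ le_rfl hwf.1.1 hl.1 hb
      ((e.fits_congr ha hwf.1.1).2 hq.1)
    have ha' : τ'.Agree tempReg σ :=
      ⟨fun r hr => (h3.reg r hr).trans (ha.reg r hr), h3.mem.trans ha.mem, h3.coins.trans ha.coins⟩
    rw [e.eval_congr ha hwf.1.1] at h2
    by_cases h0 : e.eval σ = 0
    · obtain ⟨T', s', σ'', τ'', g1, g2, g3, g4⟩ :=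
        d.exec_of_wp hw ρ τ' hwf.2 hl.2.2 ha' (h1.bounded hb) (hq.2.2 h0)
      refine ⟨_, 1 + s', _, _, .seq h1 (.iteFalse (by rw [h2, h0]) g1), g2, ?_, by
        rwa [← add_assoc]⟩
      simp only [size]
      nlinarith [Nat.zero_le ((e.cost + 1 + c.size) * s'), Nat.zero_le (c.size + d.size)]
    · obtain ⟨T', s', σ'', τ'', g1, g2, g3, g4⟩ :=
        c.exec_of_wp hw ρ τ' hwf.1.2 hl.2.1 ha' (h1.bounded hb) (hq.2.1 h0)
      refine ⟨_, 1 + s', _, _, .seq h1 (.iteTrue (by rw [h2]; exact h0) g1), g2, ?_, by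
        rwa [← add_assoc]⟩
      simp only [size]
      nlinarith [Nat.zero_le ((e.cost + 1 + d.size) * s'), Nat.zero_le (c.size + d.size)]
  | .whileDo e c, Q, σ, t, τ, hwf, hl, ha, hb, hq => by
    simp only [WF, Bool.and_eq_true] at hwf
    simp only [maxLit, max_lt_iff] at hl
    obtain ⟨f, hf⟩ := hq
    have key : ∀ (f : ℕ) (σ : State) (t : ℕ) (τ : State), τ.Agree tempReg σ → τ.Bounded (2 ^ w) →
        whileWp (2 ^ w) e (c.wp (2 ^ w)) Q f σ t →
        ∃ (τ₀ : State) (T s : ℕ) (σ' τ' : State), Exec w ρ (e.comp tempReg) τ e.cost τ₀ ∧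
          Exec w ρ (.loop tempReg (.seq c.comp (e.comp tempReg))) τ₀ T τ' ∧
          τ'.Agree tempReg σ' ∧ e.cost + T ≤ (e.cost + 1 + c.size) * s ∧ Q σ' (t + s) := by
      intro f
      induction f with
      | zero => exact fun _ _ _ _ _ h => h.elim
      | succ f ih =>
        intro σ t τ ha hb hf
        obtain ⟨τ₀, h1, h2, h3⟩ := e.exec_comp hw ρ (d := tempReg) τ le_rfl hwf.1 hl.1 hb
          ((e.fits_congr ha hwf.1).2 hf.1)
        have ha' : τ₀.Agree tempReg σ :=
          ⟨fun r hr => (h3.reg r hr).trans (ha.reg r hr), h3.mem.trans ha.mem,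
            h3.coins.trans ha.coins⟩
        rw [e.eval_congr ha hwf.1] at h2
        by_cases h0 : e.eval σ = 0
        · refine ⟨τ₀, 1, 1, σ, τ₀, h1, .loopStop (by rw [h2, h0]), ha', by omega, hf.2.2 h0⟩
        · obtain ⟨T₁, s₁, σ₁, τ₁, g1, g2, g3, g4⟩ :=
            c.exec_of_wp hw ρ τ₀ hwf.2 hl.2 ha' (h1.bounded hb) (hf.2.1 h0)
          obtain ⟨τ₂, T₂, s₂, σ₃, τ₃, k1, k2, k3, k4, k5⟩ :=
            ih σ₁ _ τ₁ g2 (g1.bounded (h1.bounded hb)) g4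
          refine ⟨τ₀, _, 1 + s₁ + s₂, σ₃, τ₃, h1,
            .loopStep (by rw [h2]; exact h0) (.seq g1 k1) k2, k3, ?_, ?_⟩
          · nlinarith [Nat.zero_le ((e.cost + 1) * s₁), Nat.zero_le c.size]
          · rwa [← add_assoc, ← add_assoc]
    obtain ⟨τ₀, T, s, σ', τ', h1, h2, h3, h4, h5⟩ := key f σ t τ ha hb hf
    exact ⟨_, s, σ', τ', .seq h1 h2, h3, h4, h5⟩

/-- Rule for `while` loops with invariant `Inv i` before the test that follows `i` rounds. -/
theorem wp_whileDo {B : ℕ} {e : Ex} {c : Cmd} {Q : State → ℕ → Prop} {σ : State} {t : ℕ} (n : ℕ)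
    (Inv : ℕ → State → ℕ → Prop) (h0 : Inv 0 σ t)
    (hfits : ∀ i ≤ n, ∀ σ' t', c.Frame σ σ' → Inv i σ' t' → e.Fits B σ')
    (hlt : ∀ i < n, ∀ σ' t', c.Frame σ σ' → Inv i σ' t' → e.eval σ' ≠ 0)
    (hlast : ∀ σ' t', c.Frame σ σ' → Inv n σ' t' → e.eval σ' = 0)
    (hstep : ∀ i < n, ∀ σ' t', c.Frame σ σ' → Inv i σ' t' → c.wp B (Inv (i + 1)) σ' (t' + 1))
    (hQ : ∀ σ' t', c.Frame σ σ' → Inv n σ' t' → Q σ' (t' + 1)) : (Cmd.whileDo e c).wp B Q σ t := by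
  refine ⟨n + 1, ?_⟩
  have key : ∀ j i σ' t', i + j = n → c.Frame σ σ' → Inv i σ' t' →
      whileWp B e (c.wp B) Q (j + 1) σ' t' := by
    intro j
    induction j with
    | zero =>
      intro i σ' t' hi hF hI
      obtain rfl : i = n := by omega
      exact ⟨hfits i le_rfl σ' t' hF hI, fun h => absurd (hlast σ' t' hF hI) h,
        fun _ => hQ σ' t' hF hI⟩
    | succ j ih =>
      intro i σ' t' hi hF hI
      refine ⟨hfits i (by omega) σ' t' hF hI, fun _ => ?_,
        fun h => absurd h (hlt i (by omega) σ' t' hF hI)⟩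
      refine c.wp_mono ?_ (c.wp_frame (hstep i (by omega) σ' t' hF hI))
      rintro σ'' t'' ⟨h1, h2⟩
      exact ih (i + 1) σ'' t'' (by omega) (hF.trans h1) h2
  exact key n 0 σ t (by omega) (Frame.refl _ _) h0

/-- Rule for `for` loops. The invariant `Inv i` holds before the test that follows `i` rounds. -/
theorem wp_forTo {B r l : ℕ} {c : Cmd} {Q : State → ℕ → Prop} {σ : State} {t : ℕ} (n : ℕ)
    (Inv : ℕ → State → ℕ → Prop) (hn : n < B) (hln : σ.reg l = n)
    (hrl : (l == r) = false) (hwr : c.wr r = false) (hwl : c.wr l = false)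
    (h0 : Inv 0 (σ.setReg r 0) (t + 1))
    (hstep : ∀ i < n, ∀ σ' t', (Cmd.forTo r l c).Frame σ σ' → σ'.reg r = i → Inv i σ' t' →
      c.wp B (fun σ'' t'' => Inv (i + 1) (σ''.setReg r (i + 1)) (t'' + 1)) σ' (t' + 1))
    (hQ : ∀ σ' t', (Cmd.forTo r l c).Frame σ σ' → Inv n σ' t' → Q σ' (t' + 1)) :
    (Cmd.forTo r l c).wp B Q σ t := by
  have hlr : l ≠ r := by simpa using hrl
  refine ⟨Ex.fits_ofNat _ _ _, ?_⟩
  have hFr : ∀ σ', (c ;; .set r (.reg r + 1)).Frame (σ.setReg r (Ex.eval σ 0)) σ' →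
      (Cmd.forTo r l c).Frame σ σ' := by
    intro σ' hF
    refine ⟨fun r' h => ?_, fun k h => ?_, hF.coins⟩
    · simp only [Cmd.forTo, wr, Bool.or_eq_false_iff] at h
      rw [hF.reg r' (by simp [wr, h])]
      have : r' ≠ r := by simpa using h.1
      simp [this]
    · simp only [Cmd.forTo, wm, Bool.or_eq_false_iff] at h
      rw [hF.mem k (by simp [wm, h])]
      rfl
  have hl : ∀ σ', (c ;; .set r (.reg r + 1)).Frame (σ.setReg r (Ex.eval σ 0)) σ' →
      σ'.reg l = n := by
    intro σ' hF
    rw [hF.reg l (by simp [wr, hwl, hlr])]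
    simp [hlr, hln]
  refine wp_whileDo n (fun i σ' t' => σ'.reg r = i ∧ Inv i σ' t') ⟨by simp, h0⟩ ?_ ?_ ?_ ?_ ?_
  · intro i _ σ' t' hF hI
    simp
  · intro i hi σ' t' hF hI
    simp [hl _ hF, hI.1, hi]
  · intro σ' t' hF hI
    simp [hl _ hF, hI.1]
  · intro i hi σ' t' hF hI
    refine c.wp_mono ?_ (c.wp_frame (hstep i hi σ' t' (hFr _ hF) hI.1 hI.2))
    rintro σ'' t'' ⟨h2, h3⟩
    have hr : σ''.reg r = i := (h2.reg r hwr).trans hI.1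
    refine ⟨by simp [hr]; omega, by simp [hr], ?_⟩
    simpa [hr] using h3
  · intro σ' t' hF hI
    exact hQ _ _ (hFr _ hF) hI.2

/-- Rule for `for` loops whose rounds take at most `K` steps each. -/
theorem wp_forTo_le {B r l : ℕ} {c : Cmd} {Q : State → ℕ → Prop} {σ : State} {t : ℕ} (n K : ℕ)
    (Inv : ℕ → State → Prop) (hn : n < B) (hln : σ.reg l = n)
    (hrl : (l == r) = false) (hwr : c.wr r = false) (hwl : c.wr l = false)
    (h0 : Inv 0 (σ.setReg r 0))
    (hstep : ∀ i < n, ∀ σ' t', (Cmd.forTo r l c).Frame σ σ' → σ'.reg r = i → Inv i σ' →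
      c.wp B (fun σ'' t'' => Inv (i + 1) (σ''.setReg r (i + 1)) ∧ t'' ≤ t' + K) σ' t')
    (hQ : ∀ σ' t', (Cmd.forTo r l c).Frame σ σ' → Inv n σ' → t' ≤ t + (n * (K + 2) + 2) →
      Q σ' t') :
    (Cmd.forTo r l c).wp B Q σ t := by
  refine wp_forTo n (fun i σ' t' => Inv i σ' ∧ t' ≤ t + (i * (K + 2) + 1)) hn hln hrl hwr hwl
    ⟨h0, by omega⟩ ?_ ?_
  · intro i hi σ' t' hF hr hI
    refine c.wp_mono ?_ (hstep i hi σ' (t' + 1) hF hr hI.1)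
    rintro σ'' t'' ⟨h1, h2⟩
    refine ⟨h1, ?_⟩
    rw [add_one_mul]
    omega
  · intro σ' t' hF hI
    exact hQ σ' (t' + 1) hF hI.1 (by omega)

end Cmd
end WordRAM

/-! ### Distances in weighted graphs -/

namespace STInstance

variable (I : STInstance)

theorem dist_le_walkLength {u v : Fin I.n} (q : I.G.Walk u v) : I.dist u v ≤ I.walkLength q :=
  iInf_le _ q

theorem exists_walk_of_dist_ne_top {u v : Fin I.n} (h : I.dist u v ≠ ⊤) :
    ∃ q : I.G.Walk u v, I.dist u v = I.walkLength q := by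
  have hne : Nonempty (I.G.Walk u v) := by
    by_contra hc
    rw [not_nonempty_iff] at hc
    exact h (iInf_of_empty _)
  obtain ⟨q, hq⟩ := ciInf_mem fun q : I.G.Walk u v => (I.walkLength q : ℕ∞)
  exact ⟨q, hq.symm⟩

theorem walkLength_append {u v x : Fin I.n} (p : I.G.Walk u v) (q : I.G.Walk v x) :
    I.walkLength (p.append q) = I.walkLength p + I.walkLength q := by
  simp [walkLength, SimpleGraph.Walk.edges_append]

theorem walkLength_cons {u v x : Fin I.n} (h : I.G.Adj u v) (q : I.G.Walk v x) :
    I.walkLength (.cons h q) = I.weight s(u, v) + I.walkLength q := by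
  simp [walkLength]

theorem dist_self (u : Fin I.n) : I.dist u u = 0 := by
  have := I.dist_le_walkLength (SimpleGraph.Walk.nil : I.G.Walk u u)
  simpa [walkLength] using this

theorem dist_comm (u v : Fin I.n) : I.dist u v = I.dist v u := by
  have key : ∀ u v, I.dist u v ≤ I.dist v u := fun u v => by
    refine le_iInf fun q => ?_
    have := I.dist_le_walkLength q.reverse
    simpa [walkLength, SimpleGraph.Walk.edges_reverse] using this
  exact le_antisymm (key u v) (key v u)

theorem dist_triangle (u v x : Fin I.n) : I.dist u x ≤ I.dist u v + I.dist v x := by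
  by_cases h1 : I.dist u v = ⊤
  · simp [h1]
  by_cases h2 : I.dist v x = ⊤
  · simp [h2]
  obtain ⟨p, hp⟩ := I.exists_walk_of_dist_ne_top h1
  obtain ⟨q, hq⟩ := I.exists_walk_of_dist_ne_top h2
  rw [hp, hq]
  refine (I.dist_le_walkLength (p.append q)).trans ?_
  rw [walkLength_append]
  simp

theorem dist_le_weight {u v : Fin I.n} (h : I.G.Adj u v) : I.dist u v ≤ I.weight s(u, v) := by
  refine (I.dist_le_walkLength h.toWalk).trans ?_
  simp [walkLength]

theorem exists_edge {u v : Fin I.n} (h : I.G.Adj u v) : ∃ i, s(I.src i, I.dst i) = s(u, v) := by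
  obtain ⟨i, -, hi⟩ := I.edges_bij.surjOn ((SimpleGraph.mem_edgeSet _).2 h)
  exact ⟨i, hi⟩

theorem adj_edge (i : Fin I.m) : I.G.Adj (I.src i) (I.dst i) :=
  (SimpleGraph.mem_edgeSet _).1 (I.edges_bij.mapsTo (Set.mem_univ i))

theorem weight_le_maxWeight {u v : Fin I.n} (h : I.G.Adj u v) :
    I.weight s(u, v) ≤ I.maxWeight := by
  obtain ⟨i, hi⟩ := I.exists_edge h
  rw [← hi]
  exact Finset.le_sup (f := I.edgeWeight) (Finset.mem_univ i)

/-- A number above all finite distances, which represents infinity. -/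
def inf : ℕ := (I.n + 1) * (I.maxWeight + 1)

theorem dist_lt_inf {u v : Fin I.n} (h : I.dist u v ≠ ⊤) : I.dist u v < I.inf := by
  classical
  obtain ⟨q, -⟩ := I.exists_walk_of_dist_ne_top h
  refine (I.dist_le_walkLength q.bypass).trans_lt ?_
  have h1 : I.walkLength q.bypass ≤ q.bypass.length * I.maxWeight := by
    rw [← SimpleGraph.Walk.length_edges, walkLength, ← List.length_map (f := I.weight)]
    refine List.sum_le_card_nsmul _ _ ?_
    simp only [List.mem_map]
    rintro x ⟨e, he, rfl⟩
    induction e with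
    | _ a b => exact I.weight_le_maxWeight (q.bypass.adj_of_mem_edges he)
  have h2 : q.bypass.length < I.n := by
    simpa using (q.bypass_isPath).length_lt
  have h3 : I.walkLength q.bypass < I.inf := by
    unfold inf
    nlinarith
  exact_mod_cast h3

/-- The distance as a natural number, with `inf` for infinity; vertices are given by their
numbers. -/
def capDist (u v : ℕ) : ℕ :=
  if h : u < I.n ∧ v < I.n then
    if I.dist ⟨u, h.1⟩ ⟨v, h.2⟩ = ⊤ then I.inf else (I.dist ⟨u, h.1⟩ ⟨v, h.2⟩).toNat
  else I.inf

theorem capDist_of_eq_top {u v : Fin I.n} (h : I.dist u v = ⊤) : I.capDist u v = I.inf := by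
  simp [capDist, h]

theorem coe_capDist {u v : Fin I.n} (h : I.dist u v ≠ ⊤) : (I.capDist u v : ℕ∞) = I.dist u v := by
  simp [capDist, h]

theorem capDist_lt_inf {u v : Fin I.n} (h : I.dist u v ≠ ⊤) : I.capDist u v < I.inf := by
  have := I.dist_lt_inf h
  rw [← I.coe_capDist h] at this
  exact_mod_cast this

theorem capDist_lt_inf_iff {u v : Fin I.n} : I.capDist u v < I.inf ↔ I.dist u v ≠ ⊤ :=
  ⟨fun h h' => by rw [I.capDist_of_eq_top h'] at h; exact h.ne rfl, I.capDist_lt_inf⟩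

theorem capDist_le_inf (u v : ℕ) : I.capDist u v ≤ I.inf := by
  by_cases h : u < I.n ∧ v < I.n
  · by_cases h' : I.dist ⟨u, h.1⟩ ⟨v, h.2⟩ = ⊤
    · exact (I.capDist_of_eq_top h').le
    · exact (I.capDist_lt_inf h').le
  · simp [capDist, h]

theorem capDist_self {u : ℕ} (hu : u < I.n) : I.capDist u u = 0 := by
  simp [capDist, hu, dist_self]

theorem capDist_comm (u v : ℕ) : I.capDist u v = I.capDist v u := by
  by_cases h : u < I.n ∧ v < I.n
  · simp [capDist, h.1, h.2, I.dist_comm ⟨u, h.1⟩]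
  · rw [capDist, capDist, dif_neg h, dif_neg fun h' => h h'.symm]

theorem capDist_triangle (u v x : ℕ) : I.capDist u x ≤ I.capDist u v + I.capDist v x := by
  by_cases hu : u < I.n ∧ v < I.n ∧ x < I.n
  · obtain ⟨hu, hv, hx⟩ := hu
    lift u to Fin I.n using hu
    lift v to Fin I.n using hv
    lift x to Fin I.n using hx
    by_cases h1 : I.dist u v = ⊤
    · rw [I.capDist_of_eq_top h1]
      exact (I.capDist_le_inf _ _).trans (Nat.le_add_right _ _)
    by_cases h2 : I.dist v x = ⊤
    · rw [I.capDist_of_eq_top h2]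
      exact (I.capDist_le_inf _ _).trans (Nat.le_add_left _ _)
    have h := I.dist_triangle u v x
    have h3 : I.dist u x ≠ ⊤ := ne_top_of_le_ne_top (by simp [h1, h2]) h
    rw [← I.coe_capDist h1, ← I.coe_capDist h2, ← I.coe_capDist h3] at h
    exact_mod_cast h
  · by_cases h1 : u < I.n ∧ v < I.n
    · have h2 : ¬ (v < I.n ∧ x < I.n) := fun h => hu ⟨h1.1, h1.2, h.2⟩
      have : I.capDist v x = I.inf := by simp [capDist, h2]
      rw [this]
      exact (I.capDist_le_inf _ _).trans (Nat.le_add_left _ _)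
    · have : I.capDist u v = I.inf := by simp [capDist, h1]
      rw [this]
      exact (I.capDist_le_inf _ _).trans (Nat.le_add_right _ _)

/-! ### Darts and adjacency lists -/

/-- Every edge `i` gives two darts, `i` in the listed and `m + i` in the reverse direction.
This is the tail of a dart. -/
def tl (d : ℕ) : ℕ := if d < I.m then I.init.mem 0 d else I.init.mem 1 (d - I.m)

/-- The head of a dart. -/
def hd (d : ℕ) : ℕ := if d < I.m then I.init.mem 1 d else I.init.mem 0 (d - I.m)

/-- The weight of a dart. -/
def wt (d : ℕ) : ℕ := if d < I.m then I.init.mem 2 d else I.init.mem 2 (d - I.m)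

theorem init_src {i : ℕ} (h : i < I.m) : I.init.mem 0 i = I.src ⟨i, h⟩ := by simp [init, h]
theorem init_dst {i : ℕ} (h : i < I.m) : I.init.mem 1 i = I.dst ⟨i, h⟩ := by simp [init, h]
theorem init_weight {i : ℕ} (h : i < I.m) : I.init.mem 2 i = I.edgeWeight ⟨i, h⟩ := by
  simp [init, h]

theorem exists_dart {u v : Fin I.n} (h : I.G.Adj u v) :
    ∃ d < 2 * I.m, I.tl d = u ∧ I.hd d = v ∧ I.wt d = I.weight s(u, v) := by
  obtain ⟨⟨i, hi⟩, he⟩ := I.exists_edge h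
  rcases Sym2.eq_iff.1 he with ⟨h1, h2⟩ | ⟨h1, h2⟩
  · refine ⟨i, by omega, ?_, ?_, ?_⟩
    · rw [tl, if_pos hi, I.init_src hi, h1]
    · rw [hd, if_pos hi, I.init_dst hi, h2]
    · rw [wt, if_pos hi, I.init_weight hi, edgeWeight, he]
  · have hn : ¬ I.m + i < I.m := by omega
    refine ⟨I.m + i, by omega, ?_, ?_, ?_⟩
    · rw [tl, if_neg hn, Nat.add_sub_cancel_left, I.init_dst hi, h2]
    · rw [hd, if_neg hn, Nat.add_sub_cancel_left, I.init_src hi, h1]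
    · rw [wt, if_neg hn, Nat.add_sub_cancel_left, I.init_weight hi, edgeWeight, he]

theorem adj_of_dart {d : ℕ} (hd : d < 2 * I.m) : ∃ u v : Fin I.n, I.G.Adj u v ∧ I.tl d = u ∧
    I.hd d = v ∧ I.wt d = I.weight s(u, v) := by
  by_cases h : d < I.m
  · refine ⟨_, _, I.adj_edge ⟨d, h⟩, ?_, ?_, ?_⟩
    · rw [tl, if_pos h, I.init_src h]
    · rw [STInstance.hd, if_pos h, I.init_dst h]
    · rw [wt, if_pos h, I.init_weight h, edgeWeight]
  · have h' : d - I.m < I.m := by omega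
    refine ⟨_, _, (I.adj_edge ⟨d - I.m, h'⟩).symm, ?_, ?_, ?_⟩
    · rw [tl, if_neg h, I.init_dst h']
    · rw [STInstance.hd, if_neg h, I.init_src h']
    · rw [wt, if_neg h, I.init_weight h', edgeWeight, Sym2.eq_swap]

theorem tl_lt {d : ℕ} (h : d < 2 * I.m) : I.tl d < I.n := by
  obtain ⟨u, v, -, h1, -⟩ := I.adj_of_dart h
  rw [h1]; exact u.2

theorem hd_lt {d : ℕ} (h : d < 2 * I.m) : I.hd d < I.n := by
  obtain ⟨u, v, -, -, h1, -⟩ := I.adj_of_dart h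
  rw [h1]; exact v.2

theorem wt_le {d : ℕ} (h : d < 2 * I.m) : I.wt d ≤ I.maxWeight := by
  obtain ⟨u, v, ha, -, -, h1⟩ := I.adj_of_dart h
  rw [h1]; exact I.weight_le_maxWeight ha

theorem capDist_dart {d : ℕ} (h : d < 2 * I.m) (s : ℕ) :
    I.capDist s (I.hd d) ≤ I.capDist s (I.tl d) + I.wt d := by
  obtain ⟨u, v, ha, h1, h2, h3⟩ := I.adj_of_dart h
  refine (I.capDist_triangle s (I.tl d) (I.hd d)).trans (Nat.add_le_add_left ?_ _)
  rw [h1, h2, h3]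
  have h4 := I.dist_le_weight ha
  have h5 : I.dist u v ≠ ⊤ := ne_top_of_le_ne_top (by simp) h4
  rw [← I.coe_capDist h5] at h4
  exact_mod_cast h4

/-- A labelling that is feasible for all darts and an upper bound for the capped distances is
equal to them. -/
theorem eq_capDist_of_feasible {s : ℕ} {D : ℕ → ℕ} (h0 : D s = 0)
    (hle : ∀ v < I.n, D v ≤ I.inf) (hge : ∀ v < I.n, I.capDist s v ≤ D v)
    (hd : ∀ d < 2 * I.m, D (I.hd d) ≤ D (I.tl d) + I.wt d) (hs : s < I.n) {v : ℕ} (hv : v < I.n) :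
    D v = I.capDist s v := by
  lift s to Fin I.n using hs
  lift v to Fin I.n using hv
  refine le_antisymm ?_ (hge v v.2)
  by_cases h : I.dist s v = ⊤
  · rw [I.capDist_of_eq_top h]
    exact hle v v.2
  obtain ⟨q, hq⟩ := I.exists_walk_of_dist_ne_top h
  have key : ∀ (x y : Fin I.n) (q : I.G.Walk x y), D y ≤ D x + I.walkLength q := by
    intro x y q
    induction q with
    | nil => simp
    | cons ha p ih =>
      obtain ⟨d, hd1, hd2, hd3, hd4⟩ := I.exists_dart ha
      have := hd d hd1
      rw [walkLength_cons]
      rw [hd2, hd3, hd4] at this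
      omega
  have h1 := key s v q
  rw [← I.coe_capDist h] at hq
  have h2 : I.capDist s v = I.walkLength q := by exact_mod_cast hq
  omega

/-- The darts below `K` with tail `v`, the last first; the dart `d` is represented by `d + 1`. -/
def adjList : ℕ → ℕ → List ℕ
  | 0, _ => []
  | K + 1, v => if I.tl K = v then (K + 1) :: adjList K v else adjList K v

theorem mem_adjList {K v p : ℕ} : p ∈ I.adjList K v ↔ 1 ≤ p ∧ p ≤ K ∧ I.tl (p - 1) = v := by
  induction K with
  | zero => simp [adjList]; omega
  | succ K ih =>
    rw [adjList]
    split_ifs with h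
    · rw [List.mem_cons, ih]
      constructor
      · rintro (rfl | ⟨h1, h2, h3⟩)
        · simp [h]
        · exact ⟨h1, by omega, h3⟩
      · rintro ⟨h1, h2, h3⟩
        by_cases hp : p = K + 1
        · exact .inl hp
        · exact .inr ⟨h1, by omega, h3⟩
    · rw [ih]
      constructor
      · rintro ⟨h1, h2, h3⟩
        exact ⟨h1, by omega, h3⟩
      · rintro ⟨h1, h2, h3⟩
        refine ⟨h1, ?_, h3⟩
        by_contra hc
        obtain rfl : p = K + 1 := by omega
        exact h h3

theorem sum_length_adjList {K : ℕ} (hK : K ≤ 2 * I.m) :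
    ∑ v ∈ Finset.range I.n, (I.adjList K v).length = K := by
  induction K with
  | zero => simp [adjList]
  | succ K ih =>
    have h1 : ∀ v, (I.adjList (K + 1) v).length = (I.adjList K v).length +
        if I.tl K = v then 1 else 0 := by
      intro v
      rw [adjList]
      split_ifs <;> simp
    simp only [h1, Finset.sum_add_distrib, ih (by omega)]
    simp [I.tl_lt (show K < 2 * I.m by omega)]

end STInstance

/-- The linked list in the array `nx` that starts with the pointer `j` consists of the pointers `L`
(the null pointer is `0`). -/
def LinkedList (nx : ℕ → ℕ) : ℕ → List ℕ → Prop
  | j, [] => j = 0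
  | j, p :: L => j = p ∧ p ≠ 0 ∧ LinkedList nx (nx p) L

theorem LinkedList.congr {nx nx' : ℕ → ℕ} {j : ℕ} {L : List ℕ} (h : LinkedList nx j L)
    (hn : ∀ p ∈ L, nx' p = nx p) : LinkedList nx' j L := by
  induction L generalizing j with
  | nil => exact h
  | cons p L ih =>
    refine ⟨h.1, h.2.1, ?_⟩
    rw [hn p (by simp)]
    exact ih h.2.2 fun p' hp' => hn p' (by simp [hp'])

/-! ### Tournament trees -/

/-- The inner nodes `1, …, P - 1` of the binary tree hold the minima of their children `2 * i` and
`2 * i + 1`. -/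
def IsTournament (P : ℕ) (tr : ℕ → ℕ) : Prop :=
  ∀ i, 1 ≤ i → i < P → tr i = min (tr (2 * i)) (tr (2 * i + 1))

theorem IsTournament.root_le {h : ℕ} {tr : ℕ → ℕ} (ht : IsTournament (2 ^ h) tr) {v : ℕ}
    (hv : v < 2 ^ h) : tr 1 ≤ tr (2 ^ h + v) := by
  have key : ∀ c ≤ h, tr ((2 ^ h + v) / 2 ^ c) ≤ tr (2 ^ h + v) := by
    intro c
    induction c with
    | zero => simp
    | succ c ih =>
      intro hc
      refine le_trans ?_ (ih (by omega))
      rw [pow_succ, ← Nat.div_div_eq_div_mul]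
      set i := (2 ^ h + v) / 2 ^ c
      have h1 : 2 ≤ i := by
        rw [Nat.le_div_iff_mul_le (by positivity)]
        calc 2 * 2 ^ c = 2 ^ (c + 1) := by ring
          _ ≤ 2 ^ h := Nat.pow_le_pow_right (by norm_num) hc
          _ ≤ _ := Nat.le_add_right _ _
      have h2 : i < 2 * 2 ^ h := (Nat.div_le_self _ _).trans_lt (by omega)
      rw [ht (i / 2) (by omega) (by omega)]
      rcases Nat.even_or_odd' i with ⟨k, hk | hk⟩
      · rw [show 2 * (i / 2) = i by omega]
        exact min_le_left _ _
      · rw [show 2 * (i / 2) + 1 = i by omega]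
        exact min_le_right _ _
  have h1 : (2 ^ h + v) / 2 ^ h = 1 := by
    rw [Nat.div_eq_of_lt_le] <;> omega
  simpa [h1] using key h le_rfl

namespace WordRAM

open Ex (reg ld)

/-- Write the word in register `14` into leaf `reg 13` of the tournament tree in bank `11`, whose
number of leaves is in register `3` and whose height is in register `4`. -/
def updTree : Cmd :=
  .set 15 (reg 3 + reg 13) ;;
  .st 11 (reg 15) (reg 14) ;;
  .forTo 16 4 (
    .set 15 (reg 15 / 2) ;;
    .ite (.lt (ld 11 (2 * reg 15)) (ld 11 (2 * reg 15 + 1)))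
      (.st 11 (reg 15) (ld 11 (2 * reg 15)))
      (.st 11 (reg 15) (ld 11 (2 * reg 15 + 1))))

theorem wp_updTree {B h v : ℕ} {σ : State} {t : ℕ}
    (h3 : σ.reg 3 = 2 ^ h) (h4 : σ.reg 4 = h) (h13 : σ.reg 13 = v) (hv : v < 2 ^ h)
    (hB : 2 * 2 ^ h < B) (ht : IsTournament (2 ^ h) (σ.mem 11)) :
    updTree.wp B (fun σ' t' => IsTournament (2 ^ h) (σ'.mem 11) ∧
      (∀ u < 2 ^ h, σ'.mem 11 (2 ^ h + u) = if u = v then σ.reg 14 else σ.mem 11 (2 ^ h + u)) ∧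
      t' ≤ t + (h * 5 + 4)) σ t := by
  have hh : h < 2 ^ h := Nat.lt_two_pow_self
  rw [updTree]
  refine ⟨by simp [h3, h13]; omega, by simp, by simp, ?_⟩
  simp only [Ex.eval_add, Ex.eval_reg, State.setReg_reg, if_true, h3, h13, if_false,
    show ¬ (14 : ℕ) = 15 by norm_num]
  refine Cmd.wp_forTo_le h 3 (fun c σ' => σ'.reg 15 = (2 ^ h + v) / 2 ^ c ∧
    (∀ u < 2 ^ h, σ'.mem 11 (2 ^ h + u) = if u = v then σ.reg 14 else σ.mem 11 (2 ^ h + u)) ∧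
    ∀ i, 1 ≤ i → i < 2 ^ h → i ≠ (2 ^ h + v) / 2 ^ c / 2 →
      σ'.mem 11 i = min (σ'.mem 11 (2 * i)) (σ'.mem 11 (2 * i + 1)))
    (by omega) (by simpa using h4) rfl rfl rfl ?_ ?_ ?_
  · refine ⟨by simp, fun u hu => ?_, fun i h1 h2 h5 => ?_⟩
    · simp [Function.update_apply]
    · simp only [State.setReg_mem, State.setMem_mem, if_true, Function.update_apply]
      rw [if_neg (by omega), if_neg (by omega), if_neg (by omega)]
      exact ht i h1 h2
  · rintro c hc σ' t' hF hr ⟨h5, h6, h7⟩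
    have e1 : (2 ^ h + v) / 2 ^ c / 2 = (2 ^ h + v) / 2 ^ (c + 1) := by
      rw [pow_succ, Nat.div_div_eq_div_mul]
    have e2 : 1 ≤ (2 ^ h + v) / 2 ^ (c + 1) := by
      rw [Nat.le_div_iff_mul_le (by positivity), one_mul]
      exact (Nat.pow_le_pow_right (by norm_num) hc).trans (Nat.le_add_right _ _)
    have e3 : (2 ^ h + v) / 2 ^ (c + 1) < 2 ^ h := by
      have := Nat.div_le_self (2 ^ h + v) (2 ^ c)
      omega
    set i := (2 ^ h + v) / 2 ^ (c + 1) with hi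
    -- both branches store the minimum of the two children of `i`
    have key : ∀ σ'' : State, σ''.reg 15 = i → (∀ j, σ''.mem 11 j = if j = i then
        min (σ'.mem 11 (2 * i)) (σ'.mem 11 (2 * i + 1)) else σ'.mem 11 j) →
        σ''.reg 15 = i ∧
        (∀ u < 2 ^ h, σ''.mem 11 (2 ^ h + u) =
          if u = v then σ.reg 14 else σ.mem 11 (2 ^ h + u)) ∧
        ∀ k, 1 ≤ k → k < 2 ^ h → k ≠ i / 2 →
          σ''.mem 11 k = min (σ''.mem 11 (2 * k)) (σ''.mem 11 (2 * k + 1)) := by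
      refine fun σ'' g1 g2 => ⟨g1, fun u hu => ?_, fun k k1 k2 k3 => ?_⟩
      · rw [g2, if_neg (by omega), h6 u hu]
      · rw [g2, g2, g2, if_neg (show ¬ 2 * k = i by omega), if_neg (show ¬ 2 * k + 1 = i by omega)]
        split_ifs with hk
        · rw [hk]
        · exact h7 k k1 k2 (by omega)
    refine ⟨by simp, ?_⟩
    simp only [Ex.eval_div, Ex.eval_reg, Ex.eval_ofNat, h5, e1]
    refine ⟨by simp; omega, fun hlt => ⟨by simp, by simp; omega, ⟨key _ (by simp) ?_, ?_⟩⟩,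
      fun hlt => ⟨by simp, by simp; omega, ⟨key _ (by simp) ?_, ?_⟩⟩⟩
    · intro j
      have hlt' : σ'.mem 11 (2 * i) < σ'.mem 11 (2 * i + 1) := by simpa using hlt
      simp [Function.update_apply, min_eq_left hlt'.le]
    · omega
    · intro j
      have hlt' : σ'.mem 11 (2 * i + 1) ≤ σ'.mem 11 (2 * i) := by simpa using hlt
      simp [Function.update_apply, min_eq_right hlt']
    · omega
  · rintro σ' t' hF ⟨h5, h6, h7⟩ ht'
    refine ⟨fun i h1 h2 => h7 i h1 h2 ?_, h6, by omega⟩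
    have : (2 ^ h + v) / 2 ^ h = 1 := by rw [Nat.div_eq_of_lt_le] <;> omega
    rw [this]
    omega

/-- Find a leaf of the tournament tree whose key equals that of the root. -/
def findMin : Cmd :=
  .set 10 1 ;;
  .forTo 16 4 (
    .ite (.eq (ld 11 (2 * reg 10)) (ld 11 (reg 10)))
      (.set 10 (2 * reg 10)) (.set 10 (2 * reg 10 + 1))) ;;
  .set 10 (reg 10 - reg 3)

theorem wp_findMin {B h : ℕ} {σ : State} {t : ℕ}
    (h3 : σ.reg 3 = 2 ^ h) (h4 : σ.reg 4 = h)
    (hB : 2 * 2 ^ h < B) (ht : IsTournament (2 ^ h) (σ.mem 11)) :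
    findMin.wp B (fun σ' t' => σ'.reg 10 < 2 ^ h ∧ σ.mem 11 (2 ^ h + σ'.reg 10) = σ.mem 11 1 ∧
      t' ≤ t + (h * 5 + 4)) σ t := by
  have hh : h < 2 ^ h := Nat.lt_two_pow_self
  rw [findMin]
  refine ⟨by simp, ?_⟩
  refine Cmd.wp_forTo_le h 3 (fun c σ' => 2 ^ c ≤ σ'.reg 10 ∧ σ'.reg 10 < 2 * 2 ^ c ∧
      σ.mem 11 (σ'.reg 10) = σ.mem 11 1)
    (by omega) (by simpa using h4) rfl rfl rfl ?_ ?_ ?_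
  · simp
  · rintro c hc σ' t' hF hr ⟨h5, h6, h7⟩
    have hm : σ'.mem 11 = σ.mem 11 := hF.mem 11 rfl
    have hp : 2 * 2 ^ c ≤ 2 ^ h := by
      rw [← pow_succ']
      exact Nat.pow_le_pow_right (by norm_num) hc
    have ht' := ht (σ'.reg 10) (by have := Nat.one_le_two_pow (n := c); omega) (by omega)
    refine ⟨by simp; omega, fun he => ⟨by simp; omega, ?_⟩, fun he => ⟨by simp; omega, ?_⟩⟩
    · have he' : σ.mem 11 (2 * σ'.reg 10) = σ.mem 11 (σ'.reg 10) := by simpa [hm] using he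
      simp [pow_succ', he', h7]
      omega
    · have he' : σ.mem 11 (2 * σ'.reg 10) ≠ σ.mem 11 (σ'.reg 10) := by simpa [hm] using he
      have he2 : σ.mem 11 (2 * σ'.reg 10 + 1) = σ.mem 11 (σ'.reg 10) := by
        rcases min_choice (σ.mem 11 (2 * σ'.reg 10)) (σ.mem 11 (2 * σ'.reg 10 + 1)) with h8 | h8
        · exact absurd (h8 ▸ ht').symm he'
        · rw [ht', h8]
      simp [pow_succ', he2, h7]
      omega
  · rintro σ' t' hF ⟨h5, h6, h7⟩ ht'
    have h3' : σ'.reg 3 = 2 ^ h := by rw [hF.reg 3 rfl]; simpa using h3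
    refine ⟨by simp, ?_, ?_, by omega⟩
    · simp [h3']; omega
    · simp only [Ex.eval_sub, Ex.eval_reg, h3', State.setReg_reg, if_true]
      rw [Nat.add_sub_cancel' h5, h7]

end WordRAM

/-! ### Dijkstra's algorithm -/

/-- The invariant of Dijkstra's algorithm from the source `s` after `i` rounds. `F` is the set of
the vertices taken from the tournament tree `tr`, `u` the last of them, and `L` the list of the
darts from `u` that have not been relaxed; `D` holds the tentative distances. The last field bounds
the number of rounds that are still needed, unless nothing is left to do. -/
structure DijkstraInv (I : STInstance) (h s i : ℕ) (F : Finset ℕ) (L : List ℕ) (nx D tr : ℕ → ℕ)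
    (u j : ℕ) : Prop where
  sub : ∀ x ∈ F, x < I.n
  chain : LinkedList nx j L
  cur : L ≠ [] → u ∈ F ∧ (∀ x ∈ F, D x ≤ D u) ∧ D u + I.maxWeight ≤ F.card * I.maxWeight
  darts : ∀ p ∈ L, 1 ≤ p ∧ p ≤ 2 * I.m ∧ I.tl (p - 1) = u
  source : D s = 0
  le : ∀ v < I.n, D v ≤ I.inf
  ge : ∀ v < I.n, I.capDist s v ≤ D v
  bound : ∀ v < I.n, D v < I.inf → D v ≤ F.card * I.maxWeight
  fin : ∀ x ∈ F, D x < I.inf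
  relaxed : ∀ d < 2 * I.m, I.tl d ∈ F → d + 1 ∉ L → D (I.hd d) ≤ D (I.tl d) + I.wt d
  mono : ∀ x ∈ F, ∀ y < I.n, y ∉ F → D x ≤ D y
  leaf : ∀ v < 2 ^ h, tr (2 ^ h + v) = if v < I.n ∧ v ∉ F then D v else I.inf
  tour : IsTournament (2 ^ h) tr
  pot : L.length + ∑ v ∈ Finset.range I.n \ F, ((I.adjList (2 * I.m) v).length + 1) + i ≤
      2 * I.m + I.n ∨ (L = [] ∧ ∀ v < I.n, v ∉ F → D v = I.inf)

namespace DijkstraInv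

variable {I : STInstance} {h s i : ℕ} {F : Finset ℕ} {L : List ℕ} {nx D tr : ℕ → ℕ} {u j : ℕ}

theorem pot_cons {p : ℕ} (H : DijkstraInv I h s i F (p :: L) nx D tr u j) :
    L.length + ∑ v ∈ Finset.range I.n \ F, ((I.adjList (2 * I.m) v).length + 1) + (i + 1) ≤
      2 * I.m + I.n := by
  rcases H.pot with hp | hp
  · simp only [List.length_cons] at hp
    omega
  · simp at hp

/-- A dart that does not improve the tentative distance of its head. -/
theorem skip {p : ℕ} (H : DijkstraInv I h s i F (p :: L) nx D tr u j)
    (hx : D (I.hd (p - 1)) ≤ D u + I.wt (p - 1)) :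
    DijkstraInv I h s (i + 1) F L nx D tr u (nx p) where
  sub := H.sub
  chain := H.chain.2.2
  cur := fun _ => H.cur (by simp)
  darts := fun q hq => H.darts q (by simp [hq])
  source := H.source
  le := H.le
  ge := H.ge
  bound := H.bound
  fin := H.fin
  relaxed := by
    intro d hd hF hL
    by_cases hp : d + 1 = p
    · have h1 := (H.darts p (by simp)).2.2
      rw [← hp, Nat.add_sub_cancel] at h1 hx
      rw [h1]
      exact hx
    · exact H.relaxed d hd hF (by simp [hp, hL])
  mono := H.mono
  leaf := H.leaf
  tour := H.tour
  pot := .inl H.pot_cons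

/-- A dart that improves the tentative distance of its head `v` to `x`. -/
theorem relax {p v x : ℕ} {tr' : ℕ → ℕ} (H : DijkstraInv I h s i F (p :: L) nx D tr u j)
    (hv : v = I.hd (p - 1)) (hx : x = D u + I.wt (p - 1)) (hlt : x < D v)
    (htr : ∀ y < 2 ^ h, tr' (2 ^ h + y) = if y = v then x else tr (2 ^ h + y))
    (htour : IsTournament (2 ^ h) tr') :
    DijkstraInv I h s (i + 1) F L nx (Function.update D v x) tr' u (nx p) := by
  obtain ⟨hp1, hp2, hp3⟩ := H.darts p (by simp)
  obtain ⟨hu, hmax, hbd⟩ := H.cur (by simp)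
  have hpm : p - 1 < 2 * I.m := by omega
  have hvn : v < I.n := hv ▸ I.hd_lt hpm
  have hvF : v ∉ F := fun hc => by have := hmax v hc; omega
  have hF : ∀ y ∈ F, y ≠ v := fun y hy h => hvF (h ▸ hy)
  have hle : ∀ y, Function.update D v x y ≤ D y := by
    intro y
    rw [Function.update_apply]
    split_ifs with hy
    · rw [hy]; exact hlt.le
    · exact le_rfl
  have hwt := I.wt_le hpm
  have hDF : ∀ y ∈ F, Function.update D v x y = D y := fun y hy =>
    Function.update_of_ne (hF y hy) _ _
  refine ⟨H.sub, H.chain.2.2, fun _ => ⟨hu, ?_, ?_⟩, fun q hq => H.darts q (by simp [hq]), ?_,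
    fun y hy => (hle y).trans (H.le y hy), ?_, ?_, ?_, ?_, ?_, ?_, htour, .inl H.pot_cons⟩
  · intro y hy
    rw [hDF y hy, hDF u hu]
    exact hmax y hy
  · rw [hDF u hu]
    exact hbd
  · have := hle s
    rw [H.source] at this
    omega
  · intro y hy
    rw [Function.update_apply]
    split_ifs with hyv
    · rw [hyv, hx, hv]
      refine (I.capDist_dart hpm s).trans ?_
      rw [hp3]
      exact Nat.add_le_add_right (H.ge u (H.sub u hu)) _
    · exact H.ge y hy
  · intro y hy
    rw [Function.update_apply]
    split_ifs with hyv
    · omega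
    · exact H.bound y hy
  · intro y hy
    rw [hDF y hy]
    exact H.fin y hy
  · intro d hd hdF hL
    rw [hDF _ hdF]
    by_cases hp : d + 1 = p
    · rw [← hp, Nat.add_sub_cancel] at hv hx hp3
      rw [← hv, Function.update_self, hp3, hx]
    · exact (hle _).trans (H.relaxed d hd hdF (by simp [hp, hL]))
  · intro y hy z hz hzF
    rw [hDF y hy, Function.update_apply]
    split_ifs with hzv
    · rw [hx]
      exact (hmax y hy).trans (Nat.le_add_right _ _)
    · exact H.mono y hy z hz hzF
  · intro y hy
    rw [htr y hy]
    by_cases hyv : y = v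
    · simp [hyv, hvn, hvF]
    · rw [if_neg hyv, H.leaf y hy, Function.update_of_ne hyv]

/-- The vertex `v` with the smallest key is taken from the tree. -/
theorem pop {v j' : ℕ} {tr' : ℕ → ℕ} (hn : I.n ≤ 2 ^ h)
    (H : DijkstraInv I h s i F [] nx D tr u j) (hv : v < 2 ^ h)
    (hmin : tr (2 ^ h + v) = tr 1) (hlt : tr 1 < I.inf)
    (hj : LinkedList nx j' (I.adjList (2 * I.m) v))
    (htr : ∀ y < 2 ^ h, tr' (2 ^ h + y) = if y = v then I.inf else tr (2 ^ h + y))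
    (htour : IsTournament (2 ^ h) tr') :
    DijkstraInv I h s (i + 1) (insert v F) (I.adjList (2 * I.m) v) nx D tr' v j' := by
  have hvF : v < I.n ∧ v ∉ F := by
    by_contra hc
    rw [← hmin, H.leaf v hv, if_neg hc] at hlt
    exact lt_irrefl _ hlt
  have hDv : D v = tr 1 := by rw [← hmin, H.leaf v hv, if_pos hvF]
  have hmin' : ∀ y < I.n, y ∉ F → D v ≤ D y := by
    intro y hy hyF
    have := H.tour.root_le (hy.trans_le hn)
    rwa [H.leaf y (hy.trans_le hn), if_pos ⟨hy, hyF⟩, ← hDv] at this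
  have hcard : (insert v F).card = F.card + 1 := Finset.card_insert_of_notMem hvF.2
  have hDb : D v ≤ F.card * I.maxWeight := H.bound v hvF.1 (by omega)
  refine ⟨?_, hj, fun _ => ⟨by simp, ?_, ?_⟩, ?_, H.source, H.le, H.ge, ?_, ?_, ?_, ?_, ?_,
    htour, ?_⟩
  · intro x hx
    rcases Finset.mem_insert.1 hx with rfl | hx
    exacts [hvF.1, H.sub x hx]
  · intro x hx
    rcases Finset.mem_insert.1 hx with rfl | hx
    exacts [le_rfl, H.mono x hx v hvF.1 hvF.2]
  · rw [hcard, add_one_mul]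
    omega
  · intro p hp
    exact (I.mem_adjList).1 hp
  · intro y hy hyi
    rw [hcard, add_one_mul]
    exact (H.bound y hy hyi).trans (Nat.le_add_right _ _)
  · intro x hx
    rcases Finset.mem_insert.1 hx with rfl | hx
    exacts [by omega, H.fin x hx]
  · intro d hd hdF hL
    rcases Finset.mem_insert.1 hdF with hdv | hdF
    · exact absurd ((I.mem_adjList).2 ⟨by omega, by omega, by simpa using hdv⟩) hL
    · exact H.relaxed d hd hdF (by simp)
  · intro x hx y hy hyF
    simp only [Finset.mem_insert, not_or] at hyF
    rcases Finset.mem_insert.1 hx with rfl | hx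
    exacts [hmin' y hy hyF.2, H.mono x hx y hy hyF.2]
  · intro y hy
    rw [htr y hy]
    by_cases hyv : y = v
    · simp [hyv]
    · rw [if_neg hyv, H.leaf y hy]
      simp [hyv]
  · rcases H.pot with hp | hp
    · left
      have h1 : v ∈ Finset.range I.n \ F := by simp [hvF.1, hvF.2]
      have h2 : Finset.range I.n \ insert v F = (Finset.range I.n \ F).erase v := by
        ext x
        simp only [Finset.mem_sdiff, Finset.mem_range, Finset.mem_insert, Finset.mem_erase]
        tauto
      have h3 := Finset.add_sum_erase _ (fun v => (I.adjList (2 * I.m) v).length + 1) h1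
      rw [h2]
      simp only [List.length_nil] at hp
      omega
    · exact absurd (hp.2 v hvF.1 hvF.2) (by omega)

theorem idle (hn : I.n ≤ 2 ^ h) (H : DijkstraInv I h s i F [] nx D tr u j) (hle : I.inf ≤ tr 1) :
    DijkstraInv I h s (i + 1) F [] nx D tr u j := by
  refine { H with pot := .inr ⟨rfl, fun v hv hvF => le_antisymm (H.le v hv) ?_⟩ }
  have := H.tour.root_le (hv.trans_le hn)
  rw [H.leaf v (hv.trans_le hn), if_pos ⟨hv, hvF⟩] at this
  exact hle.trans this

theorem final (H : DijkstraInv I h s (2 * I.m + I.n) F L nx D tr u j) (hs : s < I.n) {v : ℕ}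
    (hv : v < I.n) : D v = I.capDist s v := by
  have hL : L = [] ∧ ∀ v < I.n, v ∉ F → D v = I.inf := by
    rcases H.pot with hp | hp
    · refine ⟨List.length_eq_zero_iff.1 (by omega), fun v hv hvF => ?_⟩
      have h0 : ∑ v ∈ Finset.range I.n \ F, ((I.adjList (2 * I.m) v).length + 1) = 0 := by omega
      have := Finset.sum_eq_zero_iff.1 h0 v (by simp [hv, hvF])
      omega
    · exact hp
  refine I.eq_capDist_of_feasible H.source H.le H.ge (fun d hd => ?_) hs hv
  by_cases hF : I.tl d ∈ F
  · exact H.relaxed d hd hF (by simp [hL.1])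
  · rw [hL.2 _ (I.tl_lt hd) hF]
    exact (H.le _ (I.hd_lt hd)).trans (Nat.le_add_right _ _)

end DijkstraInv

namespace WordRAM

open Ex (reg ld)

/-- The data that the shortest path computations rely on: the capped infinity in register `2`, the
size of the tournament tree in registers `3`, `4` and `8`, the number of rounds of Dijkstra's
algorithm in register `7`, and the adjacency lists in banks `7`, `8`, `9` and `14`. -/
structure Prepared (I : STInstance) (B h : ℕ) (σ : State) : Prop where
  n : σ.reg 0 = I.n
  m : σ.reg 1 = I.m
  inf : σ.reg 2 = I.inf
  leaves : σ.reg 3 = 2 ^ h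
  height : σ.reg 4 = h
  rounds : σ.reg 7 = 2 * I.m + I.n
  nodes : σ.reg 8 = 2 * 2 ^ h
  list : ∀ v < I.n, LinkedList (σ.mem 8) (σ.mem 7 v) (I.adjList (2 * I.m) v)
  hd : ∀ d < 2 * I.m, σ.mem 9 (d + 1) = I.hd d
  wt : ∀ d < 2 * I.m, σ.mem 14 (d + 1) = I.wt d
  src : σ.mem 0 = I.init.mem 0
  dst : σ.mem 1 = I.init.mem 1
  inS : σ.mem 3 = I.init.mem 3
  inT : σ.mem 4 = I.init.mem 4
  n_le : I.n ≤ 2 ^ h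
  nodes_lt : 2 * 2 ^ h < B
  inf_lt : 2 * I.inf + I.maxWeight + 1 < B
  rounds_lt : 2 * I.m + I.n < B

theorem Prepared.congr {I : STInstance} {B h : ℕ} {σ σ' : State} (H : Prepared I B h σ)
    (hr : ∀ r ∈ [0, 1, 2, 3, 4, 7, 8], σ'.reg r = σ.reg r)
    (hm : ∀ k ∈ [0, 1, 3, 4, 7, 8, 9, 14], σ'.mem k = σ.mem k) : Prepared I B h σ' := by
  simp only [List.mem_cons, List.not_mem_nil, or_false, forall_eq_or_imp, forall_eq] at hr hm
  obtain ⟨r0, r1, r2, r3, r4, r7, r8⟩ := hr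
  obtain ⟨m0, m1, m3, m4, m7, m8, m9, m14⟩ := hm
  exact ⟨r0.trans H.n, r1.trans H.m, r2.trans H.inf, r3.trans H.leaves, r4.trans H.height,
    r7.trans H.rounds, r8.trans H.nodes, by rw [m7, m8]; exact H.list, by rw [m9]; exact H.hd,
    by rw [m14]; exact H.wt, m0.trans H.src, m1.trans H.dst, m3.trans H.inS, m4.trans H.inT, H.n_le,
    H.nodes_lt, H.inf_lt, H.rounds_lt⟩

theorem Prepared.frame {I : STInstance} {B h : ℕ} {c : Cmd} {σ σ' : State} (H : Prepared I B h σ)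
    (hF : c.Frame σ σ') (hr : ([0, 1, 2, 3, 4, 7, 8].all fun r => !c.wr r) = true)
    (hm : ([0, 1, 3, 4, 7, 8, 9, 14].all fun k => !c.wm k) = true) : Prepared I B h σ' :=
  H.congr (fun r h => hF.reg r (by simpa using List.all_eq_true.1 hr r h))
    (fun k h => hF.mem k (by simpa using List.all_eq_true.1 hm k h))

/-- One round of Dijkstra's algorithm: relax the dart in register `11`, which leaves the vertex in
register `10`, or take the next vertex from the tree. -/
def dijkstraRound : Cmd :=
  .ite (reg 11)
    (.set 13 (ld 9 (reg 11)) ;;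
      .set 14 (ld 10 (reg 10) + ld 14 (reg 11)) ;;
      .set 11 (ld 8 (reg 11)) ;;
      .ite (.lt (reg 14) (ld 10 (reg 13)))
        (.st 10 (reg 13) (reg 14) ;; updTree) .skip)
    (.ite (.lt (ld 11 1) (reg 2))
      (findMin ;; .set 11 (ld 7 (reg 10)) ;; .set 13 (reg 10) ;; .set 14 (reg 2) ;; updTree) .skip)

theorem wp_dijkstraRound {I : STInstance} {B h s i : ℕ} {σ : State} {t : ℕ} (H : Prepared I B h σ)
    (hI : ∃ F L, DijkstraInv I h s i F L (σ.mem 8) (σ.mem 10) (σ.mem 11) (σ.reg 10) (σ.reg 11)) :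
    dijkstraRound.wp B (fun σ' t' =>
      (∃ F L, DijkstraInv I h s (i + 1) F L (σ'.mem 8) (σ'.mem 10) (σ'.mem 11) (σ'.reg 10)
        (σ'.reg 11)) ∧ t' ≤ t + (h * 10 + 14)) σ t := by
  obtain ⟨F, L, hI⟩ := hI
  refine ⟨by simp, fun hj => ?_, fun hj => ?_⟩
  · cases L with
    | nil => exact absurd hI.chain hj
    | cons p L =>
      have hp : σ.reg 11 = p := hI.chain.1
      obtain ⟨hp1, hp2, hp3⟩ := hI.darts p (by simp)
      obtain ⟨hu, hmax, hbd⟩ := hI.cur (by simp)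
      have hpm : p - 1 < 2 * I.m := by omega
      have e1 : σ.mem 9 p = I.hd (p - 1) := by
        rw [← H.hd _ hpm, Nat.sub_add_cancel hp1]
      have e2 : σ.mem 14 p = I.wt (p - 1) := by
        rw [← H.wt _ hpm, Nat.sub_add_cancel hp1]
      have hfit : σ.mem 10 (σ.reg 10) + I.wt (p - 1) < B := by
        have := hI.fin _ hu
        have := I.wt_le hpm
        have := H.inf_lt
        omega
      refine ⟨by simp, by simpa [hp, e2] using hfit, by simp, by simp, fun hlt => ?_, fun hge => ?_⟩
      · refine ⟨by simp, by simp, ?_⟩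
        refine Cmd.wp_conseq (wp_updTree (B := B) (h := h) (v := I.hd (p - 1)) ?_ ?_ ?_ ?_
          H.nodes_lt ?_) ?_
        · simpa using H.leaves
        · simpa using H.height
        · simp [hp, e1]
        · exact (I.hd_lt hpm).trans_le H.n_le
        · simpa using hI.tour
        · rintro σ' t' hF ⟨h1, h2, h3⟩
          refine ⟨⟨F, L, ?_⟩, by omega⟩
          rw [hF.mem 8 rfl, hF.mem 10 rfl, hF.reg 10 rfl, hF.reg 11 rfl]
          simp [hp, e1, e2] at hlt h2 ⊢
          exact hI.relax rfl rfl hlt h2 h1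
      · refine ⟨⟨F, L, ?_⟩, by omega⟩
        simp [hp, e1, e2] at hge ⊢
        exact hI.skip hge
  · have hL : L = [] := by
      cases L with
      | nil => rfl
      | cons p L => exact absurd (hI.chain.1.symm.trans hj) hI.chain.2.1
    subst hL
    refine ⟨by simp, fun hlt => ?_, fun hge => ?_⟩
    · have hlt' : σ.mem 11 1 < I.inf := by simpa [H.inf] using hlt
      refine Cmd.wp_seq (wp_findMin H.leaves H.height H.nodes_lt hI.tour) ?_
      rintro σ' t' hF ⟨h1, h2, h3⟩
      have H' : Prepared I B h σ' := H.frame hF rfl rfl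
      refine ⟨by simp, by simp, by simp, ?_⟩
      refine Cmd.wp_conseq (wp_updTree (B := B) (h := h) (v := σ'.reg 10) ?_ ?_ ?_ h1
          H.nodes_lt ?_) ?_
      · simpa using H'.leaves
      · simpa using H'.height
      · simp
      · simpa [hF.mem 11 rfl] using hI.tour
      · rintro σ'' t'' hF' ⟨g1, g2, g3⟩
        refine ⟨⟨insert (σ'.reg 10) F, I.adjList (2 * I.m) (σ'.reg 10), ?_⟩, by omega⟩
        · rw [hF'.mem 8 rfl, hF'.mem 10 rfl, hF'.reg 10 rfl, hF'.reg 11 rfl]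
          simp [H'.inf, hF.mem 11 rfl, hF.mem 10 rfl] at g2 ⊢
          have hv : σ'.reg 10 < I.n := by
            by_contra hc
            rw [← h2, hI.leaf _ h1, if_neg (fun hh => hc hh.1)] at hlt'
            exact lt_irrefl _ hlt'
          rw [← hF.mem 8 rfl] at hI
          exact hI.pop H.n_le h1 h2 hlt' (H'.list _ hv) g2 g1
    · have hge' : I.inf ≤ σ.mem 11 1 := by simpa [H.inf] using hge
      exact ⟨⟨F, [], hI.idle H.n_le hge'⟩, by omega⟩

/-- Dijkstra's algorithm from the vertex in register `9`. The distances are written to bank `10`. -/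
def dijkstra : Cmd :=
  .forTo 12 0 (.st 10 (reg 12) (reg 2)) ;;
  .forTo 12 8 (.st 11 (reg 12) (reg 2)) ;;
  .st 10 (reg 9) 0 ;;
  .set 13 (reg 9) ;;
  .set 14 0 ;;
  updTree ;;
  .set 11 0 ;;
  .forTo 12 7 dijkstraRound

theorem wp_dijkstra {I : STInstance} {B h s : ℕ} {σ : State} {t : ℕ} (H : Prepared I B h σ)
    (h9 : σ.reg 9 = s) (hs : s < I.n) :
    dijkstra.wp B (fun σ' t' => (∀ v < I.n, σ'.mem 10 v = I.capDist s v) ∧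
      t' ≤ t + ((2 * I.m + I.n) * (h * 10 + 16) + I.n * 3 + 6 * 2 ^ h + h * 5 + 14)) σ t := by
  rw [dijkstra]
  refine Cmd.wp_seq (Cmd.wp_forTo_le I.n 1 (fun i σ' => ∀ v < i, σ'.mem 10 v = I.inf) ?_ H.n rfl
    rfl rfl ?_ ?_
    (Q := fun σ' t' => (∀ v < I.n, σ'.mem 10 v = I.inf) ∧ t' ≤ t + (I.n * 3 + 2)) ?_) ?_
  · have := H.rounds_lt
    omega
  · simp
  · intro i hi σ' t' hF hr hI
    refine ⟨by simp, by simp, ?_, by omega⟩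
    intro v hv
    have : σ'.reg 2 = I.inf := by rw [hF.reg 2 rfl]; exact H.inf
    simp [hr, this, Function.update_apply]
    intro hvi
    exact hI v (by omega)
  · intro σ' t' hF hI ht
    exact ⟨hI, ht⟩
  rintro σ₁ t₁ hF₁ ⟨hD₁, ht₁⟩
  have H₁ : Prepared I B h σ₁ := H.frame hF₁ rfl rfl
  have h9₁ : σ₁.reg 9 = s := (hF₁.reg 9 rfl).trans h9
  clear hF₁
  refine Cmd.wp_seq (Cmd.wp_forTo_le (2 * 2 ^ h) 1 (fun i σ' => ∀ v < i, σ'.mem 11 v = I.inf)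
    H.nodes_lt H₁.nodes rfl rfl rfl ?_ ?_
    (Q := fun σ' t' => (∀ v < 2 * 2 ^ h, σ'.mem 11 v = I.inf) ∧
      t' ≤ t₁ + (2 * 2 ^ h * 3 + 2)) ?_) ?_
  · simp
  · intro i hi σ' t' hF hr hI
    refine ⟨by simp, by simp, ?_, by omega⟩
    intro v hv
    have : σ'.reg 2 = I.inf := by rw [hF.reg 2 rfl]; exact H₁.inf
    simp [hr, this, Function.update_apply]
    intro hvi
    exact hI v (by omega)
  · intro σ' t' hF hI ht
    exact ⟨hI, ht⟩
  rintro σ₂ t₂ hF₂ ⟨hT₂, ht₂⟩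
  have H₂ : Prepared I B h σ₂ := H₁.frame hF₂ rfl rfl
  have h9₂ : σ₂.reg 9 = s := (hF₂.reg 9 rfl).trans h9₁
  have hD₂ : ∀ v < I.n, σ₂.mem 10 v = I.inf := by
    rw [hF₂.mem 10 rfl]
    exact hD₁
  clear hF₂
  refine ⟨by simp, by simp, by simp, by simp, ?_⟩
  refine Cmd.wp_seq (wp_updTree (B := B) (h := h) (v := s) ?_ ?_ ?_ (hs.trans_le H.n_le)
          H.nodes_lt ?_) ?_
  · simpa using H₂.leaves
  · simpa using H₂.height
  · simp [h9₂]
  · intro i h1 h2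
    simp only [State.setReg_mem, State.setMem_mem, show ¬ (11 : ℕ) = 10 by norm_num, if_false]
    rw [hT₂ _ (by omega), hT₂ _ (by omega), hT₂ _ (by omega), min_self]
  rintro σ₃ t₃ hF₃ ⟨hT₃, hl₃, ht₃⟩
  have H₃ : Prepared I B h σ₃ := (H₂.congr (by simp) (by simp)).frame hF₃ rfl rfl
  refine ⟨by simp, ?_⟩
  have hD₃ : σ₃.mem 10 = Function.update (σ₂.mem 10) s 0 := by
    rw [hF₃.mem 10 rfl]
    simp [h9₂]
  refine Cmd.wp_forTo_le (2 * I.m + I.n) (h * 10 + 14) (fun i σ' => ∃ F L,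
    DijkstraInv I h s i F L (σ'.mem 8) (σ'.mem 10) (σ'.mem 11) (σ'.reg 10) (σ'.reg 11))
    H.rounds_lt (by simpa using H₃.rounds) rfl rfl rfl ?_ ?_ ?_
  · refine ⟨∅, [], ?_⟩
    simp only [State.setReg_mem, State.setReg_reg, hD₃]
    have hinf : 0 < I.inf := by unfold STInstance.inf; positivity
    have hl : ∀ v < 2 ^ h, σ₃.mem 11 (2 ^ h + v) = if v = s then 0 else I.inf := by
      intro v hv
      rw [hl₃ v hv]
      simp [hT₂ _ (show 2 ^ h + v < 2 * 2 ^ h by omega)]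
    refine ⟨by simp, by simp [LinkedList], by simp, by simp, by simp, ?_, ?_, ?_, by simp, by simp,
      by simp, ?_, hT₃, ?_⟩
    · intro v hv
      rw [Function.update_apply, hD₂ v hv]
      split_ifs <;> omega
    · intro v hv
      rw [Function.update_apply, hD₂ v hv]
      split_ifs with hvs
      · rw [hvs, I.capDist_self hs]
      · exact I.capDist_le_inf _ _
    · intro v hv
      rw [Function.update_apply, hD₂ v hv]
      split_ifs <;> simp
    · intro v hv
      rw [hl v hv, Function.update_apply]
      by_cases hvn : v < I.n
      · simp [hvn, hD₂ v hvn]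
      · have : v ≠ s := by omega
        simp [hvn, this]
    · left
      simp [Finset.sum_add_distrib, I.sum_length_adjList le_rfl]
  · intro i hi σ' t' hF hr hI
    have H' : Prepared I B h σ' := (H₃.congr (by simp) (by simp)).frame hF rfl rfl
    exact wp_dijkstraRound H' hI
  · rintro σ' t' hF ⟨F, L, hI⟩ ht
    refine ⟨fun v hv => hI.final hs hv, ?_⟩
    rw [show h * 10 + 14 + 2 = h * 10 + 16 from rfl] at ht
    omega

end WordRAM

/-! ### The `2`-approximation from a greedy choice of centers -/

namespace STInstance

variable (I : STInstance)

theorem coe_eq_top_of_capDist {u v : Fin I.n} (h : I.capDist u v = I.inf) : I.dist u v = ⊤ := by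
  by_contra hc
  exact (I.capDist_lt_inf hc).ne h

theorem capDist_lt_inf_trans {u v x : ℕ} (h1 : I.capDist u v < I.inf)
    (h2 : I.capDist v x < I.inf) : I.capDist u x < I.inf := by
  have hu : u < I.n ∧ v < I.n := by
    by_contra hc
    simp [capDist, hc] at h1
  have hx : v < I.n ∧ x < I.n := by
    by_contra hc
    simp [capDist, hc] at h2
  obtain ⟨hu, hv⟩ := hu
  replace hx := hx.2
  lift u to Fin I.n using hu
  lift v to Fin I.n using hv
  lift x to Fin I.n using hx
  rw [capDist_lt_inf_iff] at *
  exact ne_top_of_le_ne_top (by simp [h1, h2]) (I.dist_triangle u v x)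

/-- The numbers of the vertices of `T`. -/
def targets : Finset ℕ := I.T.map Fin.valEmbedding

theorem mem_targets {t : ℕ} : t ∈ I.targets ↔ t < I.n ∧ I.init.mem 4 t ≠ 0 := by
  simp only [targets, Finset.mem_map, Fin.valEmbedding_apply, init]
  constructor
  · rintro ⟨x, hx, rfl⟩
    simp [hx]
  · rintro ⟨h, h'⟩
    refine ⟨⟨t, h⟩, ?_, rfl⟩
    by_contra hc
    simp [h, hc] at h'

theorem coe_mem_targets {t : Fin I.n} : (t : ℕ) ∈ I.targets ↔ t ∈ I.T :=
  Finset.mem_map' Fin.valEmbedding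

/-- The eccentricity as a natural number, with `inf` for infinity. -/
def capEcc (s : ℕ) : ℕ := I.targets.sup (I.capDist s)

theorem capEcc_le_inf (s : ℕ) : I.capEcc s ≤ I.inf :=
  Finset.sup_le fun _ _ => I.capDist_le_inf _ _

theorem capDist_le_capEcc {s t : ℕ} (ht : t ∈ I.targets) : I.capDist s t ≤ I.capEcc s :=
  Finset.le_sup (f := I.capDist s) ht

theorem exists_capEcc (s : ℕ) (h : I.capEcc s ≠ 0) :
    ∃ t ∈ I.targets, I.capEcc s = I.capDist s t := by
  have hne : I.targets.Nonempty := by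
    by_contra hc
    rw [Finset.not_nonempty_iff_eq_empty] at hc
    exact h (by simp [capEcc, hc])
  obtain ⟨t, ht, h'⟩ := Finset.exists_mem_eq_sup _ hne (I.capDist s)
  exact ⟨t, ht, h'⟩

theorem capEcc_sub_le (x s : ℕ) : I.capEcc x - I.capDist x s ≤ I.capEcc s := by
  by_cases h : I.capEcc x = 0
  · simp [h]
  obtain ⟨t, ht, h'⟩ := I.exists_capEcc x h
  have := I.capDist_triangle x s t
  have := I.capDist_le_capEcc (s := s) ht
  omega

theorem ecc_eq_of_capEcc_lt {s : Fin I.n} (h : I.capEcc s < I.inf) :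
    I.ecc s = (I.capEcc s : ℕ∞) := by
  have hd : ∀ t ∈ I.T, I.dist s t = (I.capDist s t : ℕ∞) := by
    intro t ht
    refine (I.coe_capDist ?_).symm
    rw [← I.capDist_lt_inf_iff]
    exact (I.capDist_le_capEcc (I.coe_mem_targets.2 ht)).trans_lt h
  refine le_antisymm (iSup₂_le fun t ht => ?_) ?_
  · rw [hd t ht]
    exact_mod_cast I.capDist_le_capEcc (I.coe_mem_targets.2 ht)
  · by_cases h0 : I.capEcc s = 0
    · simp [h0]
    obtain ⟨t, ht, h'⟩ := I.exists_capEcc s h0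
    lift t to Fin I.n using (I.mem_targets.1 ht).1
    rw [h']
    rw [← hd t (I.coe_mem_targets.1 ht)]
    exact le_iSup₂ (f := fun t (_ : t ∈ I.T) => I.dist s t) t (I.coe_mem_targets.1 ht)

theorem inf_pos : 0 < I.inf := by unfold inf; positivity

theorem ecc_eq_top_of_capEcc {s : Fin I.n} (h : I.capEcc s = I.inf) : I.ecc s = ⊤ := by
  obtain ⟨t, ht, h'⟩ := I.exists_capEcc s (by rw [h]; exact I.inf_pos.ne')
  lift t to Fin I.n using (I.mem_targets.1 ht).1
  have : I.dist s t = ⊤ := I.coe_eq_top_of_capDist (h'.symm.trans h)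
  refine top_le_iff.1 (this ▸ ?_)
  exact le_iSup₂ (f := fun t (_ : t ∈ I.T) => I.dist s t) t (I.coe_mem_targets.1 ht)

/-- The edge `e` has an end at distance less than `R / 2` from `c`. -/
def MeetsBall (R c e : ℕ) : Prop :=
  2 * I.capDist c (I.init.mem 0 e) < R ∨ 2 * I.capDist c (I.init.mem 1 e) < R

/-- The vertex `x` is the center `c` or an end of an edge that meets the ball around it. -/
def NearBall (R c x : ℕ) : Prop :=
  x = c ∨ ∃ e < I.m, I.MeetsBall R c e ∧ (x = I.init.mem 0 e ∨ x = I.init.mem 1 e)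

/-- A shortest path from `c` to `s` either stays in the open ball of radius `R / 2` around `c` or
has a vertex `x` just outside of it. -/
theorem exists_nearBall {R : ℕ} {c s : Fin I.n} (hR : 0 < R) (h : I.capDist c s < I.inf) :
    ∃ x < I.n, I.NearBall R c x ∧ I.capDist c x + I.capDist x s = I.capDist c s ∧
      (x = s ∨ R ≤ 2 * I.capDist c x) := by
  have hfin : ∀ {u v : Fin I.n} (q : I.G.Walk u v), I.capDist u v ≤ I.walkLength q := by
    intro u v q
    have h1 := I.dist_le_walkLength q
    rw [← I.coe_capDist (ne_top_of_le_ne_top (by simp) h1)] at h1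
    exact_mod_cast h1
  have key : ∀ (a b : Fin I.n) (q : I.G.Walk a b), I.NearBall R c a → 2 * I.capDist c a < R →
      I.capDist c a + I.walkLength q = I.capDist c b →
      ∃ x < I.n, I.NearBall R c x ∧ I.capDist c x + I.capDist x b = I.capDist c b ∧
        (x = b ∨ R ≤ 2 * I.capDist c x) := by
    intro a b q
    induction q with
    | @nil u => exact fun h1 h2 h3 => ⟨u, u.2, h1, by simp [I.capDist_self], .inl rfl⟩
    | @cons a a' b ha p ih =>
      intro h1 h2 h3
      rw [walkLength_cons] at h3
      have hnear : I.NearBall R c a' := by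
        obtain ⟨⟨i, hi⟩, he⟩ := I.exists_edge ha
        right
        refine ⟨i, hi, ?_⟩
        rw [MeetsBall, I.init_src hi, I.init_dst hi]
        rcases Sym2.eq_iff.1 he with ⟨g1, g2⟩ | ⟨g1, g2⟩ <;> rw [g1, g2] <;> simp [h2]
      have h4 : I.capDist c a' ≤ I.capDist c a + I.weight s(a, a') := by
        refine (I.capDist_triangle c a a').trans (Nat.add_le_add_left ?_ _)
        simpa [walkLength] using hfin ha.toWalk
      have h5 := hfin p
      have h6 := I.capDist_triangle c a' b
      by_cases h7 : 2 * I.capDist c a' < R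
      · exact ih hnear h7 (by omega)
      · exact ⟨a', a'.2, hnear, by omega, .inr (by omega)⟩
  have htop := I.capDist_lt_inf_iff.1 h
  obtain ⟨q, hq⟩ := I.exists_walk_of_dist_ne_top htop
  rw [← I.coe_capDist htop] at hq
  refine key c s q (.inl rfl) (by simpa [I.capDist_self]) ?_
  rw [I.capDist_self c.2, zero_add]
  exact_mod_cast hq.symm

/-- Centers `w 0, …, w (q - 1)` in `T` whose mutual distances are at least `R`, such that every
vertex of `T` has distance at most `R` from one of them. -/
structure IsGreedy (q R : ℕ) (w : ℕ → ℕ) : Prop where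
  mem : ∀ i < q, w i ∈ I.targets
  sep : ∀ i < q, ∀ j < q, i ≠ j → R ≤ I.capDist (w i) (w j)
  cover : ∀ t ∈ I.targets, I.inf ≤ R ∨ ∃ i < q, I.capDist (w i) t ≤ R

variable {I}

/-- If no center is at distance at least half the eccentricity `D` of `s`, then the balls of radius
`R / 2 > D / 4` around the centers are disjoint, and a path from `s` to a center `c` leaves
the ball of `c` at a vertex at distance less than `D / 4` from `s`. -/
theorem IsGreedy.approx {q R c s est : ℕ} {w : ℕ → ℕ} (H : I.IsGreedy q R w) (hq : 2 ≤ q)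
    (hc : ∃ i < q, c = w i) (hs : s < I.n) (h1 : ∀ i < q, I.capDist (w i) s ≤ est)
    (h2 : ∀ x, I.NearBall R c x → I.capEcc x - I.capDist x s ≤ est) :
    I.capEcc s ≤ 2 * est ∧ (I.capEcc s = I.inf → I.inf ≤ est) := by
  obtain ⟨i, hi, rfl⟩ := hc
  constructor
  · by_contra! hlt
    -- `t` is farther than half the eccentricity from all centers, so `R` is larger than that
    obtain ⟨t, ht, hst⟩ := I.exists_capEcc s (by omega)
    have hD := I.capEcc_le_inf s
    have hR : I.capEcc s < 2 * R := by
      rcases H.cover t ht with h3 | ⟨j, hj, h3⟩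
      · have := I.inf_pos
        omega
      · have h4 := I.capDist_triangle s (w j) t
        rw [I.capDist_comm s (w j)] at h4
        have := h1 j hj
        omega
    have hwi := h1 i hi
    have hwn := (I.mem_targets.1 (H.mem i hi)).1
    obtain ⟨x, hx, hnear, hsum, hx'⟩ := I.exists_nearBall (R := R) (c := ⟨w i, hwn⟩) (s := ⟨s, hs⟩)
      (by omega) (by simp only; omega)
    simp only at hsum hx' hnear
    have hest := h2 x hnear
    have h5 : I.capEcc s ≤ I.capEcc x + I.capDist x s := by
      have := I.capEcc_sub_le s x
      rw [I.capDist_comm s x] at this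
      omega
    rcases hx' with rfl | hx'
    · rw [I.capDist_self hs] at hest
      omega
    · omega
  · -- If the eccentricity is infinite and `s` is connected to all centers, then none of them is
    -- connected to `t`, so `R` is infinite and two centers are not connected to each other.
    intro hinf
    by_contra! hlt
    obtain ⟨t, ht, hst⟩ := I.exists_capEcc s (by have := I.inf_pos; omega)
    have hfar : ∀ j < q, I.capDist (w j) t = I.inf := by
      intro j hj
      refine le_antisymm (I.capDist_le_inf _ _) ?_
      by_contra! hcon
      have h3 : I.capDist s (w j) < I.inf := by
        rw [I.capDist_comm]; exact (h1 j hj).trans_lt hlt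
      have := I.capDist_lt_inf_trans h3 hcon
      omega
    have hR : I.inf ≤ R := by
      rcases H.cover t ht with h3 | ⟨j, hj, h3⟩
      · exact h3
      · rwa [hfar j hj] at h3
    have h01 := H.sep 0 (by omega) 1 (by omega) (by omega)
    have h3 : I.capDist (w 0) s < I.inf := (h1 0 (by omega)).trans_lt hlt
    have h4 : I.capDist s (w 1) < I.inf := by
      rw [I.capDist_comm]; exact (h1 1 (by omega)).trans_lt hlt
    have := I.capDist_lt_inf_trans h3 h4
    omega

open Classical in
variable (I) in
/-- The number of edges that meet the ball around `c`. -/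
def ballEdges (R c : ℕ) : ℕ := ((Finset.range I.m).filter (I.MeetsBall R c)).card

/-- Some ball meets few edges, as every end of an edge is in at most one of the disjoint balls. -/
theorem IsGreedy.mul_le {q R b : ℕ} {w : ℕ → ℕ} (H : I.IsGreedy q R w)
    (hb : ∀ i < q, b ≤ I.ballEdges R (w i)) : q * b ≤ 2 * I.m := by
  classical
  have hone : ∀ a, ((Finset.range q).filter fun i => 2 * I.capDist (w i) a < R).card ≤ 1 := by
    intro a
    refine Finset.card_le_one.2 fun i hi j hj => ?_
    simp only [Finset.mem_filter, Finset.mem_range] at hi hj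
    by_contra hij
    have h1 := H.sep i hi.1 j hj.1 hij
    have h2 := I.capDist_triangle (w i) a (w j)
    rw [I.capDist_comm a (w j)] at h2
    omega
  calc q * b = ∑ i ∈ Finset.range q, b := by simp
    _ ≤ ∑ i ∈ Finset.range q, I.ballEdges R (w i) :=
      Finset.sum_le_sum fun i hi => hb i (Finset.mem_range.1 hi)
    _ = ∑ e ∈ Finset.range I.m, ((Finset.range q).filter fun i => I.MeetsBall R (w i) e).card := by
      simp only [ballEdges, Finset.card_filter]
      exact Finset.sum_comm
    _ ≤ ∑ e ∈ Finset.range I.m, 2 := by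
      refine Finset.sum_le_sum fun e _ => ?_
      have h1 : ((Finset.range q).filter fun i => I.MeetsBall R (w i) e) =
          ((Finset.range q).filter fun i => 2 * I.capDist (w i) (I.init.mem 0 e) < R) ∪
          ((Finset.range q).filter fun i => 2 * I.capDist (w i) (I.init.mem 1 e) < R) := by
        rw [← Finset.filter_or]
        exact Finset.filter_congr fun i _ => Iff.rfl
      rw [h1]
      refine (Finset.card_union_le _ _).trans ?_
      have := hone (I.init.mem 0 e)
      have := hone (I.init.mem 1 e)
      omega
    _ = 2 * I.m := by simp [mul_comm]

/-- Estimates that are correct for the capped eccentricities are correct. -/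
theorem isApprox_two_of_capEcc {σ : WordRAM.State}
    (h : ∀ v < I.n, σ.mem 5 v ≤ I.capEcc v ∧ I.capEcc v ≤ 2 * σ.mem 5 v ∧
      (I.capEcc v = I.inf → I.inf ≤ σ.mem 5 v) ∧ (σ.mem 5 v = 0 ∨
        σ.mem 6 v = if σ.mem 5 v < I.inf then 1 else 0)) : I.IsApprox 2 σ := by
  intro s _
  obtain ⟨h1, h2, h3, h4⟩ := h s s.2
  have h5 : ENNReal.ofReal 2 = 2 := by simp
  rw [h5, estimate]
  rcases (I.capEcc_le_inf s).lt_or_eq with hlt | heq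
  · have he : I.estimate σ s = (σ.mem 5 s : ℝ≥0∞) := by
      rw [estimate]
      rcases h4 with h4 | h4
      · simp [h4]
      · rw [h4, if_pos (by omega)]
        simp
    rw [estimate] at he
    rw [he, I.ecc_eq_of_capEcc_lt hlt]
    constructor
    · refine ENNReal.div_le_of_le_mul ?_
      rw [mul_comm]
      exact_mod_cast h2
    · exact_mod_cast h1
  · have h6 := h3 heq
    have h7 := I.inf_pos
    rw [I.ecc_eq_top_of_capEcc heq]
    rcases h4 with h4 | h4
    · omega
    · rw [h4, if_neg (by omega)]
      have : (σ.mem 5 s : ℝ≥0∞) ≠ 0 := by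
        have : σ.mem 5 s ≠ 0 := by omega
        exact_mod_cast this
      simp [ENNReal.div_zero this]

end STInstance

/-! ### A program for the approximation -/

namespace WordRAM

open Ex (reg ld)

/-- Rule for a `for` loop that changes cell `i` of bank `k` to `f i` in round `i`. -/
theorem Cmd.wp_forTo_map {B r l : ℕ} {c : Cmd} {σ : State} {t : ℕ} (n K k : ℕ) (f : ℕ → ℕ)
    (hn : n < B) (hln : σ.reg l = n)
    (hrl : (l == r) = false) (hwr : c.wr r = false) (hwl : c.wr l = false)
    (hstep : ∀ i < n, ∀ σ' t', (Cmd.forTo r l c).Frame σ σ' → σ'.reg r = i →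
      σ'.mem k i = σ.mem k i →
      c.wp B (fun σ'' t'' => (∀ v, σ''.mem k v = if v = i then f i else σ'.mem k v) ∧
        t'' ≤ t' + K) σ' t') :
    (Cmd.forTo r l c).wp B (fun σ' t' => (∀ v, σ'.mem k v = if v < n then f v else σ.mem k v) ∧
      t' ≤ t + (n * (K + 2) + 2)) σ t := by
  refine Cmd.wp_forTo_le n K (fun i σ' => ∀ v, σ'.mem k v = if v < i then f v else σ.mem k v)
    hn hln hrl hwr hwl (by simp) ?_ (fun σ' t' _ h1 h2 => ⟨h1, h2⟩)
  intro i hi σ' t' hF hr hI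
  refine Cmd.wp_mono _ ?_ (hstep i hi σ' t' hF hr (by rw [hI, if_neg (lt_irrefl i)]))
  rintro σ'' t'' ⟨h1, h2⟩
  refine ⟨fun v => ?_, h2⟩
  rw [State.setReg_mem, h1, hI]
  by_cases hv : v = i
  · simp [hv]
  · simp [hv, show v < i + 1 ↔ v < i by omega]

/-- Bookkeeping before the shortest path computations, see `Prepared`. -/
def prepare : Cmd :=
  .set 6 (reg 1 + reg 1) ;;
  .set 7 (reg 6 + reg 0) ;;
  .set 5 0 ;;
  .forTo 12 1 (.ite (.lt (reg 5) (ld 2 (reg 12))) (.set 5 (ld 2 (reg 12))) .skip) ;;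
  .set 2 ((reg 0 + 1) * (reg 5 + 1)) ;;
  .set 3 1 ;;
  .set 4 0 ;;
  .forTo 12 0 (.ite (.lt (reg 3) (reg 0)) (.set 3 (reg 3 + reg 3) ;; .set 4 (reg 4 + 1)) .skip) ;;
  .set 8 (reg 3 + reg 3) ;;
  .forTo 12 6 (
    .ite (.lt (reg 12) (reg 1))
      (.set 13 (ld 0 (reg 12)) ;; .set 14 (ld 1 (reg 12)) ;; .set 15 (ld 2 (reg 12)))
      (.set 13 (ld 1 (reg 12 - reg 1)) ;; .set 14 (ld 0 (reg 12 - reg 1)) ;;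
        .set 15 (ld 2 (reg 12 - reg 1))) ;;
    .st 9 (reg 12 + 1) (reg 14) ;;
    .st 14 (reg 12 + 1) (reg 15) ;;
    .st 8 (reg 12 + 1) (ld 7 (reg 13)) ;;
    .st 7 (reg 13) (reg 12 + 1))

theorem maxWeight_eq (I : STInstance) :
    I.maxWeight = (Finset.range I.m).sup (I.init.mem 2) := by
  refine le_antisymm (Finset.sup_le fun i _ => ?_) (Finset.sup_le fun i hi => ?_)
  · rw [← I.init_weight i.2]
    exact Finset.le_sup (f := I.init.mem 2) (Finset.mem_range.2 i.2)
  · rw [I.init_weight (Finset.mem_range.1 hi)]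
    exact Finset.le_sup (f := I.edgeWeight) (Finset.mem_univ _)

theorem wp_prepare {I : STInstance} {B t : ℕ}
    (hB : 2 * I.inf + 6 * I.n + 2 * I.m + I.maxWeight + 4 < B) :
    prepare.wp B (fun σ' t' => (∃ h, Prepared I B h σ' ∧ 2 ^ h ≤ 2 * I.n + 1) ∧
      t' ≤ t + (24 * I.m + 5 * I.n + 20)) I.init t := by
  have i0 : I.init.reg 0 = I.n := rfl
  have i1 : I.init.reg 1 = I.m := rfl
  rw [prepare]
  refine ⟨by simp [i1]; omega, by simp [i0, i1]; omega, by simp, ?_⟩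
  refine Cmd.wp_seq (P := fun σ' t' => σ'.reg 5 = I.maxWeight ∧ t' ≤ t + (I.m * 4 + 5))
    (Cmd.wp_forTo_le I.m 2 (fun i σ' => σ'.reg 5 = (Finset.range i).sup (I.init.mem 2)) (by omega)
    (by simp [i1]) rfl rfl rfl (by simp) ?_ ?_) ?_
  · intro i hi σ' t' hF hr hI
    have hm : σ'.mem 2 = I.init.mem 2 := (hF.mem 2 rfl).trans rfl
    have hs : (Finset.range (i + 1)).sup (I.init.mem 2) =
        max (I.init.mem 2 i) ((Finset.range i).sup (I.init.mem 2)) := by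
      rw [Finset.range_add_one, Finset.sup_insert]
    refine ⟨by simp, fun hlt => ⟨by simp, ?_, by omega⟩, fun hge => ⟨?_, by omega⟩⟩
    · have hlt' : (Finset.range i).sup (I.init.mem 2) < I.init.mem 2 i := by
        simpa [hr, hm, hI] using hlt
      simp [hr, hm, hs, max_eq_left hlt'.le]
    · have hge' : I.init.mem 2 i ≤ (Finset.range i).sup (I.init.mem 2) := by
        simpa [hr, hm, hI] using hge
      simp [hI, hs, max_eq_right hge']
  · intro σ' t' hF hI ht
    exact ⟨by rw [hI, maxWeight_eq], by omega⟩
  rintro σ₁ t₁ hF₁ ⟨h5, ht₁⟩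
  have r0 : σ₁.reg 0 = I.n := (hF₁.reg 0 rfl).trans rfl
  have r1 : σ₁.reg 1 = I.m := (hF₁.reg 1 rfl).trans rfl
  have r6 : σ₁.reg 6 = 2 * I.m := by rw [hF₁.reg 6 rfl]; simp [i1]; omega
  have r7 : σ₁.reg 7 = 2 * I.m + I.n := by rw [hF₁.reg 7 rfl]; simp [i1, i0]; omega
  have hm₁ : ∀ k, k < 16 → σ₁.mem k = I.init.mem k := fun k hk => (hF₁.mem k (by
    simp [Cmd.forTo, Cmd.wm])).trans rfl
  clear hF₁
  have e2 : (I.n + 1) * (I.maxWeight + 1) = I.inf := rfl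
  have hW : I.maxWeight ≤ I.inf := by rw [← e2]; nlinarith [Nat.zero_le (I.n * I.maxWeight)]
  refine ⟨by simp [r0, h5, e2]; omega, by simp, by simp, ?_⟩
  simp only [Ex.eval_add, Ex.eval_mul, Ex.eval_reg, Ex.eval_ofNat, r0, h5, e2]
  refine Cmd.wp_seq (P := fun σ' t' => (∃ h, σ'.reg 4 = h ∧ σ'.reg 3 = 2 ^ h ∧ I.n ≤ 2 ^ h ∧
      2 ^ h ≤ 2 * I.n + 1) ∧ t' ≤ t₁ + (I.n * 5 + 5))
    (Cmd.wp_forTo_le I.n 3 (fun i σ' => ∃ h, σ'.reg 4 = h ∧ σ'.reg 3 = 2 ^ h ∧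
      (I.n ≤ 2 ^ h ∨ i + 1 ≤ 2 ^ h) ∧ 2 ^ h ≤ 2 * I.n + 1) (by omega)
    (by simp [r0]) rfl rfl rfl ⟨0, by simp, by simp, by simp, by simp⟩ ?_ ?_) ?_
  · rintro i hi σ' t' hF hr ⟨h, hI1, hI2, hI3, hI4⟩
    have r0' : σ'.reg 0 = I.n := (hF.reg 0 rfl).trans (by simp [r0])
    have hh : h < 2 ^ h := Nat.lt_two_pow_self
    refine ⟨by simp, fun hlt => ⟨by simp [hI2]; omega, by simp [hI1]; omega,
      ⟨h + 1, ?_, ?_, ?_, ?_⟩, by omega⟩, fun hge => ⟨⟨h, ?_, ?_, ?_, ?_⟩, by omega⟩⟩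
    · simp [hI1]
    · simp [hI2, pow_succ]; omega
    · simp [hI2, r0'] at hlt
      rw [pow_succ]; omega
    · simp [hI2, r0'] at hlt
      rw [pow_succ]; omega
    · simp [hI1]
    · simp [hI2]
    · simp [hI2, r0'] at hge
      omega
    · exact hI4
  · rintro σ' t' hF ⟨h, hI1, hI2, hI3, hI4⟩ ht
    exact ⟨⟨h, hI1, hI2, by omega, hI4⟩, by omega⟩
  rintro σ₂ t₂ hF₂ ⟨⟨h, r4, r3, hn, hn'⟩, ht₂⟩
  have r0' : σ₂.reg 0 = I.n := (hF₂.reg 0 rfl).trans (by simp [r0])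
  have r1' : σ₂.reg 1 = I.m := (hF₂.reg 1 rfl).trans (by simp [r1])
  have r2' : σ₂.reg 2 = I.inf := (hF₂.reg 2 rfl).trans (by simp)
  have r6' : σ₂.reg 6 = 2 * I.m := (hF₂.reg 6 rfl).trans (by simp [r6])
  have r7' : σ₂.reg 7 = 2 * I.m + I.n := (hF₂.reg 7 rfl).trans (by simp [r7])
  have hm₂ : ∀ k, k < 16 → σ₂.mem k = I.init.mem k := fun k hk => (hF₂.mem k (by
    simp [Cmd.forTo, Cmd.wm])).trans (hm₁ k hk)
  clear hF₂
  refine ⟨by simp [r3]; omega, ?_⟩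
  simp only [Ex.eval_add, Ex.eval_reg, r3]
  refine Cmd.wp_forTo_le (2 * I.m) 8 (fun K σ' =>
    (∀ v < I.n, LinkedList (σ'.mem 8) (σ'.mem 7 v) (I.adjList K v)) ∧
    (∀ d < K, σ'.mem 9 (d + 1) = I.hd d) ∧ ∀ d < K, σ'.mem 14 (d + 1) = I.wt d)
    (by omega) (by simp [r6']) rfl rfl rfl ?_ ?_ ?_
  · simp [hm₂, STInstance.adjList, LinkedList, STInstance.init]
  · rintro K hK σ' t' hF hr ⟨hI1, hI2, hI3⟩
    have s1 : σ'.reg 1 = I.m := (hF.reg 1 rfl).trans (by simp [r1'])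
    have m0 : σ'.mem 0 = I.init.mem 0 := (hF.mem 0 rfl).trans (hm₂ 0 (by norm_num))
    have m1 : σ'.mem 1 = I.init.mem 1 := (hF.mem 1 rfl).trans (hm₂ 1 (by norm_num))
    have m2 : σ'.mem 2 = I.init.mem 2 := (hF.mem 2 rfl).trans (hm₂ 2 (by norm_num))
    refine Cmd.wp_seq (P := fun σ'' t'' => (σ''.reg 12 = K ∧ σ''.reg 13 = I.tl K ∧
      σ''.reg 14 = I.hd K ∧ σ''.reg 15 = I.wt K ∧ σ''.mem = σ'.mem) ∧ t'' ≤ t' + 4) ?_ ?_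
    · refine ⟨by simp, fun hlt => ⟨by simp, by simp, by simp, ?_⟩,
        fun hge => ⟨by simp, by simp, by simp, ?_⟩⟩
      · simp [hr, s1] at hlt
        simp [hr, m0, m1, m2, STInstance.tl, STInstance.hd, STInstance.wt, hlt]
      · simp [hr, s1] at hge
        simp [hr, s1, m0, m1, m2, STInstance.tl, STInstance.hd, STInstance.wt, hge.not_gt]
    · rintro σ'' t'' - ⟨⟨g12, g13, g14, g15, gm⟩, ht''⟩
      have hB' : K + 1 < B := by omega
      refine ⟨by simp [g12, hB'], by simp, by simp [g12, hB'], by simp, by simp [g12, hB'], by simp,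
        by simp, by simp [g12, hB'], ⟨?_, ?_, ?_⟩, by omega⟩
      · intro v hv
        simp only [State.setReg_mem, State.setMem_mem, Ex.eval_add, Ex.eval_reg, Ex.eval_ofNat,
          Ex.eval_ld, State.setMem_reg, g12, g13, g14, g15, gm]
        simp only [Nat.reduceEqDiff, ↓reduceIte]
        have hold : LinkedList (Function.update (σ'.mem 8) (K + 1) (σ'.mem 7 (I.tl K)))
            (σ'.mem 7 v) (I.adjList K v) := by
          refine (hI1 v hv).congr fun p hp => Function.update_of_ne ?_ _ _
          have := (I.mem_adjList.1 hp).2.1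
          omega
        rw [STInstance.adjList]
        by_cases hKv : I.tl K = v
        · subst hKv
          rw [if_pos rfl, Function.update_self]
          refine ⟨rfl, by omega, ?_⟩
          rw [Function.update_self]
          exact hold
        · rw [if_neg hKv, Function.update_of_ne (Ne.symm hKv)]
          exact hold
      · intro d hd
        simp [g12, g14, gm, Function.update_apply]
        split_ifs with hdK
        · rw [hdK]
        · exact hI2 d (by omega)
      · intro d hd
        simp [g12, g15, gm, Function.update_apply]
        split_ifs with hdK
        · rw [hdK]
        · exact hI3 d (by omega)
  · rintro σ' t' hF ⟨hI1, hI2, hI3⟩ ht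
    refine ⟨⟨h, ⟨?_, ?_, ?_, ?_, ?_, ?_, ?_, hI1, hI2, hI3, ?_, ?_, ?_, ?_, hn, by omega, by omega,
      by omega⟩, hn'⟩, by omega⟩
    · exact (hF.reg 0 rfl).trans (by simp [r0'])
    · exact (hF.reg 1 rfl).trans (by simp [r1'])
    · exact (hF.reg 2 rfl).trans (by simp [r2'])
    · exact (hF.reg 3 rfl).trans (by simp [r3])
    · exact (hF.reg 4 rfl).trans (by simp [r4])
    · exact (hF.reg 7 rfl).trans (by simp [r7'])
    · exact (hF.reg 8 rfl).trans (by simp; omega)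
    · exact (hF.mem 0 rfl).trans (hm₂ 0 (by norm_num))
    · exact (hF.mem 1 rfl).trans (hm₂ 1 (by norm_num))
    · exact (hF.mem 3 rfl).trans (hm₂ 3 (by norm_num))
    · exact (hF.mem 4 rfl).trans (hm₂ 4 (by norm_num))

end WordRAM

namespace WordRAM

open Ex (reg ld)

/-- Write to register `9` a vertex of `T` with the largest key in bank `12`, and to register `22`
its key. Register `21` holds the largest key so far plus `1`, or `0` before the first vertex. -/
def pickFarthest : Cmd :=
  .set 21 0 ;;
  .forTo 12 0 (.ite (ld 4 (reg 12))
    (.ite (.lt (reg 21) (ld 12 (reg 12) + 1))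
      (.set 21 (ld 12 (reg 12) + 1) ;; .set 9 (reg 12)) .skip) .skip) ;;
  .set 22 (reg 21 - 1)

theorem wp_pickFarthest {I : STInstance} {B h : ℕ} {σ : State} {t : ℕ} (H : Prepared I B h σ)
    (hT : I.targets.Nonempty) (hle : ∀ v < I.n, σ.mem 12 v ≤ I.inf) :
    pickFarthest.wp B (fun σ' t' => σ'.reg 9 ∈ I.targets ∧ σ'.reg 22 = σ.mem 12 (σ'.reg 9) ∧
      (∀ v ∈ I.targets, σ.mem 12 v ≤ σ'.reg 22) ∧ t' ≤ t + (I.n * 6 + 4)) σ t := by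
  rw [pickFarthest]
  refine ⟨by simp, Cmd.wp_forTo_le I.n 4 (fun i σ' =>
    (∀ v ∈ I.targets, v < i → σ.mem 12 v + 1 ≤ σ'.reg 21) ∧
    (σ'.reg 21 = 0 ∨ σ'.reg 9 ∈ I.targets ∧ σ'.reg 21 = σ.mem 12 (σ'.reg 9) + 1))
    (by have := H.rounds_lt; omega) (by simpa using H.n) rfl rfl rfl (by simp) ?_ ?_⟩
  · rintro i hi σ' t' hF hr ⟨hI1, hI2⟩
    have m4 : σ'.mem 4 = I.init.mem 4 := (hF.mem 4 rfl).trans (by simpa using H.inT)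
    have m12 : σ'.mem 12 = σ.mem 12 := (hF.mem 12 rfl).trans (by simp)
    have hfit : σ.mem 12 i + 1 < B := by
      have := hle i hi
      have := H.inf_lt
      omega
    refine ⟨by simp, fun hT' => ⟨by simpa [hr, m12] using hfit,
      fun hlt => ⟨by simpa [hr, m12] using hfit, by simp, ⟨?_, .inr ⟨?_, ?_⟩⟩, by omega⟩,
      fun hge => ⟨⟨?_, ?_⟩, by omega⟩⟩, fun hT' => ⟨⟨?_, ?_⟩, by omega⟩⟩
    · intro v hv hvi
      simp [hr, m12] at hlt ⊢
      rcases Nat.lt_succ_iff_lt_or_eq.1 hvi with h1 | rfl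
      · have := hI1 v hv h1
        omega
      · exact le_rfl
    · simp [hr, m4] at hT' ⊢
      exact I.mem_targets.2 ⟨hi, hT'⟩
    · simp [hr, m12]
    · intro v hv hvi
      simp [hr, m12] at hge ⊢
      rcases Nat.lt_succ_iff_lt_or_eq.1 hvi with h1 | rfl
      · exact hI1 v hv h1
      · exact hge
    · simpa using hI2
    · intro v hv hvi
      simp [hr, m4] at hT' ⊢
      rcases Nat.lt_succ_iff_lt_or_eq.1 hvi with h1 | rfl
      · exact hI1 v hv h1
      · exact absurd hT' (I.mem_targets.1 hv).2
    · simpa using hI2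
  · rintro σ' t' hF ⟨hI1, hI2⟩ ht
    have h1 : ∀ v ∈ I.targets, σ.mem 12 v + 1 ≤ σ'.reg 21 := fun v hv =>
      hI1 v hv (I.mem_targets.1 hv).1
    obtain ⟨v, hv⟩ := hT
    have h2 := h1 v hv
    rcases hI2 with h3 | ⟨h3, h4⟩
    · omega
    · refine ⟨by simp, by simpa using h3, by simp [h4], ?_, by omega⟩
      intro v hv
      have := h1 v hv
      simp
      omega

/-- Raise the estimates in bank `5` to the distances in bank `10`, and lower the keys in bank `12`
to them. -/
def absorb : Cmd :=
  .forTo 12 0 (.ite (.lt (ld 5 (reg 12)) (ld 10 (reg 12)))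
    (.st 5 (reg 12) (ld 10 (reg 12))) .skip) ;;
  .forTo 12 0 (.ite (.lt (ld 10 (reg 12)) (ld 12 (reg 12)))
    (.st 12 (reg 12) (ld 10 (reg 12))) .skip)

theorem wp_absorb {I : STInstance} {B h : ℕ} {σ : State} {t : ℕ} (H : Prepared I B h σ) :
    absorb.wp B (fun σ' t' => (∀ v < I.n, σ'.mem 5 v = max (σ.mem 5 v) (σ.mem 10 v)) ∧
      (∀ v < I.n, σ'.mem 12 v = min (σ.mem 12 v) (σ.mem 10 v)) ∧ t' ≤ t + (I.n * 8 + 4)) σ t := by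
  have hn : I.n < B := by have := H.rounds_lt; omega
  refine Cmd.wp_seq (Cmd.wp_forTo_map I.n 2 5 (fun v => max (σ.mem 5 v) (σ.mem 10 v)) hn H.n
    rfl rfl rfl ?_) ?_
  · intro i hi σ' t' hF hr hold
    have m10 : σ'.mem 10 = σ.mem 10 := hF.mem 10 rfl
    refine ⟨by simp, fun hlt => ⟨by simp, by simp, ?_, by omega⟩, fun hge => ⟨?_, by omega⟩⟩
    · simp [hr, m10, hold] at hlt
      intro v
      simp [hr, m10, Function.update_apply, max_eq_right hlt.le]
    · simp [hr, m10, hold] at hge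
      intro v
      split_ifs with hv
      · rw [hv, hold, max_eq_left hge]
      · rfl
  rintro σ₁ t₁ hF₁ ⟨h1, ht₁⟩
  refine Cmd.wp_conseq (Cmd.wp_forTo_map I.n 2 12 (fun v => min (σ.mem 12 v) (σ.mem 10 v)) hn
    ((hF₁.reg 0 rfl).trans H.n) rfl rfl rfl ?_) ?_
  · intro i hi σ' t' hF hr hold
    have m10 : σ'.mem 10 = σ.mem 10 := (hF.mem 10 rfl).trans (hF₁.mem 10 rfl)
    have m12 : σ₁.mem 12 = σ.mem 12 := hF₁.mem 12 rfl
    rw [m12] at hold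
    refine ⟨by simp, fun hlt => ⟨by simp, by simp, ?_, by omega⟩, fun hge => ⟨?_, by omega⟩⟩
    · simp [hr, m10, hold] at hlt
      intro v
      simp [hr, m10, Function.update_apply, min_eq_right hlt.le]
    · simp [hr, m10, hold] at hge
      intro v
      split_ifs with hv
      · rw [hv, hold, min_eq_left hge]
      · rfl
  · rintro σ₂ t₂ hF₂ ⟨h2, ht₂⟩
    refine ⟨fun v hv => ?_, fun v hv => ?_, by omega⟩
    · rw [hF₂.mem 5 rfl, h1, if_pos hv]
    · rw [h2, if_pos hv]

/-- A bound for the number of steps of `dijkstra`. -/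
def dijkstraTime (I : STInstance) (h : ℕ) : ℕ :=
  (2 * I.m + I.n) * (h * 10 + 16) + I.n * 3 + 6 * 2 ^ h + h * 5 + 14

/-- The greedy choice of centers, the number of which is in register `5`. They are written to
bank `13`. -/
def greedy : Cmd :=
  .forTo 12 0 (.st 12 (reg 12) (reg 2)) ;;
  .set 22 (reg 2) ;;
  .forTo 19 5 (pickFarthest ;; .st 13 (reg 19) (reg 9) ;; dijkstra ;; absorb)

/-- The invariant of the greedy choice after `i` rounds: `w` lists the centers, `md` holds the
distances to the closest of them, and `est` the estimates. -/
structure GreedyInv (I : STInstance) (i R : ℕ) (est md w : ℕ → ℕ) : Prop where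
  mem : ∀ j < i, w j ∈ I.targets
  sep : ∀ a < i, ∀ b < i, a ≠ b → R ≤ I.capDist (w a) (w b)
  far : ∀ t ∈ I.targets, md t ≤ R
  le_inf : ∀ v < I.n, md v ≤ I.inf
  le_dist : ∀ v < I.n, ∀ j < i, md v ≤ I.capDist (w j) v
  attained : ∀ v < I.n, md v = I.inf ∨ ∃ j < i, md v = I.capDist (w j) v
  dist_le : ∀ v < I.n, ∀ j < i, I.capDist (w j) v ≤ est v
  le_ecc : ∀ v < I.n, est v ≤ I.capEcc v

theorem GreedyInv.isGreedy {I : STInstance} {i R : ℕ} {est md w : ℕ → ℕ}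
    (H : GreedyInv I i R est md w) : I.IsGreedy i R w where
  mem := H.mem
  sep := H.sep
  cover := fun t ht => by
    have h1 := H.far t ht
    rcases H.attained t (I.mem_targets.1 ht).1 with h2 | ⟨j, hj, h2⟩
    · exact .inl (h2 ▸ h1)
    · exact .inr ⟨j, hj, h2 ▸ h1⟩

theorem GreedyInv.step {I : STInstance} {i R x : ℕ} {est est' md md' w w' : ℕ → ℕ}
    (H : GreedyInv I i R est md w) (hx : x ∈ I.targets) (hw : ∀ j, w' j = if j = i then x else w j)
    (hfar : ∀ t ∈ I.targets, md t ≤ md x)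
    (hest : ∀ v < I.n, est' v = max (est v) (I.capDist x v))
    (hmd : ∀ v < I.n, md' v = min (md v) (I.capDist x v)) :
    GreedyInv I (i + 1) (md x) est' md' w' := by
  have hxn := (I.mem_targets.1 hx).1
  have hR := H.far x hx
  have hi : w' i = x := by simp [hw]
  have hj : ∀ j < i, w' j = w j := fun j hj => by simp [hw, hj.ne]
  have hcases : ∀ {j}, j < i + 1 → (j < i ∧ w' j = w j) ∨ (j = i ∧ w' j = x) := by
    intro j hji
    rcases Nat.lt_succ_iff_lt_or_eq.1 hji with h1 | rfl
    exacts [.inl ⟨h1, hj j h1⟩, .inr ⟨rfl, hi⟩]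
  refine ⟨?_, ?_, ?_, ?_, ?_, ?_, ?_, ?_⟩
  · intro j hji
    rcases hcases hji with ⟨h1, h2⟩ | ⟨h1, h2⟩ <;> rw [h2]
    exacts [H.mem j h1, hx]
  · intro a ha b hb hab
    rcases hcases ha with ⟨h1, h2⟩ | ⟨h1, h2⟩ <;> rcases hcases hb with ⟨h3, h4⟩ | ⟨h3, h4⟩ <;>
      rw [h2, h4]
    · exact hR.trans (H.sep a h1 b h3 hab)
    · exact H.le_dist x hxn a h1
    · rw [I.capDist_comm]
      exact H.le_dist x hxn b h3
    · omega
  · intro t ht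
    rw [hmd t (I.mem_targets.1 ht).1]
    exact (min_le_left _ _).trans (hfar t ht)
  · intro v hv
    rw [hmd v hv]
    exact (min_le_left _ _).trans (H.le_inf v hv)
  · intro v hv j hji
    rw [hmd v hv]
    rcases hcases hji with ⟨h1, h2⟩ | ⟨h1, h2⟩ <;> rw [h2]
    exacts [(min_le_left _ _).trans (H.le_dist v hv j h1), min_le_right _ _]
  · intro v hv
    rw [hmd v hv]
    rcases min_choice (md v) (I.capDist x v) with h1 | h1 <;> rw [h1]
    · rcases H.attained v hv with h2 | ⟨j, hji, h2⟩
      · exact .inl h2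
      · exact .inr ⟨j, by omega, by rw [hj j hji, h2]⟩
    · exact .inr ⟨i, by omega, by rw [hi]⟩
  · intro v hv j hji
    rw [hest v hv]
    rcases hcases hji with ⟨h1, h2⟩ | ⟨h1, h2⟩ <;> rw [h2]
    exacts [(H.dist_le v hv j h1).trans (le_max_left _ _), le_max_right _ _]
  · intro v hv
    rw [hest v hv]
    refine max_le (H.le_ecc v hv) ?_
    rw [I.capDist_comm]
    exact I.capDist_le_capEcc hx

theorem wp_greedy {I : STInstance} {B h q : ℕ} {σ : State} {t : ℕ} (H : Prepared I B h σ)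
    (hT : I.targets.Nonempty) (hq : q < B) (h5 : σ.reg 5 = q) (hest : ∀ v < I.n, σ.mem 5 v = 0) :
    greedy.wp B (fun σ' t' => GreedyInv I q (σ'.reg 22) (σ'.mem 5) (σ'.mem 12) (σ'.mem 13) ∧
      t' ≤ t + (q * (dijkstraTime I h + I.n * 14 + 11) + I.n * 3 + 5)) σ t := by
  have hn : I.n < B := by have := H.rounds_lt; omega
  refine Cmd.wp_seq (Cmd.wp_forTo_map I.n 1 12 (fun _ => I.inf) hn H.n rfl rfl rfl ?_) ?_
  · intro i hi σ' t' hF hr hold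
    have r2 : σ'.reg 2 = I.inf := (hF.reg 2 rfl).trans H.inf
    refine ⟨by simp, by simp, ?_, by omega⟩
    intro v
    simp [hr, r2, Function.update_apply]
  rintro σ₁ t₁ hF₁ ⟨h1, ht₁⟩
  have H₁ : Prepared I B h σ₁ := H.frame hF₁ rfl rfl
  refine ⟨by simp, Cmd.wp_forTo_le q (dijkstraTime I h + I.n * 14 + 9) (fun i σ' =>
    GreedyInv I i (σ'.reg 22) (σ'.mem 5) (σ'.mem 12) (σ'.mem 13)) hq
    ((hF₁.reg 5 rfl).trans h5) rfl rfl rfl ?_ ?_ ?_⟩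
  · have h12 : ∀ v < I.n, σ₁.mem 12 v = I.inf := fun v hv => by rw [h1, if_pos hv]
    refine ⟨by simp, by simp, ?_, ?_, by simp, ?_, by simp, ?_⟩
    · intro t ht
      simp [h12 t (I.mem_targets.1 ht).1, H₁.inf]
    · intro v hv
      simp [h12 v hv]
    · intro v hv
      simp [h12 v hv]
    · intro v hv
      simp [hF₁.mem 5 rfl, hest v hv]
  · rintro i hi σ' t' hF hr hI
    have H' : Prepared I B h σ' := (H₁.congr (by simp) (by simp)).frame hF rfl rfl
    refine Cmd.wp_seq (wp_pickFarthest H' hT hI.le_inf) ?_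
    rintro σ₂ t₂ hF₂ ⟨g1, g2, g3, ht₂⟩
    have H₂ : Prepared I B h σ₂ := H'.frame hF₂ rfl rfl
    refine ⟨by simp, by simp, ?_⟩
    refine Cmd.wp_seq (wp_dijkstra (H₂.congr (by simp) (by simp)) rfl
      (I.mem_targets.1 g1).1) ?_
    rintro σ₃ t₃ hF₃ ⟨g4, ht₃⟩
    have H₃ : Prepared I B h σ₃ := (H₂.congr (by simp) (by simp)).frame hF₃ rfl rfl
    refine Cmd.wp_conseq (wp_absorb H₃) ?_
    rintro σ₄ t₄ hF₄ ⟨g5, g6, ht₄⟩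
    constructor
    · have e22 : σ₄.reg 22 = σ'.mem 12 (σ₂.reg 9) := by
        rw [hF₄.reg 22 rfl, hF₃.reg 22 rfl]
        simpa using g2
      have e13 : ∀ j, σ₄.mem 13 j = if j = i then σ₂.reg 9 else σ'.mem 13 j := by
        intro j
        rw [hF₄.mem 13 rfl, hF₃.mem 13 rfl]
        simp [Function.update_apply, hF₂.reg 19 rfl, hr, hF₂.mem 13 rfl]
      have e5 : σ₃.mem 5 = σ'.mem 5 := (hF₃.mem 5 rfl).trans (by simp [hF₂.mem 5 rfl])
      have e12 : σ₃.mem 12 = σ'.mem 12 := (hF₃.mem 12 rfl).trans (by simp [hF₂.mem 12 rfl])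
      simp only [State.setReg_mem, State.setReg_reg, Nat.reduceEqDiff, ↓reduceIte, e22]
      refine hI.step g1 e13 ?_ ?_ ?_
      · rw [← g2]
        exact g3
      · intro v hv
        rw [g5 v hv, g4 v hv, e5]
        simp
      · intro v hv
        rw [g6 v hv, g4 v hv, e12]
        simp
    · unfold dijkstraTime
      omega
  · intro σ' t' hF hI ht
    refine ⟨hI, ?_⟩
    rw [show dijkstraTime I h + I.n * 14 + 9 + 2 = dijkstraTime I h + I.n * 14 + 11 from rfl] at ht
    omega

end WordRAM

namespace WordRAM

open Ex (reg ld)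

/-- The test whether edge `reg 12` meets the ball of radius `reg 22 / 2`, when bank `10` holds the
distances from its center. -/
def meetsBallTest : Ex :=
  .lt (ld 10 (ld 0 (reg 12)) + ld 10 (ld 0 (reg 12))) (reg 22) +
    .lt (ld 10 (ld 1 (reg 12)) + ld 10 (ld 1 (reg 12))) (reg 22)

theorem meetsBallTest_spec {I : STInstance} {B h c e : ℕ} {σ : State} (H : Prepared I B h σ)
    (hD : ∀ v < I.n, σ.mem 10 v = I.capDist c v) (he : e < I.m) (hr : σ.reg 12 = e) :
    meetsBallTest.Fits B σ ∧ (meetsBallTest.eval σ ≠ 0 ↔ I.MeetsBall (σ.reg 22) c e) := by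
  have h1 : I.init.mem 0 e < I.n := by rw [I.init_src he]; exact Fin.is_lt _
  have h2 : I.init.mem 1 e < I.n := by rw [I.init_dst he]; exact Fin.is_lt _
  have h3 := I.capDist_le_inf c (I.init.mem 0 e)
  have h4 := I.capDist_le_inf c (I.init.mem 1 e)
  have h5 := H.inf_lt
  have h6 : ∀ p q : Prop, [Decidable p] → [Decidable q] →
      (if p then 1 else 0) + (if q then 1 else 0) ≤ 2 := by
    intro p q _ _
    split_ifs <;> omega
  have h7 := I.inf_pos
  constructor
  · simp only [meetsBallTest, Ex.fits_add, Ex.fits_lt, Ex.fits_ld, Ex.fits_reg, Ex.eval_ld,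
      Ex.eval_reg, hr, H.src, H.dst, hD _ h1, hD _ h2, true_and, and_true, Ex.eval_lt, Ex.eval_add]
    exact ⟨by omega, by omega, (h6 _ _).trans_lt (by omega)⟩
  · simp only [meetsBallTest, Ex.eval_ld, Ex.eval_reg, hr, H.src, H.dst, hD _ h1, hD _ h2,
      Ex.eval_lt, Ex.eval_add, STInstance.MeetsBall, two_mul]
    split_ifs <;> simp_all

/-- Count in register `24` the edges that meet the ball whose center is in register `9`. -/
def countBall : Cmd :=
  dijkstra ;;
  .set 24 0 ;;
  .forTo 12 1 (.ite meetsBallTest (.set 24 (reg 24 + 1)) .skip)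

theorem ballEdges_le (I : STInstance) (R c : ℕ) : I.ballEdges R c ≤ I.m := by
  classical
  exact (Finset.card_filter_le _ _).trans (by simp)

open Classical in
theorem card_meetsBall_succ (I : STInstance) (R c i : ℕ) :
    ((Finset.range (i + 1)).filter (I.MeetsBall R c)).card =
      ((Finset.range i).filter (I.MeetsBall R c)).card + if I.MeetsBall R c i then 1 else 0 := by
  rw [Finset.range_add_one, Finset.filter_insert]
  split_ifs with h
  · rw [Finset.card_insert_of_notMem (by simp)]
  · rfl

theorem wp_countBall {I : STInstance} {B h c R : ℕ} {σ : State} {t : ℕ} (H : Prepared I B h σ)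
    (h9 : σ.reg 9 = c) (hc : c < I.n) (h22 : σ.reg 22 = R) :
    countBall.wp B (fun σ' t' => σ'.reg 24 = I.ballEdges R c ∧
      t' ≤ t + (dijkstraTime I h + I.m * 4 + 3)) σ t := by
  classical
  refine Cmd.wp_seq (wp_dijkstra H h9 hc) ?_
  rintro σ₁ t₁ hF₁ ⟨hD, ht₁⟩
  have H₁ : Prepared I B h σ₁ := H.frame hF₁ rfl rfl
  refine ⟨by simp, Cmd.wp_forTo_le I.m 2 (fun i σ' => σ'.reg 24 =
    ((Finset.range i).filter (I.MeetsBall R c)).card) (by have := H.rounds_lt; omega)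
    (by simpa using H₁.m) rfl rfl rfl (by simp) ?_ ?_⟩
  · intro i hi σ' t' hF hr hI
    have H' : Prepared I B h σ' := (H₁.congr (by simp) (by simp)).frame hF rfl rfl
    have hD' : ∀ v < I.n, σ'.mem 10 v = I.capDist c v := by
      rw [hF.mem 10 rfl]
      exact hD
    have h22' : σ'.reg 22 = R := by
      rw [hF.reg 22 rfl]
      simpa [h22] using hF₁.reg 22 rfl
    obtain ⟨k1, k2⟩ := meetsBallTest_spec H' hD' hi hr
    rw [h22'] at k2
    have hle : ((Finset.range i).filter (I.MeetsBall R c)).card ≤ i :=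
      (Finset.card_filter_le _ _).trans (by simp)
    refine ⟨k1, fun hm => ⟨?_, ?_, by omega⟩, fun hm => ⟨?_, by omega⟩⟩
    · have := H.rounds_lt
      simp [hI]
      omega
    · simp [hI, card_meetsBall_succ, k2.1 hm]
    · have : ¬ I.MeetsBall R c i := fun hc => k2.2 hc hm
      simp [hI, card_meetsBall_succ, this]
  · intro σ' t' hF hI ht
    refine ⟨hI, ?_⟩
    unfold dijkstraTime
    omega

/-- Find in register `25` the center whose ball meets the fewest edges. -/
def bestCenter : Cmd :=
  .set 23 (reg 1 + 1) ;;
  .forTo 19 5 (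
    .set 9 (ld 13 (reg 19)) ;;
    countBall ;;
    .ite (.lt (reg 24) (reg 23)) (.set 23 (reg 24) ;; .set 25 (reg 9)) .skip)

theorem wp_bestCenter {I : STInstance} {B h q R : ℕ} {w : ℕ → ℕ} {σ : State} {t : ℕ}
    (H : Prepared I B h σ) (h5 : σ.reg 5 = q) (hq0 : 0 < q) (hq : q < B) (h22 : σ.reg 22 = R)
    (hw : σ.mem 13 = w) (hT : ∀ j < q, w j ∈ I.targets) :
    bestCenter.wp B (fun σ' t' => (∃ j < q, σ'.reg 25 = w j) ∧
      (∀ j < q, I.ballEdges R (σ'.reg 25) ≤ I.ballEdges R (w j)) ∧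
      t' ≤ t + (q * (dijkstraTime I h + I.m * 4 + 9) + 3)) σ t := by
  refine ⟨?_, Cmd.wp_forTo_le q (dijkstraTime I h + I.m * 4 + 7) (fun i σ' =>
    (∀ j < i, σ'.reg 23 ≤ I.ballEdges R (w j)) ∧
    ((i = 0 ∧ σ'.reg 23 = I.m + 1) ∨
      ∃ j < i, σ'.reg 25 = w j ∧ σ'.reg 23 = I.ballEdges R (w j))) hq
    (by simpa using h5) rfl rfl rfl ?_ ?_ ?_⟩
  · have := H.rounds_lt
    have := H.inf_lt
    have := I.inf_pos
    by_cases hm : I.n = 0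
    · obtain ⟨x, hx⟩ : I.targets.Nonempty := ⟨_, hT 0 hq0⟩
      have := (I.mem_targets.1 hx).1
      omega
    · simp [H.m]
      omega
  · simp [H.m]
  · rintro i hi σ' t' hF hr ⟨hI1, hI2⟩
    have H' : Prepared I B h σ' := (H.congr (by simp) (by simp)).frame hF rfl rfl
    have hw' : σ'.mem 13 = w := (hF.mem 13 rfl).trans (by simpa using hw)
    have h22' : σ'.reg 22 = R := (hF.reg 22 rfl).trans (by simpa using h22)
    refine ⟨by simp, ?_⟩
    refine Cmd.wp_seq (wp_countBall (c := w i) (R := R) (H'.congr (by simp) (by simp))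
      (by simp [hr, hw']) (I.mem_targets.1 (hT i hi)).1 (by simp [h22'])) ?_
    rintro σ₁ t₁ hF₁ ⟨g1, ht₁⟩
    have e23 : σ₁.reg 23 = σ'.reg 23 := (hF₁.reg 23 rfl).trans (by simp)
    have e25 : σ₁.reg 25 = σ'.reg 25 := (hF₁.reg 25 rfl).trans (by simp)
    have e9 : σ₁.reg 9 = w i := (hF₁.reg 9 rfl).trans (by simp [hr, hw'])
    refine ⟨by simp, fun hlt => ⟨by simp, by simp, ⟨?_, .inr ⟨i, by omega, ?_, ?_⟩⟩, by omega⟩,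
      fun hge => ⟨⟨?_, ?_⟩, by omega⟩⟩
    · intro j hj
      simp [g1, e23] at hlt ⊢
      rcases Nat.lt_succ_iff_lt_or_eq.1 hj with h1 | rfl
      · have := hI1 j h1
        omega
      · exact le_rfl
    · simp [e9]
    · simp [g1]
    · intro j hj
      simp [g1, e23] at hge ⊢
      rcases Nat.lt_succ_iff_lt_or_eq.1 hj with h1 | rfl
      · exact hI1 j h1
      · exact hge
    · simp [g1, e23] at hge
      right
      rcases hI2 with ⟨h1, h2⟩ | ⟨j, h1, h2, h3⟩
      · have := ballEdges_le I R (w i)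
        omega
      · exact ⟨j, by omega, by simp [e25, h2], by simp [e23, h3]⟩
  · rintro σ' t' hF ⟨hI1, hI2⟩ ht
    rcases hI2 with ⟨h1, h2⟩ | ⟨j, h1, h2, h3⟩
    · omega
    · refine ⟨⟨j, h1, h2⟩, fun i hi => ?_, ?_⟩
      · rw [h2, ← h3]
        exact hI1 i hi
      · rw [show dijkstraTime I h + I.m * 4 + 7 + 2 = dijkstraTime I h + I.m * 4 + 9 from rfl] at ht
        omega

/-- List in bank `15` the center in register `25` and the ends of the edges that meet its ball;
register `26` receives the length of the list. -/
def collect : Cmd :=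
  .set 9 (reg 25) ;;
  dijkstra ;;
  .st 15 0 (reg 25) ;;
  .set 26 1 ;;
  .forTo 12 1 (.ite meetsBallTest
    (.st 15 (reg 26) (ld 0 (reg 12)) ;;
      .st 15 (reg 26 + 1) (ld 1 (reg 12)) ;;
      .set 26 (reg 26 + 2)) .skip)

theorem wp_collect {I : STInstance} {B h c R : ℕ} {σ : State} {t : ℕ} (H : Prepared I B h σ)
    (h25 : σ.reg 25 = c) (hc : c < I.n) (h22 : σ.reg 22 = R) :
    collect.wp B (fun σ' t' => σ'.reg 26 = 1 + 2 * I.ballEdges R c ∧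
      (∀ j < σ'.reg 26, σ'.mem 15 j < I.n) ∧
      (∀ x, I.NearBall R c x → ∃ j < σ'.reg 26, σ'.mem 15 j = x) ∧
      t' ≤ t + (dijkstraTime I h + I.m * 6 + 5)) σ t := by
  classical
  refine ⟨by simp, Cmd.wp_seq (wp_dijkstra (s := c) (H.congr (by simp) (by simp)) (by simp [h25])
    hc) ?_⟩
  rintro σ₁ t₁ hF₁ ⟨hD, ht₁⟩
  have H₁ : Prepared I B h σ₁ := (H.congr (by simp) (by simp)).frame hF₁ rfl rfl
  have h25₁ : σ₁.reg 25 = c := (hF₁.reg 25 rfl).trans (by simp [h25])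
  have h22₁ : σ₁.reg 22 = R := (hF₁.reg 22 rfl).trans (by simp [h22])
  have hcard : ∀ i, ((Finset.range i).filter (I.MeetsBall R c)).card ≤ i := fun i =>
    (Finset.card_filter_le _ _).trans (by simp)
  refine ⟨by simp, by simp, by simp, Cmd.wp_forTo_le I.m 4 (fun i σ' =>
    σ'.reg 26 = 1 + 2 * ((Finset.range i).filter (I.MeetsBall R c)).card ∧
      (∀ j < σ'.reg 26, σ'.mem 15 j < I.n) ∧
      (∃ j < σ'.reg 26, σ'.mem 15 j = c) ∧
      ∀ e < i, I.MeetsBall R c e → ∀ x, x = I.init.mem 0 e ∨ x = I.init.mem 1 e →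
        ∃ j < σ'.reg 26, σ'.mem 15 j = x) (by have := H.rounds_lt; omega)
    (by simpa using H₁.m) rfl rfl rfl ?_ ?_ ?_⟩
  · simp [h25₁, hc]
  · rintro i hi σ' t' hF hr ⟨hI1, hI2, hI3, hI4⟩
    have H' : Prepared I B h σ' := (H₁.congr (by simp) (by simp)).frame hF rfl rfl
    have hD' : ∀ v < I.n, σ'.mem 10 v = I.capDist c v := by
      rw [hF.mem 10 rfl]
      simpa using hD
    have h22' : σ'.reg 22 = R := (hF.reg 22 rfl).trans (by simpa using h22₁)
    obtain ⟨k1, k2⟩ := meetsBallTest_spec H' hD' hi hr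
    rw [h22'] at k2
    have hB : 2 * i + 3 < B := by
      have := H.rounds_lt
      omega
    have h1 : I.init.mem 0 i < I.n := by rw [I.init_src hi]; exact Fin.is_lt _
    have h2 : I.init.mem 1 i < I.n := by rw [I.init_dst hi]; exact Fin.is_lt _
    have hci := hcard i
    refine ⟨k1, fun hm => ⟨by simp, by simp, by simp [hI1]; omega, by simp,
      by simp [hI1]; omega, ?_,
      by omega⟩, fun hm => ⟨?_, by omega⟩⟩
    · have hM := k2.1 hm
      set L := σ'.reg 26 with hL
      -- the new list
      have hnew : ∀ j, (Function.update (Function.update (σ'.mem 15) L (I.init.mem 0 i)) (L + 1)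
          (I.init.mem 1 i)) j = if j = L + 1 then I.init.mem 1 i else if j = L then I.init.mem 0 i
            else σ'.mem 15 j := by
        intro j
        simp [Function.update_apply]
      simp [← hL, hr, H'.src, H'.dst, hnew]
      refine ⟨?_, ?_, ?_, ?_⟩
      · rw [card_meetsBall_succ, if_pos hM, hI1]
        ring
      · intro j hj
        split_ifs with g1 g2
        · exact h2
        · exact h1
        · exact hI2 j (by omega)
      · obtain ⟨j, hj, hj'⟩ := hI3
        exact ⟨j, by omega, by rw [if_neg (by omega), if_neg (by omega), hj']⟩
      · intro e he hMe
        rcases he.lt_or_eq with h3 | rfl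
        · constructor
          · obtain ⟨j, hj, hj'⟩ := hI4 e h3 hMe _ (.inl rfl)
            exact ⟨j, by omega, by rw [if_neg (by omega), if_neg (by omega), hj']⟩
          · obtain ⟨j, hj, hj'⟩ := hI4 e h3 hMe _ (.inr rfl)
            exact ⟨j, by omega, by rw [if_neg (by omega), if_neg (by omega), hj']⟩
        · exact ⟨⟨L, by omega, by simp⟩, ⟨L + 1, by omega, by simp⟩⟩
    · have hM : ¬ I.MeetsBall R c i := fun hc => k2.2 hc hm
      refine ⟨?_, hI2, hI3, ?_⟩
      · rw [card_meetsBall_succ, if_neg hM]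
        exact hI1
      · intro e he hMe x hx
        rcases Nat.lt_succ_iff_lt_or_eq.1 he with h3 | rfl
        · exact hI4 e h3 hMe x hx
        · exact absurd hMe hM
  · rintro σ' t' hF ⟨hI1, hI2, hI3, hI4⟩ ht
    refine ⟨hI1, hI2, ?_, ?_⟩
    · rintro x (rfl | ⟨e, he, hM, hx⟩)
      · exact hI3
      · exact hI4 e he hM x hx
    · unfold dijkstraTime
      omega

/-- Raise the estimates in bank `5` by means of the eccentricities of the vertices listed in bank
`15` and the distances from them. -/
def improve : Cmd :=
  .forTo 19 26 (
    .set 9 (ld 15 (reg 19)) ;;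
    dijkstra ;;
    .set 27 0 ;;
    .forTo 12 0 (.ite (ld 4 (reg 12))
      (.ite (.lt (reg 27) (ld 10 (reg 12))) (.set 27 (ld 10 (reg 12))) .skip) .skip) ;;
    .forTo 12 0 (.ite (.lt (ld 5 (reg 12)) (reg 27 - ld 10 (reg 12)))
      (.st 5 (reg 12) (reg 27 - ld 10 (reg 12))) .skip))

theorem wp_improve {I : STInstance} {B h L : ℕ} {src : ℕ → ℕ} {σ : State} {t : ℕ}
    (H : Prepared I B h σ) (h26 : σ.reg 26 = L) (hL : L < B) (hsrc : σ.mem 15 = src)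
    (hlt : ∀ j < L, src j < I.n) (hle : ∀ v < I.n, σ.mem 5 v ≤ I.capEcc v) :
    improve.wp B (fun σ' t' => (∀ v < I.n, σ.mem 5 v ≤ σ'.mem 5 v ∧ σ'.mem 5 v ≤ I.capEcc v ∧
      ∀ j < L, I.capEcc (src j) - I.capDist (src j) v ≤ σ'.mem 5 v) ∧
      t' ≤ t + (L * (dijkstraTime I h + I.n * 9 + 8) + 2)) σ t := by
  have hn : I.n < B := by have := H.rounds_lt; omega
  refine Cmd.wp_forTo_le L (dijkstraTime I h + I.n * 9 + 6) (fun i σ' =>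
    ∀ v < I.n, σ.mem 5 v ≤ σ'.mem 5 v ∧ σ'.mem 5 v ≤ I.capEcc v ∧
      ∀ j < i, I.capEcc (src j) - I.capDist (src j) v ≤ σ'.mem 5 v) hL h26 rfl rfl rfl ?_ ?_ ?_
  · intro v hv
    exact ⟨le_rfl, hle v hv, by simp⟩
  · intro i hi σ' t' hF hr hI
    have H' : Prepared I B h σ' := H.frame hF rfl rfl
    have hsrc' : σ'.mem 15 = src := (hF.mem 15 rfl).trans hsrc
    refine ⟨by simp, Cmd.wp_seq (wp_dijkstra (s := src i) (H'.congr (by simp) (by simp))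
      (by simp [hr, hsrc']) (hlt i hi)) ?_⟩
    rintro σ₁ t₁ hF₁ ⟨hD, ht₁⟩
    have H₁ : Prepared I B h σ₁ := (H'.congr (by simp) (by simp)).frame hF₁ rfl rfl
    have m5₁ : σ₁.mem 5 = σ'.mem 5 := (hF₁.mem 5 rfl).trans (by simp)
    refine ⟨by simp, ?_⟩
    refine Cmd.wp_seq (P := fun σ'' t'' => σ''.reg 27 = I.capEcc (src i) ∧
      t'' ≤ t₁ + (I.n * 5 + 3)) (Cmd.wp_forTo_le I.n 3 (fun i' σ'' =>
      (∀ x ∈ I.targets, x < i' → I.capDist (src i) x ≤ σ''.reg 27) ∧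
      (σ''.reg 27 ≤ I.capEcc (src i))) hn (by simpa using H₁.n) rfl rfl rfl (by simp) ?_ ?_) ?_
    · rintro x hx σ'' t'' hF'' hr'' ⟨g1, g2⟩
      have m4 : σ''.mem 4 = I.init.mem 4 := (hF''.mem 4 rfl).trans (by simpa using H₁.inT)
      have m10 : σ''.mem 10 x = I.capDist (src i) x := by
        rw [hF''.mem 10 rfl]
        simpa using hD x hx
      refine ⟨by simp, fun hT => ⟨by simp, fun hlt => ⟨by simp, ⟨?_, ?_⟩, by omega⟩,
        fun hge => ⟨⟨?_, ?_⟩, by omega⟩⟩, fun hT => ⟨⟨?_, ?_⟩, by omega⟩⟩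
      · intro y hy hyx
        simp [hr'', m10] at hlt ⊢
        rcases Nat.lt_succ_iff_lt_or_eq.1 hyx with h3 | rfl
        · exact (g1 y hy h3).trans hlt.le
        · exact le_rfl
      · simp [hr'', m4, m10] at hT ⊢
        exact I.capDist_le_capEcc (I.mem_targets.2 ⟨hx, hT⟩)
      · intro y hy hyx
        simp [hr'', m10] at hge ⊢
        rcases Nat.lt_succ_iff_lt_or_eq.1 hyx with h3 | rfl
        · exact g1 y hy h3
        · exact hge
      · simpa using g2
      · intro y hy hyx
        simp [hr'', m4] at hT ⊢
        rcases Nat.lt_succ_iff_lt_or_eq.1 hyx with h3 | rfl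
        · exact g1 y hy h3
        · exact absurd hT (I.mem_targets.1 hy).2
      · simpa using g2
    · rintro σ'' t'' hF'' ⟨g1, g2⟩ ht''
      refine ⟨le_antisymm g2 (Finset.sup_le fun x hx => ?_), by omega⟩
      exact g1 x hx (I.mem_targets.1 hx).1
    rintro σ₂ t₂ hF₂ ⟨h27, ht₂⟩
    have m5₂ : σ₂.mem 5 = σ'.mem 5 := (hF₂.mem 5 rfl).trans (by simpa using m5₁)
    have m10₂ : ∀ v < I.n, σ₂.mem 10 v = I.capDist (src i) v := by
      rw [hF₂.mem 10 rfl]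
      simpa using hD
    refine Cmd.wp_conseq (Cmd.wp_forTo_map I.n 2 5 (fun v => max (σ'.mem 5 v)
      (I.capEcc (src i) - I.capDist (src i) v)) hn ?_ rfl rfl rfl ?_) ?_
    · exact (hF₂.reg 0 rfl).trans (by simpa using H₁.n)
    · intro x hx σ'' t'' hF'' hr'' hold
      have m10 : σ''.mem 10 x = I.capDist (src i) x := by
        rw [hF''.mem 10 rfl, m10₂ x hx]
      have r27 : σ''.reg 27 = I.capEcc (src i) := (hF''.reg 27 rfl).trans h27
      rw [m5₂] at hold
      refine ⟨by simp, fun hlt => ⟨by simp, by simp, ?_, by omega⟩, fun hge => ⟨?_, by omega⟩⟩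
      · simp [hr'', m10, hold, r27] at hlt
        intro v
        have hlt' : σ'.mem 5 x ≤ I.capEcc (src i) - I.capDist (src i) x := by omega
        simp [hr'', m10, r27, Function.update_apply, max_eq_right hlt']
      · simp [hr'', m10, hold, r27] at hge
        intro v
        split_ifs with hv
        · rw [hv, hold, max_eq_left (by omega)]
        · rfl
    · rintro σ₃ t₃ hF₃ ⟨h5, ht₃⟩
      refine ⟨fun v hv => ?_, ?_⟩
      · obtain ⟨k1, k2, k3⟩ := hI v hv
        rw [State.setReg_mem, h5, if_pos hv]
        refine ⟨k1.trans (le_max_left _ _), max_le k2 (I.capEcc_sub_le _ _), fun j hj => ?_⟩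
        rcases Nat.lt_succ_iff_lt_or_eq.1 hj with h3 | rfl
        · exact (k3 j h3).trans (le_max_left _ _)
        · exact le_max_right _ _
      · unfold dijkstraTime
        omega
  · intro σ' t' hF hI ht
    refine ⟨hI, ?_⟩
    rw [show dijkstraTime I h + I.n * 9 + 6 + 2 = dijkstraTime I h + I.n * 9 + 8 from rfl] at ht
    omega

end WordRAM

namespace WordRAM

open Ex (reg ld)

/-- Set register `5` to the number of centers, about the square root of `n + m + 1`. -/
def chooseNumber : Cmd :=
  .set 17 (reg 0 + reg 1 + 1) ;;
  .set 5 2 ;;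
  .forTo 12 17 (.ite (.lt (reg 5 * reg 5) (reg 17)) (.set 5 (reg 5 + 1)) .skip)

theorem wp_chooseNumber {I : STInstance} {B h : ℕ} {σ : State} {t : ℕ} (H : Prepared I B h σ)
    (hB : 4 * (I.n + I.m + 1) + 8 < B) :
    chooseNumber.wp B (fun σ' t' => ∃ q, σ'.reg 5 = q ∧ 2 ≤ q ∧ I.n + I.m + 1 ≤ q * q ∧
      q * q ≤ 4 * (I.n + I.m + 1) ∧ t' ≤ t + (4 * (I.n + I.m + 1) + 4)) σ t := by
  refine ⟨by simp [H.n, H.m]; omega, by simp, ?_⟩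
  refine Cmd.wp_forTo_le (I.n + I.m + 1) 2 (fun i σ' => 2 ≤ σ'.reg 5 ∧
    (i ≤ σ'.reg 5 * σ'.reg 5 ∨ I.n + I.m + 1 ≤ σ'.reg 5 * σ'.reg 5) ∧
    (σ'.reg 5 = 2 ∨ (σ'.reg 5 - 1) * (σ'.reg 5 - 1) < I.n + I.m + 1)) (by omega)
    (by simp [H.n, H.m]) rfl rfl rfl (by simp) ?_ ?_
  · rintro i hi σ' t' hF hr ⟨h1, h2, h3⟩
    have r17 : σ'.reg 17 = I.n + I.m + 1 := (hF.reg 17 rfl).trans (by simp [H.n, H.m])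
    have hq : σ'.reg 5 * σ'.reg 5 ≤ 4 * (I.n + I.m + 1) := by
      rcases h3 with h3 | h3
      · rw [h3]; omega
      · obtain ⟨q, hq⟩ := Nat.exists_eq_add_of_le h1
        rw [hq] at h3 ⊢
        rw [show 2 + q - 1 = q + 1 by omega] at h3
        nlinarith
    have hq' : σ'.reg 5 ≤ σ'.reg 5 * σ'.reg 5 := Nat.le_mul_self _
    refine ⟨by simp; omega, fun hlt => ⟨by simp; omega, ⟨?_, ?_, ?_⟩, by omega⟩,
      fun hge => ⟨⟨?_, ?_, ?_⟩, by omega⟩⟩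
    · simp; omega
    · simp
      left
      rcases h2 with h2 | h2
      · nlinarith
      · nlinarith
    · simp [r17] at hlt ⊢
      omega
    · simpa using h1
    · simp [r17] at hge ⊢
      omega
    · simpa using h3
  · rintro σ' t' hF ⟨h1, h2, h3⟩ ht
    refine ⟨_, rfl, h1, by omega, ?_, ?_⟩
    · rcases h3 with h3 | h3
      · rw [h3]; omega
      · obtain ⟨q, hq⟩ := Nat.exists_eq_add_of_le h1
        rw [hq] at h3 ⊢
        rw [show 2 + q - 1 = q + 1 by omega] at h3
        nlinarith
    · omega

/-- Write the denominators of the finite estimates. -/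
def output : Cmd :=
  .forTo 12 0 (.ite (.lt (ld 5 (reg 12)) (reg 2)) (.st 6 (reg 12) 1) .skip)

theorem wp_output {I : STInstance} {B h : ℕ} {σ : State} {t : ℕ} (H : Prepared I B h σ)
    (h6 : ∀ v < I.n, σ.mem 6 v = 0) :
    output.wp B (fun σ' t' => (∀ v < I.n, σ'.mem 6 v = if σ.mem 5 v < I.inf then 1 else 0) ∧
      t' ≤ t + (I.n * 4 + 2)) σ t := by
  refine Cmd.wp_mono _ ?_ (Cmd.wp_forTo_map I.n 2 6 (fun v => if σ.mem 5 v < I.inf then 1 else 0)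
    (by have := H.rounds_lt; omega) H.n rfl rfl rfl ?_)
  · rintro σ' t' ⟨h1, h2⟩
    exact ⟨fun v hv => by rw [h1, if_pos hv], by omega⟩
  · intro i hi σ' t' hF hr hold
    have m5 : σ'.mem 5 = σ.mem 5 := hF.mem 5 rfl
    have r2 : σ'.reg 2 = I.inf := (hF.reg 2 rfl).trans H.inf
    refine ⟨by simp, fun hlt => ⟨by simp, by simp, ?_, by omega⟩, fun hge => ⟨?_, by omega⟩⟩
    · simp [hr, m5, r2] at hlt
      intro v
      simp [hr, Function.update_apply, hlt]
    · simp [hr, m5, r2] at hge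
      intro v
      split_ifs with hv h0
      · omega
      · rw [hv, hold, h6 i hi]
      · rfl

/-- The approximation algorithm; nothing is to be done if `T` is empty. -/
def approxEcc : Cmd :=
  prepare ;;
  chooseNumber ;;
  .forTo 12 0 (.ite (ld 4 (reg 12)) (.set 18 1) .skip) ;;
  .ite (reg 18) (greedy ;; bestCenter ;; collect ;; improve ;; output) .skip

theorem le_four_mul_add_one {q b m L : ℕ} (hq : 2 ≤ q) (hb : q * b ≤ 2 * m) (hm : m ≤ q * q)
    (hL : L ≤ 2 * b + 1) : L ≤ 4 * q + 1 := by
  have h2 : q * b ≤ q * (2 * q) := hb.trans (by nlinarith)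
  have h3 := Nat.le_of_mul_le_mul_left h2 (by omega)
  omega

theorem dijkstraTime_le (I : STInstance) {h : ℕ} (hh : 2 ^ h ≤ 2 * I.n + 1) :
    dijkstraTime I h ≤ 75 * ((I.n + I.m + 1) * (h + 1)) := by
  unfold dijkstraTime
  generalize 2 ^ h = P at *
  have h1 : (2 * I.m + I.n) * (h * 10 + 16) ≤ 32 * ((I.n + I.m + 1) * (h + 1)) := by
    calc (2 * I.m + I.n) * (h * 10 + 16) ≤ (2 * (I.n + I.m + 1)) * (16 * (h + 1)) :=
          Nat.mul_le_mul (by omega) (by omega)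
      _ = _ := by ring
  have h2 : h + 1 ≤ (I.n + I.m + 1) * (h + 1) := Nat.le_mul_of_pos_left _ (by omega)
  have h3 : I.n + I.m + 1 ≤ (I.n + I.m + 1) * (h + 1) := Nat.le_mul_of_pos_right _ (by omega)
  omega

/-- The number of elementary commands of the approximation algorithm: `q` shortest path
computations for the greedy choice, `q` for the choice of the best center and `L` for its ball. -/
theorem main_branch_time (I : STInstance) (h : ℕ) {q L t₃ t₄ t₅ t₆ t₇ t₈ : ℕ}
    (hh : 2 ^ h ≤ 2 * I.n + 1) (hL : L ≤ 4 * q + 1)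
    (h₃ : t₃ ≤ 28 * I.m + 13 * I.n + 40)
    (h₄ : t₄ ≤ t₃ + 1 + (q * (dijkstraTime I h + I.n * 14 + 11) + I.n * 3 + 5))
    (h₅ : t₅ ≤ t₄ + (q * (dijkstraTime I h + I.m * 4 + 9) + 3))
    (h₆ : t₆ ≤ t₅ + (dijkstraTime I h + I.m * 6 + 5))
    (h₇ : t₇ ≤ t₆ + (L * (dijkstraTime I h + I.n * 9 + 8) + 2))
    (h₈ : t₈ ≤ t₇ + (I.n * 4 + 2)) :
    t₈ ≤ 1000 * ((q + 1) * ((I.n + I.m + 1) * (h + 1))) := by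
  have hD := dijkstraTime_le I hh
  have hA : I.n + I.m + 1 ≤ (I.n + I.m + 1) * (h + 1) := Nat.le_mul_of_pos_right _ (by omega)
  generalize (I.n + I.m + 1) * (h + 1) = A at *
  generalize dijkstraTime I h = D at *
  have e1 : q * (D + I.n * 14 + 11) ≤ q * (90 * A) := Nat.mul_le_mul_left _ (by omega)
  have e2 : q * (D + I.m * 4 + 9) ≤ q * (90 * A) := Nat.mul_le_mul_left _ (by omega)
  have e3 : L * (D + I.n * 9 + 8) ≤ (4 * q + 1) * (90 * A) := Nat.mul_le_mul hL (by omega)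
  have e5 : q * (90 * A) = 90 * (q * A) := by ring
  have e6 : (4 * q + 1) * (90 * A) = 360 * (q * A) + 90 * A := by ring
  rw [e5] at e1 e2
  rw [e6] at e3
  rw [add_one_mul]
  omega

theorem wp_approxEcc {I : STInstance} {B : ℕ}
    (hB : 2 * I.inf + 6 * I.n + 4 * I.m + I.maxWeight + 20 < B) :
    approxEcc.wp B (fun σ' t' => I.IsApprox 2 σ' ∧ ∃ h q, 2 ^ h ≤ 2 * I.n + 1 ∧
      q * q ≤ 4 * (I.n + I.m + 1) ∧
      t' ≤ 1000 * ((q + 1) * ((I.n + I.m + 1) * (h + 1)))) I.init 0 := by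
  refine Cmd.wp_seq (wp_prepare (by omega)) ?_
  rintro σ₁ t₁ hF₁ ⟨⟨h, H₁, hh⟩, ht₁⟩
  refine Cmd.wp_seq (wp_chooseNumber H₁ (by have := H₁.rounds_lt; omega)) ?_
  rintro σ₂ t₂ hF₂ ⟨q, h5, hq2, hqN, hq4, ht₂⟩
  have H₂ : Prepared I B h σ₂ := H₁.frame hF₂ rfl rfl
  have hn : I.n < B := by have := H₁.rounds_lt; omega
  have hqB : q < B := by
    have := Nat.le_mul_self q
    omega
  have hzero : ∀ k ∈ [5, 6], ∀ v, σ₂.mem k v = 0 := by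
    intro k hk v
    simp only [List.mem_cons, List.not_mem_nil, or_false] at hk
    rcases hk with rfl | rfl
    · rw [hF₂.mem 5 rfl, hF₁.mem 5 rfl]; rfl
    · rw [hF₂.mem 6 rfl, hF₁.mem 6 rfl]; rfl
  have h18 : σ₂.reg 18 = 0 := by rw [hF₂.reg 18 rfl, hF₁.reg 18 rfl]; rfl
  refine Cmd.wp_seq (P := fun σ' t' => (σ'.reg 18 ≠ 0 ↔ I.targets.Nonempty) ∧
    t' ≤ t₂ + (I.n * 4 + 2)) (Cmd.wp_forTo_le I.n 2 (fun i σ' => σ'.reg 18 ≠ 0 ↔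
      ∃ t ∈ I.targets, t < i) hn H₂.n rfl rfl rfl (by simp [h18]) ?_ ?_) ?_
  · rintro i hi σ' t' hF hr hI
    have m4 : σ'.mem 4 = I.init.mem 4 := (hF.mem 4 rfl).trans (by simpa using H₂.inT)
    refine ⟨by simp, fun hT => ⟨by simp, ?_, by omega⟩, fun hT => ⟨?_, by omega⟩⟩
    · simp [hr, m4] at hT ⊢
      exact ⟨i, I.mem_targets.2 ⟨hi, hT⟩, le_rfl⟩
    · simp [hr, m4] at hT
      simp only [State.setReg_reg, Nat.reduceEqDiff, ↓reduceIte, hI]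
      constructor
      · rintro ⟨t, h1, h2⟩
        exact ⟨t, h1, by omega⟩
      · rintro ⟨t, h1, h2⟩
        rcases Nat.lt_succ_iff_lt_or_eq.1 h2 with h3 | rfl
        · exact ⟨t, h1, h3⟩
        · exact absurd hT (I.mem_targets.1 h1).2
  · rintro σ' t' hF hI ht
    refine ⟨hI.trans ⟨fun ⟨t, h1, _⟩ => ⟨t, h1⟩, fun ⟨t, h1⟩ => ⟨t, h1, (I.mem_targets.1 h1).1⟩⟩,
      by omega⟩
  rintro σ₃ t₃ hF₃ ⟨hne, ht₃⟩
  have H₃ : Prepared I B h σ₃ := H₂.frame hF₃ rfl rfl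
  have h5₃ : σ₃.reg 5 = q := (hF₃.reg 5 rfl).trans h5
  have m5 : ∀ v, σ₃.mem 5 v = 0 := by rw [hF₃.mem 5 rfl]; exact hzero 5 (by simp)
  have m6 : ∀ v, σ₃.mem 6 v = 0 := by rw [hF₃.mem 6 rfl]; exact hzero 6 (by simp)
  set N := I.n + I.m + 1 with hN
  have hA : N ≤ N * (h + 1) := Nat.le_mul_of_pos_right _ (by omega)
  have hA' : N * (h + 1) ≤ (q + 1) * (N * (h + 1)) := Nat.le_mul_of_pos_left _ (by omega)
  refine ⟨by simp, fun hT => ?_, fun hT => ⟨?_, h, q, hh, hq4, ?_⟩⟩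
  · have hT' := hne.1 hT
    refine Cmd.wp_seq (wp_greedy (H₃.congr (by simp) (by simp)) hT' hqB h5₃ fun v _ => m5 v) ?_
    rintro σ₄ t₄ hF₄ ⟨hG, ht₄⟩
    have H₄ : Prepared I B h σ₄ := H₃.frame hF₄ rfl rfl
    have hg := hG.isGreedy
    refine Cmd.wp_seq (wp_bestCenter H₄ ((hF₄.reg 5 rfl).trans h5₃) (by omega) hqB rfl rfl
      hG.mem) ?_
    rintro σ₅ t₅ hF₅ ⟨hc, hmin, ht₅⟩
    have H₅ : Prepared I B h σ₅ := H₄.frame hF₅ rfl rfl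
    have hcn : σ₅.reg 25 < I.n := by
      obtain ⟨j, hj, h'⟩ := hc
      rw [h']
      exact (I.mem_targets.1 (hG.mem j hj)).1
    refine Cmd.wp_seq (wp_collect H₅ rfl hcn (hF₅.reg 22 rfl)) ?_
    rintro σ₆ t₆ hF₆ ⟨h26, hlt, hnear, ht₆⟩
    have H₆ : Prepared I B h σ₆ := H₅.frame hF₆ rfl rfl
    have hbe := ballEdges_le I (σ₄.reg 22) (σ₅.reg 25)
    have m56 : σ₆.mem 5 = σ₄.mem 5 := (hF₆.mem 5 rfl).trans (hF₅.mem 5 rfl)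
    refine Cmd.wp_seq (wp_improve H₆ rfl (by have := H₁.rounds_lt; omega) rfl hlt ?_) ?_
    · rw [m56]
      exact hG.le_ecc
    rintro σ₇ t₇ hF₇ ⟨hest, ht₇⟩
    have H₇ : Prepared I B h σ₇ := H₆.frame hF₇ rfl rfl
    have m67 : ∀ v, σ₇.mem 6 v = 0 := by
      rw [hF₇.mem 6 rfl, hF₆.mem 6 rfl, hF₅.mem 6 rfl, hF₄.mem 6 rfl]
      exact m6
    refine Cmd.wp_conseq (wp_output H₇ fun v _ => m67 v) ?_
    rintro σ₈ t₈ hF₈ ⟨h6, ht₈⟩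
    refine ⟨STInstance.isApprox_two_of_capEcc fun v hv => ?_, h, q, hh, hq4, ?_⟩
    · rw [hF₈.mem 5 rfl]
      obtain ⟨k1, k2, k3⟩ := hest v hv
      rw [m56] at k1
      have := hg.approx (c := σ₅.reg 25) (est := σ₇.mem 5 v) hq2 hc hv
        (fun i hi => (hG.dist_le v hv i hi).trans k1) (fun x hx => by
          obtain ⟨j, hj, rfl⟩ := hnear x hx
          exact k3 j hj)
      exact ⟨k2, this.1, this.2, .inr (h6 v hv)⟩
    · have hs : σ₆.reg 26 ≤ 4 * q + 1 := by
        have h1 := hg.mul_le (b := I.ballEdges (σ₄.reg 22) (σ₅.reg 25)) hmin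
        exact le_trans (by omega) (le_four_mul_add_one (b := I.ballEdges (σ₄.reg 22) (σ₅.reg 25))
          hq2 h1 (by omega) le_rfl)
      exact main_branch_time I h hh hs (by clear_value N; omega) ht₄ ht₅ ht₆ ht₇ ht₈
  · refine STInstance.isApprox_two_of_capEcc fun v hv => ?_
    have h0 : I.capEcc v = 0 := by
      have : ¬ I.targets.Nonempty := fun h => (hne.2 h) hT
      rw [Finset.not_nonempty_iff_eq_empty] at this
      simp [STInstance.capEcc, this]
    have := I.inf_pos
    exact ⟨by simp [m5], by simp [h0], by omega, .inl (m5 v)⟩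
  · omega

/-- A bound for the number of steps of the approximation algorithm in terms of `N = n + m + 1`. -/
theorem approxEcc_time {n m h q t : ℕ} (hh : 2 ^ h ≤ 2 * n + 1)
    (hq : q * q ≤ 4 * (n + m + 1)) (ht : t ≤ 1000 * ((q + 1) * ((n + m + 1) * (h + 1)))) :
    (t : ℝ) ≤ 9000 / Real.log 2 * ((n + m + 1 : ℕ) : ℝ) ^ (3 / 2 : ℝ) *
      Real.log (n + m + 2) ^ 1 := by
  have hN : (1 : ℝ) ≤ ((n + m + 1 : ℕ) : ℝ) := by exact_mod_cast Nat.le_add_left 1 (n + m)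
  set N : ℝ := ((n + m + 1 : ℕ) : ℝ) with hNdef
  have hlog2 : 0 < Real.log 2 := Real.log_pos (by norm_num)
  have e0 : Real.log (n + m + 2) = Real.log (N + 1) := by
    congr 1
    rw [hNdef]; push_cast; ring
  have e1 : (q : ℝ) + 1 ≤ 3 * N ^ (1 / 2 : ℝ) := by
    have h1 : (q : ℝ) * q ≤ 4 * N := by rw [hNdef]; exact_mod_cast hq
    have h2 : (1 : ℝ) ≤ N ^ (1 / 2 : ℝ) := Real.one_le_rpow hN (by norm_num)
    have h3 : N ^ (1 / 2 : ℝ) * N ^ (1 / 2 : ℝ) = N := by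
      rw [← Real.rpow_add (by linarith)]; norm_num
    nlinarith [q.cast_nonneg (α := ℝ)]
  have e2 : (h : ℝ) * Real.log 2 + Real.log 2 ≤ 3 * Real.log (N + 1) := by
    have h1 : ((2 : ℝ) ^ h) ≤ (N + 1) ^ 2 := by
      have : (2 ^ h : ℝ) ≤ 2 * n + 1 := by exact_mod_cast hh
      have h2 : (n : ℝ) + 1 ≤ N := by
        rw [hNdef]; push_cast; linarith [m.cast_nonneg (α := ℝ)]
      nlinarith
    have h2 := Real.log_le_log (by positivity) h1
    rw [Real.log_pow, Real.log_pow] at h2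
    have h3 : Real.log 2 ≤ Real.log (N + 1) := Real.log_le_log (by norm_num) (by linarith)
    push_cast at h2
    linarith
  have e3 : N ^ (3 / 2 : ℝ) = N ^ (1 / 2 : ℝ) * N := by
    rw [show (3 / 2 : ℝ) = 1 / 2 + 1 by norm_num, Real.rpow_add (by linarith), Real.rpow_one]
  have e4 : (h : ℝ) + 1 ≤ 3 * Real.log (N + 1) / Real.log 2 := by
    rw [le_div_iff₀ hlog2]
    linarith
  have hx : 0 ≤ N ^ (1 / 2 : ℝ) := by positivity
  have hl : 0 ≤ Real.log (N + 1) := Real.log_nonneg (by linarith)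
  calc (t : ℝ) ≤ 1000 * (((q : ℝ) + 1) * (N * ((h : ℝ) + 1))) := by
        rw [hNdef]; exact_mod_cast ht
    _ ≤ 1000 * ((3 * N ^ (1 / 2 : ℝ)) * (N * (3 * Real.log (N + 1) / Real.log 2))) := by
        gcongr
    _ = 9000 / Real.log 2 * (N ^ (1 / 2 : ℝ) * N) * Real.log (N + 1) := by ring
    _ = _ := by rw [e0, e3, pow_one]

theorem bounded_init {I : STInstance} {B : ℕ} (hB : I.n + I.m + I.maxWeight + 1 < B) :
    I.init.Bounded B := by
  constructor
  · intro r
    match r with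
    | 0 => simp [STInstance.init]; omega
    | 1 => simp [STInstance.init]; omega
    | r + 2 => simp [STInstance.init]; omega
  · intro k a
    match k with
    | 0 =>
      by_cases h : a < I.m
      · rw [I.init_src h]; have := (I.src ⟨a, h⟩).2; omega
      · simp [STInstance.init, h]; omega
    | 1 =>
      by_cases h : a < I.m
      · rw [I.init_dst h]; have := (I.dst ⟨a, h⟩).2; omega
      · simp [STInstance.init, h]; omega
    | 2 =>
      by_cases h : a < I.m
      · rw [I.init_weight h]
        have := Finset.le_sup (f := I.edgeWeight) (Finset.mem_univ ⟨a, h⟩)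
        have h2 : Finset.univ.sup I.edgeWeight = I.maxWeight := rfl
        omega
      · simp [STInstance.init, h]; omega
    | 3 => simp only [STInstance.init]; split_ifs <;> omega
    | 4 => simp only [STInstance.init]; split_ifs <;> omega
    | k + 5 => simp [STInstance.init]; omega

theorem pow_le_two_pow_wordLength (I : STInstance) (c : ℕ) :
    (I.n + I.m + I.maxWeight + 2) ^ c ≤ 2 ^ I.wordLength c := by
  rw [STInstance.wordLength, mul_comm, pow_mul]
  exact Nat.pow_le_pow_left (Nat.lt_size_self _) c

instance : MeasureTheory.IsProbabilityMeasure coinLaw := by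
  unfold coinLaw
  infer_instance

end WordRAM

open WordRAM in
theorem exists_approximation (a : ℕ) :
    ∃ (p : WordRAM.Prog) (c e : ℕ) (C : ℝ), ∀ I : STInstance,
      WordRAM.Achieves (I.wordLength c) p I.init
        (C * ((I.n + I.m + 1 : ℕ) : ℝ) ^ (3 / 2 : ℝ) * Real.log (I.n + I.m + 2) ^ e)
        (ENNReal.ofReal (1 - 1 / (I.n : ℝ) ^ a)) (I.IsApprox 2) := by
  -- `8` times the number of bits: a word has room for numbers up to `(n + m + W + 2) ^ 8`
  refine ⟨approxEcc.comp, 8, 1, approxEcc.size * (9000 / Real.log 2), fun I => ?_⟩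
  have hw := pow_le_two_pow_wordLength I 8
  have hbig : 2 * I.inf + 6 * I.n + 4 * I.m + I.maxWeight + 20 < 2 ^ I.wordLength 8 := by
    refine lt_of_lt_of_le ?_ hw
    set Z := I.n + I.m + I.maxWeight + 2 with hZ
    have h1 : I.inf ≤ Z * Z := Nat.mul_le_mul (by omega) (by omega)
    have h2 : Z ≤ Z * Z := Nat.le_mul_self _
    have h4 : 2 ≤ Z := by omega
    have h5 : 4 ≤ Z * Z := by nlinarith
    have h3 : Z ^ 8 = (Z * Z) * (Z * Z) * ((Z * Z) * (Z * Z)) := by ring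
    rw [h3]
    generalize Z * Z = A at *
    have h6 : 16 ≤ A * A := by nlinarith
    have h7 : 4 * A ≤ A * A := by nlinarith
    nlinarith
  have hw0 : 0 < I.wordLength 8 := by
    by_contra hc
    obtain hc : I.wordLength 8 = 0 := by omega
    rw [hc] at hbig
    omega
  have key : ∀ ρ, ∃ (t : ℕ) (σ' : State), Exec (I.wordLength 8) ρ approxEcc.comp I.init t σ' ∧
      (t : ℝ) ≤ approxEcc.size * (9000 / Real.log 2) * ((I.n + I.m + 1 : ℕ) : ℝ) ^ (3 / 2 : ℝ) *
        Real.log (I.n + I.m + 2) ^ 1 ∧ I.IsApprox 2 σ' := by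
    intro ρ
    have hlit : approxEcc.maxLit ≤ 2 := by decide
    obtain ⟨T, s, σ', τ', h1, h2, h3, h4, h, q, h5, h6, h7⟩ := Cmd.exec_of_wp hw0 ρ approxEcc I.init
      rfl (by omega) ⟨fun _ _ => rfl, rfl, rfl⟩ (bounded_init (by omega)) (wp_approxEcc hbig)
    rw [zero_add] at h7
    refine ⟨T, τ', h1, ?_, ?_⟩
    · have h8 := approxEcc_time h5 h6 h7
      calc (T : ℝ) ≤ approxEcc.size * s := by exact_mod_cast h3
        _ ≤ approxEcc.size * (9000 / Real.log 2 * ((I.n + I.m + 1 : ℕ) : ℝ) ^ (3 / 2 : ℝ) *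
            Real.log (I.n + I.m + 2) ^ 1) := by gcongr
        _ = _ := by ring
    · intro s hs
      have := h4 s hs
      rwa [STInstance.estimate, ← h2.mem] at this
  -- the algorithm tosses no coins, so it succeeds with probability `1`
  refine ⟨fun ρ => ?_, ?_⟩
  · obtain ⟨t, σ', h1, h2, -⟩ := key ρ
    exact ⟨t, σ', h1, h2⟩
  · have huniv : {ρ | ∃ (t : ℕ) (σ' : State), Exec (I.wordLength 8) ρ approxEcc.comp I.init t σ' ∧
        I.IsApprox 2 σ'} = Set.univ := by
      refine Set.eq_univ_of_forall fun ρ => ?_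
      obtain ⟨t, σ', h1, -, h3⟩ := key ρ
      exact ⟨t, σ', h1, h3⟩
    rw [huniv, MeasureTheory.measure_univ]
    refine ENNReal.ofReal_le_one.2 ?_
    have : (0 : ℝ) ≤ 1 / (I.n : ℝ) ^ a := by positivity
    linarith

/-! ### Digits -/

/-- The digit number `p` of `w` in base `N`. -/
def dig (N p w : ℕ) : ℕ := w / N ^ p % N

/-- The number `w` with its base `N` digit number `p` replaced by `0`. -/
def erase (N p w : ℕ) : ℕ := w - dig N p w * N ^ p

/-- The number with the `K` base `N` digits `f 0, f 1, …`. -/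
def ofDig (N K : ℕ) (f : ℕ → ℕ) : ℕ := ∑ p ∈ Finset.range K, f p * N ^ p

section Digits

variable {N K : ℕ}

theorem dig_lt (hN : 0 < N) (p w : ℕ) : dig N p w < N := Nat.mod_lt _ hN

theorem ofDig_congr {f g : ℕ → ℕ} (h : ∀ p < K, f p = g p) : ofDig N K f = ofDig N K g :=
  Finset.sum_congr rfl fun p hp => by rw [h p (Finset.mem_range.1 hp)]

@[simp] theorem dig_zero (N p : ℕ) : dig N p 0 = 0 := by simp [dig]

theorem ofDig_lt {f : ℕ → ℕ} (hf : ∀ p < K, f p < N) : ofDig N K f < N ^ K := by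
  induction K with
  | zero => simp [ofDig]
  | succ K ih =>
    have h1 := ih fun p hp => hf p (by omega)
    have h2 := hf K (by omega)
    rw [ofDig, Finset.sum_range_succ, ← ofDig, pow_succ]
    calc ofDig N K f + f K * N ^ K < N ^ K + f K * N ^ K := by omega
      _ = N ^ K * (f K + 1) := by ring
      _ ≤ N ^ K * N := Nat.mul_le_mul_left _ h2

theorem dig_ofDig {f : ℕ → ℕ} (hf : ∀ p < K, f p < N) {p : ℕ} (hp : p < K) :
    dig N p (ofDig N K f) = f p := by
  induction K with
  | zero => omega
  | succ K ih =>
    have hN : 0 < N := by have := hf p hp; omega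
    have h1 := ofDig_lt (K := K) fun p hp => hf p (by omega)
    rw [ofDig, Finset.sum_range_succ, ← ofDig, dig]
    rcases Nat.lt_succ_iff_lt_or_eq.1 hp with h | rfl
    · obtain ⟨e, rfl⟩ : ∃ e, K = p + (e + 1) := ⟨K - p - 1, by omega⟩
      have h2 : f (p + (e + 1)) * N ^ (p + (e + 1)) = N ^ p * (N * (f (p + (e + 1)) * N ^ e)) := by
        ring
      rw [h2, Nat.add_mul_div_left _ _ (by positivity), Nat.add_mul_mod_self_left]
      exact ih (fun p hp => hf p (by omega)) h
    · rw [Nat.add_mul_div_right _ _ (by positivity), Nat.div_eq_of_lt h1, zero_add,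
        Nat.mod_eq_of_lt (hf p hp)]

theorem eq_of_dig {w w' : ℕ} (hw : w < N ^ K) (hw' : w' < N ^ K)
    (h : ∀ p < K, dig N p w = dig N p w') : w = w' := by
  have : (finFunctionFinEquiv (m := N) (n := K)).symm ⟨w, hw⟩ =
      (finFunctionFinEquiv (m := N) (n := K)).symm ⟨w', hw'⟩ := by
    funext p
    exact Fin.ext (by simpa [finFunctionFinEquiv, dig] using h p p.2)
  simpa using this

theorem ofDig_dig (hN : 0 < N) {w : ℕ} (hw : w < N ^ K) : ofDig N K (fun p => dig N p w) = w :=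
  eq_of_dig (ofDig_lt fun p _ => dig_lt hN p w) hw fun _ hp =>
    dig_ofDig (fun p _ => dig_lt hN p w) hp

theorem erase_eq (hN : 0 < N) {p w : ℕ} (hp : p < K) (hw : w < N ^ K) :
    erase N p w = ofDig N K (fun q => if q = p then 0 else dig N q w) := by
  have h1 : w = ofDig N K (fun q => if q = p then 0 else dig N q w) + dig N p w * N ^ p := by
    conv_lhs => rw [← ofDig_dig hN hw]
    rw [ofDig, ofDig, ← Finset.add_sum_erase _ _ (Finset.mem_range.2 hp),
      ← Finset.add_sum_erase _ (fun q => (if q = p then 0 else dig N q w) * N ^ q)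
        (Finset.mem_range.2 hp)]
    rw [Finset.sum_congr rfl (g := fun q => (if q = p then 0 else dig N q w) * N ^ q)]
    · simp
      omega
    · intro q hq
      simp [Finset.ne_of_mem_erase hq]
  rw [erase]
  omega

theorem dig_erase (hN : 0 < N) {p q w : ℕ} (hp : p < K) (hq : q < K) (hw : w < N ^ K) :
    dig N q (erase N p w) = if q = p then 0 else dig N q w := by
  rw [erase_eq hN hp hw, dig_ofDig (fun r _ => ?_) hq]
  split_ifs
  · exact hN
  · exact dig_lt hN _ _

theorem erase_le (p w : ℕ) : erase N p w ≤ w := Nat.sub_le _ _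

theorem erase_of_dig {p w : ℕ} (h : dig N p w = 0) : erase N p w = w := by simp [erase, h]

theorem erase_of_le {p w : ℕ} (hw : w < N ^ K) (hp : K ≤ p) : erase N p w = w := by
  rcases Nat.eq_zero_or_pos N with rfl | hN
  · rcases Nat.eq_zero_or_pos K with rfl | hK
    · simp at hw
      simp [hw, erase]
    · simp [hK.ne'] at hw
  · apply erase_of_dig
    rw [dig, Nat.div_eq_of_lt (hw.trans_le (Nat.pow_le_pow_right hN hp)), Nat.zero_mod]

end Digits

/-! ### The layered graph of a tuple problem -/

/-- The data of a tuple problem: there are `k` groups, a value of a group is a number below `N`, and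
`bad g A c` says that the coordinate `c < d` is not covered by the value `A` of group `g`. The value
`0` covers nothing, and the coordinate `unit g` is covered by no value of another group. -/
structure TupleProblem where
  k : ℕ
  N : ℕ
  d : ℕ
  bad : ℕ → ℕ → ℕ → Prop
  unit : ℕ → ℕ
  two_le : 2 ≤ k
  N_pos : 0 < N
  bad_zero : ∀ g c, bad g 0 c
  unit_lt : ∀ g < k, unit g < d
  bad_unit : ∀ g g' A, g' ≠ g → bad g' A (unit g)

namespace TupleProblem

variable (Γ : TupleProblem)

theorem d_pos : 0 < Γ.d := (Nat.zero_le _).trans_lt (Γ.unit_lt 0 (by have := Γ.two_le; omega))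

/-- The number of tuples of `k - 1` values. -/
def NN : ℕ := Γ.N ^ (Γ.k - 1)

/-- The number of tuples of `k - 1` coordinates. -/
def X : ℕ := Γ.d ^ (Γ.k - 1)

theorem NN_pos : 0 < Γ.NN := Nat.pow_pos Γ.N_pos

theorem X_pos : 0 < Γ.X := Nat.pow_pos Γ.d_pos

/-- The number of vertices: a vertex consists of a level, a tuple of values and a tuple of
coordinates. -/
def nV : ℕ := (Γ.k + 1) * (Γ.NN * Γ.X)

/-- The vertex on level `i` with the tuples `w` and `x`. -/
def enc (i w x : ℕ) : ℕ := (i * Γ.NN + w) * Γ.X + x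

/-- The level of a vertex. -/
def lev (z : ℕ) : ℕ := z / Γ.X / Γ.NN

/-- The tuple of values of a vertex. -/
def wd (z : ℕ) : ℕ := z / Γ.X % Γ.NN

/-- The tuple of coordinates of a vertex. -/
def xd (z : ℕ) : ℕ := z % Γ.X

variable {Γ}

theorem wd_lt (z : ℕ) : Γ.wd z < Γ.NN := Nat.mod_lt _ Γ.NN_pos

theorem xd_lt (z : ℕ) : Γ.xd z < Γ.X := Nat.mod_lt _ Γ.X_pos

theorem enc_dec (z : ℕ) : Γ.enc (Γ.lev z) (Γ.wd z) (Γ.xd z) = z := by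
  rw [enc, lev, wd, xd, Nat.div_add_mod', Nat.div_add_mod']

section

variable {i w x : ℕ}

theorem enc_div (hx : x < Γ.X) : Γ.enc i w x / Γ.X = i * Γ.NN + w := by
  rw [enc, mul_comm, Nat.mul_add_div Γ.X_pos, Nat.div_eq_of_lt hx, add_zero]

theorem lev_enc (hw : w < Γ.NN) (hx : x < Γ.X) : Γ.lev (Γ.enc i w x) = i := by
  rw [lev, enc_div hx, mul_comm, Nat.mul_add_div Γ.NN_pos, Nat.div_eq_of_lt hw, add_zero]

theorem wd_enc (hw : w < Γ.NN) (hx : x < Γ.X) : Γ.wd (Γ.enc i w x) = w := by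
  rw [wd, enc_div hx, mul_comm, Nat.mul_add_mod, Nat.mod_eq_of_lt hw]

theorem xd_enc (hx : x < Γ.X) : Γ.xd (Γ.enc i w x) = x := by
  rw [xd, enc, mul_comm, Nat.mul_add_mod, Nat.mod_eq_of_lt hx]

theorem enc_lt (hi : i ≤ Γ.k) (hw : w < Γ.NN) (hx : x < Γ.X) : Γ.enc i w x < Γ.nV := by
  have h1 : i * Γ.NN + w + 1 ≤ (Γ.k + 1) * Γ.NN := by
    calc _ ≤ i * Γ.NN + Γ.NN := by omega
      _ = (i + 1) * Γ.NN := by ring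
      _ ≤ _ := Nat.mul_le_mul_right _ (by omega)
  calc Γ.enc i w x < (i * Γ.NN + w) * Γ.X + Γ.X := by rw [enc]; omega
    _ = (i * Γ.NN + w + 1) * Γ.X := by ring
    _ ≤ (Γ.k + 1) * Γ.NN * Γ.X := Nat.mul_le_mul_right _ h1
    _ = _ := by rw [nV, mul_assoc]

theorem lev_le {z : ℕ} (hz : z < Γ.nV) : Γ.lev z ≤ Γ.k := by
  rw [lev, Nat.div_div_eq_div_mul]
  refine Nat.lt_succ_iff.1 ((Nat.div_lt_iff_lt_mul (Nat.mul_pos Γ.X_pos Γ.NN_pos)).2 ?_)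
  rw [mul_comm Γ.X]
  exact hz

end

variable (Γ)

/-- The condition for the edge from level `i` to level `i + 1` with the tuples `w` and `x`.
Position `p` of `w` is a value of group `p` if `p < k - 1 - i`, and then the coordinates from
position `p` on are bad for it; otherwise it is a value of group `p + 1`, and then the coordinates
up to position `p` are bad for it. No value of group `k - 1 - i` occurs. -/
def Valid (i w x : ℕ) : Prop :=
  ∀ p < Γ.k - 1, ∀ j < Γ.k - 1,
    (p < Γ.k - 1 - i → p ≤ j → Γ.bad p (dig Γ.N p w) (dig Γ.d j x)) ∧
    (Γ.k - 1 - i ≤ p → j ≤ p → Γ.bad (p + 1) (dig Γ.N p w) (dig Γ.d j x))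

/-- The end on level `i` of the edge with the tuples `w` and `x`. -/
def low (i w x : ℕ) : ℕ := Γ.enc i (erase Γ.N (Γ.k - 1 - i) w) (if i = 0 then 0 else x)

/-- The end on level `i + 1` of the edge with the tuples `w` and `x`. -/
def high (i w x : ℕ) : ℕ :=
  Γ.enc (i + 1) (if i = Γ.k - 1 then w else erase Γ.N (Γ.k - 2 - i) w)
    (if i = Γ.k - 1 then 0 else x)

/-- The vertices that are ends of an edge between two levels. -/
def Proper (z : ℕ) : Prop :=
  ((Γ.lev z = 0 ∨ Γ.lev z = Γ.k) ∧ Γ.xd z = 0) ∨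
    (Γ.lev z ≠ 0 ∧ Γ.lev z < Γ.k ∧ dig Γ.N (Γ.k - 1 - Γ.lev z) (Γ.wd z) = 0 ∧
      Γ.Valid (Γ.lev z) (Γ.wd z) (Γ.xd z))

/-- The candidates for edges are the numbers below `2 * nV`: the candidate `z < nV` for the edge
with the level and the tuples of `z`, and the candidate `nV + z` for a pendant edge between `0` and
`z`. -/
def Keep (c : ℕ) : Prop :=
  if c < Γ.nV then Γ.lev c < Γ.k ∧ Γ.Valid (Γ.lev c) (Γ.wd c) (Γ.xd c) else ¬ Γ.Proper (c - Γ.nV)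

/-- The first end of a candidate. -/
def fst (c : ℕ) : ℕ := if c < Γ.nV then Γ.low (Γ.lev c) (Γ.wd c) (Γ.xd c) else 0

/-- The second end of a candidate. -/
def snd (c : ℕ) : ℕ := if c < Γ.nV then Γ.high (Γ.lev c) (Γ.wd c) (Γ.xd c) else c - Γ.nV

/-- The data of an edge between two levels. -/
structure IsEdge (i w x : ℕ) : Prop where
  lt : i < Γ.k
  w_lt : w < Γ.NN
  x_lt : x < Γ.X
  valid : Γ.Valid i w x

variable {Γ}

theorem erase_lt {p w : ℕ} (hw : w < Γ.NN) : erase Γ.N p w < Γ.NN := (erase_le p w).trans_lt hw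

theorem Valid.congr {i i' w w' x : ℕ} (h : Γ.Valid i w x)
    (hw : ∀ p < Γ.k - 1, dig Γ.N p w' = 0 ∨ dig Γ.N p w' = dig Γ.N p w ∧
      (p < Γ.k - 1 - i ↔ p < Γ.k - 1 - i')) : Γ.Valid i' w' x := by
  intro p hp j hj
  rcases hw p hp with h0 | ⟨h0, h1⟩
  · rw [h0]
    exact ⟨fun _ _ => Γ.bad_zero _ _, fun _ _ => Γ.bad_zero _ _⟩
  · rw [h0]
    exact ⟨fun h2 h3 => (h p hp j hj).1 (h1.2 h2) h3, fun h2 h3 => (h p hp j hj).2 (by omega) h3⟩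

namespace IsEdge

variable {i w x : ℕ}

theorem lev_low (h : Γ.IsEdge i w x) : Γ.lev (Γ.low i w x) = i :=
  lev_enc (erase_lt h.w_lt) (by split_ifs; exacts [Γ.X_pos, h.x_lt])

theorem wd_low (h : Γ.IsEdge i w x) : Γ.wd (Γ.low i w x) = erase Γ.N (Γ.k - 1 - i) w :=
  wd_enc (erase_lt h.w_lt) (by split_ifs; exacts [Γ.X_pos, h.x_lt])

theorem xd_low (h : Γ.IsEdge i w x) : Γ.xd (Γ.low i w x) = if i = 0 then 0 else x :=
  xd_enc (by split_ifs; exacts [Γ.X_pos, h.x_lt])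

theorem lev_high (h : Γ.IsEdge i w x) : Γ.lev (Γ.high i w x) = i + 1 :=
  lev_enc (by split_ifs; exacts [h.w_lt, erase_lt h.w_lt])
    (by split_ifs; exacts [Γ.X_pos, h.x_lt])

theorem wd_high (h : Γ.IsEdge i w x) :
    Γ.wd (Γ.high i w x) = if i = Γ.k - 1 then w else erase Γ.N (Γ.k - 2 - i) w :=
  wd_enc (by split_ifs; exacts [h.w_lt, erase_lt h.w_lt])
    (by split_ifs; exacts [Γ.X_pos, h.x_lt])

theorem xd_high (h : Γ.IsEdge i w x) : Γ.xd (Γ.high i w x) = if i = Γ.k - 1 then 0 else x :=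
  xd_enc (by split_ifs; exacts [Γ.X_pos, h.x_lt])

theorem low_lt (h : Γ.IsEdge i w x) : Γ.low i w x < Γ.nV :=
  enc_lt h.lt.le (erase_lt h.w_lt) (by split_ifs; exacts [Γ.X_pos, h.x_lt])

theorem high_lt (h : Γ.IsEdge i w x) : Γ.high i w x < Γ.nV :=
  enc_lt h.lt (by split_ifs; exacts [h.w_lt, erase_lt h.w_lt])
    (by split_ifs; exacts [Γ.X_pos, h.x_lt])

theorem dig_low (h : Γ.IsEdge i w x) {p : ℕ} (hp : p < Γ.k - 1) :
    dig Γ.N p (Γ.wd (Γ.low i w x)) = if p = Γ.k - 1 - i then 0 else dig Γ.N p w := by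
  rw [h.wd_low]
  rcases Nat.eq_zero_or_pos i with rfl | hi
  · rw [erase_of_le h.w_lt (by omega), if_neg (by omega)]
  · exact dig_erase Γ.N_pos (K := Γ.k - 1) (by omega) hp h.w_lt

theorem dig_high (h : Γ.IsEdge i w x) {p : ℕ} (hp : p < Γ.k - 1) :
    dig Γ.N p (Γ.wd (Γ.high i w x)) =
      if i ≠ Γ.k - 1 ∧ p = Γ.k - 2 - i then 0 else dig Γ.N p w := by
  have := h.lt
  rw [h.wd_high]
  by_cases hi : i = Γ.k - 1
  · simp [hi]
  · rw [if_neg hi, dig_erase Γ.N_pos (K := Γ.k - 1) (by omega) hp h.w_lt]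
    simp [hi]

theorem proper_low (h : Γ.IsEdge i w x) : Γ.Proper (Γ.low i w x) := by
  have hk := Γ.two_le
  rcases Nat.eq_zero_or_pos i with rfl | hi
  · exact .inl ⟨.inl h.lev_low, by simp [h.xd_low]⟩
  · refine .inr ⟨by rw [h.lev_low]; omega, by rw [h.lev_low]; exact h.lt, ?_, ?_⟩
    · rw [h.lev_low, h.dig_low (by omega), if_pos rfl]
    · rw [h.lev_low, h.xd_low, if_neg hi.ne']
      refine h.valid.congr fun p hp => ?_
      rw [h.dig_low hp]
      split_ifs
      · exact .inl rfl
      · exact .inr ⟨rfl, Iff.rfl⟩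

theorem proper_high (h : Γ.IsEdge i w x) : Γ.Proper (Γ.high i w x) := by
  have hk := Γ.two_le
  have hi := h.lt
  by_cases hi' : i = Γ.k - 1
  · exact .inl ⟨.inr (by rw [h.lev_high]; omega), by rw [h.xd_high, if_pos hi']⟩
  · refine .inr ⟨by rw [h.lev_high]; omega, by rw [h.lev_high]; omega, ?_, ?_⟩
    · rw [h.lev_high, h.dig_high (by omega), if_pos ⟨hi', by omega⟩]
    · rw [h.lev_high, h.xd_high, if_neg hi']
      refine h.valid.congr fun p hp => ?_
      rw [h.dig_high hp]
      split_ifs with h1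
      · exact .inl rfl
      · exact .inr ⟨rfl, by omega⟩

/-- An edge is determined by its two ends. -/
theorem ext (h : Γ.IsEdge i w x) {i' w' x' : ℕ} (h' : Γ.IsEdge i' w' x')
    (hl : Γ.low i w x = Γ.low i' w' x') (hh : Γ.high i w x = Γ.high i' w' x') :
    i = i' ∧ w = w' ∧ x = x' := by
  have hk := Γ.two_le
  have hi : i = i' := by rw [← h.lev_low, hl, h'.lev_low]
  subst hi
  have hi := h.lt
  refine ⟨rfl, eq_of_dig h.w_lt h'.w_lt fun p hp => ?_, ?_⟩
  · have h1 := h.dig_low hp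
    have h2 := h.dig_high hp
    rw [hl, h'.dig_low hp] at h1
    rw [hh, h'.dig_high hp] at h2
    by_cases e1 : p = Γ.k - 1 - i
    · rw [if_neg (by omega), if_neg (by omega)] at h2
      exact h2.symm
    · rw [if_neg e1, if_neg e1] at h1
      exact h1.symm
  · have h1 := h.xd_low
    have h2 := h.xd_high
    rw [hl, h'.xd_low] at h1
    rw [hh, h'.xd_high] at h2
    by_cases e1 : i = 0
    · rw [if_neg (by omega), if_neg (by omega)] at h2
      exact h2.symm
    · rw [if_neg e1, if_neg e1] at h1
      exact h1.symm

end IsEdge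

theorem proper_zero : Γ.Proper 0 := .inl ⟨.inl (by simp [lev]), by simp [xd]⟩

/-- The ends of a kept candidate: either an edge between two levels or a pendant edge. -/
theorem Keep.cases {c : ℕ} (hc : Γ.Keep c) (hc2 : c < 2 * Γ.nV) :
    (c < Γ.nV ∧ Γ.IsEdge (Γ.lev c) (Γ.wd c) (Γ.xd c) ∧
      Γ.fst c = Γ.low (Γ.lev c) (Γ.wd c) (Γ.xd c) ∧
      Γ.snd c = Γ.high (Γ.lev c) (Γ.wd c) (Γ.xd c)) ∨
    (Γ.nV ≤ c ∧ Γ.fst c = 0 ∧ Γ.snd c = c - Γ.nV ∧ Γ.snd c < Γ.nV ∧ ¬ Γ.Proper (Γ.snd c)) := by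
  unfold Keep at hc
  unfold fst snd
  split_ifs at hc ⊢ with h
  · exact .inl ⟨h, ⟨hc.1, wd_lt _, xd_lt _, hc.2⟩, rfl, rfl⟩
  · exact .inr ⟨by omega, rfl, rfl, by omega, hc⟩

theorem IsEdge.keep {i w x : ℕ} (h : Γ.IsEdge i w x) : Γ.Keep (Γ.enc i w x) ∧
    Γ.enc i w x < Γ.nV ∧ Γ.fst (Γ.enc i w x) = Γ.low i w x ∧
    Γ.snd (Γ.enc i w x) = Γ.high i w x := by
  have h1 := enc_lt h.lt.le h.w_lt h.x_lt
  simp only [Keep, fst, snd, h1, if_true, lev_enc h.w_lt h.x_lt, wd_enc h.w_lt h.x_lt,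
    xd_enc h.x_lt, and_self, and_true]
  exact ⟨h.lt, h.valid⟩

theorem Keep.fst_lt {c : ℕ} (hc : Γ.Keep c) (hc2 : c < 2 * Γ.nV) : Γ.fst c < Γ.nV := by
  rcases hc.cases hc2 with ⟨_, h, h1, _⟩ | ⟨h1, h2, _⟩
  · rw [h1]; exact h.low_lt
  · rw [h2]; omega

theorem Keep.snd_lt {c : ℕ} (hc : Γ.Keep c) (hc2 : c < 2 * Γ.nV) : Γ.snd c < Γ.nV := by
  rcases hc.cases hc2 with ⟨_, h, _, h1⟩ | ⟨_, _, _, h2, _⟩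
  · rw [h1]; exact h.high_lt
  · exact h2

theorem Keep.fst_ne_snd {c : ℕ} (hc : Γ.Keep c) (hc2 : c < 2 * Γ.nV) : Γ.fst c ≠ Γ.snd c := by
  rcases hc.cases hc2 with ⟨_, h, h1, h2⟩ | ⟨_, h1, _, _, h2⟩
  · intro he
    have := h.lev_high
    rw [← h2, ← he, h1, h.lev_low] at this
    omega
  · intro he
    rw [← he, h1] at h2
    exact h2 proper_zero

/-- Different candidates are different edges. -/
theorem Keep.inj {c c' : ℕ} (hc : Γ.Keep c) (hc2 : c < 2 * Γ.nV) (hc' : Γ.Keep c')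
    (hc2' : c' < 2 * Γ.nV) (h : s(Γ.fst c, Γ.snd c) = s(Γ.fst c', Γ.snd c')) : c = c' := by
  rcases hc.cases hc2 with ⟨_, h, h1, h2⟩ | ⟨_, h1, h2, _, h3⟩ <;>
  rcases hc'.cases hc2' with ⟨_, h', h1', h2'⟩ | ⟨_, h1', h2', _, h3'⟩ <;>
  rcases Sym2.eq_iff.1 ‹s(_, _) = _› with ⟨e1, e2⟩ | ⟨e1, e2⟩
  · rw [h1, h1'] at e1
    rw [h2, h2'] at e2
    obtain ⟨a1, a2, a3⟩ := h.ext h' e1 e2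
    rw [← enc_dec (Γ := Γ) c, a1, a2, a3, enc_dec]
  · rw [h1, h2'] at e1
    rw [h2, h1'] at e2
    have a1 := congrArg Γ.lev e1
    have a2 := congrArg Γ.lev e2
    rw [h.lev_low, h'.lev_high] at a1
    rw [h.lev_high, h'.lev_low] at a2
    omega
  · rw [h2] at e2
    rw [← e2] at h3'
    exact absurd h.proper_high h3'
  · rw [h1] at e1
    rw [← e1] at h3'
    exact absurd h.proper_low h3'
  · rw [e2, h2'] at h3
    exact absurd h'.proper_high h3
  · rw [e2, h1'] at h3
    exact absurd h'.proper_low h3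
  · omega
  · rw [e2, h1'] at h3
    exact absurd proper_zero h3

open Classical in
variable (Γ) in
/-- The list of the candidates below `c` that are edges. -/
def edgeList (c : ℕ) : List ℕ := (List.range c).filter fun c => Γ.Keep c

theorem mem_edgeList {c e : ℕ} : e ∈ Γ.edgeList c ↔ e < c ∧ Γ.Keep e := by
  simp [edgeList]

theorem nodup_edgeList (c : ℕ) : (Γ.edgeList c).Nodup := List.nodup_range.filter _

theorem get_edgeList (i : Fin (Γ.edgeList (2 * Γ.nV)).length) :
    (Γ.edgeList (2 * Γ.nV))[i] < 2 * Γ.nV ∧ Γ.Keep (Γ.edgeList (2 * Γ.nV))[i] :=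
  mem_edgeList.1 (List.getElem_mem _)

open Classical in
variable (Γ) in
/-- The unweighted instance of a tuple problem. The vertices `enc k w 0` are in `T`, all others
in `S`. -/
def inst : STInstance where
  n := Γ.nV
  m := (Γ.edgeList (2 * Γ.nV)).length
  src i := ⟨Γ.fst (Γ.edgeList (2 * Γ.nV))[i], (get_edgeList i).2.fst_lt (get_edgeList i).1⟩
  dst i := ⟨Γ.snd (Γ.edgeList (2 * Γ.nV))[i], (get_edgeList i).2.snd_lt (get_edgeList i).1⟩
  G := SimpleGraph.fromRel fun a b => ∃ c < 2 * Γ.nV, Γ.Keep c ∧ Γ.fst c = a ∧ Γ.snd c = b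
  edges_bij := by
    refine ⟨fun i _ => ?_, fun i _ j _ h => ?_, fun e he => ?_⟩
    · have h1 := get_edgeList i
      simp only [SimpleGraph.mem_edgeSet, SimpleGraph.fromRel_adj, ne_eq, Fin.mk.injEq]
      exact ⟨h1.2.fst_ne_snd h1.1, .inl ⟨_, h1.1, h1.2, rfl, rfl⟩⟩
    · have h1 := get_edgeList i
      have h2 := get_edgeList j
      have h3 := congrArg (Sym2.map Fin.val) h
      simp only [Sym2.map_mk] at h3
      have h4 := h1.2.inj h1.1 h2.2 h2.1 h3
      exact Fin.ext ((nodup_edgeList _).getElem_inj_iff.1 h4)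
    · induction e with | _ a b
      have key : ∀ a b : Fin Γ.nV, (∃ c < 2 * Γ.nV, Γ.Keep c ∧ Γ.fst c = a ∧ Γ.snd c = b) →
          ∃ i : Fin (Γ.edgeList (2 * Γ.nV)).length, Γ.fst (Γ.edgeList (2 * Γ.nV))[i] = a ∧
            Γ.snd (Γ.edgeList (2 * Γ.nV))[i] = b := by
        rintro a b ⟨c, hc, hk, ha, hb⟩
        obtain ⟨i, hi, rfl⟩ := List.getElem_of_mem (mem_edgeList.2 ⟨hc, hk⟩)
        exact ⟨⟨i, hi⟩, ha, hb⟩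
      rw [SimpleGraph.mem_edgeSet, SimpleGraph.fromRel_adj] at he
      rcases he.2 with h | h
      · obtain ⟨i, h1, h2⟩ := key a b h
        exact ⟨i, trivial, congrArg₂ (fun a b => s(a, b)) (Fin.ext h1) (Fin.ext h2)⟩
      · obtain ⟨i, h1, h2⟩ := key b a h
        exact ⟨i, trivial, (congrArg₂ (fun a b => s(a, b)) (Fin.ext h1) (Fin.ext h2)).trans
          Sym2.eq_swap⟩
  weight := fun _ => 1
  S := (Finset.univ.filter fun z : Fin Γ.nV => Γ.lev z = Γ.k ∧ Γ.xd z = 0)ᶜ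
  T := Finset.univ.filter fun z : Fin Γ.nV => Γ.lev z = Γ.k ∧ Γ.xd z = 0

end TupleProblem

/-! ### Distances in the layered graph -/

section Gaps

variable {k L : ℕ} {l : ℕ → ℕ}

/-- The step `t` is the only one between the numbers up to `e` and the larger ones. -/
def CrossedOnce (l : ℕ → ℕ) (L e t : ℕ) : Prop :=
  t < L ∧ l t = e ∧ l (t + 1) = e + 1 ∧ (∀ s ≤ t, l s ≤ e) ∧ ∀ s, t < s → s ≤ L → e + 1 ≤ l s

theorem exists_crossedOnce (h0 : l 0 = 0) (hL : l L = k)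
    (hstep : ∀ t < L, l (t + 1) = l t + 1 ∨ l t = l (t + 1) + 1) {e : ℕ} (he : e < k)
    (hd : ∀ t < L, l t = l (t + 1) + 1 → l (t + 1) ≠ e) : ∃ t, CrossedOnce l L e t := by
  classical
  have hex : ∃ s, s ≤ L ∧ e + 1 ≤ l s := ⟨L, le_rfl, by omega⟩
  obtain ⟨h1, h2⟩ := Nat.find_spec hex
  have hmin := fun s => Nat.find_min hex (m := s)
  generalize Nat.find hex = s₀ at h1 h2 hmin
  have hs₀ : s₀ ≠ 0 := by rintro rfl; omega
  obtain ⟨t, rfl⟩ : ∃ t, s₀ = t + 1 := ⟨s₀ - 1, by omega⟩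
  have hle : ∀ s ≤ t, l s ≤ e := fun s hs => by
    by_contra hc
    exact hmin s (by omega) ⟨by omega, by omega⟩
  have h3 := hle t le_rfl
  refine ⟨t, by omega, ?_, ?_, hle, fun s hs hsL => ?_⟩
  · rcases hstep t (by omega) with h | h <;> omega
  · rcases hstep t (by omega) with h | h <;> omega
  · induction s, hs using Nat.le_induction with
    | base => exact h2
    | succ s hs ih =>
      have := ih (by omega)
      rcases hstep s (by omega) with h | h
      · omega
      · have := hd s (by omega) h
        omega

open Classical in
theorem add_two_mul_card (h0 : l 0 = 0)
    (hstep : ∀ t < L, l (t + 1) = l t + 1 ∨ l t = l (t + 1) + 1) :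
    l L + 2 * ((Finset.range L).filter fun t => l t = l (t + 1) + 1).card = L := by
  induction L with
  | zero => simp [h0]
  | succ L ih =>
    have := ih fun t ht => hstep t (by omega)
    rw [Finset.range_add_one, Finset.filter_insert]
    rcases hstep L (by omega) with h | h
    · rw [if_neg (by omega)]
      omega
    · rw [if_pos h, Finset.card_insert_of_notMem (by simp)]
      omega

/-- A walk of fewer than `3 * k - 2` steps from `0` to `k` crosses two of the gaps only once: the
others are crossed at least three times. -/
theorem exists_two_crossedOnce (h0 : l 0 = 0) (hL : l L = k)
    (hstep : ∀ t < L, l (t + 1) = l t + 1 ∨ l t = l (t + 1) + 1) (hlen : L < 3 * k - 2) :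
    ∃ g g' t t', g < g' ∧ g' < k ∧ CrossedOnce l L g t ∧ CrossedOnce l L g' t' := by
  classical
  have h1 := add_two_mul_card h0 hstep
  set D := (Finset.range L).filter fun t => l t = l (t + 1) + 1 with hD
  have h2 : 1 < (Finset.range k \ D.image fun t => l (t + 1)).card := by
    have h3 := Finset.le_card_sdiff (D.image fun t => l (t + 1)) (Finset.range k)
    have h4 := Finset.card_image_le (s := D) (f := fun t => l (t + 1))
    rw [Finset.card_range] at h3
    omega
  obtain ⟨a, ha, b, hb, hab⟩ := Finset.one_lt_card.1 h2
  have key : ∀ e ∈ Finset.range k \ D.image fun t => l (t + 1),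
      e < k ∧ ∃ t, CrossedOnce l L e t := by
    intro e he
    simp only [hD, Finset.mem_sdiff, Finset.mem_range, Finset.mem_image, Finset.mem_filter,
      not_exists, not_and, and_imp] at he
    exact ⟨he.1, exists_crossedOnce h0 hL hstep he.1 he.2⟩
  obtain ⟨a1, t, a2⟩ := key a ha
  obtain ⟨b1, t', b2⟩ := key b hb
  rcases lt_or_gt_of_ne hab with h | h
  · exact ⟨a, b, t, t', h, b1, a2, b2⟩
  · exact ⟨b, a, t', t, h, a1, b2, a2⟩

end Gaps

namespace TupleProblem

variable {Γ : TupleProblem}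

theorem walkLength_inst {u v : Fin Γ.inst.n} (q : Γ.inst.G.Walk u v) :
    Γ.inst.walkLength q = q.length := by
  rw [STInstance.walkLength, ← SimpleGraph.Walk.length_edges]
  change (q.edges.map fun _ => 1).sum = _
  simp

theorem adj_inst {a b : Fin Γ.inst.n} : Γ.inst.G.Adj a b ↔ a ≠ b ∧
    ((∃ c < 2 * Γ.nV, Γ.Keep c ∧ Γ.fst c = (a : ℕ) ∧ Γ.snd c = (b : ℕ)) ∨
      ∃ c < 2 * Γ.nV, Γ.Keep c ∧ Γ.fst c = (b : ℕ) ∧ Γ.snd c = (a : ℕ)) := Iff.rfl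

theorem isEdge_zero : Γ.IsEdge 0 0 0 :=
  ⟨by have := Γ.two_le; omega, Γ.NN_pos, Γ.X_pos, fun p _ j _ => by
    simp [Γ.bad_zero]⟩

open Classical in
variable (Γ) in
/-- The retraction of the pendant vertices to a neighbour of the vertex `0` to which they are
attached. -/
def retract (z : ℕ) : ℕ := if Γ.Proper z then z else Γ.high 0 0 0

/-- After the retraction every edge joins two consecutive levels. -/
theorem isEdge_of_adj {a b : Fin Γ.inst.n} (h : Γ.inst.G.Adj a b) : ∃ i w x, Γ.IsEdge i w x ∧
    (Γ.retract a = Γ.low i w x ∧ Γ.retract b = Γ.high i w x ∨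
      Γ.retract b = Γ.low i w x ∧ Γ.retract a = Γ.high i w x) := by
  have key : ∀ c < 2 * Γ.nV, Γ.Keep c → ∃ i w x, Γ.IsEdge i w x ∧
      Γ.retract (Γ.fst c) = Γ.low i w x ∧ Γ.retract (Γ.snd c) = Γ.high i w x := by
    intro c hc hk
    rcases hk.cases hc with ⟨_, h1, h2, h3⟩ | ⟨_, h1, _, _, h2⟩
    · refine ⟨_, _, _, h1, ?_, ?_⟩
      · rw [h2, retract, if_pos h1.proper_low]
      · rw [h3, retract, if_pos h1.proper_high]
    · refine ⟨0, 0, 0, isEdge_zero, ?_, ?_⟩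
      · rw [h1, retract, if_pos proper_zero]
        simp [low, enc, erase]
      · rw [retract, if_neg h2]
  rcases (adj_inst.1 h).2 with ⟨c, hc, hk, h1, h2⟩ | ⟨c, hc, hk, h1, h2⟩
  · obtain ⟨i, w, x, h3, h4, h5⟩ := key c hc hk
    exact ⟨i, w, x, h3, .inl ⟨by rw [← h1, h4], by rw [← h2, h5]⟩⟩
  · obtain ⟨i, w, x, h3, h4, h5⟩ := key c hc hk
    exact ⟨i, w, x, h3, .inr ⟨by rw [← h1, h4], by rw [← h2, h5]⟩⟩

theorem retract_source {w : ℕ} (hw : w < Γ.NN) : Γ.retract (Γ.enc 0 w 0) = Γ.enc 0 w 0 :=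
  if_pos (.inl ⟨.inl (lev_enc hw Γ.X_pos), xd_enc Γ.X_pos⟩)

theorem retract_target {w : ℕ} (hw : w < Γ.NN) : Γ.retract (Γ.enc Γ.k w 0) = Γ.enc Γ.k w 0 :=
  if_pos (.inl ⟨.inr (lev_enc hw Γ.X_pos), xd_enc Γ.X_pos⟩)

theorem lev_step {u v : Fin Γ.inst.n} (q : Γ.inst.G.Walk u v) {t : ℕ} (ht : t < q.length) :
    Γ.lev (Γ.retract (q.getVert (t + 1))) = Γ.lev (Γ.retract (q.getVert t)) + 1 ∨
      Γ.lev (Γ.retract (q.getVert t)) = Γ.lev (Γ.retract (q.getVert (t + 1))) + 1 := by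
  obtain ⟨i, w, x, h, ⟨h1, h2⟩ | ⟨h1, h2⟩⟩ := isEdge_of_adj (q.adj_getVert_succ ht)
  · rw [h1, h2, h.lev_low, h.lev_high]
    exact .inl rfl
  · rw [h1, h2, h.lev_low, h.lev_high]
    exact .inr rfl

theorem k_le_length {u v : Fin Γ.inst.n} {a b : ℕ} (ha : a < Γ.NN) (hb : b < Γ.NN)
    (hu : (u : ℕ) = Γ.enc 0 a 0) (hv : (v : ℕ) = Γ.enc Γ.k b 0) (q : Γ.inst.G.Walk u v) :
    Γ.k ≤ q.length := by
  have h := add_two_mul_card (L := q.length) (l := fun t => Γ.lev (Γ.retract (q.getVert t)))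
    (by simp [hu, retract_source ha, lev_enc ha Γ.X_pos]) fun t ht => lev_step q ht
  simp only [SimpleGraph.Walk.getVert_length, hv, retract_target hb, lev_enc hb Γ.X_pos] at h
  omega

/-- If `A` is a solution of the tuple problem, every walk from the source that belongs to its first
`k - 1` values to the target that belongs to its last `k - 1` values has length at least
`3 * k - 2`. Otherwise two gaps `g < g'` are crossed only once. Up to the first of these crossings
the values of the groups up to `k - 2 - g` are those of the source, after the second one the values
of the other groups are those of the target, and the coordinates do not change in between. So the
coordinate at position `k - 2 - g` is bad for all values of `A`. -/
theorem three_mul_le_length {A : ℕ → ℕ} (hA : ∀ g, A g < Γ.N)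
    (hsol : ∀ c < Γ.d, ∃ g < Γ.k, ¬ Γ.bad g (A g) c) {u v : Fin Γ.inst.n}
    (hu : (u : ℕ) = Γ.enc 0 (ofDig Γ.N (Γ.k - 1) A) 0)
    (hv : (v : ℕ) = Γ.enc Γ.k (ofDig Γ.N (Γ.k - 1) fun p => A (p + 1)) 0)
    (q : Γ.inst.G.Walk u v) : 3 * Γ.k - 2 ≤ q.length := by
  have hk := Γ.two_le
  have hwu : ofDig Γ.N (Γ.k - 1) A < Γ.NN := ofDig_lt fun p _ => hA p
  have hwv : (ofDig Γ.N (Γ.k - 1) fun p => A (p + 1)) < Γ.NN := ofDig_lt fun p _ => hA (p + 1)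
  by_contra hlen
  rw [not_le] at hlen
  set z : ℕ → ℕ := fun t => Γ.retract (q.getVert t) with hz
  have hz0 : z 0 = Γ.enc 0 (ofDig Γ.N (Γ.k - 1) A) 0 := by simp [hz, hu, retract_source hwu]
  have hzL : z q.length = Γ.enc Γ.k (ofDig Γ.N (Γ.k - 1) fun p => A (p + 1)) 0 := by
    simp [hz, hv, retract_target hwv]
  have hstep : ∀ t < q.length, ∃ i w x, Γ.IsEdge i w x ∧
      (z t = Γ.low i w x ∧ z (t + 1) = Γ.high i w x ∨
        z (t + 1) = Γ.low i w x ∧ z t = Γ.high i w x) := fun t ht =>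
    isEdge_of_adj (q.adj_getVert_succ ht)
  obtain ⟨g, g', t, t', hgg, hg', ⟨ht, a1, a2, a3, a4⟩, ht', b1, b2, b3, b4⟩ :=
    exists_two_crossedOnce (l := fun t => Γ.lev (z t)) (L := q.length) (k := Γ.k)
      (by simp [hz0, lev_enc hwu Γ.X_pos]) (by simp [hzL, lev_enc hwv Γ.X_pos])
      (fun t ht => lev_step q ht) hlen
  simp only at a1 a2 a3 a4 b1 b2 b3 b4
  have htt : t < t' := by
    by_contra hc
    have := a3 t' (by omega)
    omega
  -- the values of the source are kept up to the first crossing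
  have hleft : ∀ p < Γ.k - 1 - g, ∀ s ≤ t, dig Γ.N p (Γ.wd (z s)) = A p := by
    intro p hp s hs
    induction s with
    | zero => rw [hz0, wd_enc hwu Γ.X_pos, dig_ofDig (fun p _ => hA p) (by omega)]
    | succ s ih =>
      have l1 := a3 s (by omega)
      have l2 := a3 (s + 1) hs
      obtain ⟨i, w, x, h, ⟨h1, h2⟩ | ⟨h1, h2⟩⟩ := hstep s (by omega)
      · rw [h2, h.lev_high] at l2
        rw [← ih (by omega), h1, h2, h.dig_low (by omega), h.dig_high (by omega), if_neg (by omega),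
          if_neg (by omega)]
      · rw [h2, h.lev_high] at l1
        rw [← ih (by omega), h1, h2, h.dig_low (by omega), h.dig_high (by omega), if_neg (by omega),
          if_neg (by omega)]
  -- after the second crossing the values are already those of the target
  have hright : ∀ p < Γ.k - 1, Γ.k - 1 - g' ≤ p → ∀ r, r + (t' + 1) ≤ q.length →
      dig Γ.N p (Γ.wd (z (q.length - r))) = A (p + 1) := by
    intro p hp hp' r hr
    induction r with
    | zero =>
      rw [Nat.sub_zero, hzL, wd_enc hwv Γ.X_pos, dig_ofDig (fun p _ => hA (p + 1)) (by omega)]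
    | succ r ih =>
      have ih := ih (by omega)
      obtain ⟨s, hs⟩ : ∃ s, s = q.length - (r + 1) := ⟨_, rfl⟩
      rw [show q.length - r = s + 1 by omega] at ih
      rw [← hs]
      have l1 := b4 s (by omega) (by omega)
      have l2 := b4 (s + 1) (by omega) (by omega)
      obtain ⟨i, w, x, h, ⟨h1, h2⟩ | ⟨h1, h2⟩⟩ := hstep s (by omega)
      · rw [h1, h.lev_low] at l1
        have := h.lt
        rw [← ih, h1, h2, h.dig_low (by omega), h.dig_high (by omega), if_neg (by omega),
          if_neg (by omega)]
      · rw [h1, h.lev_low] at l2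
        have := h.lt
        rw [← ih, h1, h2, h.dig_low (by omega), h.dig_high (by omega), if_neg (by omega),
          if_neg (by omega)]
  -- between the two crossings the coordinates do not change
  have hmid : ∀ s, t + 1 ≤ s → s ≤ t' → Γ.xd (z s) = Γ.xd (z (t + 1)) := by
    intro s hs
    induction s, hs using Nat.le_induction with
    | base => exact fun _ => rfl
    | succ s hs ih =>
      intro hs'
      have l1 := a4 s (by omega) (by omega)
      have l2 := b3 (s + 1) (by omega)
      have l3 := a4 (s + 1) (by omega) (by omega)
      have l4 := b3 s (by omega)
      rw [← ih (by omega)]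
      obtain ⟨i, w, x, h, ⟨h1, h2⟩ | ⟨h1, h2⟩⟩ := hstep s (by omega)
      · rw [h1, h.lev_low] at l1
        rw [h2, h.lev_high] at l2
        rw [h1, h2, h.xd_low, h.xd_high, if_neg (by omega), if_neg (by omega)]
      · rw [h1, h.lev_low] at l3
        rw [h2, h.lev_high] at l4
        rw [h1, h2, h.xd_low, h.xd_high, if_neg (by omega), if_neg (by omega)]
  obtain ⟨i, w, x, h, h12⟩ := hstep t ht
  obtain ⟨h1, h2⟩ : z t = Γ.low i w x ∧ z (t + 1) = Γ.high i w x := by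
    refine h12.resolve_right fun h => ?_
    rw [h.1, IsEdge.lev_low ‹_›] at a2
    rw [h.2, IsEdge.lev_high ‹_›] at a1
    omega
  obtain ⟨i', w', x', h', h12'⟩ := hstep t' ht'
  obtain ⟨h1', h2'⟩ : z t' = Γ.low i' w' x' ∧ z (t' + 1) = Γ.high i' w' x' := by
    refine h12'.resolve_right fun h => ?_
    rw [h.1, h'.lev_low] at b2
    rw [h.2, h'.lev_high] at b1
    omega
  obtain rfl : i = g := by rw [← a1, h1, h.lev_low]
  obtain rfl : i' = g' := by rw [← b1, h1', h'.lev_low]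
  have hx : x' = x := by
    have := hmid t' (by omega) le_rfl
    rwa [h1', h2, h'.xd_low, h.xd_high, if_neg (by omega), if_neg (by omega)] at this
  subst hx
  obtain ⟨γ, hγ, hbad⟩ := hsol _ (dig_lt Γ.d_pos (Γ.k - 2 - i) x')
  by_cases hγi : γ < Γ.k - 1 - i
  · have e1 := hleft γ hγi t le_rfl
    rw [h1, h.dig_low (by omega), if_neg (by omega)] at e1
    have := (h.valid γ (by omega) (Γ.k - 2 - i) (by omega)).1 hγi (by omega)
    rw [e1] at this
    exact hbad this
  · obtain ⟨p, rfl⟩ : ∃ p, γ = p + 1 := ⟨γ - 1, by omega⟩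
    have e1 := hright p (by omega) (by omega) (q.length - (t' + 1)) (by omega)
    rw [show q.length - (q.length - (t' + 1)) = t' + 1 by omega, h2', h'.dig_high (by omega),
      if_neg (by omega)] at e1
    have := (h'.valid p (by omega) (Γ.k - 2 - i) (by omega)).2 (by omega) (by omega)
    rw [e1] at this
    exact hbad this

end TupleProblem

namespace TupleProblem

variable {Γ : TupleProblem}

variable (Γ) in
/-- There is a walk of at most `n` edges between two vertices. -/
def Reach (n a b : ℕ) : Prop :=
  ∃ (ha : a < Γ.nV) (hb : b < Γ.nV) (q : Γ.inst.G.Walk ⟨a, ha⟩ ⟨b, hb⟩), q.length ≤ n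

namespace Reach

variable {n n' a b c : ℕ}

theorem symm (h : Γ.Reach n a b) : Γ.Reach n b a := by
  obtain ⟨ha, hb, q, hq⟩ := h
  exact ⟨hb, ha, q.reverse, by simpa using hq⟩

theorem trans (h : Γ.Reach n a b) (h' : Γ.Reach n' b c) : Γ.Reach (n + n') a c := by
  obtain ⟨ha, hb, q, hq⟩ := h
  obtain ⟨_, hc, q', hq'⟩ := h'
  exact ⟨ha, hc, q.append q', by rw [SimpleGraph.Walk.length_append]; omega⟩

theorem refl (ha : a < Γ.nV) : Γ.Reach 0 a a := ⟨ha, ha, .nil, le_rfl⟩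

theorem of_keep (hc : c < 2 * Γ.nV) (hk : Γ.Keep c) : Γ.Reach 1 (Γ.fst c) (Γ.snd c) := by
  have h : Γ.inst.G.Adj ⟨Γ.fst c, hk.fst_lt hc⟩ ⟨Γ.snd c, hk.snd_lt hc⟩ :=
    adj_inst.2 ⟨fun he => hk.fst_ne_snd hc (congrArg Fin.val he), .inl ⟨c, hc, hk, rfl, rfl⟩⟩
  exact ⟨_, _, .cons h .nil, le_rfl⟩

theorem dist_le (h : Γ.Reach n a b) {u v : Fin Γ.inst.n} (hu : (u : ℕ) = a) (hv : (v : ℕ) = b) :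
    Γ.inst.dist u v ≤ n := by
  subst hu hv
  obtain ⟨_, _, q, hq⟩ := h
  refine (iInf_le _ q).trans ?_
  rw [walkLength_inst]
  exact_mod_cast hq

end Reach

theorem IsEdge.reach {i w x : ℕ} (h : Γ.IsEdge i w x) :
    Γ.Reach 1 (Γ.low i w x) (Γ.high i w x) := by
  obtain ⟨h1, h2, h3, h4⟩ := h.keep
  have := Reach.of_keep (by omega) h1
  rwa [h3, h4] at this

theorem nV_pos : 0 < Γ.nV := Nat.mul_pos (by omega) (Nat.mul_pos Γ.NN_pos Γ.X_pos)

variable (Γ) in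
/-- The tuple of the `i`-th edge on the way from the source with the values `a` to the target with
the values `b`. -/
def mixed (a b : ℕ → ℕ) (i : ℕ) : ℕ :=
  ofDig Γ.N (Γ.k - 1) fun p => if p < Γ.k - 1 - i then a p else b (p + 1)

section

variable {a b : ℕ → ℕ} {x : ℕ}

variable (Γ) in
/-- The coordinates `x` give a way of `k` edges from the source with the values `a` to the target
with the values `b`. -/
structure IsWay (a b : ℕ → ℕ) (x : ℕ) : Prop where
  a_lt : ∀ g, a g < Γ.N
  b_lt : ∀ g, b g < Γ.N
  x_lt : x < Γ.X
  bad_a : ∀ p < Γ.k - 1, ∀ j < Γ.k - 1, p ≤ j → Γ.bad p (a p) (dig Γ.d j x)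
  bad_b : ∀ p < Γ.k - 1, ∀ j < Γ.k - 1, j ≤ p → Γ.bad (p + 1) (b (p + 1)) (dig Γ.d j x)

theorem IsWay.mixed_lt (h : Γ.IsWay a b x) (i : ℕ) : Γ.mixed a b i < Γ.NN :=
  ofDig_lt fun p _ => by split_ifs; exacts [h.a_lt _, h.b_lt _]

theorem IsWay.dig_mixed (h : Γ.IsWay a b x) (i : ℕ) {p : ℕ} (hp : p < Γ.k - 1) :
    dig Γ.N p (Γ.mixed a b i) = if p < Γ.k - 1 - i then a p else b (p + 1) :=
  dig_ofDig (fun p _ => by split_ifs; exacts [h.a_lt _, h.b_lt _]) hp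

theorem IsWay.isEdge (h : Γ.IsWay a b x) {i : ℕ} (hi : i < Γ.k) :
    Γ.IsEdge i (Γ.mixed a b i) x := by
  refine ⟨hi, h.mixed_lt i, h.x_lt, fun p hp j hj => ⟨fun h1 h2 => ?_, fun h1 h2 => ?_⟩⟩
  · rw [h.dig_mixed i hp, if_pos h1]
    exact h.bad_a p hp j hj h2
  · rw [h.dig_mixed i hp, if_neg (by omega)]
    exact h.bad_b p hp j hj h2

theorem IsWay.high_eq (h : Γ.IsWay a b x) {i : ℕ} (hi : i + 1 < Γ.k) :
    Γ.high i (Γ.mixed a b i) x = Γ.low (i + 1) (Γ.mixed a b (i + 1)) x := by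
  have e : erase Γ.N (Γ.k - 2 - i) (Γ.mixed a b i) =
      erase Γ.N (Γ.k - 1 - (i + 1)) (Γ.mixed a b (i + 1)) := by
    refine eq_of_dig (K := Γ.k - 1) (N := Γ.N) (erase_lt (h.mixed_lt i))
      (erase_lt (h.mixed_lt (i + 1))) fun p hp => ?_
    rw [dig_erase Γ.N_pos (K := Γ.k - 1) (by omega) hp (h.mixed_lt _),
      dig_erase Γ.N_pos (K := Γ.k - 1) (by omega) hp (h.mixed_lt _), h.dig_mixed _ hp,
      h.dig_mixed _ hp]
    split_ifs <;> first | rfl | omega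
  rw [high, low, if_neg (by omega), if_neg (by omega), if_neg (by omega), e]

theorem IsWay.reach_low (h : Γ.IsWay a b x) {i : ℕ} (hi : i < Γ.k) :
    Γ.Reach i (Γ.enc 0 (ofDig Γ.N (Γ.k - 1) a) 0) (Γ.low i (Γ.mixed a b i) x) := by
  induction i with
  | zero =>
    have e : Γ.mixed a b 0 = ofDig Γ.N (Γ.k - 1) a :=
      ofDig_congr fun p hp => if_pos (by omega)
    rw [low, erase_of_le (h.mixed_lt 0) (by omega), e]
    exact .refl (enc_lt (by omega) (ofDig_lt fun p _ => h.a_lt p) Γ.X_pos)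
  | succ i ih =>
    rw [← h.high_eq hi]
    exact (ih (by omega)).trans (h.isEdge (by omega)).reach

theorem IsWay.reach (h : Γ.IsWay a b x) : Γ.Reach Γ.k (Γ.enc 0 (ofDig Γ.N (Γ.k - 1) a) 0)
    (Γ.enc Γ.k (ofDig Γ.N (Γ.k - 1) fun p => b (p + 1)) 0) := by
  have hk := Γ.two_le
  have h1 := (h.reach_low (i := Γ.k - 1) (by omega)).trans
    (h.isEdge (i := Γ.k - 1) (by omega)).reach
  have e : Γ.mixed a b (Γ.k - 1) = ofDig Γ.N (Γ.k - 1) fun p => b (p + 1) :=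
    ofDig_congr fun p _ => if_neg (by omega)
  rwa [high, if_pos rfl, if_pos rfl, Nat.sub_add_cancel (by omega), e] at h1

end

theorem ofDig_zero {N K : ℕ} : ofDig N K (fun _ => 0) = 0 := by simp [ofDig]

theorem enc_zero : Γ.enc 0 0 0 = 0 := by simp [enc]

/-- Every source is within distance `2 * (k - 1)` of the source `0`: on the way up to level `k - 1`
all its values are replaced by `0`. -/
theorem reach_source {w : ℕ} (hw : w < Γ.NN) : Γ.Reach (2 * (Γ.k - 1)) (Γ.enc 0 w 0) 0 := by
  have hk := Γ.two_le
  have hx : ∀ p < Γ.k - 1, Γ.unit (Γ.k - 1) < Γ.d := fun _ _ => Γ.unit_lt _ (by omega)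
  have key : ∀ a : ℕ → ℕ, (∀ g, a g < Γ.N) →
      Γ.IsWay a (fun _ => 0) (ofDig Γ.d (Γ.k - 1) fun _ => Γ.unit (Γ.k - 1)) := by
    refine fun a ha => ⟨ha, fun _ => Γ.N_pos, ofDig_lt hx, fun p hp j hj _ => ?_,
      fun _ _ _ _ _ => Γ.bad_zero _ _⟩
    rw [dig_ofDig hx hj]
    exact Γ.bad_unit _ _ _ (by omega)
  have e : ∀ a, Γ.mixed a (fun _ => 0) (Γ.k - 1) = Γ.mixed (fun _ => 0) (fun _ => 0) (Γ.k - 1) :=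
    fun a => ofDig_congr fun p _ => by rw [if_neg (by omega), if_neg (by omega)]
  have h1 := (key _ fun g => dig_lt Γ.N_pos g w).reach_low (i := Γ.k - 1) (by omega)
  have h2 := (key _ fun _ => Γ.N_pos).reach_low (i := Γ.k - 1) (by omega)
  rw [ofDig_dig Γ.N_pos hw, e] at h1
  rw [ofDig_zero, enc_zero] at h2
  rw [two_mul]
  exact h1.trans h2.symm

theorem reach_target {w : ℕ} (hw : w < Γ.NN) : Γ.Reach Γ.k 0 (Γ.enc Γ.k w 0) := by
  have hk := Γ.two_le
  have hx : ∀ p < Γ.k - 1, Γ.unit 0 < Γ.d := fun _ _ => Γ.unit_lt _ (by omega)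
  have h : Γ.IsWay (fun _ => 0) (fun g => dig Γ.N (g - 1) w)
      (ofDig Γ.d (Γ.k - 1) fun _ => Γ.unit 0) := by
    refine ⟨fun _ => Γ.N_pos, fun _ => dig_lt Γ.N_pos _ _, ofDig_lt hx,
      fun _ _ _ _ _ => Γ.bad_zero _ _, fun p hp j hj _ => ?_⟩
    rw [dig_ofDig hx hj]
    exact Γ.bad_unit _ _ _ (by omega)
  have := h.reach
  simp only [ofDig_zero, enc_zero, Nat.add_sub_cancel] at this
  rwa [ofDig_dig Γ.N_pos hw] at this

/-- If the problem has no solution, every target is within distance `k` of every source: the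
coordinate at position `j` is one that is bad for the first `j + 1` values of the source together
with the last `k - 1 - j` values of the target. -/
theorem reach_of_unsolvable
    (hno : ∀ A : ℕ → ℕ, (∀ g, A g < Γ.N) → ∃ c < Γ.d, ∀ g < Γ.k, Γ.bad g (A g) c) {w w' : ℕ}
    (hw : w < Γ.NN) (hw' : w' < Γ.NN) : Γ.Reach Γ.k (Γ.enc 0 w 0) (Γ.enc Γ.k w' 0) := by
  choose c hc hbad using fun j => hno (fun g => if g ≤ j then dig Γ.N g w else dig Γ.N (g - 1) w')
    fun g => by split_ifs <;> exact dig_lt Γ.N_pos _ _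
  have h : Γ.IsWay (fun g => dig Γ.N g w) (fun g => dig Γ.N (g - 1) w')
      (ofDig Γ.d (Γ.k - 1) c) := by
    refine ⟨fun _ => dig_lt Γ.N_pos _ _, fun _ => dig_lt Γ.N_pos _ _, ofDig_lt fun j _ => hc j,
      fun p hp j hj hpj => ?_, fun p hp j hj hpj => ?_⟩
    · have := hbad j p (by omega)
      rwa [if_pos hpj, ← dig_ofDig (fun j _ => hc j) hj] at this
    · have := hbad j (p + 1) (by omega)
      rwa [if_neg (by omega), ← dig_ofDig (fun j _ => hc j) hj] at this
  have := h.reach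
  simp only [Nat.add_sub_cancel] at this
  rwa [ofDig_dig Γ.N_pos hw, ofDig_dig Γ.N_pos hw'] at this

theorem exists_reach_zero {z : ℕ} (hz : z < Γ.nV) : ∃ n, Γ.Reach n z 0 := by
  obtain ⟨r, hr⟩ : ∃ r, r = Γ.k - Γ.lev z := ⟨_, rfl⟩
  have hk := Γ.two_le
  induction r using Nat.strong_induction_on generalizing z with
  | _ r ih =>
    by_cases hp : Γ.Proper z
    · have hz' := enc_dec (Γ := Γ) z
      rcases hp with ⟨h1 | h1, h2⟩ | ⟨h1, h2, h3, h4⟩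
      · rw [h1, h2] at hz'
        rw [← hz']
        exact ⟨_, reach_source (wd_lt z)⟩
      · rw [h1, h2] at hz'
        rw [← hz']
        exact ⟨_, (reach_target (wd_lt z)).symm⟩
      · have h : Γ.IsEdge (Γ.lev z) (Γ.wd z) (Γ.xd z) := ⟨h2, wd_lt z, xd_lt z, h4⟩
        have e : Γ.low (Γ.lev z) (Γ.wd z) (Γ.xd z) = z := by
          rw [low, erase_of_dig h3, if_neg h1, hz']
        obtain ⟨n, hn⟩ := ih (Γ.k - (Γ.lev z + 1)) (by omega) h.high_lt (by rw [h.lev_high])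
        have := h.reach
        rw [e] at this
        exact ⟨_, this.trans hn⟩
    · have hk : Γ.Keep (Γ.nV + z) := by
        rw [Keep, if_neg (by omega), Nat.add_sub_cancel_left]
        exact hp
      have := Reach.of_keep (by omega) hk
      rw [fst, snd, if_neg (by omega), if_neg (by omega), Nat.add_sub_cancel_left] at this
      exact ⟨_, this.symm⟩

theorem mem_T {t : Fin Γ.inst.n} : t ∈ Γ.inst.T ↔ ∃ w < Γ.NN, (t : ℕ) = Γ.enc Γ.k w 0 := by
  have h : t ∈ Γ.inst.T ↔ Γ.lev t = Γ.k ∧ Γ.xd t = 0 :=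
    Finset.mem_filter.trans (and_iff_right (Finset.mem_univ t))
  rw [h]
  constructor
  · rintro ⟨h1, h2⟩
    exact ⟨_, wd_lt t, by rw [← h1, ← h2, enc_dec]⟩
  · rintro ⟨w, hw, ht⟩
    rw [ht, lev_enc hw Γ.X_pos, xd_enc Γ.X_pos]
    exact ⟨rfl, rfl⟩

theorem mem_S {s : Fin Γ.inst.n} : s ∈ Γ.inst.S ↔ s ∉ Γ.inst.T :=
  Finset.mem_compl

theorem source_mem_S {s : Fin Γ.inst.n} {w : ℕ} (hw : w < Γ.NN) (hs : (s : ℕ) = Γ.enc 0 w 0) :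
    s ∈ Γ.inst.S := by
  rw [mem_S, mem_T]
  rintro ⟨w', hw', h⟩
  have := congrArg Γ.lev (hs.symm.trans h)
  rw [lev_enc hw Γ.X_pos, lev_enc hw' Γ.X_pos] at this
  have := Γ.two_le
  omega

theorem isUnweightedBichromatic : Γ.inst.IsUnweightedBichromatic := by
  refine ⟨?_, fun _ => rfl, ?_, ?_, ?_⟩
  · have : Nonempty (Fin Γ.inst.n) := ⟨⟨0, nV_pos⟩⟩
    have key : ∀ u : Fin Γ.inst.n, Γ.inst.G.Reachable u ⟨0, nV_pos⟩ := fun u => by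
      obtain ⟨n, _, _, q, _⟩ := exists_reach_zero u.2
      exact ⟨q⟩
    exact ⟨fun u v => (key u).trans (key v).symm⟩
  · exact ⟨⟨0, nV_pos⟩, source_mem_S Γ.NN_pos enc_zero.symm⟩
  · exact ⟨⟨_, enc_lt le_rfl Γ.NN_pos Γ.X_pos⟩, mem_T.2 ⟨0, Γ.NN_pos, rfl⟩⟩
  · ext t
    rw [Finset.mem_compl, mem_S, not_not]

theorem ecc_le {s : Fin Γ.inst.n} {w n : ℕ} (hs : (s : ℕ) = Γ.enc 0 w 0)
    (h : ∀ w' < Γ.NN, Γ.Reach n (Γ.enc 0 w 0) (Γ.enc Γ.k w' 0)) : Γ.inst.ecc s ≤ n :=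
  iSup₂_le fun t ht => by
    obtain ⟨w', hw', ht'⟩ := mem_T.1 ht
    exact (h w' hw').dist_le hs ht'

theorem le_ecc {s t : Fin Γ.inst.n} {n : ℕ} (ht : t ∈ Γ.inst.T)
    (h : ∀ q : Γ.inst.G.Walk s t, n ≤ q.length) : (n : ℕ∞) ≤ Γ.inst.ecc s := by
  refine le_trans (le_iInf fun q => ?_) (le_iSup₂ (f := fun t _ => Γ.inst.dist s t) t ht)
  rw [walkLength_inst]
  exact_mod_cast h q

theorem ecc_of_unsolvable
    (hno : ∀ A : ℕ → ℕ, (∀ g, A g < Γ.N) → ∃ c < Γ.d, ∀ g < Γ.k, Γ.bad g (A g) c)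
    {s : Fin Γ.inst.n} {w : ℕ} (hw : w < Γ.NN) (hs : (s : ℕ) = Γ.enc 0 w 0) :
    Γ.inst.ecc s = Γ.k :=
  le_antisymm (ecc_le hs fun _ hw' => reach_of_unsolvable hno hw hw')
    (le_ecc (t := ⟨_, enc_lt le_rfl Γ.NN_pos Γ.X_pos⟩) (mem_T.2 ⟨0, Γ.NN_pos, rfl⟩) fun q =>
      k_le_length hw Γ.NN_pos hs rfl q)

theorem ecc_of_solution {A : ℕ → ℕ} (hA : ∀ g, A g < Γ.N)
    (hsol : ∀ c < Γ.d, ∃ g < Γ.k, ¬ Γ.bad g (A g) c) {s : Fin Γ.inst.n}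
    (hs : (s : ℕ) = Γ.enc 0 (ofDig Γ.N (Γ.k - 1) A) 0) :
    Γ.inst.ecc s = (3 * Γ.k - 2 : ℕ) := by
  have hwv : (ofDig Γ.N (Γ.k - 1) fun p => A (p + 1)) < Γ.NN := ofDig_lt fun p _ => hA (p + 1)
  refine le_antisymm (ecc_le hs fun w' hw' => ?_)
    (le_ecc (t := ⟨_, enc_lt le_rfl hwv Γ.X_pos⟩) (mem_T.2 ⟨_, hwv, rfl⟩) fun q =>
      three_mul_le_length hA hsol hs rfl q)
  have := Γ.two_le
  rw [show 3 * Γ.k - 2 = 2 * (Γ.k - 1) + Γ.k by omega]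
  exact (reach_source (ofDig_lt fun p _ => hA p)).trans (reach_target hw')

end TupleProblem

/-! ### Satisfiability as a tuple problem -/

namespace CNF

variable (φ : CNF)

theorem init_mem_ne_zero {b : Bool} {j v : ℕ} (hj : j < φ.numClauses) (hv : v < φ.numVars) :
    φ.init.mem (if b then 0 else 1) (j * φ.numVars + v) ≠ 0 ↔
      ((⟨v, hv⟩, b) : Fin φ.numVars × Bool) ∈ φ.clause ⟨j, hj⟩ := by
  have key : (∃ (j' : Fin φ.numClauses) (v' : Fin φ.numVars),
      j * φ.numVars + v = j' * φ.numVars + v' ∧ (v', b) ∈ φ.clause j') ↔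
      ((⟨v, hv⟩, b) : Fin φ.numVars × Bool) ∈ φ.clause ⟨j, hj⟩ := by
    constructor
    · rintro ⟨j', v', h, hm⟩
      have h1 := congrArg (· / φ.numVars) h
      have h2 := congrArg (· % φ.numVars) h
      simp only [mul_comm _ φ.numVars, Nat.mul_add_div (by omega : 0 < φ.numVars),
        Nat.div_eq_of_lt hv, Nat.div_eq_of_lt v'.2, Nat.mul_add_mod, Nat.mod_eq_of_lt hv,
        Nat.mod_eq_of_lt v'.2, add_zero] at h1 h2
      have e1 : j' = ⟨j, hj⟩ := Fin.ext h1.symm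
      have e2 : v' = ⟨v, hv⟩ := Fin.ext h2.symm
      rwa [e1, e2] at hm
    · exact fun h => ⟨⟨j, hj⟩, ⟨v, hv⟩, rfl, h⟩
  cases b
  · simpa [CNF.init] using key
  · simpa [CNF.init] using key

variable (k : ℕ)

/-- The number of variables in each of the `k` groups. -/
def groupSize : ℕ := φ.numVars / k + 1

/-- The value `A` of group `g` covers the coordinate `c`. The value `0` covers nothing; the value
`A + 1` stands for the assignment of the variables `g * h, …, g * h + h - 1` (`h` is the group size)
given by the binary digits of `A`, and it covers the clauses that this assignment satisfies and one
more coordinate that belongs to the group. -/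
def Covers (g A c : ℕ) : Prop :=
  A ≠ 0 ∧ ((c < φ.numClauses ∧ ∃ v < φ.groupSize k, g * φ.groupSize k + v < φ.numVars ∧
    φ.init.mem (if dig 2 v (A - 1) = 1 then 0 else 1)
      (c * φ.numVars + (g * φ.groupSize k + v)) ≠ 0) ∨ c = φ.numClauses + g)

/-- The tuple problem whose solutions are the satisfying assignments. -/
def tupleProblem {k : ℕ} (hk : 2 ≤ k) : TupleProblem where
  k := k
  N := 2 ^ φ.groupSize k + 1
  d := φ.numClauses + k
  bad g A c := ¬ φ.Covers k g A c
  unit g := φ.numClauses + g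
  two_le := hk
  N_pos := by positivity
  bad_zero g c h := h.1 rfl
  unit_lt g hg := by omega
  bad_unit := by
    rintro g g' A hne ⟨_, h | h⟩
    · omega
    · omega

theorem numVars_lt {k : ℕ} (hk : 2 ≤ k) : φ.numVars < k * φ.groupSize k := by
  rw [groupSize, mul_add_one]
  have := Nat.div_add_mod φ.numVars k
  have := Nat.mod_lt φ.numVars (by omega : 0 < k)
  omega

theorem groupSize_pos : 0 < φ.groupSize k := Nat.succ_pos _

theorem satisfiable_iff {k : ℕ} (hk : 2 ≤ k) : φ.Satisfiable ↔
    ∃ A : ℕ → ℕ, (∀ g, A g < (φ.tupleProblem hk).N) ∧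
      ∀ c < (φ.tupleProblem hk).d, ∃ g < (φ.tupleProblem hk).k,
        ¬ (φ.tupleProblem hk).bad g (A g) c := by
  simp only [tupleProblem, not_not]
  have hn := φ.numVars_lt hk
  have hh := φ.groupSize_pos k
  set h := φ.groupSize k with hdef
  constructor
  · rintro ⟨τ, hτ⟩
    set f : ℕ → ℕ → ℕ := fun g v => if hv : g * h + v < φ.numVars then (τ ⟨_, hv⟩).toNat else 0
      with hf
    have hf2 : ∀ g, ∀ v < h, f g v < 2 := by
      intro g v _
      simp only [hf]
      split_ifs
      · exact Bool.toNat_lt _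
      · norm_num
    refine ⟨fun g => ofDig 2 h (f g) + 1, fun g => Nat.succ_lt_succ (ofDig_lt (hf2 g)),
      fun c hc => ?_⟩
    by_cases hcM : c < φ.numClauses
    · obtain ⟨⟨v, b⟩, hl, hv⟩ := hτ ⟨c, hcM⟩
      have hvh := Nat.mod_lt v.1 hh
      have hdm := Nat.div_add_mod' v.1 h
      refine ⟨v / h, (Nat.div_lt_iff_lt_mul hh).2 (by have := v.2; omega), Nat.succ_ne_zero _,
        .inl ⟨hcM, v % h, hvh, by rw [hdm]; exact v.2, ?_⟩⟩
      have hd : dig 2 (v % h) (ofDig 2 h (f (v / h)) + 1 - 1) = b.toNat := by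
        rw [Nat.add_sub_cancel, dig_ofDig (hf2 _) hvh]
        simp only [hf, hdm, v.2, dif_pos]
        exact congrArg Bool.toNat hv
      have := (φ.init_mem_ne_zero (b := b) hcM v.2).2 hl
      simp only [hd]
      rw [← hdef, hdm]
      cases b <;> simpa using this
    · exact ⟨c - φ.numClauses, by omega, Nat.succ_ne_zero _, .inr (by omega)⟩
  · rintro ⟨A, _, hA⟩
    refine ⟨fun v => decide (dig 2 (v % h) (A (v / h) - 1) = 1), fun j => ?_⟩
    obtain ⟨g, _, _, ⟨_, v, hv, hgv, hm⟩ | h3⟩ := hA j (by omega)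
    · refine ⟨(⟨g * h + v, hgv⟩, decide (dig 2 v (A g - 1) = 1)), ?_, ?_⟩
      · refine (φ.init_mem_ne_zero j.2 hgv).1 ?_
        simpa using hm
      · have e1 : (g * h + v) / h = g := by
          rw [mul_comm, Nat.mul_add_div hh, Nat.div_eq_of_lt hv, add_zero]
        have e2 : (g * h + v) % h = v := by rw [mul_comm, Nat.mul_add_mod, Nat.mod_eq_of_lt hv]
        simp only [e1, e2]
    · omega

/-- If the formula is satisfiable, the source given by a satisfying assignment has eccentricity
`3 * k - 2`. -/
theorem exists_ecc_of_satisfiable {k : ℕ} (hk : 2 ≤ k) (h : φ.Satisfiable) :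
    ∃ w < (φ.tupleProblem hk).NN, ∀ s : Fin (φ.tupleProblem hk).inst.n,
      (s : ℕ) = (φ.tupleProblem hk).enc 0 w 0 →
        (φ.tupleProblem hk).inst.ecc s = (3 * k - 2 : ℕ) := by
  obtain ⟨A, hA, hsol⟩ := (φ.satisfiable_iff hk).1 h
  exact ⟨_, ofDig_lt fun p _ => hA p, fun s hs => TupleProblem.ecc_of_solution hA hsol hs⟩

/-- If the formula is not satisfiable, all sources have eccentricity `k`. -/
theorem ecc_of_not_satisfiable {k : ℕ} (hk : 2 ≤ k) (h : ¬ φ.Satisfiable) {w : ℕ}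
    (hw : w < (φ.tupleProblem hk).NN) {s : Fin (φ.tupleProblem hk).inst.n}
    (hs : (s : ℕ) = (φ.tupleProblem hk).enc 0 w 0) :
    (φ.tupleProblem hk).inst.ecc s = k := by
  refine TupleProblem.ecc_of_unsolvable (fun A hA => ?_) hw hs
  by_contra hc
  push Not at hc
  exact h ((φ.satisfiable_iff hk).2 ⟨A, hA, hc⟩)

end CNF

/-! ### A program that writes the layered graph of a formula -/

namespace WordRAM

open Ex (reg ld)

/-- Register and memory contents that are fixed while the layered graph of a formula is written: the
sizes of the formula and of its tuple problem, the formula and the powers of `N` and `d`. -/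
structure Ready (φ : CNF) {k : ℕ} (hk : 2 ≤ k) (B : ℕ) (σ : State) : Prop where
  vars : σ.reg 0 = φ.numVars
  clauses : σ.reg 1 = φ.numClauses
  size : σ.reg 3 = φ.groupSize k
  N : σ.reg 4 = (φ.tupleProblem hk).N
  d : σ.reg 5 = (φ.tupleProblem hk).d
  NN : σ.reg 6 = (φ.tupleProblem hk).NN
  X : σ.reg 7 = (φ.tupleProblem hk).X
  nV : σ.reg 8 = (φ.tupleProblem hk).nV
  len : σ.reg 10 = k - 1
  cands : σ.reg 13 = 2 * (φ.tupleProblem hk).nV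
  pos : σ.mem 0 = φ.init.mem 0
  neg : σ.mem 1 = φ.init.mem 1
  powN : ∀ p < k, σ.mem 2 p = (φ.tupleProblem hk).N ^ p
  powd : ∀ p < k, σ.mem 3 p = (φ.tupleProblem hk).d ^ p
  big : 4 * (φ.tupleProblem hk).nV +
    (φ.numClauses + 2 * k + 2) * (φ.numVars + 2 * k + 2) + 10 < B

section

variable {φ : CNF} {k : ℕ} {hk : 2 ≤ k} {B : ℕ} {σ σ' : State}

theorem Ready.congr (H : Ready φ hk B σ)
    (hr : ∀ r ∈ [0, 1, 3, 4, 5, 6, 7, 8, 10, 13], σ'.reg r = σ.reg r)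
    (hm : ∀ k ∈ [0, 1, 2, 3], σ'.mem k = σ.mem k) : Ready φ hk B σ' := by
  simp only [List.mem_cons, List.not_mem_nil, or_false, forall_eq_or_imp, forall_eq] at hr hm
  obtain ⟨r0, r1, r3, r4, r5, r6, r7, r8, r10, r13⟩ := hr
  obtain ⟨m0, m1, m2, m3⟩ := hm
  exact ⟨r0.trans H.vars, r1.trans H.clauses, r3.trans H.size, r4.trans H.N, r5.trans H.d,
    r6.trans H.NN, r7.trans H.X, r8.trans H.nV, r10.trans H.len, r13.trans H.cands,
    m0.trans H.pos, m1.trans H.neg, by rw [m2]; exact H.powN, by rw [m3]; exact H.powd, H.big⟩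

theorem Ready.frame {c : Cmd} (H : Ready φ hk B σ) (hF : c.Frame σ σ')
    (hr : ([0, 1, 3, 4, 5, 6, 7, 8, 10, 13].all fun r => !c.wr r) = true)
    (hm : ([0, 1, 2, 3].all fun k => !c.wm k) = true) : Ready φ hk B σ' :=
  H.congr (fun r h => hF.reg r (by simpa using List.all_eq_true.1 hr r h))
    (fun k h => hF.mem k (by simpa using List.all_eq_true.1 hm k h))

/-- Crude bounds for the numbers that occur. -/
theorem Ready.bounds (H : Ready φ hk B σ) :
    (φ.numClauses + 2 * k + 2) * (φ.numVars + 2 * k + 2) < B ∧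
    (φ.numClauses + 2 * k + 2) + (φ.numVars + 2 * k + 2) ≤
      (φ.numClauses + 2 * k + 2) * (φ.numVars + 2 * k + 2) ∧
    k * φ.groupSize k ≤ φ.numVars + k := by
  refine ⟨by have := H.big; omega, ?_, ?_⟩
  · have h1 : ∀ a b : ℕ, a + 2 + (b + 2) ≤ (a + 2) * (b + 2) := fun a b => by nlinarith
    exact h1 _ _
  · rw [CNF.groupSize, mul_add_one]
    have := Nat.mul_div_le φ.numVars k
    omega

end

namespace Ex

/-- The shift of `a` to the right by `b` binary digits. -/
def shr (a b : Ex) : Ex := .bin .shr a b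

@[simp] theorem eval_shr (σ : State) (a b : Ex) :
    (a.shr b).eval σ = a.eval σ / 2 ^ b.eval σ := Nat.shiftRight_eq_div_pow _ _

@[simp] theorem fits_shr (B : ℕ) (σ : State) (a b : Ex) :
    (a.shr b).Fits B σ ↔ a.Fits B σ ∧ b.Fits B σ :=
  ⟨fun h => ⟨h.1, h.2.1⟩, fun h => ⟨h.1, h.2, trivial⟩⟩

end Ex

/-- Set register `24` to a nonzero value iff the value in register `21` of the group in register
`23` covers the coordinate in register `22`. -/
def checkCovers : Cmd :=
  .set 24 0 ;;
  .ite (reg 21)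
    (.ite (.lt (reg 22) (reg 1))
      (.forTo 25 3
        (.ite (.lt (reg 23 * reg 3 + reg 25) (reg 0))
          (.ite (((reg 21 - 1).shr (reg 25) % 2).eq 1)
            (.ite (ld 0 (reg 22 * reg 0 + (reg 23 * reg 3 + reg 25))) (.set 24 1) .skip)
            (.ite (ld 1 (reg 22 * reg 0 + (reg 23 * reg 3 + reg 25))) (.set 24 1) .skip))
          .skip))
      (.ite (.eq (reg 22) (reg 1 + reg 23)) (.set 24 1) .skip))
    .skip

theorem wp_checkCovers {φ : CNF} {k : ℕ} {hk : 2 ≤ k} {B g A c : ℕ} {σ : State} {t : ℕ}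
    (H : Ready φ hk B σ) (hA : σ.reg 21 = A) (hc : σ.reg 22 = c) (hg : σ.reg 23 = g) (hgk : g < k) :
    checkCovers.wp B (fun σ' t' => (σ'.reg 24 ≠ 0 ↔ φ.Covers k g A c) ∧
      t' ≤ t + (φ.groupSize k * 6 + 6)) σ t := by
  obtain ⟨b1, b2, b3⟩ := H.bounds
  have hgh : g * φ.groupSize k + φ.groupSize k ≤ φ.numVars + k := by
    rw [← add_one_mul]
    exact (Nat.mul_le_mul_right _ hgk).trans b3
  refine ⟨by simp, by simp, fun h0 => ⟨by simp, fun h1 => ?_, fun h1 => ?_⟩, fun h0 => ?_⟩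
  · have hA0 : A ≠ 0 := by simpa [hA] using h0
    have hcM : c < φ.numClauses := by simpa [hc, H.clauses] using h1
    have hcn : c * φ.numVars + (φ.numVars + k) < B := by
      refine lt_of_le_of_lt ?_ b1
      calc c * φ.numVars + (φ.numVars + k) ≤ (c + 1) * (φ.numVars + 2 * k + 2) := by nlinarith
        _ ≤ _ := Nat.mul_le_mul_right _ (by omega)
    refine Cmd.wp_forTo_le (φ.groupSize k) 4 (fun i σ' => σ'.reg 24 ≠ 0 ↔
      ∃ v < i, g * φ.groupSize k + v < φ.numVars ∧
        φ.init.mem (if dig 2 v (A - 1) = 1 then 0 else 1)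
          (c * φ.numVars + (g * φ.groupSize k + v)) ≠ 0)
      (by omega) (by simp [H.size]) rfl rfl rfl (by simp) ?_ ?_
    · intro v hv σ' t' hF hr hI
      have r0 : σ'.reg 0 = φ.numVars := (hF.reg 0 rfl).trans (by simp [H.vars])
      have r3 : σ'.reg 3 = φ.groupSize k := (hF.reg 3 rfl).trans (by simp [H.size])
      have r21 : σ'.reg 21 = A := (hF.reg 21 rfl).trans (by simp [hA])
      have r22 : σ'.reg 22 = c := (hF.reg 22 rfl).trans (by simp [hc])
      have r23 : σ'.reg 23 = g := (hF.reg 23 rfl).trans (by simp [hg])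
      have m0 : σ'.mem 0 = φ.init.mem 0 := (hF.mem 0 rfl).trans (by simp [H.pos])
      have m1 : σ'.mem 1 = φ.init.mem 1 := (hF.mem 1 rfl).trans (by simp [H.neg])
      have hsucc : (∃ v' < v + 1, g * φ.groupSize k + v' < φ.numVars ∧
          φ.init.mem (if dig 2 v' (A - 1) = 1 then 0 else 1)
            (c * φ.numVars + (g * φ.groupSize k + v')) ≠ 0) ↔ σ'.reg 24 ≠ 0 ∨
          (g * φ.groupSize k + v < φ.numVars ∧
          φ.init.mem (if dig 2 v (A - 1) = 1 then 0 else 1)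
            (c * φ.numVars + (g * φ.groupSize k + v)) ≠ 0) := by
        rw [hI]
        constructor
        · rintro ⟨v', h1, h2⟩
          rcases Nat.lt_succ_iff_lt_or_eq.1 h1 with h | rfl
          · exact .inl ⟨v', h, h2⟩
          · exact .inr h2
        · rintro (⟨v', h1, h2⟩ | h2)
          · exact ⟨v', by omega, h2⟩
          · exact ⟨v, by omega, h2⟩
      refine ⟨by simp [r23, r3, hr]; omega, fun h2 => ⟨by simp, fun h3 => ?_, fun h3 => ?_⟩,
        fun h2 => ⟨?_, by omega⟩⟩
      · have h2' : g * φ.groupSize k + v < φ.numVars := by simpa [r23, r3, hr, r0] using h2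
        have h3' : dig 2 v (A - 1) = 1 := by simpa [r21, hr, dig] using h3
        refine ⟨by simp [r22, r23, r3, hr, r0]; omega, fun h4 => ⟨by simp, ?_, by omega⟩,
          fun h4 => ⟨?_, by omega⟩⟩
        · have h4' : φ.init.mem 0 (c * φ.numVars + (g * φ.groupSize k + v)) ≠ 0 := by
            simpa [r22, r23, r3, hr, r0, m0] using h4
          simp only [State.setReg_reg, hsucc, h3', if_true]
          simp [h2', h4']
        · have h4' : φ.init.mem 0 (c * φ.numVars + (g * φ.groupSize k + v)) = 0 := by
            simpa [r22, r23, r3, hr, r0, m0] using h4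
          simp only [State.setReg_reg, hsucc, h3', if_true]
          simp [h4']
      · have h2' : g * φ.groupSize k + v < φ.numVars := by simpa [r23, r3, hr, r0] using h2
        have h3' : ¬ dig 2 v (A - 1) = 1 := by simpa [r21, hr, dig] using h3
        refine ⟨by simp [r22, r23, r3, hr, r0]; omega, fun h4 => ⟨by simp, ?_, by omega⟩,
          fun h4 => ⟨?_, by omega⟩⟩
        · have h4' : φ.init.mem 1 (c * φ.numVars + (g * φ.groupSize k + v)) ≠ 0 := by
            simpa [r22, r23, r3, hr, r0, m1] using h4
          simp only [State.setReg_reg, hsucc, if_neg h3']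
          simp [h2', h4']
        · have h4' : φ.init.mem 1 (c * φ.numVars + (g * φ.groupSize k + v)) = 0 := by
            simpa [r22, r23, r3, hr, r0, m1] using h4
          simp only [State.setReg_reg, hsucc, if_neg h3']
          simp [h4']
      · have h2' : ¬ g * φ.groupSize k + v < φ.numVars := by simpa [r23, r3, hr, r0] using h2
        simp only [State.setReg_reg, hsucc, h2']
        simp
    · intro σ' t' hF hI ht
      refine ⟨hI.trans ?_, by omega⟩
      simp only [CNF.Covers, hA0, hcM, ne_eq, not_false_eq_true, true_and]
      exact ⟨.inl, fun h => h.resolve_right (by omega)⟩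
  · have hA0 : A ≠ 0 := by simpa [hA] using h0
    have hcM : ¬ c < φ.numClauses := by simpa [hc, H.clauses] using h1
    refine ⟨by simp [H.clauses, hg]; omega, fun h2 => ⟨by simp, ?_, by omega⟩,
      fun h2 => ⟨?_, by omega⟩⟩
    · have h2' : c = φ.numClauses + g := by simpa [hc, H.clauses, hg] using h2
      simp [CNF.Covers, hA0, h2']
    · have h2' : ¬ c = φ.numClauses + g := by simpa [hc, H.clauses, hg] using h2
      simp [CNF.Covers, hA0, h2', hcM]
  · have hA0 : A = 0 := by simpa [hA] using h0
    refine ⟨?_, by omega⟩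
    simp [CNF.Covers, hA0]

/-- The part of the condition `TupleProblem.Valid` that concerns the positions `p` and `j`. -/
def _root_.TupleProblem.ValidAt (Γ : TupleProblem) (i w x p j : ℕ) : Prop :=
  (p < Γ.k - 1 - i → p ≤ j → Γ.bad p (dig Γ.N p w) (dig Γ.d j x)) ∧
    (Γ.k - 1 - i ≤ p → j ≤ p → Γ.bad (p + 1) (dig Γ.N p w) (dig Γ.d j x))

/-- Set register `18` to `0` unless the tuples in registers `15` and `16` satisfy the condition for
an edge from the level in register `14`. -/
def checkValid : Cmd :=
  .set 17 (reg 10 - reg 14) ;;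
  .set 18 1 ;;
  .forTo 19 10 (
    .forTo 20 10 (
      .set 21 (reg 15 / ld 2 (reg 19) % reg 4) ;;
      .set 22 (reg 16 / ld 3 (reg 20) % reg 5) ;;
      .ite (.lt (reg 19) (reg 17))
        (.set 23 (reg 19) ;; .set 26 (.lt (reg 20) (reg 19)))
        (.set 23 (reg 19 + 1) ;; .set 26 (.lt (reg 19) (reg 20))) ;;
      .ite (reg 26) .skip (checkCovers ;; .ite (reg 24) (.set 18 0) .skip)))

/-- The number of steps of `checkValid`. -/
def validTime (φ : CNF) (k : ℕ) : ℕ := k * (k * (φ.groupSize k * 6 + 20) + 10) + 10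

theorem wp_checkValid {φ : CNF} {k : ℕ} {hk : 2 ≤ k} {B i w x : ℕ} {σ : State} {t : ℕ}
    (H : Ready φ hk B σ) (hi : σ.reg 14 = i) (hw : σ.reg 15 = w) (hx : σ.reg 16 = x) :
    checkValid.wp B (fun σ' t' => (σ'.reg 18 ≠ 0 ↔ (φ.tupleProblem hk).Valid i w x) ∧
      σ'.reg 17 = k - 1 - i ∧ t' ≤ t + validTime φ k) σ t := by
  set Γ := φ.tupleProblem hk with hΓ
  have hΓk : Γ.k = k := rfl
  obtain ⟨b1, b2, b3⟩ := H.bounds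
  refine ⟨by simp, by simp, Cmd.wp_forTo_le (k - 1) ((k - 1) * (φ.groupSize k * 6 + 6 + 10) + 2)
    (fun p σ' => σ'.reg 18 ≠ 0 ↔ ∀ p' < p, ∀ j < k - 1, Γ.ValidAt i w x p' j)
    (by omega) (by simp [H.len]) rfl rfl rfl (by simp) ?_ ?_⟩
  · intro p hp σ₁ t₁ hF₁ hr₁ hI₁
    have H₁ : Ready φ hk B σ₁ := (H.congr (by simp) (by simp)).frame hF₁ rfl rfl
    have h17 : σ₁.reg 17 = k - 1 - i := by
      rw [hF₁.reg 17 rfl]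
      simp [H.len, hi]
    have h15 : σ₁.reg 15 = w := by
      rw [hF₁.reg 15 rfl]
      simp [hw]
    have h16 : σ₁.reg 16 = x := by
      rw [hF₁.reg 16 rfl]
      simp [hx]
    refine Cmd.wp_forTo_le (k - 1) (φ.groupSize k * 6 + 6 + 8)
      (fun j σ' => σ'.reg 18 ≠ 0 ↔ (∀ p' < p, ∀ j < k - 1, Γ.ValidAt i w x p' j) ∧
        ∀ j' < j, Γ.ValidAt i w x p j') (by omega) H₁.len rfl rfl rfl (by simp [hI₁]) ?_ ?_
    · intro j hj σ₂ t₂ hF₂ hr₂ hI₂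
      have H₂ : Ready φ hk B σ₂ := H₁.frame hF₂ rfl rfl
      have h17' : σ₂.reg 17 = k - 1 - i := (hF₂.reg 17 rfl).trans h17
      have h15' : σ₂.reg 15 = w := (hF₂.reg 15 rfl).trans h15
      have h16' : σ₂.reg 16 = x := (hF₂.reg 16 rfl).trans h16
      have h19' : σ₂.reg 19 = p := (hF₂.reg 19 rfl).trans hr₁
      have hsucc : ((∀ p' < p, ∀ j < k - 1, Γ.ValidAt i w x p' j) ∧
          ∀ j' < j + 1, Γ.ValidAt i w x p j') ↔ σ₂.reg 18 ≠ 0 ∧ Γ.ValidAt i w x p j := by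
        rw [hI₂, and_assoc]
        refine and_congr_right fun _ => ⟨fun h => ⟨fun j' hj' => h j' (by omega), h j (by omega)⟩,
          fun h j' hj' => ?_⟩
        rcases Nat.lt_succ_iff_lt_or_eq.1 hj' with h' | rfl
        · exact h.1 j' h'
        · exact h.2
      refine ⟨by simp, by simp, ?_⟩
      refine Cmd.wp_seq (P := fun σ' t' => t' ≤ t₂ + 5 ∧ σ'.reg 21 = dig Γ.N p w ∧
        σ'.reg 22 = dig Γ.d j x ∧ σ'.reg 23 < k ∧
        (σ'.reg 26 ≠ 0 → Γ.ValidAt i w x p j) ∧ (σ'.reg 26 = 0 → (Γ.ValidAt i w x p j ↔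
          Γ.bad (σ'.reg 23) (dig Γ.N p w) (dig Γ.d j x)))) (σ := (σ₂.setReg 21 _).setReg 22 _) ?_ ?_
      · have e21 : w / σ₂.mem 2 p % σ₂.reg 4 = dig Γ.N p w := by
          rw [H₂.powN p (by omega), H₂.N]; rfl
        have e22 : x / σ₂.mem 3 j % σ₂.reg 5 = dig Γ.d j x := by
          rw [H₂.powd j (by omega), H₂.d]; rfl
        refine ⟨by simp, fun hlt => ⟨by simp, by simp, by omega, ?_⟩,
          fun hlt => ⟨by simp [h19']; omega, by simp, by omega, ?_⟩⟩
        · have hlt' : p < k - 1 - i := by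
            have h2 := hlt
            simp [h19', h17'] at h2
            omega
          refine ⟨by simp [h15', h19', e21], by simp [h16', hr₂, e22], by simp [h19']; omega,
            fun h => ?_, fun h => ?_⟩
          · have h' : j < p := by simpa [h19', hr₂] using h
            exact ⟨fun _ h2 => by omega, fun h2 => by omega⟩
          · have h' : p ≤ j := by simpa [h19', hr₂] using h
            simp only [State.setReg_reg, Nat.reduceEqDiff, ↓reduceIte, Ex.eval_reg, h19']
            exact ⟨fun h => h.1 hlt' h',
              fun h => ⟨fun _ _ => h, fun h2 => absurd hlt' (not_lt.2 h2)⟩⟩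
        · have hlt' : k - 1 - i ≤ p := by
            have h2 := hlt
            simp [h19', h17'] at h2
            omega
          refine ⟨by simp [h15', h19', e21], by simp [h16', hr₂, e22], by simp [h19']; omega,
            fun h => ?_, fun h => ?_⟩
          · have h' : p < j := by simpa [h19', hr₂] using h
            exact ⟨fun h2 => by omega, fun _ h2 => by omega⟩
          · have h' : j ≤ p := by simpa [h19', hr₂] using h
            simp only [State.setReg_reg, Nat.reduceEqDiff, ↓reduceIte, Ex.eval_reg, Ex.eval_add,
              Ex.eval_ofNat, h19']
            exact ⟨fun h => h.2 hlt' h',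
              fun h => ⟨fun h2 => absurd h2 (not_lt.2 hlt'), fun _ _ => h⟩⟩
      · rintro σ₃ t₃ hF₃ ⟨ht₃, g1, g2, g3, g4, g5⟩
        have H₃ : Ready φ hk B σ₃ := (H₂.congr (by simp) (by simp)).frame hF₃ rfl rfl
        have g18 : σ₃.reg 18 = σ₂.reg 18 := (hF₃.reg 18 rfl).trans (by simp)
        refine ⟨by simp, fun h => ⟨?_, by omega⟩, fun h => ?_⟩
        · rw [hsucc]
          simp [g18, g4 h]
        · refine Cmd.wp_seq (wp_checkCovers H₃ g1 g2 rfl g3) ?_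
          rintro σ₄ t₄ hF₄ ⟨hcov, ht₄⟩
          have g18' : σ₄.reg 18 = σ₂.reg 18 := (hF₄.reg 18 rfl).trans g18
          have hb : Γ.ValidAt i w x p j ↔ ¬ φ.Covers k (σ₃.reg 23) (dig Γ.N p w) (dig Γ.d j x) :=
            g5 h
          refine ⟨by simp, fun h2 => ⟨by simp, ?_, by omega⟩, fun h2 => ⟨?_, by omega⟩⟩
          · rw [hsucc, hb]
            simp [hcov.1 h2]
          · rw [hsucc, hb]
            have : ¬ φ.Covers k (σ₃.reg 23) (dig Γ.N p w) (dig Γ.d j x) := fun hc => hcov.2 hc h2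
            simp [this, g18']
    · intro σ' t' hF hI ht
      refine ⟨?_, by omega⟩
      simp only [State.setReg_reg, Nat.reduceEqDiff, if_false, hI]
      constructor
      · rintro ⟨h1, h2⟩ p' hp'
        rcases Nat.lt_succ_iff_lt_or_eq.1 hp' with h' | rfl
        · exact h1 p' h'
        · exact h2
      · exact fun h => ⟨fun p' hp' => h p' (by omega), h p (by omega)⟩
  · intro σ' t' hF hI ht
    refine ⟨hI, by rw [hF.reg 17 rfl]; simp [H.len, hi], ht.trans ?_⟩
    unfold validTime
    have e1 : (k - 1) * (φ.groupSize k * 6 + 6 + 10) ≤ k * (φ.groupSize k * 6 + 20) :=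
      Nat.mul_le_mul (by omega) (by omega)
    have e2 : (k - 1) * ((k - 1) * (φ.groupSize k * 6 + 6 + 10) + 2 + 2) ≤
        k * (k * (φ.groupSize k * 6 + 20) + 10) := Nat.mul_le_mul (by omega) (by omega)
    omega

end WordRAM

namespace TupleProblem

variable (Γ : TupleProblem)

/-- The contents of the bank for the first ends of the edges, after the candidates below `c` have
been treated. -/
def firstEnds (c i : ℕ) : ℕ := ((Γ.edgeList c).map Γ.fst).getD i 0

/-- The contents of the bank for the second ends of the edges. -/
def secondEnds (c i : ℕ) : ℕ := ((Γ.edgeList c).map Γ.snd).getD i 0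

/-- The contents of the bank for the weights of the edges. -/
def weights (c i : ℕ) : ℕ := if i < (Γ.edgeList c).length then 1 else 0

variable {Γ}

theorem edgeList_succ_of_keep {c : ℕ} (h : Γ.Keep c) :
    Γ.edgeList (c + 1) = Γ.edgeList c ++ [c] := by
  simp [edgeList, List.range_succ, List.filter_append, h]

theorem edgeList_succ_of_not_keep {c : ℕ} (h : ¬ Γ.Keep c) : Γ.edgeList (c + 1) = Γ.edgeList c := by
  simp [edgeList, List.range_succ, List.filter_append, h]

theorem length_edgeList_le (c : ℕ) : (Γ.edgeList c).length ≤ c :=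
  (List.length_filter_le _ _).trans (by simp)

theorem _root_.List.getD_append_singleton (l : List ℕ) (a : ℕ) :
    (fun i => (l ++ [a]).getD i 0) = Function.update (fun i => l.getD i 0) l.length a := by
  funext i
  by_cases h : i = l.length
  · subst h
    simp
  · rw [Function.update_of_ne h]
    rcases Nat.lt_or_gt_of_ne h with h | h
    · rw [List.getD_append _ _ _ _ h]
    · rw [List.getD_eq_default _ _ (by simp; omega), List.getD_eq_default _ _ (by omega)]

theorem firstEnds_succ {c : ℕ} (h : Γ.Keep c) :
    Γ.firstEnds (c + 1) = Function.update (Γ.firstEnds c) (Γ.edgeList c).length (Γ.fst c) := by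
  have := List.getD_append_singleton ((Γ.edgeList c).map Γ.fst) (Γ.fst c)
  rw [List.length_map] at this
  refine Eq.trans (funext fun i => ?_) this
  rw [firstEnds, edgeList_succ_of_keep h, List.map_append, List.map_singleton]

theorem secondEnds_succ {c : ℕ} (h : Γ.Keep c) :
    Γ.secondEnds (c + 1) = Function.update (Γ.secondEnds c) (Γ.edgeList c).length (Γ.snd c) := by
  have := List.getD_append_singleton ((Γ.edgeList c).map Γ.snd) (Γ.snd c)
  rw [List.length_map] at this
  refine Eq.trans (funext fun i => ?_) this
  rw [secondEnds, edgeList_succ_of_keep h, List.map_append, List.map_singleton]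

theorem weights_succ {c : ℕ} (h : Γ.Keep c) :
    Γ.weights (c + 1) = Function.update (Γ.weights c) (Γ.edgeList c).length 1 := by
  funext i
  rw [weights, edgeList_succ_of_keep h, List.length_append, List.length_singleton]
  by_cases hi : i = (Γ.edgeList c).length
  · subst hi
    simp
  · rw [Function.update_of_ne hi, weights]
    simp only [show i < (Γ.edgeList c).length + 1 ↔ i < (Γ.edgeList c).length by omega]

theorem ends_succ_of_not_keep {c : ℕ} (h : ¬ Γ.Keep c) : Γ.firstEnds (c + 1) = Γ.firstEnds c ∧
    Γ.secondEnds (c + 1) = Γ.secondEnds c ∧ Γ.weights (c + 1) = Γ.weights c := by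
  refine ⟨funext fun i => ?_, funext fun i => ?_, funext fun i => ?_⟩
  · rw [firstEnds, edgeList_succ_of_not_keep h, firstEnds]
  · rw [secondEnds, edgeList_succ_of_not_keep h, secondEnds]
  · rw [weights, edgeList_succ_of_not_keep h, weights]

theorem firstEnds_eq : Γ.firstEnds (2 * Γ.nV) = Γ.inst.init.mem 0 := by
  funext i
  by_cases h : i < Γ.inst.m
  · rw [Γ.inst.init_src h, firstEnds, List.getD_eq_getElem _ _ (by rw [List.length_map]; exact h)]
    simp [inst]
  · rw [firstEnds, List.getD_eq_default _ _ (by rw [List.length_map]; exact not_lt.1 h)]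
    simp [STInstance.init, h]

theorem secondEnds_eq : Γ.secondEnds (2 * Γ.nV) = Γ.inst.init.mem 1 := by
  funext i
  by_cases h : i < Γ.inst.m
  · rw [Γ.inst.init_dst h, secondEnds, List.getD_eq_getElem _ _ (by rw [List.length_map]; exact h)]
    simp [inst]
  · rw [secondEnds, List.getD_eq_default _ _ (by rw [List.length_map]; exact not_lt.1 h)]
    simp [STInstance.init, h]

theorem weights_eq : Γ.weights (2 * Γ.nV) = Γ.inst.init.mem 2 := by
  funext i
  by_cases h : i < Γ.inst.m
  · rw [Γ.inst.init_weight h, weights]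
    exact if_pos h
  · have : Γ.inst.init.mem 2 i = 0 := by simp [STInstance.init, h]
    rw [this, weights]
    exact if_neg h

theorem inst_mem_three (i : ℕ) : Γ.inst.init.mem 3 i =
    if i < Γ.nV then (if Γ.lev i = Γ.k ∧ Γ.xd i = 0 then 0 else 1) else 0 := by
  have e : Γ.inst.n = Γ.nV := rfl
  by_cases h : i < Γ.nV
  · have hS : (⟨i, h⟩ : Fin Γ.inst.n) ∈ Γ.inst.S ↔ ¬ (Γ.lev i = Γ.k ∧ Γ.xd i = 0) := by
      rw [mem_S]
      exact not_congr (Finset.mem_filter.trans (and_iff_right (Finset.mem_univ _)))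
    rw [if_pos h]
    simp only [STInstance.init, e, h, dif_pos, hS, ite_not]
  · rw [if_neg h]
    simp only [STInstance.init, e, h, dif_neg, not_false_eq_true]

theorem inst_mem_four (i : ℕ) : Γ.inst.init.mem 4 i =
    if i < Γ.nV then (if Γ.lev i = Γ.k ∧ Γ.xd i = 0 then 1 else 0) else 0 := by
  have e : Γ.inst.n = Γ.nV := rfl
  by_cases h : i < Γ.nV
  · have hT : (⟨i, h⟩ : Fin Γ.inst.n) ∈ Γ.inst.T ↔ (Γ.lev i = Γ.k ∧ Γ.xd i = 0) :=
      Finset.mem_filter.trans (and_iff_right (Finset.mem_univ _))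
    rw [if_pos h]
    simp only [STInstance.init, e, h, dif_pos, hT]
  · rw [if_neg h]
    simp only [STInstance.init, e, h, dif_neg, not_false_eq_true]

end TupleProblem

namespace WordRAM

open Ex (reg ld)

/-- Decode candidate `reg 12`: set register `26` to a nonzero value iff it is kept, and registers
`27` and `28` to its ends. -/
def checkCandidate : Cmd :=
  .ite (.lt (reg 12) (reg 8)) (.set 30 (reg 12)) (.set 30 (reg 12 - reg 8)) ;;
  .set 14 (reg 30 / reg 7 / reg 6) ;;
  .set 15 (reg 30 / reg 7 % reg 6) ;;
  .set 16 (reg 30 % reg 7) ;;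
  checkValid ;;
  .ite (.lt (reg 12) (reg 8))
    (.ite (.lt (reg 10) (reg 14)) (.set 26 0)
      (.set 26 (reg 18) ;;
        .set 31 (ld 2 (reg 17)) ;;
        .set 27 ((reg 14 * reg 6 + (reg 15 - reg 15 / reg 31 % reg 4 * reg 31)) * reg 7 +
          .lt 0 (reg 14) * reg 16) ;;
        .set 31 (ld 2 (reg 17 - 1)) ;;
        .set 28 (((reg 14 + 1) * reg 6 +
          (reg 15 - .lt 0 (reg 17) * (reg 15 / reg 31 % reg 4 * reg 31))) * reg 7 +
          .lt 0 (reg 17) * reg 16)))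
    (.ite (reg 14)
        (.ite (.lt (reg 10) (reg 14)) (.set 26 (reg 16))
          (.ite (reg 15 / ld 2 (reg 17) % reg 4) (.set 26 1) (.set 26 (1 - reg 18))))
        (.set 26 (reg 16)) ;;
      .set 27 0 ;;
      .set 28 (reg 30))

theorem enc_fits {Γ : TupleProblem} {B i w x : ℕ} (hi : i ≤ Γ.k) (hw : w < Γ.NN) (hx : x < Γ.X)
    (hB : Γ.nV < B) : i * Γ.NN < B ∧ i * Γ.NN + w < B ∧ (i * Γ.NN + w) * Γ.X < B ∧
      (i * Γ.NN + w) * Γ.X + x < B := by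
  have h1 := TupleProblem.enc_lt hi hw hx
  rw [TupleProblem.enc] at h1
  have h2 : i * Γ.NN + w ≤ (i * Γ.NN + w) * Γ.X := Nat.le_mul_of_pos_right _ Γ.X_pos
  omega

theorem dig_mul_le (N p w : ℕ) : dig N p w * N ^ p ≤ w :=
  (Nat.mul_le_mul_right _ (Nat.mod_le _ _)).trans (Nat.div_mul_le_self _ _)

theorem wp_checkCandidate {φ : CNF} {k : ℕ} {hk : 2 ≤ k} {B c : ℕ} {σ : State} {t : ℕ}
    (H : Ready φ hk B σ) (hc : σ.reg 12 = c) (hc2 : c < 2 * (φ.tupleProblem hk).nV) :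
    checkCandidate.wp B (fun σ' t' => (σ'.reg 26 ≠ 0 ↔ (φ.tupleProblem hk).Keep c) ∧
      ((φ.tupleProblem hk).Keep c → σ'.reg 27 = (φ.tupleProblem hk).fst c ∧
        σ'.reg 28 = (φ.tupleProblem hk).snd c) ∧ t' ≤ t + (validTime φ k + 13)) σ t := by
  set Γ := φ.tupleProblem hk with hΓ
  have hΓk : Γ.k = k := rfl
  have hbig : 4 * Γ.nV + (φ.numClauses + 2 * k + 2) * (φ.numVars + 2 * k + 2) + 10 < B := H.big
  obtain ⟨b1, b2, -⟩ := H.bounds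
  obtain ⟨z, hz⟩ : ∃ z, z = if c < Γ.nV then c else c - Γ.nV := ⟨_, rfl⟩
  have hzV : z < Γ.nV := by rw [hz]; split_ifs <;> omega
  refine Cmd.wp_seq (P := fun σ' t' => σ'.reg 30 = z ∧ t' ≤ t + 2)
    ⟨by simp, fun h => ⟨by simp, ?_, by omega⟩, fun h => ⟨by simp, ?_, by omega⟩⟩ ?_
  · have h' : c < Γ.nV := by simpa [hc, H.nV] using h
    simp [hz, h', hc]
  · have h' : ¬ c < Γ.nV := by simpa [hc, H.nV] using h
    have h8 : σ.reg 8 = Γ.nV := H.nV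
    simp [hz, h', hc, h8]
  rintro σ₁ t₁ hF₁ ⟨h30, ht₁⟩
  have H₁ : Ready φ hk B σ₁ := H.frame hF₁ rfl rfl
  have e14 : Γ.lev z = z / σ₁.reg 7 / σ₁.reg 6 := by rw [H₁.X, H₁.NN]; rfl
  have e15 : Γ.wd z = z / σ₁.reg 7 % σ₁.reg 6 := by rw [H₁.X, H₁.NN]; rfl
  have e16 : Γ.xd z = z % σ₁.reg 7 := by rw [H₁.X]; rfl
  refine ⟨by simp, by simp, by simp, ?_⟩
  refine Cmd.wp_seq (wp_checkValid (i := Γ.lev z) (w := Γ.wd z) (x := Γ.xd z)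
    (H₁.congr (by simp) (by simp)) (by simp [e14, h30]) (by simp [e15, h30])
    (by simp [e16, h30])) ?_
  rintro σ₂ t₂ hF₂ ⟨h18, h17, ht₂⟩
  have H₂ : Ready φ hk B σ₂ := (H₁.congr (by simp) (by simp)).frame hF₂ rfl rfl
  have r12 : σ₂.reg 12 = c := by
    rw [hF₂.reg 12 rfl]
    simpa [hc] using hF₁.reg 12 rfl
  have r30 : σ₂.reg 30 = z := by
    rw [hF₂.reg 30 rfl]
    simpa using h30
  have r14 : σ₂.reg 14 = Γ.lev z := by
    rw [hF₂.reg 14 rfl]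
    simp [e14, h30]
  have r15 : σ₂.reg 15 = Γ.wd z := by
    rw [hF₂.reg 15 rfl]
    simp [e15, h30]
  have r16 : σ₂.reg 16 = Γ.xd z := by
    rw [hF₂.reg 16 rfl]
    simp [e16, h30]
  change σ₂.reg 18 ≠ 0 ↔ Γ.Valid (Γ.lev z) (Γ.wd z) (Γ.xd z) at h18
  have hw := TupleProblem.wd_lt (Γ := Γ) z
  have hx := TupleProblem.xd_lt (Γ := Γ) z
  have hX : Γ.X ≤ Γ.nV := by
    calc Γ.X = 1 * (1 * Γ.X) := by ring
      _ ≤ _ := Nat.mul_le_mul (by omega) (Nat.mul_le_mul_right _ Γ.NN_pos)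
  have hNN : Γ.NN ≤ Γ.nV := by
    calc Γ.NN = 1 * (Γ.NN * 1) := by ring
      _ ≤ _ := Nat.mul_le_mul (by omega) (Nat.mul_le_mul_left _ Γ.X_pos)
  have hlev := TupleProblem.lev_le hzV
  rw [hΓk] at hlev
  clear hF₁ hF₂ e14 e15 e16
  refine ⟨by simp, fun h1 => ⟨by simp, fun h2 => ⟨by simp, ?_, ?_, by omega⟩, fun h2 => ?_⟩,
    fun h1 => ?_⟩
  · have h1' : c < Γ.nV := by simpa [r12, H₂.nV] using h1
    have h2' : k - 1 < Γ.lev z := by simpa [r14, H₂.len] using h2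
    rw [if_pos h1'] at hz
    rw [hz] at h2'
    simp [TupleProblem.Keep, h1', hΓk]
    omega
  · have h1' : c < Γ.nV := by simpa [r12, H₂.nV] using h1
    have h2' : k - 1 < Γ.lev z := by simpa [r14, H₂.len] using h2
    rw [if_pos h1'] at hz
    rw [hz] at h2'
    intro hK
    rw [TupleProblem.Keep, if_pos h1', hΓk] at hK
    omega
  · have h1' : c < Γ.nV := by simpa [r12, H₂.nV] using h1
    have h2' : Γ.lev z ≤ k - 1 := by
      have h3 := h2
      simp [r14, H₂.len] at h3
      omega
    rw [if_pos h1'] at hz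
    have eN := H₂.N
    have eNN := H₂.NN
    have eX := H₂.X
    rw [← hΓ] at eN eNN eX
    have m1 : σ₂.mem 2 (k - 1 - Γ.lev z) = Γ.N ^ (k - 1 - Γ.lev z) := H₂.powN _ (by omega)
    have m2 : σ₂.mem 2 (k - 1 - Γ.lev z - 1) = Γ.N ^ (k - 1 - Γ.lev z - 1) :=
      H₂.powN _ (by omega)
    have d1 := dig_mul_le Γ.N (k - 1 - Γ.lev z) (Γ.wd z)
    have d2 := dig_mul_le Γ.N (k - 1 - Γ.lev z - 1) (Γ.wd z)
    have hite : ∀ p : Prop, [Decidable p] → ∀ a : ℕ, (if p then 1 else 0) * a =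
        if p then a else 0 := fun p _ a => by split_ifs <;> simp
    obtain ⟨f1, f2, f3, f4⟩ := enc_fits (Γ := Γ) (B := B) (i := Γ.lev z)
      (w := erase Γ.N (k - 1 - Γ.lev z) (Γ.wd z)) (x := if 0 < Γ.lev z then Γ.xd z else 0)
      (by omega) (TupleProblem.erase_lt hw) (by split_ifs <;> omega) (by omega)
    obtain ⟨g1, g2, g3, g4⟩ := enc_fits (Γ := Γ) (B := B) (i := Γ.lev z + 1)
      (w := Γ.wd z - if 0 < k - 1 - Γ.lev z then
        dig Γ.N (k - 1 - Γ.lev z - 1) (Γ.wd z) * Γ.N ^ (k - 1 - Γ.lev z - 1) else 0)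
      (x := if 0 < k - 1 - Γ.lev z then Γ.xd z else 0)
      (by omega) (by omega) (by split_ifs <;> omega) (by omega)
    have hK : Γ.Keep c ↔ Γ.Valid (Γ.lev z) (Γ.wd z) (Γ.xd z) := by
      rw [TupleProblem.Keep, if_pos h1', ← hz, hΓk]
      exact and_iff_right (by omega)
    refine ⟨by simp, by simp, ?_, by simp, ?_, ?_, ?_, by omega⟩
    · simp only [Ex.fits_add, Ex.fits_mul, Ex.fits_reg, Ex.fits_sub, Ex.fits_div, Ex.fits_mod,
        Ex.fits_lt, Ex.fits_ofNat, Ex.eval_add, Ex.eval_mul, Ex.eval_sub, Ex.eval_div, Ex.eval_mod,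
        Ex.eval_lt, Ex.eval_reg, Ex.eval_ld, Ex.eval_ofNat, State.setReg_reg, State.setReg_mem,
        Nat.reduceEqDiff, if_false, if_true, r14, r15, r16, h17, m1, eN, eNN, eX, true_and,
        and_true, hite]
      rw [← dig, ← erase]
      refine ⟨⟨⟨f1, by omega, f2⟩, f3⟩, by split_ifs <;> omega, f4⟩
    · simp only [Ex.fits_add, Ex.fits_mul, Ex.fits_reg, Ex.fits_sub, Ex.fits_div, Ex.fits_mod,
        Ex.fits_lt, Ex.fits_ofNat, Ex.eval_add, Ex.eval_mul, Ex.eval_sub, Ex.eval_div, Ex.eval_mod,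
        Ex.eval_lt, Ex.eval_reg, Ex.eval_ld, Ex.eval_ofNat, State.setReg_reg, State.setReg_mem,
        Nat.reduceEqDiff, if_false, if_true, r14, r15, r16, h17, m2, eN, eNN, eX, true_and,
        and_true, hite]
      rw [← dig]
      refine ⟨⟨⟨⟨by omega, g1⟩, ⟨by omega, by split_ifs <;> omega⟩, g2⟩, g3⟩,
        by split_ifs <;> omega, g4⟩
    · simp [hK, h18]
    · intro hKc
      rw [TupleProblem.fst, TupleProblem.snd, if_pos h1', if_pos h1', ← hz, TupleProblem.low,
        TupleProblem.high, TupleProblem.enc, TupleProblem.enc, hΓk]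
      constructor
      · simp only [Ex.eval_add, Ex.eval_mul, Ex.eval_sub, Ex.eval_div, Ex.eval_mod,
          Ex.eval_lt, Ex.eval_reg, Ex.eval_ld, Ex.eval_ofNat, State.setReg_reg, State.setReg_mem,
          Nat.reduceEqDiff, if_false, if_true, r14, r15, r16, h17, m1, eN, eNN, eX, hite]
        rw [← dig, ← erase]
        congr 1
        by_cases h0 : Γ.lev z = 0
        · simp [h0]
        · rw [if_pos (by omega), if_neg h0]
      · simp only [Ex.eval_add, Ex.eval_mul, Ex.eval_sub, Ex.eval_div, Ex.eval_mod,
          Ex.eval_lt, Ex.eval_reg, Ex.eval_ld, Ex.eval_ofNat, State.setReg_reg, State.setReg_mem,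
          Nat.reduceEqDiff, if_false, if_true, r14, r15, r16, h17, m2, eN, eNN, eX, hite]
        rw [← dig]
        by_cases h0 : Γ.lev z = k - 1
        · simp [h0]
        · rw [if_pos (by omega), if_pos (by omega), if_neg h0, if_neg h0, erase,
            show k - 2 - Γ.lev z = k - 1 - Γ.lev z - 1 by omega]
  · have h1' : ¬ c < Γ.nV := by simpa [r12, H₂.nV] using h1
    rw [if_neg h1'] at hz
    have hK : Γ.Keep c ↔ ¬ Γ.Proper z := by rw [TupleProblem.Keep, if_neg h1', ← hz]
    have hfs : Γ.fst c = 0 ∧ Γ.snd c = z := by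
      rw [TupleProblem.fst, TupleProblem.snd, if_neg h1', if_neg h1', ← hz]
      exact ⟨rfl, rfl⟩
    refine Cmd.wp_seq (P := fun σ' t' => σ'.reg 30 = z ∧ (σ'.reg 26 ≠ 0 ↔ ¬ Γ.Proper z) ∧
      t' ≤ t₂ + 5) ⟨by simp, fun h2 => ⟨by simp, fun h3 => ⟨by simp, ?_, ?_, by omega⟩,
        fun h3 => ⟨by simp, fun h4 => ⟨by simp, ?_, ?_, by omega⟩,
          fun h4 => ⟨by simp, ?_, ?_, by omega⟩⟩⟩, fun h2 => ⟨by simp, ?_, ?_, by omega⟩⟩ ?_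
    · simpa using r30
    · have h3' : Γ.lev z = k := by
        have h5 := h3
        simp [r14, H₂.len] at h5
        omega
      simp [r16, TupleProblem.Proper, h3', hΓk]
    · simpa using r30
    · have h2' : Γ.lev z ≠ 0 := by simpa [r14] using h2
      have h3' : Γ.lev z < k := by
        have h5 := h3
        simp [r14, H₂.len] at h5
        omega
      have h4' : ¬ dig Γ.N (k - 1 - Γ.lev z) (Γ.wd z) = 0 := by
        have h5 := h4
        simp [r15, h17, H₂.powN (k - 1 - Γ.lev z) (by omega), H₂.N] at h5
        exact h5
      simp [TupleProblem.Proper, h2', h3'.ne, hΓk, h4']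
    · simpa using r30
    · have h2' : Γ.lev z ≠ 0 := by simpa [r14] using h2
      have h3' : Γ.lev z < k := by
        have h5 := h3
        simp [r14, H₂.len] at h5
        omega
      have h4' : dig Γ.N (k - 1 - Γ.lev z) (Γ.wd z) = 0 := by
        have h5 := h4
        simp [r15, h17, H₂.powN (k - 1 - Γ.lev z) (by omega), H₂.N] at h5
        exact h5
      simp only [TupleProblem.Proper, h2', h3'.ne, hΓk, h4', ← h18, h3', or_self, false_and,
        false_or, true_and, ne_eq, not_false_eq_true, State.setReg_reg, if_true, Ex.eval_sub,
        Ex.eval_ofNat, Ex.eval_reg]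
      omega
    · simpa using r30
    · have h2' : Γ.lev z = 0 := by simpa [r14] using h2
      simp [r16, TupleProblem.Proper, h2']
    · rintro σ₃ t₃ - ⟨g30, g26, ht₃⟩
      refine ⟨by simp, by simp, ?_, fun _ => ?_, by omega⟩
      · simp [hK, g26]
      · simp [hfs, g30]

end WordRAM

namespace WordRAM

open Ex (reg ld)

/-- Write the kept candidates to banks `10`, `11` and `12`, and their number to register `11`. -/
def writeEdges : Cmd :=
  .forTo 12 13 (
    checkCandidate ;;
    .ite (reg 26)
      (.st 10 (reg 11) (reg 27) ;; .st 11 (reg 11) (reg 28) ;; .st 12 (reg 11) 1 ;;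
        .set 11 (reg 11 + 1))
      .skip)

theorem wp_writeEdges {φ : CNF} {k : ℕ} {hk : 2 ≤ k} {B : ℕ} {σ : State} {t : ℕ}
    (H : Ready φ hk B σ) (h11 : σ.reg 11 = 0) (hm : ∀ b ∈ [10, 11, 12], ∀ i, σ.mem b i = 0) :
    writeEdges.wp B (fun σ' t' => σ'.reg 11 = (φ.tupleProblem hk).inst.m ∧
      σ'.mem 10 = (φ.tupleProblem hk).inst.init.mem 0 ∧
      σ'.mem 11 = (φ.tupleProblem hk).inst.init.mem 1 ∧
      σ'.mem 12 = (φ.tupleProblem hk).inst.init.mem 2 ∧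
      t' ≤ t + (2 * (φ.tupleProblem hk).nV * (validTime φ k + 20) + 2)) σ t := by
  set Γ := φ.tupleProblem hk with hΓ
  have hbig : 4 * Γ.nV + (φ.numClauses + 2 * k + 2) * (φ.numVars + 2 * k + 2) + 10 < B := H.big
  simp only [List.mem_cons, List.not_mem_nil, or_false, forall_eq_or_imp, forall_eq] at hm
  refine Cmd.wp_forTo_le (2 * Γ.nV) (validTime φ k + 18) (fun c σ' =>
    σ'.reg 11 = (Γ.edgeList c).length ∧ σ'.mem 10 = Γ.firstEnds c ∧ σ'.mem 11 = Γ.secondEnds c ∧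
      σ'.mem 12 = Γ.weights c) (by omega) H.cands rfl rfl rfl ?_ ?_ ?_
  · refine ⟨by simp [h11, TupleProblem.edgeList], funext fun i => ?_, funext fun i => ?_,
      funext fun i => ?_⟩
    · simp [hm.1, TupleProblem.firstEnds, TupleProblem.edgeList]
    · simp [hm.2.1, TupleProblem.secondEnds, TupleProblem.edgeList]
    · simp [hm.2.2, TupleProblem.weights, TupleProblem.edgeList]
  · rintro c hc σ₁ t₁ hF₁ hr₁ ⟨i1, i2, i3, i4⟩
    have H₁ : Ready φ hk B σ₁ := H.frame hF₁ rfl rfl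
    refine Cmd.wp_seq (wp_checkCandidate H₁ hr₁ hc) ?_
    rintro σ₂ t₂ hF₂ ⟨h26, hends, ht₂⟩
    have r11 : σ₂.reg 11 = (Γ.edgeList c).length := (hF₂.reg 11 rfl).trans i1
    have m10 : σ₂.mem 10 = Γ.firstEnds c := (hF₂.mem 10 rfl).trans i2
    have m11 : σ₂.mem 11 = Γ.secondEnds c := (hF₂.mem 11 rfl).trans i3
    have m12 : σ₂.mem 12 = Γ.weights c := (hF₂.mem 12 rfl).trans i4
    have hlen := Γ.length_edgeList_le c
    refine ⟨by simp, fun h => ?_, fun h => ?_⟩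
    · have hK : Γ.Keep c := h26.1 h
      obtain ⟨e1, e2⟩ : σ₂.reg 27 = Γ.fst c ∧ σ₂.reg 28 = Γ.snd c := hends hK
      refine ⟨by simp, by simp, by simp, by simp, by simp, by simp, by simp [r11]; omega,
        ⟨?_, ?_, ?_, ?_⟩, by omega⟩
      · simp [r11, TupleProblem.edgeList_succ_of_keep hK]
      · rw [TupleProblem.firstEnds_succ hK]
        funext v
        simp [r11, m10, e1, Function.update_apply]
      · rw [TupleProblem.secondEnds_succ hK]
        funext v
        simp [r11, m11, e2, Function.update_apply]
      · rw [TupleProblem.weights_succ hK]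
        funext v
        simp [r11, m12, Function.update_apply]
    · have hK : ¬ Γ.Keep c := fun hK => h26.2 hK h
      obtain ⟨n1, n2, n3⟩ := TupleProblem.ends_succ_of_not_keep hK
      refine ⟨⟨?_, ?_, ?_, ?_⟩, by omega⟩
      · simp [r11, TupleProblem.edgeList_succ_of_not_keep hK]
      · simp [m10, n1]
      · simp [m11, n2]
      · simp [m12, n3]
  · rintro σ' t' hF ⟨i1, i2, i3, i4⟩ ht
    refine ⟨i1, i2.trans TupleProblem.firstEnds_eq, i3.trans TupleProblem.secondEnds_eq,
      i4.trans TupleProblem.weights_eq, ht⟩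

/-- Write the characteristic vectors of the two sets of vertices to banks `13` and `14`. -/
def writeSets : Cmd :=
  .forTo 12 8 (
    .ite ((reg 12 / reg 7 / reg 6).eq (reg 10 + 1))
      (.ite (reg 12 % reg 7) (.st 13 (reg 12) 1) (.st 14 (reg 12) 1))
      (.st 13 (reg 12) 1))

theorem wp_writeSets {φ : CNF} {k : ℕ} {hk : 2 ≤ k} {B : ℕ} {σ : State} {t : ℕ}
    (H : Ready φ hk B σ) (hm : ∀ b ∈ [13, 14], ∀ i, σ.mem b i = 0) :
    writeSets.wp B (fun σ' t' => σ'.mem 13 = (φ.tupleProblem hk).inst.init.mem 3 ∧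
      σ'.mem 14 = (φ.tupleProblem hk).inst.init.mem 4 ∧
      t' ≤ t + ((φ.tupleProblem hk).nV * 5 + 2)) σ t := by
  set Γ := φ.tupleProblem hk with hΓ
  have hΓk : Γ.k = k := rfl
  have hbig : 4 * Γ.nV + (φ.numClauses + 2 * k + 2) * (φ.numVars + 2 * k + 2) + 10 < B := H.big
  obtain ⟨b1, b2, -⟩ := H.bounds
  simp only [List.mem_cons, List.not_mem_nil, or_false, forall_eq_or_imp, forall_eq] at hm
  refine Cmd.wp_forTo_le Γ.nV 3 (fun c σ' =>
    (∀ i, σ'.mem 13 i = if i < c then (if Γ.lev i = Γ.k ∧ Γ.xd i = 0 then 0 else 1) else 0) ∧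
    ∀ i, σ'.mem 14 i = if i < c then (if Γ.lev i = Γ.k ∧ Γ.xd i = 0 then 1 else 0) else 0)
    (by omega) H.nV rfl rfl rfl (by simp [hm]) ?_ ?_
  · rintro c hc σ₁ t₁ hF₁ hr₁ ⟨i1, i2⟩
    have H₁ : Ready φ hk B σ₁ := H.frame hF₁ rfl rfl
    have hsub : k - 1 + 1 = k := by omega
    have hlev : Ex.eval σ₁ ((reg 12 / reg 7 / reg 6).eq (reg 10 + 1)) ≠ 0 ↔ Γ.lev c = Γ.k := by
      simp only [Ex.eval_eq, Ex.eval_div, Ex.eval_reg, Ex.eval_add, Ex.eval_ofNat, hr₁, H₁.X,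
        H₁.NN, H₁.len, hsub, TupleProblem.lev, hΓk]
      split_ifs <;> simp_all
    have hxd : Ex.eval σ₁ (reg 12 % reg 7) = Γ.xd c := by
      have h7 : σ₁.reg 7 = Γ.X := H₁.X
      simp [hr₁, h7, TupleProblem.xd]
    have hlt : ∀ i, i ≠ c → (i < c + 1 ↔ i < c) := fun i hi => by omega
    refine ⟨by simp [H₁.len]; omega, fun h => ⟨by simp, fun h' => ⟨by simp, by simp, ⟨?_, ?_⟩,
      by omega⟩, fun h' => ⟨by simp, by simp, ⟨?_, ?_⟩, by omega⟩⟩,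
      fun h => ⟨by simp, by simp, ⟨?_, ?_⟩, by omega⟩⟩
    all_goals
      intro i
      rcases eq_or_ne i c with rfl | hi
    · rw [hxd] at h'
      simp [hr₁, h']
    · simp [hr₁, hi, i1, hlt i hi]
    · rw [hxd] at h'
      simp [i2, h']
    · simp [i2, hlt i hi]
    · rw [hxd] at h'
      simp [i1, hlev.1 h, h']
    · simp [i1, hlt i hi]
    · rw [hxd] at h'
      simp [hr₁, hlev.1 h, h']
    · simp [hr₁, hi, i2, hlt i hi]
    · have h1 : ¬ Γ.lev i = Γ.k := fun hc => hlev.2 hc h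
      simp [hr₁, h1]
    · simp [hr₁, hi, i1, hlt i hi]
    · have h1 : ¬ Γ.lev i = Γ.k := fun hc => hlev.2 hc h
      simp [i2, h1]
    · simp [i2, hlt i hi]
  · rintro σ' t' hF ⟨i1, i2⟩ ht
    refine ⟨funext fun i => ?_, funext fun i => ?_, ht⟩
    · rw [i1, TupleProblem.inst_mem_three]
    · rw [i2, TupleProblem.inst_mem_four]

/-- Write the powers of register `r` with exponents up to `reg 10` to bank `b`. -/
def writePowers (b r : ℕ) : Cmd :=
  .st b 0 1 ;;
  .forTo 12 10 (.st b (reg 12 + 1) (ld b (reg 12) * reg r))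

theorem wp_writePowers {B b r K a : ℕ} {σ : State} {t : ℕ} (hr : r ≠ 12) (h10 : σ.reg 10 = K)
    (ha : σ.reg r = a) (hK : K + 1 < B) (hB : a ^ K < B) (ha0 : 0 < a) :
    (writePowers b r).wp B (fun σ' t' => (∀ p ≤ K, σ'.mem b p = a ^ p) ∧
      t' ≤ t + (K * 3 + 3)) σ t := by
  refine ⟨by simp, by simp, Cmd.wp_forTo_le K 1 (fun i σ' => ∀ p ≤ i, σ'.mem b p = a ^ p)
    (by omega) (by simp [h10]) rfl rfl rfl ?_ ?_ ?_⟩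
  · intro p hp
    obtain rfl : p = 0 := by omega
    simp
  · intro i hi σ' t' hF h12 hI
    have hra : σ'.reg r = a := by
      rw [hF.reg r (by simp [Cmd.forTo, Cmd.wr, hr])]
      simp [ha]
    have hpow : a ^ (i + 1) < B := (Nat.pow_le_pow_right ha0 hi).trans_lt hB
    refine ⟨by simp [h12]; omega, by simp [h12, hra, hI i le_rfl, ← pow_succ]; exact hpow, ?_,
      by omega⟩
    intro p hp
    rcases Nat.le_succ_iff.1 hp with h | rfl
    · simp [h12, hI p h, show p ≠ i + 1 by omega]
    · simp [h12, hra, hI i le_rfl, pow_succ]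
  · intro σ' t' hF hI ht
    exact ⟨hI, by omega⟩

/-- The power `2 ^ a`. -/
def Ex.twoPow (a : Ex) : Ex := .bin .shl 1 a

@[simp] theorem Ex.eval_twoPow (σ : State) (a : Ex) : a.twoPow.eval σ = 2 ^ a.eval σ :=
  Nat.one_shiftLeft _

@[simp] theorem Ex.fits_twoPow (B : ℕ) (σ : State) (a : Ex) :
    a.twoPow.Fits B σ ↔ a.Fits B σ ∧ 2 ^ a.eval σ < B :=
  ⟨fun h => ⟨h.2.1, (Nat.one_shiftLeft _).symm.trans_lt h.2.2⟩,
    fun h => ⟨trivial, h.1, (Nat.one_shiftLeft _).trans_lt h.2⟩⟩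

/-- Compute the sizes of the tuple problem, see `Ready`. -/
def setup (k : ℕ) : Cmd :=
  .set 10 (.lit (k - 1)) ;;
  .set 3 (reg 0 / .lit k + 1) ;;
  .set 4 ((reg 3).twoPow + 1) ;;
  .set 5 (reg 1 + .lit k) ;;
  writePowers 2 4 ;;
  writePowers 3 5 ;;
  .set 6 (ld 2 (reg 10)) ;;
  .set 7 (ld 3 (reg 10)) ;;
  .set 8 (.lit (k + 1) * (reg 6 * reg 7)) ;;
  .set 13 (reg 8 + reg 8)

theorem wp_setup {φ : CNF} {k : ℕ} {hk : 2 ≤ k} {B t : ℕ}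
    (hB : 4 * (φ.tupleProblem hk).nV +
      (φ.numClauses + 2 * k + 2) * (φ.numVars + 2 * k + 2) + 10 < B) :
    (setup k).wp B (fun σ' t' => Ready φ hk B σ' ∧ t' ≤ t + (6 * k + 20)) φ.init t := by
  set Γ := φ.tupleProblem hk with hΓ
  have hΓk : Γ.k = k := rfl
  have hN : Γ.N = 2 ^ φ.groupSize k + 1 := rfl
  have hd : Γ.d = φ.numClauses + k := rfl
  have hX : Γ.X ≤ Γ.nV := by
    calc Γ.X = 1 * (1 * Γ.X) := by ring
      _ ≤ _ := Nat.mul_le_mul (by omega) (Nat.mul_le_mul_right _ Γ.NN_pos)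
  have hNN : Γ.NN ≤ Γ.nV := by
    calc Γ.NN = 1 * (Γ.NN * 1) := by ring
      _ ≤ _ := Nat.mul_le_mul (by omega) (Nat.mul_le_mul_left _ Γ.X_pos)
  have hNX : Γ.NN * Γ.X ≤ Γ.nV := Nat.le_mul_of_pos_left _ (by omega)
  have hNle : Γ.N ≤ Γ.NN := Nat.le_self_pow (by omega) _
  have hbig : (φ.numClauses + 2 * k + 2) + (φ.numVars + 2 * k + 2) < B := by
    have h1 : ∀ a b : ℕ, a + 2 + (b + 2) ≤ (a + 2) * (b + 2) := fun a b => by nlinarith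
    exact (h1 _ _).trans_lt (by omega)
  have hdiv : φ.numVars / k ≤ φ.numVars := Nat.div_le_self _ _
  have i0 : φ.init.reg 0 = φ.numVars := rfl
  have i1 : φ.init.reg 1 = φ.numClauses := rfl
  have hgs : φ.numVars / k + 1 = φ.groupSize k := rfl
  refine ⟨by simp, by simp [i0]; omega, by simp [i0, hgs]; omega, by simp [i1]; omega, ?_⟩
  refine Cmd.wp_seq (wp_writePowers (K := k - 1) (a := Γ.N) (by norm_num) (by simp)
    (by simp [i0, hgs, hN]) (by omega) (lt_of_le_of_lt hNN (by omega)) Γ.N_pos) ?_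
  rintro σ₁ t₁ hF₁ ⟨p1, ht₁⟩
  refine Cmd.wp_seq (wp_writePowers (K := k - 1) (a := Γ.d) (by norm_num)
    (by rw [hF₁.reg 10 rfl]; simp) (by rw [hF₁.reg 5 rfl]; simp [i1, hd]) (by omega)
    (lt_of_le_of_lt hX (by omega)) Γ.d_pos) ?_
  rintro σ₂ t₂ hF₂ ⟨p2, ht₂⟩
  have p1' : ∀ p ≤ k - 1, σ₂.mem 2 p = Γ.N ^ p := by
    rw [hF₂.mem 2 rfl]
    exact p1
  have r10 : σ₂.reg 10 = k - 1 := by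
    rw [hF₂.reg 10 rfl, hF₁.reg 10 rfl]
    simp
  have q6 : σ₂.mem 2 (k - 1) = Γ.NN := p1' _ le_rfl
  have q7 : σ₂.mem 3 (k - 1) = Γ.X := p2 _ le_rfl
  have q8 : (k + 1) * (Γ.NN * Γ.X) = Γ.nV := rfl
  refine ⟨by simp, by simp, by simp [r10, q6, q7, q8]; omega,
    by simp [r10, q6, q7, q8]; omega, ?_, by omega⟩
  constructor
  · simp [hF₂.reg 0 rfl, hF₁.reg 0 rfl, i0]
  · simp [hF₂.reg 1 rfl, hF₁.reg 1 rfl, i1]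
  · simp [hF₂.reg 3 rfl, hF₁.reg 3 rfl, i0, hgs]
  · simp [hF₂.reg 4 rfl, hF₁.reg 4 rfl, i0, hgs, ← hΓ, hN]
  · simp [hF₂.reg 5 rfl, hF₁.reg 5 rfl, i1, ← hΓ, hd]
  · simp [r10, q6, ← hΓ]
  · simp [r10, q7, ← hΓ]
  · simp [r10, q6, q7, q8, ← hΓ]
  · simp [r10]
  · simp [r10, q6, q7, q8, ← hΓ, two_mul]
  · simp [hF₂.mem 0 rfl, hF₁.mem 0 rfl]
  · simp [hF₂.mem 1 rfl, hF₁.mem 1 rfl]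
  · exact fun p hp => p1' p (by omega)
  · exact fun p hp => p2 p (by omega)
  · exact hB

/-- Write the instance of the tuple problem of a formula: the numbers of vertices and edges to
registers `8` and `11`, and the memory of the instance to the banks from number `10` on. -/
def writeInstance (k : ℕ) : Cmd := setup k ;; writeEdges ;; writeSets

theorem wp_writeInstance {φ : CNF} {k : ℕ} {hk : 2 ≤ k} {B : ℕ}
    (hB : 4 * (φ.tupleProblem hk).nV +
      (φ.numClauses + 2 * k + 2) * (φ.numVars + 2 * k + 2) + 10 < B) :
    (writeInstance k).wp B (fun σ' t' => Ready φ hk B σ' ∧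
      σ'.reg 11 = (φ.tupleProblem hk).inst.m ∧ σ'.coins = 0 ∧
      (∀ b, σ'.mem (10 + b) = (φ.tupleProblem hk).inst.init.mem b) ∧
      t' ≤ (φ.tupleProblem hk).nV * (2 * validTime φ k + 45) + (6 * k + 30)) φ.init 0 := by
  refine Cmd.wp_conseq (P := fun σ' t' => Ready φ hk B σ' ∧
    σ'.reg 11 = (φ.tupleProblem hk).inst.m ∧
    (σ'.mem 10 = (φ.tupleProblem hk).inst.init.mem 0 ∧
      σ'.mem 11 = (φ.tupleProblem hk).inst.init.mem 1 ∧
      σ'.mem 12 = (φ.tupleProblem hk).inst.init.mem 2 ∧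
      σ'.mem 13 = (φ.tupleProblem hk).inst.init.mem 3 ∧
      σ'.mem 14 = (φ.tupleProblem hk).inst.init.mem 4) ∧
    t' ≤ (φ.tupleProblem hk).nV * (2 * validTime φ k + 45) + (6 * k + 30)) ?_ ?_
  · refine Cmd.wp_seq (wp_setup (hk := hk) hB) ?_
    rintro σ₁ t₁ hF₁ ⟨H₁, ht₁⟩
    have hz : ∀ b ∈ [10, 11, 12, 13, 14], ∀ i, σ₁.mem b i = 0 := by
      intro b hb i
      simp only [List.mem_cons, List.not_mem_nil, or_false] at hb
      rcases hb with rfl | rfl | rfl | rfl | rfl <;> (rw [hF₁.mem _ rfl]; rfl)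
    refine Cmd.wp_seq (wp_writeEdges H₁ ((hF₁.reg 11 rfl).trans rfl)
      fun b hb => hz b (by simp at hb ⊢; omega)) ?_
    rintro σ₂ t₂ hF₂ ⟨h11, m0, m1, m2, ht₂⟩
    have H₂ := H₁.frame hF₂ rfl rfl
    refine Cmd.wp_conseq (wp_writeSets H₂ fun b hb i => ?_) ?_
    · simp only [List.mem_cons, List.not_mem_nil, or_false] at hb
      rcases hb with rfl | rfl <;> (rw [hF₂.mem _ rfl]; exact hz _ (by simp) i)
    · rintro σ₃ t₃ hF₃ ⟨m3, m4, ht₃⟩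
      refine ⟨H₂.frame hF₃ rfl rfl, (hF₃.reg 11 rfl).trans h11, ⟨(hF₃.mem 10 rfl).trans m0,
        (hF₃.mem 11 rfl).trans m1, (hF₃.mem 12 rfl).trans m2, m3, m4⟩, ?_⟩
      have e : (φ.tupleProblem hk).nV * (2 * validTime φ k + 45) =
          2 * (φ.tupleProblem hk).nV * (validTime φ k + 20) + (φ.tupleProblem hk).nV * 5 := by ring
      omega
  · rintro σ' t' hF ⟨H', h11, ⟨m0, m1, m2, m3, m4⟩, ht⟩
    refine ⟨H', h11, hF.coins, fun b => ?_, ht⟩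
    match b with
    | 0 => exact m0
    | 1 => exact m1
    | 2 => exact m2
    | 3 => exact m3
    | 4 => exact m4
    | b + 5 =>
      have hwm : (writeInstance k).wm (10 + (b + 5)) = false := by
        simp [writeInstance, setup, writeEdges, writeSets, writePowers, checkCandidate, checkValid,
          checkCovers, Cmd.forTo, Cmd.wm]
        omega
      rw [hF.mem _ hwm]
      funext i
      rw [show 10 + (b + 5) = b + 15 by omega]
      rfl

end WordRAM

/-! ### Satisfiability through eccentricities -/

namespace WordRAM

open Ex (reg ld)

/-- A command that sets register `0` to a nonzero value if the words in registers `21` and `22` are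
in the relation `R`, and otherwise leaves it alone. -/
structure IsJudge (k : ℕ) (judge : Cmd) (R : ℕ → ℕ → Prop) : Prop where
  wf : judge.WF
  maxLit_le : judge.maxLit ≤ k
  wr : ∀ r, r ≠ 0 → judge.wr r = false
  wm : ∀ b, judge.wm b = false
  wp : ∀ (B : ℕ) (σ : State) (t : ℕ), judge.wp B (fun σ' t' =>
    (σ'.reg 0 ≠ 0 ↔ σ.reg 0 ≠ 0 ∨ R (σ.reg 21) (σ.reg 22)) ∧ t' ≤ t + 3) σ t

/-- The judge that accepts the nonzero words. -/
def judgeBit : Cmd := .ite (reg 21) (.set 0 1) .skip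

theorem isJudge_judgeBit {k : ℕ} (hk : 2 ≤ k) : IsJudge k judgeBit fun a _ => a ≠ 0 where
  wf := rfl
  maxLit_le := (show judgeBit.maxLit ≤ 1 from le_rfl).trans (by omega)
  wr r hr := by simp [judgeBit, Cmd.wr, hr]
  wm b := by simp [judgeBit, Cmd.wm]
  wp B σ t := by
    refine ⟨by simp, fun h => ⟨by simp, ?_, by omega⟩, fun h => ⟨?_, by omega⟩⟩
    · have : σ.reg 21 ≠ 0 := by simpa using h
      simp [this]
    · have : σ.reg 21 = 0 := by simpa using h
      simp [this]

/-- The judge that accepts the quotients larger than `k`. The product `k * b` need not fit into a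
word, so `a > k * b` is tested as `(a - 1) / b > k - 1`, and separately if `b = 0`. -/
def judgeRatio (k : ℕ) : Cmd :=
  .ite (reg 22)
    (.ite (.lt (.lit (k - 1)) ((reg 21 - 1) / reg 22)) (.set 0 1) .skip)
    (.ite (reg 21) (.set 0 1) .skip)

theorem isJudge_judgeRatio {k : ℕ} (hk : 2 ≤ k) :
    IsJudge k (judgeRatio k) fun a b => k * b < a where
  wf := rfl
  maxLit_le := by
    simp only [judgeRatio, Cmd.maxLit]
    refine max_le (Nat.zero_le _) (max_le (max_le (max_le ?_ ?_) (max_le ?_ ?_)) ?_)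
    · exact Nat.sub_le _ _
    · exact (show _ ≤ 1 from le_rfl).trans (by omega)
    · exact (show _ ≤ 1 from le_rfl).trans (by omega)
    · exact Nat.zero_le _
    · exact (show _ ≤ 1 from le_rfl).trans (by omega)
  wr r hr := by simp [judgeRatio, Cmd.wr, hr]
  wm b := by simp [judgeRatio, Cmd.wm]
  wp B σ t := by
    refine ⟨by simp, fun h => ⟨by simp, fun h2 => ⟨by simp, ?_, by omega⟩,
      fun h2 => ⟨?_, by omega⟩⟩, fun h => ⟨by simp, fun h2 => ⟨by simp, ?_, by omega⟩,
      fun h2 => ⟨?_, by omega⟩⟩⟩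
    all_goals
      have key : σ.reg 22 ≠ 0 → (k - 1 < (σ.reg 21 - 1) / σ.reg 22 ↔ k * σ.reg 22 < σ.reg 21) := by
        intro hb
        have h3 : k - 1 < (σ.reg 21 - 1) / σ.reg 22 ↔ k ≤ (σ.reg 21 - 1) / σ.reg 22 := by omega
        have h4 : 0 < k * σ.reg 22 := Nat.mul_pos (by omega) (by omega)
        rw [h3, Nat.le_div_iff_mul_le (by omega)]
        omega
    · have hb : σ.reg 22 ≠ 0 := by simpa using h
      have h5 : k - 1 < (σ.reg 21 - 1) / σ.reg 22 := by
        by_contra h5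
        simp [h5] at h2
      simp [(key hb).1 h5]
    · have hb : σ.reg 22 ≠ 0 := by simpa using h
      have h3 := key hb
      have h4 : ¬ k - 1 < (σ.reg 21 - 1) / σ.reg 22 := by
        intro h5
        simp [h5] at h2
      rw [h3] at h4
      simp [h4]
    · have hb : σ.reg 22 = 0 := by simpa using h
      have ha : σ.reg 21 ≠ 0 := by simpa using h2
      simp [hb]
      omega
    · have hb : σ.reg 22 = 0 := by simpa using h
      have ha : σ.reg 21 = 0 := by simpa using h2
      simp [ha]

/-- Judge the answers in banks `15` and `16` for all sources, which are the multiples of `X`. -/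
def judgeAll (judge : Cmd) : Cmd :=
  .set 0 0 ;;
  .forTo 12 6 (
    .set 21 (ld 15 (reg 12 * reg 7)) ;;
    .set 22 (ld 16 (reg 12 * reg 7)) ;;
    judge)

theorem wp_judgeAll {k : ℕ} {judge : Cmd} {R : ℕ → ℕ → Prop} (hJ : IsJudge k judge R)
    {B NN X : ℕ} {σ : State} {t : ℕ} (h6 : σ.reg 6 = NN) (h7 : σ.reg 7 = X) (hN : NN < B)
    (hB : NN * X < B) :
    (judgeAll judge).wp B (fun σ' t' =>
      (σ'.reg 0 ≠ 0 ↔ ∃ w < NN, R (σ.mem 15 (w * X)) (σ.mem 16 (w * X))) ∧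
      t' ≤ t + (NN * 7 + 3)) σ t := by
  refine ⟨by simp, Cmd.wp_forTo_le NN 5 (fun i σ' => σ'.reg 0 ≠ 0 ↔
    ∃ w < i, R (σ.mem 15 (w * X)) (σ.mem 16 (w * X))) hN (by simp [h6]) rfl
    (by simp [Cmd.wr, hJ.wr]) (by simp [Cmd.wr, hJ.wr]) (by simp) ?_
    fun σ' t' hF hI ht => ⟨hI, by omega⟩⟩
  intro i hi σ₁ t₁ hF hr hI
  have r7 : σ₁.reg 7 = X := by
    rw [hF.reg 7 (by simp [Cmd.forTo, Cmd.wr, hJ.wr])]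
    simp [h7]
  have m15 : σ₁.mem 15 = σ.mem 15 := by
    rw [hF.mem 15 (by simp [Cmd.forTo, Cmd.wm, hJ.wm])]
    simp
  have m16 : σ₁.mem 16 = σ.mem 16 := by
    rw [hF.mem 16 (by simp [Cmd.forTo, Cmd.wm, hJ.wm])]
    simp
  have hle : i * X ≤ NN * X := Nat.mul_le_mul_right _ hi.le
  refine ⟨by simp [hr, r7]; omega, by simp [hr, r7]; omega, ?_⟩
  refine Cmd.wp_conseq (hJ.wp B _ _) ?_
  rintro σ₂ t₂ - ⟨h0, ht₂⟩
  refine ⟨?_, by omega⟩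
  rw [State.setReg_reg, if_neg (by norm_num), h0]
  simp only [State.setReg_reg, State.setReg_mem, Nat.reduceEqDiff, if_true, if_false, Ex.eval_ld,
    Ex.eval_mul, Ex.eval_reg, hr, r7, m15, m16, hI]
  constructor
  · rintro (⟨w, h1, h2⟩ | h)
    · exact ⟨w, by omega, h2⟩
    · exact ⟨i, by omega, h⟩
  · rintro ⟨w, h1, h2⟩
    rcases Nat.lt_succ_iff_lt_or_eq.1 h1 with h | rfl
    · exact .inl ⟨w, h, h2⟩
    · exact .inr h2

/-- The first register used by the program for eccentricities. -/
def winReg (k : ℕ) : ℕ := tempReg + (writeInstance k).comp.regBound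

/-- The program for satisfiability that writes the layered graph, runs the program `p` for
eccentricities on it, in registers and banks of its own, and judges the answers. -/
def satProg (k : ℕ) (p : Prog) (judge : Cmd) : Prog :=
  .seq (writeInstance k).comp
    (.seq (.op .add (0 + winReg k) 8 (0 + winReg k))
      (.seq (.op .add (1 + winReg k) 11 (1 + winReg k))
        (.seq (p.shift (winReg k) 10) (judgeAll judge).comp)))

/-- A bound for the number of steps of `satProg` besides those of `p`. -/
def overhead (φ : CNF) {k : ℕ} (hk : 2 ≤ k) (judge : Cmd) : ℕ :=
  (writeInstance k).size * ((φ.tupleProblem hk).nV * (2 * validTime φ k + 45) + (6 * k + 30)) +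
    (2 + (judgeAll judge).size * ((φ.tupleProblem hk).NN * 7 + 3))

theorem maxLit_writeInstance_le {k : ℕ} (hk : 2 ≤ k) : (writeInstance k).maxLit ≤ k + 1 := by
  simp only [writeInstance, setup, Cmd.maxLit, writePowers, Cmd.forTo]
  have h1 : writeEdges.maxLit ≤ k + 1 := (show writeEdges.maxLit ≤ 2 by decide).trans (by omega)
  have h2 : writeSets.maxLit ≤ k + 1 := (show writeSets.maxLit ≤ 1 by decide).trans (by omega)
  have e3 : ∀ a b : Ex, (a / b).maxLit = max a.maxLit b.maxLit := fun _ _ => rfl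
  have e4 : ∀ a b : Ex, (a.lt b).maxLit = max a.maxLit b.maxLit := fun _ _ => rfl
  have e5 : ∀ a : Ex, a.twoPow.maxLit = max 1 a.maxLit := fun _ => rfl
  simp only [e3, e4, e5, Ex.maxLit]
  omega

theorem bounded_cnf_init {φ : CNF} {B : ℕ} (hB : φ.numVars + φ.numClauses + 1 < B) :
    φ.init.Bounded B := by
  constructor
  · intro r
    match r with
    | 0 => simp [CNF.init]; omega
    | 1 => simp [CNF.init]; omega
    | r + 2 => simp [CNF.init]; omega
  · intro b a
    match b with
    | 0 => simp only [CNF.init]; split_ifs <;> omega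
    | 1 => simp only [CNF.init]; split_ifs <;> omega
    | b + 2 => simp [CNF.init]; omega

/-- Every execution of `p` on the layered graph gives an execution of `satProg` on the formula, the
answer of which is whether `R` accepts the words that `p` has written for some source. -/
theorem exec_satProg {φ : CNF} {k : ℕ} (hk : 2 ≤ k) {judge : Cmd} {R : ℕ → ℕ → Prop}
    (hJ : IsJudge k judge R) {w w' : ℕ} (hw' : w' ≤ w)
    (hB : 4 * (φ.tupleProblem hk).nV +
      (φ.numClauses + 2 * k + 2) * (φ.numVars + 2 * k + 2) + 10 < 2 ^ w)
    {ρ : ℕ → Bool} {p : Prog} {t : ℕ} {σ' : State}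
    (h : Exec w' ρ p (φ.tupleProblem hk).inst.init t σ') :
    ∃ T τ, Exec w ρ (satProg k p judge) φ.init T τ ∧ T ≤ overhead φ hk judge + t ∧
      (τ.reg 0 ≠ 0 ↔ ∃ v < (φ.tupleProblem hk).NN,
        R (σ'.mem 5 (v * (φ.tupleProblem hk).X)) (σ'.mem 6 (v * (φ.tupleProblem hk).X))) := by
  set Γ := φ.tupleProblem hk with hΓ
  have hw0 : 0 < w := by
    by_contra hc
    obtain rfl : w = 0 := by omega
    rw [pow_zero] at hB
    omega
  have hsum : (φ.numClauses + 2 * k + 2) + (φ.numVars + 2 * k + 2) < 2 ^ w := by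
    have h1 : ∀ a b : ℕ, a + 2 + (b + 2) ≤ (a + 2) * (b + 2) := fun a b => by nlinarith
    exact (h1 _ _).trans_lt (by omega)
  have hm : Γ.inst.m ≤ 2 * Γ.nV := TupleProblem.length_edgeList_le _
  have hb₀ : φ.init.Bounded (2 ^ w) := bounded_cnf_init (by omega)
  obtain ⟨T₁, s₁, σ₁, τ₁, x₁, a₁, ht₁, H₁, h11, hc₁, hmem₁, hs₁⟩ := Cmd.exec_of_wp hw0 ρ
    (writeInstance k) φ.init rfl ((maxLit_writeInstance_le hk).trans_lt (by omega))
    ⟨fun _ _ => rfl, rfl, rfl⟩ hb₀ (wp_writeInstance (hk := hk) hB)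
  have hb₁ := x₁.bounded hb₀
  -- the registers of the window are still `0`
  have hzero : ∀ r, τ₁.reg (r + winReg k) = 0 := by
    intro r
    rw [x₁.reg_eq (by rw [winReg]; omega)]
    rw [show r + winReg k = (r + 38 + (writeInstance k).comp.regBound) + 2 by
      rw [winReg, tempReg]; omega]
    rfl
  have r8 : τ₁.reg 8 = Γ.nV := (a₁.reg 8 (by decide)).trans H₁.nV
  have r11 : τ₁.reg 11 = Γ.inst.m := (a₁.reg 11 (by decide)).trans h11
  have hK : 40 ≤ winReg k := by rw [winReg, tempReg]; omega
  set τ₃ := (τ₁.setReg (0 + winReg k) Γ.nV).setReg (1 + winReg k) Γ.inst.m with hτ₃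
  have x₂ : Exec w ρ (.op .add (0 + winReg k) 8 (0 + winReg k)) τ₁ 1
      (τ₁.setReg (0 + winReg k) Γ.nV) := by
    have := Exec.op (w := w) (ρ := ρ) .add (0 + winReg k) 8 (0 + winReg k) τ₁ (by
      simp only [BinOp.eval, r8, hzero]; omega)
    simpa only [BinOp.eval, r8, hzero, add_zero] using this
  have x₃ : Exec w ρ (.op .add (1 + winReg k) 11 (1 + winReg k)) (τ₁.setReg (0 + winReg k) Γ.nV) 1
      τ₃ := by
    have e1 : (τ₁.setReg (0 + winReg k) Γ.nV).reg 11 = Γ.inst.m := by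
      rw [State.setReg_reg, if_neg (by omega), r11]
    have e2 : (τ₁.setReg (0 + winReg k) Γ.nV).reg (1 + winReg k) = 0 := by
      rw [State.setReg_reg, if_neg (by omega), hzero]
    have := Exec.op (w := w) (ρ := ρ) .add (1 + winReg k) 11 (1 + winReg k)
      (τ₁.setReg (0 + winReg k) Γ.nV) (by simp only [BinOp.eval, e1, e2]; omega)
    simpa only [BinOp.eval, e1, e2, add_zero] using this
  have hwin : τ₃.window (winReg k) 10 = Γ.inst.init := by
    have e1 : (fun r => τ₃.reg (r + winReg k)) = Γ.inst.init.reg := by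
      funext r
      match r with
      | 0 =>
        rw [hτ₃, State.setReg_reg, if_neg (by omega), State.setReg_reg, if_pos rfl]
        rfl
      | 1 =>
        rw [hτ₃, State.setReg_reg, if_pos rfl]
        rfl
      | r + 2 =>
        rw [hτ₃, State.setReg_reg, if_neg (by omega), State.setReg_reg, if_neg (by omega), hzero]
        rfl
    have e2 : (fun b => τ₃.mem (b + 10)) = Γ.inst.init.mem := by
      funext b
      rw [hτ₃, State.setReg_mem, State.setReg_mem, a₁.mem, add_comm b, hmem₁]
    have e3 : τ₃.coins = Γ.inst.init.coins := a₁.coins.trans hc₁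
    rw [State.window, e1, e2, e3]
  have x₄ := (h.mono hw').shift (winReg k) 10 τ₃
  rw [← hwin, State.withWindow_window] at x₄
  set τ₄ := τ₃.withWindow (winReg k) 10 σ' with hτ₄
  have hb₄ : τ₄.Bounded (2 ^ w) := x₄.bounded (x₃.bounded (x₂.bounded hb₁))
  have hlow : ∀ r < 40, τ₄.reg r = σ₁.reg r := by
    intro r hr
    have : τ₄.reg r = τ₃.reg r := by simp [hτ₄, State.withWindow]; omega
    rw [this, hτ₃, State.setReg_reg, if_neg (by omega), State.setReg_reg, if_neg (by omega)]
    exact a₁.reg r hr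
  have hNX : Γ.NN * Γ.X ≤ Γ.nV := Nat.le_mul_of_pos_left _ (by omega)
  have hNN : Γ.NN ≤ Γ.NN * Γ.X := Nat.le_mul_of_pos_right _ Γ.X_pos
  have hwf : (judgeAll judge).WF := by
    have := hJ.wf
    simp [judgeAll, Cmd.forTo, Cmd.WF, this]
    decide
  have hlit : (judgeAll judge).maxLit < 2 ^ w := by
    have h1 := hJ.maxLit_le
    have e1 : (judgeAll judge).maxLit ≤ max 1 judge.maxLit := by
      have e4 : ∀ a b : Ex, (a.lt b).maxLit = max a.maxLit b.maxLit := fun _ _ => rfl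
      simp only [judgeAll, Cmd.forTo, Cmd.maxLit, e4, Ex.maxLit]
      omega
    exact e1.trans_lt (max_lt (by omega) (by omega))
  obtain ⟨T₅, s₅, σ₅, τ₅, x₅, a₅, ht₅, hres, hs₅⟩ := Cmd.exec_of_wp hw0 ρ (judgeAll judge) τ₄ hwf
    hlit ⟨fun _ _ => rfl, rfl, rfl⟩ hb₄ (wp_judgeAll hJ (t := 0) (NN := Γ.NN) (X := Γ.X)
      ((hlow 6 (by norm_num)).trans H₁.NN) ((hlow 7 (by norm_num)).trans H₁.X) (by omega)
      (by omega))
  refine ⟨_, τ₅, .seq x₁ (.seq x₂ (.seq x₃ (.seq x₄ x₅))), ?_, ?_⟩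
  · have k1 : (writeInstance k).size * s₁ ≤ (writeInstance k).size *
        (Γ.nV * (2 * validTime φ k + 45) + (6 * k + 30)) := Nat.mul_le_mul_left _ (by
          have hs : 0 + s₁ ≤ Γ.nV * (2 * validTime φ k + 45) + (6 * k + 30) := hs₁
          omega)
    have k2 : (judgeAll judge).size * s₅ ≤ (judgeAll judge).size * (Γ.NN * 7 + 3) :=
      Nat.mul_le_mul_left _ (by omega)
    rw [overhead, ← hΓ]
    omega
  · rw [a₅.reg 0 (by decide), hres]
    have m15 : τ₄.mem 15 = σ'.mem 5 := State.withWindow_mem _ 10 _ _ 5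
    have m16 : τ₄.mem 16 = σ'.mem 6 := State.withWindow_mem _ 10 _ _ 6
    rw [m15, m16]

end WordRAM

/-! ### The lower bounds -/

namespace CNF

variable {φ : CNF} {k D : ℕ}

/-- A constant for the size of the layered graphs of formulas with at most `D * n` clauses. -/
def sizeConst (k D : ℕ) : ℕ := (k + 1) * (4 ^ (k - 1) * (D + k) ^ (k - 1))

theorem numClauses_add_le (hM : φ.numClauses ≤ D * φ.numVars) (a : ℕ) :
    φ.numClauses + a ≤ (D + a) * (φ.numVars + 1) := by
  nlinarith

theorem NN_le (hk : 2 ≤ k) :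
    (φ.tupleProblem hk).NN ≤ 4 ^ (k - 1) * 2 ^ (φ.numVars / k * (k - 1)) := by
  have h1 : (φ.tupleProblem hk).N ≤ 4 * 2 ^ (φ.numVars / k) := by
    have : (φ.tupleProblem hk).N = 2 * 2 ^ (φ.numVars / k) + 1 := by
      rw [← pow_succ']
      rfl
    have := Nat.one_le_two_pow (n := φ.numVars / k)
    omega
  calc (φ.tupleProblem hk).NN ≤ (4 * 2 ^ (φ.numVars / k)) ^ (k - 1) := Nat.pow_le_pow_left h1 _
    _ = _ := by rw [mul_pow, pow_mul]

theorem nV_le (hk : 2 ≤ k) (hM : φ.numClauses ≤ D * φ.numVars) :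
    (φ.tupleProblem hk).nV ≤
      sizeConst k D * (φ.numVars + 1) ^ (k - 1) * 2 ^ (φ.numVars / k * (k - 1)) := by
  have h2 : (φ.tupleProblem hk).X ≤ (D + k) ^ (k - 1) * (φ.numVars + 1) ^ (k - 1) := by
    rw [← mul_pow]
    exact Nat.pow_le_pow_left (numClauses_add_le hM k) _
  calc (φ.tupleProblem hk).nV
      ≤ (k + 1) * (4 ^ (k - 1) * 2 ^ (φ.numVars / k * (k - 1)) *
          ((D + k) ^ (k - 1) * (φ.numVars + 1) ^ (k - 1))) :=
        Nat.mul_le_mul_left _ (Nat.mul_le_mul (NN_le hk) h2)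
    _ = _ := by rw [sizeConst]; ring

theorem nV_le_two_pow (hk : 2 ≤ k) (hM : φ.numClauses ≤ D * φ.numVars) :
    (φ.tupleProblem hk).nV ≤ sizeConst k D * 2 ^ (k * φ.numVars) := by
  refine (nV_le hk hM).trans ?_
  rw [mul_assoc]
  refine Nat.mul_le_mul_left _ ?_
  have h1 : φ.numVars + 1 ≤ 2 ^ φ.numVars := Nat.lt_two_pow_self
  calc (φ.numVars + 1) ^ (k - 1) * 2 ^ (φ.numVars / k * (k - 1))
      ≤ (2 ^ φ.numVars) ^ (k - 1) * 2 ^ φ.numVars := by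
        refine Nat.mul_le_mul (Nat.pow_le_pow_left h1 _) (Nat.pow_le_pow_right (by norm_num) ?_)
        exact (Nat.mul_le_mul_left _ (Nat.sub_le _ _)).trans (Nat.div_mul_le_self _ _)
    _ = 2 ^ (φ.numVars * (k - 1) + φ.numVars) := by rw [← pow_mul, ← pow_add]
    _ = _ := by
        obtain ⟨j, rfl⟩ : ∃ j, k = j + 1 := ⟨k - 1, by omega⟩
        congr 1
        simp only [Nat.add_sub_cancel]
        ring

/-- A constant for the word length. -/
def wordConst (k D : ℕ) : ℕ := 5 * sizeConst k D + (D + 2 * k + 2) * (2 * k + 3) + 10 + k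

theorem mul_two_pow_lt (a n : ℕ) (ha : a < b) (hb : b + k ≤ c) :
    a * 2 ^ (k * n) < 2 ^ (c * (n + 1)) := by
  calc a * 2 ^ (k * n) < 2 ^ b * 2 ^ (k * n) :=
        Nat.mul_lt_mul_of_pos_right (ha.trans Nat.lt_two_pow_self) (by positivity)
    _ = 2 ^ (b + k * n) := (pow_add _ _ _).symm
    _ ≤ _ := Nat.pow_le_pow_right (by norm_num) (by nlinarith)

theorem bounds_lt_two_pow (hk : 2 ≤ k) (hM : φ.numClauses ≤ D * φ.numVars) :
    4 * (φ.tupleProblem hk).nV + (φ.numClauses + 2 * k + 2) * (φ.numVars + 2 * k + 2) + 10 <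
      2 ^ ((wordConst k D + 1) * (φ.numVars + 1)) := by
  refine lt_of_le_of_lt ?_ (mul_two_pow_lt (k := k) (4 * sizeConst k D +
    (D + 2 * k + 2) * (2 * k + 3) + 10) φ.numVars (Nat.lt_succ_self _)
    (by rw [wordConst]; omega))
  have h1 := nV_le_two_pow hk hM
  have h2 : (φ.numClauses + 2 * k + 2) * (φ.numVars + 2 * k + 2) ≤
      (D + 2 * k + 2) * (2 * k + 3) * 2 ^ (k * φ.numVars) := by
    have h3 : φ.numVars + 1 ≤ 2 ^ φ.numVars := Nat.lt_two_pow_self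
    calc (φ.numClauses + 2 * k + 2) * (φ.numVars + 2 * k + 2)
        ≤ ((D + 2 * k + 2) * (φ.numVars + 1)) * ((2 * k + 3) * (φ.numVars + 1)) := by
          refine Nat.mul_le_mul ?_ (by nlinarith)
          have := numClauses_add_le hM (2 * k + 2)
          simpa only [add_assoc] using this
      _ = (D + 2 * k + 2) * (2 * k + 3) * ((φ.numVars + 1) * (φ.numVars + 1)) := by ring
      _ ≤ (D + 2 * k + 2) * (2 * k + 3) * (2 ^ φ.numVars * 2 ^ φ.numVars) :=
          Nat.mul_le_mul_left _ (Nat.mul_le_mul h3 h3)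
      _ ≤ _ := by
          rw [← pow_add]
          exact Nat.mul_le_mul_left _ (Nat.pow_le_pow_right (by norm_num) (by nlinarith))
  have h4 : 1 ≤ 2 ^ (k * φ.numVars) := Nat.one_le_two_pow
  nlinarith

theorem wordLength_le (hk : 2 ≤ k) (hM : φ.numClauses ≤ D * φ.numVars) (c : ℕ) :
    (φ.tupleProblem hk).inst.wordLength c ≤ c * wordConst k D * (φ.numVars + 1) := by
  rw [STInstance.wordLength, mul_assoc]
  refine Nat.mul_le_mul_left _ (Nat.size_le.2 (lt_of_le_of_lt ?_
    (mul_two_pow_lt (k := k) (5 * sizeConst k D) φ.numVars (Nat.lt_succ_self _)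
      (by rw [wordConst]; omega))))
  have h1 : (φ.tupleProblem hk).inst.m ≤ 2 * (φ.tupleProblem hk).nV :=
    TupleProblem.length_edgeList_le _
  have h2 : (φ.tupleProblem hk).inst.maxWeight ≤ 1 :=
    Finset.sup_le fun i _ => (TupleProblem.isUnweightedBichromatic.2.1 i).le
  have h3 : (φ.tupleProblem hk).inst.n = (φ.tupleProblem hk).nV := rfl
  have h4 : 0 < (φ.tupleProblem hk).nV := TupleProblem.nV_pos
  have h5 := nV_le_two_pow hk hM
  rw [h3, mul_assoc]
  omega

end CNF

namespace WordRAM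

/-- A constant for the number of steps of the reduction. -/
def overheadConst (k : ℕ) (judge : Cmd) : ℕ :=
  (writeInstance k).size * (52 * k * k + 26 * k + 95) + (2 + (judgeAll judge).size * 10)

theorem overhead_le {φ : CNF} {k : ℕ} (hk : 2 ≤ k) (judge : Cmd) :
    overhead φ hk judge ≤
      overheadConst k judge * (φ.numVars + 1) * (φ.tupleProblem hk).nV := by
  have h0 : 0 < (φ.tupleProblem hk).nV := TupleProblem.nV_pos
  have h1 : (φ.tupleProblem hk).NN ≤ (φ.tupleProblem hk).nV :=
    (Nat.le_mul_of_pos_right _ (φ.tupleProblem hk).X_pos).trans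
      (Nat.le_mul_of_pos_left _ (Nat.succ_pos _))
  set V := (φ.tupleProblem hk).nV
  set n := φ.numVars with hn
  have h2 : validTime φ k ≤ (26 * k * k + 10 * k + 10) * (n + 1) := by
    have h3 : φ.groupSize k ≤ n + 1 := Nat.succ_le_succ (Nat.div_le_self _ _)
    calc validTime φ k ≤ k * (k * ((n + 1) * 6 + 20 * (n + 1)) + 10 * (n + 1)) + 10 * (n + 1) := by
          unfold validTime
          gcongr <;> omega
      _ = _ := by ring
  have hnV : V ≤ (n + 1) * V := Nat.le_mul_of_pos_left _ (Nat.succ_pos _)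
  have h1V : 1 ≤ (n + 1) * V := Nat.mul_pos (Nat.succ_pos _) h0
  have h4 : V * (2 * validTime φ k + 45) + (6 * k + 30) ≤
      (52 * k * k + 26 * k + 95) * ((n + 1) * V) := by
    calc V * (2 * validTime φ k + 45) + (6 * k + 30)
        ≤ V * (2 * ((26 * k * k + 10 * k + 10) * (n + 1)) + 45 * (n + 1)) +
          (6 * k + 30) * ((n + 1) * V) := by
          gcongr
          · omega
          · exact Nat.le_mul_of_pos_right _ h1V
      _ = _ := by ring
  calc overhead φ hk judge
      ≤ (writeInstance k).size * ((52 * k * k + 26 * k + 95) * ((n + 1) * V)) +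
        (2 * ((n + 1) * V) + (judgeAll judge).size * (10 * ((n + 1) * V))) := by
        rw [overhead]
        gcongr <;> omega
    _ = _ := by rw [overheadConst]; ring

theorem exists_bound_poly_mul_pow (e : ℕ) {r s : ℝ} (hr : 0 < r) (hrs : r < s) :
    ∃ K : ℝ, ∀ n : ℕ, ((n : ℝ) + 1) ^ e * r ^ n ≤ K * s ^ n := by
  have hs : 0 < s := hr.trans hrs
  have h1 : |r / s| < 1 := by
    rw [abs_of_pos (div_pos hr hs)]
    exact (div_lt_one hs).2 hrs
  obtain ⟨K, hK⟩ := (tendsto_pow_const_mul_const_pow_of_abs_lt_one e h1).bddAbove_range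
  refine ⟨K * (s / r), fun n => ?_⟩
  have h2 : ((n + 1 : ℕ) : ℝ) ^ e * (r / s) ^ (n + 1) ≤ K := hK ⟨n + 1, rfl⟩
  have h3 : ((n : ℝ) + 1) ^ e * r ^ n =
      (((n + 1 : ℕ) : ℝ) ^ e * (r / s) ^ (n + 1)) * ((s / r) * s ^ n) := by
    rw [div_pow, pow_succ r, pow_succ s]
    push_cast
    field_simp
  rw [h3, mul_assoc K]
  exact mul_le_mul_of_nonneg_right h2 (by positivity)

/-- The number of steps of the reduction: if `p` takes `C * m ^ (k / (k - 1) - δ)` steps on graphs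
with `m` edges, then the total is exponential in `n` with a base smaller than `2`, since the layered
graph has `2 ^ ((k - 1) * n / k)` vertices, up to a polynomial. -/
theorem exists_base {k : ℕ} (hk : 2 ≤ k) {δ : ℝ} (hδ : 0 < δ) : ∃ ε : ℝ, 0 < ε ∧ ε < 1 ∧
    ∀ (D : ℕ) (judge : Cmd) (C : ℝ), ∃ K : ℝ, ∀ φ : CNF, φ.numClauses ≤ D * φ.numVars → ∀ m : ℕ,
      m ≤ 2 * (φ.tupleProblem hk).nV → (overhead φ hk judge : ℝ) +
        C * (m : ℝ) ^ (1 + 1 / ((k : ℝ) - 1) - δ) ≤ K * (2 - ε) ^ φ.numVars := by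
  have hk1 : (0 : ℝ) < (k : ℝ) - 1 := by
    have : (2 : ℝ) ≤ k := by exact_mod_cast hk
    linarith
  have hk0 : (0 : ℝ) < k := by linarith
  -- the exponent may be assumed to be at least `1`
  set δ' := min δ (1 / ((k : ℝ) - 1)) with hδ'
  have hδ'0 : 0 < δ' := lt_min hδ (by positivity)
  set x := 1 + 1 / ((k : ℝ) - 1) - δ' with hx
  have hx1 : 1 ≤ x := by
    have := min_le_right δ (1 / ((k : ℝ) - 1))
    linarith
  have hxk : x * (((k : ℝ) - 1) / k) = 1 - δ' * (((k : ℝ) - 1) / k) := by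
    rw [hx]
    field_simp
    ring
  set r : ℝ := 2 ^ (x * (((k : ℝ) - 1) / k)) with hr
  have hr1 : 1 ≤ r := Real.one_le_rpow (by norm_num) (by positivity)
  have hr2 : r < 2 := by
    rw [hr, hxk]
    calc (2 : ℝ) ^ (1 - δ' * (((k : ℝ) - 1) / k)) < 2 ^ (1 : ℝ) := by
          refine Real.rpow_lt_rpow_of_exponent_lt (by norm_num) ?_
          have : 0 < δ' * (((k : ℝ) - 1) / k) := by positivity
          linarith
      _ = 2 := Real.rpow_one 2
  refine ⟨(2 - r) / 2, by linarith, by linarith, fun D judge C => ?_⟩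
  obtain ⟨j, hj⟩ := exists_nat_ge (((k - 1 : ℕ) : ℝ) * x + 1)
  obtain ⟨K, hK⟩ := exists_bound_poly_mul_pow j (s := 2 - (2 - r) / 2)
    (show (0 : ℝ) < r by linarith) (by linarith)
  set A : ℝ := (overheadConst k judge + |C|) * (2 * CNF.sizeConst k D) ^ x with hA
  have hA0 : 0 ≤ A := by positivity
  refine ⟨A * K, fun φ hM m hm => ?_⟩
  set V := (φ.tupleProblem hk).nV with hV
  set n := φ.numVars with hn
  have hV1 : (1 : ℝ) ≤ V := by exact_mod_cast (TupleProblem.nV_pos : 0 < (φ.tupleProblem hk).nV)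
  have hn1 : (1 : ℝ) ≤ (n : ℝ) + 1 := by linarith [Nat.cast_nonneg (α := ℝ) n]
  have h1 : (m : ℝ) ^ (1 + 1 / ((k : ℝ) - 1) - δ) ≤ (2 * V : ℝ) ^ x := by
    have hone : (1 : ℝ) ≤ (2 * V : ℝ) ^ x := Real.one_le_rpow (by linarith) (by linarith)
    rcases Nat.eq_zero_or_pos m with rfl | hm0
    · rw [Nat.cast_zero]
      exact (Real.zero_rpow_le_one _).trans hone
    · calc (m : ℝ) ^ (1 + 1 / ((k : ℝ) - 1) - δ) ≤ (m : ℝ) ^ x := by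
            refine Real.rpow_le_rpow_of_exponent_le (by exact_mod_cast hm0) ?_
            have := min_le_left δ (1 / ((k : ℝ) - 1))
            linarith
        _ ≤ _ := Real.rpow_le_rpow (Nat.cast_nonneg _) (by exact_mod_cast hm) (by linarith)
  have h2 : (overhead φ hk judge : ℝ) ≤ overheadConst k judge * (n + 1) * (2 * V : ℝ) ^ x := by
    have h3 : (overhead φ hk judge : ℝ) ≤ overheadConst k judge * (n + 1) * V := by
      exact_mod_cast overhead_le hk judge
    refine h3.trans (mul_le_mul_of_nonneg_left ?_ (by positivity))
    calc (V : ℝ) ≤ 2 * V := by linarith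
      _ = (2 * V : ℝ) ^ (1 : ℝ) := (Real.rpow_one _).symm
      _ ≤ _ := Real.rpow_le_rpow_of_exponent_le (by linarith) hx1
  have h4 : C * (m : ℝ) ^ (1 + 1 / ((k : ℝ) - 1) - δ) ≤ |C| * (n + 1) * (2 * V : ℝ) ^ x := by
    calc C * (m : ℝ) ^ (1 + 1 / ((k : ℝ) - 1) - δ)
        ≤ |C| * (2 * V : ℝ) ^ x := mul_le_mul (le_abs_self C) h1 (by positivity) (abs_nonneg _)
      _ ≤ _ := mul_le_mul_of_nonneg_right (le_mul_of_one_le_right (abs_nonneg _) hn1)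
          (by positivity)
  have h5 : (2 * V : ℝ) ^ x ≤
      (2 * CNF.sizeConst k D) ^ x * ((n + 1 : ℝ) ^ (((k - 1 : ℕ) : ℝ) * x) * r ^ n) := by
    have h6 : (V : ℝ) ≤ CNF.sizeConst k D * (n + 1) ^ (k - 1) * 2 ^ (n / k * (k - 1)) := by
      exact_mod_cast CNF.nV_le hk hM
    have h7 : (2 : ℝ) ^ (n / k * (k - 1)) ≤ 2 ^ ((n : ℝ) * (((k : ℝ) - 1) / k)) := by
      rw [← Real.rpow_natCast]
      refine Real.rpow_le_rpow_of_exponent_le (by norm_num) ?_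
      have h8 : ((n / k : ℕ) : ℝ) ≤ n / k := Nat.cast_div_le
      rw [Nat.cast_mul, Nat.cast_sub (by omega), Nat.cast_one]
      calc ((n / k : ℕ) : ℝ) * ((k : ℝ) - 1) ≤ n / k * ((k : ℝ) - 1) :=
            mul_le_mul_of_nonneg_right h8 hk1.le
        _ = _ := by ring
    calc (2 * V : ℝ) ^ x
        ≤ ((2 * CNF.sizeConst k D) * ((n + 1 : ℝ) ^ (k - 1) *
            2 ^ ((n : ℝ) * (((k : ℝ) - 1) / k)))) ^ x := by
          refine Real.rpow_le_rpow (by positivity) ?_ (by linarith)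
          calc (2 * V : ℝ) ≤ 2 * (CNF.sizeConst k D * (n + 1) ^ (k - 1) *
                2 ^ ((n : ℝ) * (((k : ℝ) - 1) / k))) := by
                refine mul_le_mul_of_nonneg_left (h6.trans ?_) (by norm_num)
                exact mul_le_mul_of_nonneg_left h7 (by positivity)
            _ = _ := by ring
      _ = _ := by
          rw [Real.mul_rpow (x := 2 * (CNF.sizeConst k D : ℝ)) (by positivity) (by positivity)]
          congr 1
          rw [Real.mul_rpow (by positivity) (by positivity), ← Real.rpow_natCast, ← Real.rpow_mul
            (by positivity), ← Real.rpow_mul (by norm_num), hr, ← Real.rpow_natCast,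
            ← Real.rpow_mul (by norm_num)]
          congr 2
          ring
  have h9 : (n + 1 : ℝ) * (n + 1 : ℝ) ^ (((k - 1 : ℕ) : ℝ) * x) ≤ (n + 1 : ℝ) ^ j := by
    rw [← Real.rpow_natCast, ← Real.rpow_one_add' (by positivity) (by positivity)]
    exact Real.rpow_le_rpow_of_exponent_le hn1 (by linarith)
  calc (overhead φ hk judge : ℝ) + C * (m : ℝ) ^ (1 + 1 / ((k : ℝ) - 1) - δ)
      ≤ (overheadConst k judge + |C|) * (n + 1) * (2 * V : ℝ) ^ x := by linarith
    _ ≤ (overheadConst k judge + |C|) * (n + 1) * ((2 * CNF.sizeConst k D) ^ x *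
          ((n + 1 : ℝ) ^ (((k - 1 : ℕ) : ℝ) * x) * r ^ n)) :=
        mul_le_mul_of_nonneg_left h5 (by positivity)
    _ = A * (((n + 1 : ℝ) * (n + 1 : ℝ) ^ (((k - 1 : ℕ) : ℝ) * x)) * r ^ n) := by rw [hA]; ring
    _ ≤ A * ((n + 1 : ℝ) ^ j * r ^ n) := by gcongr
    _ ≤ A * (K * (2 - (2 - r) / 2) ^ n) := mul_le_mul_of_nonneg_left (hK n) hA0
    _ = _ := by ring

/-- The hypothesis fails if a fast algorithm gives answers that tell eccentricity `k` from
`3 * k - 2` by a test `R`. -/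
theorem not_SETH_of_solvableBichromatic {k : ℕ} (hk : 2 ≤ k) {δ : ℝ} (hδ : 0 < δ) {judge : Cmd}
    {R : ℕ → ℕ → Prop} (hJ : IsJudge k judge R) {Good : STInstance → State → Prop}
    (hR : ∀ I σ, Good I σ → ∀ s ∈ I.S, (I.ecc s = k → ¬ R (σ.mem 5 s) (σ.mem 6 s)) ∧
      (I.ecc s = (3 * k - 2 : ℕ) → R (σ.mem 5 s) (σ.mem 6 s)))
    (h : SolvableBichromatic (1 + 1 / ((k : ℝ) - 1) - δ) Good) : ¬ SETH := by
  rw [SETH, not_not]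
  obtain ⟨p, c, C, hp⟩ := h
  obtain ⟨ε, hε0, hε1, hε⟩ := exists_base hk hδ
  refine ⟨ε, hε0, hε1, fun D => ?_⟩
  obtain ⟨K, hK⟩ := hε D judge C
  refine ⟨satProg k p judge, c * CNF.wordConst k D + (CNF.wordConst k D + 1), K, fun φ hM => ?_⟩
  obtain ⟨hrun, hprob⟩ := hp _ (TupleProblem.isUnweightedBichromatic (Γ := φ.tupleProblem hk))
  have hw' : (φ.tupleProblem hk).inst.wordLength c ≤
      (c * CNF.wordConst k D + (CNF.wordConst k D + 1)) * (φ.numVars + 1) :=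
    (CNF.wordLength_le hk hM c).trans (Nat.mul_le_mul_right _ (Nat.le_add_right _ _))
  have hB := (CNF.bounds_lt_two_pow hk hM).trans_le (Nat.pow_le_pow_right (by norm_num)
    (Nat.mul_le_mul_right (φ.numVars + 1)
      (Nat.le_add_left (CNF.wordConst k D + 1) (c * CNF.wordConst k D))))
  refine ⟨fun ρ => ?_, hprob.trans (MeasureTheory.measure_mono ?_)⟩
  · obtain ⟨t, σ', hex, ht⟩ := hrun ρ
    obtain ⟨T, τ, hex', hT, -⟩ := exec_satProg hk hJ hw' hB hex
    refine ⟨T, τ, hex', le_trans ?_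
      (hK φ hM (φ.tupleProblem hk).inst.m (TupleProblem.length_edgeList_le _))⟩
    have : (T : ℝ) ≤ overhead φ hk judge + t := by exact_mod_cast hT
    exact this.trans (add_le_add_right ht _)
  · rintro ρ ⟨t, σ', hex, hgood⟩
    obtain ⟨T, τ, hex', -, hτ⟩ := exec_satProg hk hJ hw' hB hex
    refine ⟨T, τ, hex', hτ.trans ?_⟩
    set Γ := φ.tupleProblem hk with hΓ
    have henc : ∀ v, Γ.enc 0 v 0 = v * Γ.X := fun v => by simp [TupleProblem.enc]
    have hlt : ∀ v < Γ.NN, v * Γ.X < Γ.inst.n := fun v hv => by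
      rw [← henc]
      exact TupleProblem.enc_lt (Nat.zero_le _) hv Γ.X_pos
    constructor
    · rintro ⟨v, hv, hRv⟩
      by_contra hns
      have hs : ((⟨v * Γ.X, hlt v hv⟩ : Fin Γ.inst.n) : ℕ) = Γ.enc 0 v 0 := (henc v).symm
      exact (hR _ _ hgood _ (TupleProblem.source_mem_S hv hs)).1
        (φ.ecc_of_not_satisfiable hk hns hv hs) hRv
    · intro hsat
      obtain ⟨v, hv, hecc⟩ := φ.exists_ecc_of_satisfiable hk hsat
      have hs : ((⟨v * Γ.X, hlt v hv⟩ : Fin Γ.inst.n) : ℕ) = Γ.enc 0 v 0 := (henc v).symm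
      exact ⟨v, hv, (hR _ _ hgood _ (TupleProblem.source_mem_S hv hs)).2 (hecc _ hs)⟩

/-- An approximation better than `(3 * k - 2) / k` decides between `k` and `3 * k - 2`. -/
theorem not_SETH_of_isApprox {k : ℕ} (hk : 2 ≤ k) {α δ : ℝ} (hδ : 0 < δ)
    (hα : k * α < (3 * k - 2 : ℕ))
    (h : SolvableBichromatic (1 + 1 / ((k : ℝ) - 1) - δ) (fun I => I.IsApprox α)) : ¬ SETH := by
  refine not_SETH_of_solvableBichromatic hk hδ (isJudge_judgeRatio hk) ?_ h
  intro I σ hgood s hs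
  obtain ⟨h1, h2⟩ := hgood s hs
  have hdiv : ∀ a b : ℕ, (k : ℝ≥0∞) < (a : ℝ≥0∞) / (b : ℝ≥0∞) ↔ k * b < a := by
    intro a b
    rcases Nat.eq_zero_or_pos b with rfl | hb
    · rcases Nat.eq_zero_or_pos a with rfl | ha
      · simp
      · rw [Nat.cast_zero, ENNReal.div_zero (by exact_mod_cast ha.ne')]
        simp [ha]
    · rw [ENNReal.lt_div_iff_mul_lt (.inl (by exact_mod_cast hb.ne'))
        (.inl (ENNReal.natCast_ne_top b))]
      exact_mod_cast Iff.rfl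
  constructor
  · intro he hlt
    rw [he] at h2
    exact absurd ((hdiv _ _).2 hlt) (not_lt.2 h2)
  · intro he
    rw [he] at h1
    refine (hdiv _ _).1 (lt_of_lt_of_le ?_ h1)
    have h3 : ((3 * k - 2 : ℕ) : ℝ≥0∞) = ENNReal.ofReal (3 * k - 2 : ℕ) :=
      (ENNReal.ofReal_natCast _).symm
    have h4 : (0 : ℝ) < (3 * k - 2 : ℕ) := by
      have : 0 < 3 * k - 2 := by omega
      exact_mod_cast this
    change (k : ℝ≥0∞) < ((3 * k - 2 : ℕ) : ℝ≥0∞) / ENNReal.ofReal α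
    rcases le_or_gt α 0 with hα0 | hα0
    · rw [ENNReal.ofReal_of_nonpos hα0,
        ENNReal.div_zero (by rw [h3]; exact (ENNReal.ofReal_pos.2 h4).ne')]
      exact ENNReal.natCast_lt_top k
    · rw [h3, ← ENNReal.ofReal_div_of_pos hα0, ← ENNReal.ofReal_natCast,
        ENNReal.ofReal_lt_ofReal_iff (by positivity), lt_div_iff₀ hα0]
      exact hα

end WordRAM

end

theorem mainTheorem3 :
    -- the algorithm, for all undirected weighted graphs and all `S`, `T`; `a` is the exponent
    -- in the probability of failure
    (∀ a : ℕ, ∃ (p : WordRAM.Prog) (c e : ℕ) (C : ℝ), ∀ I : STInstance,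
      WordRAM.Achieves (I.wordLength c) p I.init
        (C * ((I.n + I.m + 1 : ℕ) : ℝ) ^ (3 / 2 : ℝ) * Real.log (I.n + I.m + 2) ^ e)
        (ENNReal.ofReal (1 - 1 / (I.n : ℝ) ^ a)) (I.IsApprox 2)) ∧
    -- no better approximation in time `O(m ^ (2 - δ))`
    (∀ ε δ : ℝ, 0 < ε → 0 < δ →
      SolvableBichromatic (2 - δ) (fun I => I.IsApprox (2 - ε)) → ¬ SETH) ∧
    -- no faster `2`-approximation
    (∀ ε : ℝ, 0 < ε →
      SolvableBichromatic (3 / 2 - ε) (fun I => I.IsApprox 2) → ¬ SETH) ∧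
    -- the general trade-off
    (SETH → ∀ k : ℕ, 2 ≤ k → ∀ δ : ℝ, 0 < δ →
      ¬ SolvableBichromatic (1 + 1 / ((k : ℝ) - 1) - δ)
        (fun I => I.Distinguishes k (3 * k - 2))) := by
  refine ⟨exists_approximation, fun ε δ hε hδ h => ?_, fun ε hε h => ?_,
    fun hS k hk δ hδ h => ?_⟩
  · refine WordRAM.not_SETH_of_isApprox (k := 2) (α := 2 - ε) le_rfl hδ ?_ ?_
    · norm_num
      linarith
    · convert h using 2
      norm_num
  · refine WordRAM.not_SETH_of_isApprox (k := 3) (α := 2) (by norm_num) hε (by norm_num) ?_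
    convert h using 2
    norm_num
  · refine WordRAM.not_SETH_of_solvableBichromatic hk hδ (WordRAM.isJudge_judgeBit hk) ?_ h hS
    intro I σ hgood s hs
    have := hgood s hs
    exact ⟨fun he h0 => h0 (this.1 he), this.2⟩
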